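/- **Lorentz–Strichartz estimates.** For $1\le p<\infty$ and $1\le r\le\infty$ let $$\|f\|_{L^{p,r}}=p^{1/r}\,\Big\|\lambda\,\big|\{x:|f(x)|>\lambda\}\big|^{1/p}\Big\|_{L^r((0,\infty),\,d\lambda/\lambda)}$$ be the Lorentz quasinorm. For an interval $J\subset\mathbb R$ put $\|f\|_{L_t^qL_x^p(J)}=\big\|\,\|f(t,\cdot)\|_{L^p(\mathbb R)}\big\|_{L^q(J,dt)}$ and $\|f\|_{L_t^{q,r}L_x^p(J)}=\big\|\,\|f(t,\cdot)\|_{L^p(\mathbb R)}\big\|_{L^{q,r}(J,dt)}$. Let $|\partial_x|^{\sigma}$ and $e^{-t\partial_x^3}$ be the Fourier multipliers with symbols $|\xi|^\sigma$ and $e^{it\xi^3}$ (where $\partial_x$ has symbol $i\xi$). Let $\theta_1,\theta_2\in(0,1)$, $\alpha\in[0,\tfrac12]$, $(q_i,p_i)=\big(\tfrac{6}{\theta_i(\alpha+1)},\tfrac{2}{1-\theta_i}\big)$ for $i\in\{1,2\}$, and $\tfrac1{p_2}+\tfrac1{p_2'}=\tfrac1{q_2}+\tfrac1{q_2'}=1$.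 There is a constant $C$ depending only on $\theta_1,\theta_2,\alpha$ such that the following holds for every interval $J\subset\mathbb R$, every $t_0\in J$, and every family $g(s)$, $s\in J$, of tempered distributions on $\mathbb R$ such that $|\partial_x|^{-\theta_2\alpha/2}g$ is a measurable function on $J\times\mathbb R$ for which the norm on the right-hand side of the estimate in question is finite. 1. If $q_1\le q_2$ (the exponent $q_1$ is finite because $\theta_1>0$), then $$\bigg\|\int_{t_0}^t|\partial_x|^{\frac{\theta_1\alpha}{2}}e^{-(t-s)\partial_x^3}g(s,\cdot)\,ds\bigg\|_{L_t^{q_1,2}L_x^{p_1}(J)}\le C\,\big\||\partial_x|^{-\frac{\theta_2\alpha}{2}}g\big\|_{L_t^{q_2'}L_x^{p_2'}(J)}.$$ 2. If $q_2\le q_1$, then $$\bigg\|\int_{t_0}^t|\partial_x|^{\frac{\theta_1\alpha}{2}}e^{-(t-s)\partial_x^3}g(s,\cdot)\,ds\bigg\|_{L_t^{q_1,\frac{2q_1}{q_2}}L_x^{p_1}(J)}\le C\,\big\||\partial_x|^{-\frac{\theta_2\alpha}{2}}g\big\|_{L_t^{q_2',2}L_x^{p_2'}(J)}.$$ In both cases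 the integral over $s$ converges in the weak sense (tested against each Schwartz function) for every $t\in J$, and the resulting tempered distribution is, for almost every $t\in J$, the slice at time $t$ of a measurable function on $J\times\mathbb R$; the left-hand side is the norm of this function. -/

import Mathlib

open MeasureTheory Set
open scoped ENNReal NNReal SchwartzMap FourierTransform

noncomputable section

namespace AiryStrichartz

/-- The Lorentz quasinorm
`p ^ (1/r) * ‖ y * μ {x | |f x| > y} ^ (1/p) ‖_{L^r((0, ∞), dy / y)}` of `L^{p,r}(μ)`
(with `p ^ (1/∞) = 1`). -/
def lorentzNorm {X ε : Type*} [MeasurableSpace X] [ENorm ε]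
    (p : ℝ) (r : ℝ≥0∞) (μ : Measure X) (f : X → ε) : ℝ≥0∞ :=
  ENNReal.ofReal (p ^ (1 / r.toReal)) *
    eLpNorm (fun y : ℝ => ENNReal.ofReal y * μ {x | ENNReal.ofReal y < ‖f x‖ₑ} ^ (1 / p)) r
      ((volume.restrict (Ioi (0 : ℝ))).withDensity fun y => ENNReal.ofReal y⁻¹)

/-- The mixed Lebesgue norm `L_t^q L_x^p (J × ℝ)`; the first variable of `f` is time. -/
def mixedNorm (q p : ℝ) (J : Set ℝ) (f : ℝ → ℝ → ℂ) : ℝ≥0∞ :=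
  eLpNorm (fun t => eLpNorm (f t) (ENNReal.ofReal p) volume) (ENNReal.ofReal q)
    (volume.restrict J)

/-- The mixed Lorentz norm `L_t^{q,r} L_x^p (J × ℝ)`; the first variable of `f` is time. -/
def mixedLorentzNorm (q : ℝ) (r : ℝ≥0∞) (p : ℝ) (J : Set ℝ) (f : ℝ → ℝ → ℂ) : ℝ≥0∞ :=
  lorentzNorm q r (volume.restrict J) fun t => eLpNorm (f t) (ENNReal.ofReal p) volume

/-- `f` is (jointly) measurable on the spacetime slab `J × ℝ`, up to null sets. -/
def MeasurableOnSlab (J : Set ℝ) (f : ℝ → ℝ → ℂ) : Prop :=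
  AEStronglyMeasurable (Function.uncurry f) ((volume.restrict J).prod volume)

/-- The tempered distribution `T` is given by integration against the function `f`. -/
def IsFunction (T : 𝓢'(ℝ, ℂ)) (f : ℝ → ℂ) : Prop :=
  ∀ φ : 𝓢(ℝ, ℂ), Integrable (fun x => f x * φ x) ∧ T φ = ∫ x, f x * φ x

/-- `S = a(D) T`: the Fourier transform of `T` is a function `m`, and the Fourier transform of `S`
is the function `a * m`. With Mathlib's normalization of the Fourier transform, `∂_x` has the
symbol `2 π i ξ`. -/
def IsFourierMultiplier (a : ℝ → ℂ) (T S : 𝓢'(ℝ, ℂ)) : Prop :=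
  ∃ m : ℝ → ℂ, IsFunction (𝓕 T) m ∧ IsFunction (𝓕 S) fun ξ => a ξ * m ξ

/-- The symbol of `|∂_x| ^ σ`. -/
def absDerivSymbol (σ : ℝ) (ξ : ℝ) : ℂ :=
  ((|2 * Real.pi * ξ| ^ σ : ℝ) : ℂ)

/-- The symbol of the Airy propagator `exp (-t ∂_x ^ 3)`. -/
def airySymbol (t : ℝ) (ξ : ℝ) : ℂ :=
  Complex.exp (-(t : ℂ) * (2 * Real.pi * Complex.I * ξ) ^ 3)

/-- The function `h` on `J × ℝ` is `|∂_x| ^ σ g`, at almost every time of `J`. -/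
def IsAbsDeriv (σ : ℝ) (J : Set ℝ) (g : ℝ → 𝓢'(ℝ, ℂ)) (h : ℝ → ℝ → ℂ) : Prop :=
  ∀ᵐ s ∂volume.restrict J, ∃ H : 𝓢'(ℝ, ℂ),
    IsFourierMultiplier (absDerivSymbol σ) (g s) H ∧ IsFunction H (h s)

/-- `U` is the Duhamel term `∫_{t₀}^t |∂_x| ^ σ exp (-(t - s) ∂_x ^ 3) g(s) ds`, the integral being
taken in the sense of tempered distributions (tested against each Schwartz function). -/
def IsDuhamelTerm (σ t₀ t : ℝ) (g : ℝ → 𝓢'(ℝ, ℂ)) (U : 𝓢'(ℝ, ℂ)) : Prop :=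
  ∃ W : ℝ → 𝓢'(ℝ, ℂ),
    (∀ᵐ s ∂volume.restrict (uIoc t₀ t),
      IsFourierMultiplier (fun ξ => absDerivSymbol σ ξ * airySymbol (t - s) ξ) (g s) (W s)) ∧
    ∀ φ : 𝓢(ℝ, ℂ), IntervalIntegrable (fun s => W s φ) volume t₀ t ∧
      U φ = ∫ s in t₀..t, W s φ

/-- The Duhamel term `∫_{t₀}^t |∂_x| ^ σ exp (-(t - s) ∂_x ^ 3) g(s) ds` exists at every time `t`
of `J`, and it is the function `u` on `J × ℝ`, at almost every time of `J`. -/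
def IsDuhamel (σ : ℝ) (J : Set ℝ) (t₀ : ℝ) (g : ℝ → 𝓢'(ℝ, ℂ)) (u : ℝ → ℝ → ℂ) : Prop :=
  ∃ U : ℝ → 𝓢'(ℝ, ℂ), (∀ t ∈ J, IsDuhamelTerm σ t₀ t g (U t)) ∧
    ∀ᵐ t ∂volume.restrict J, IsFunction (U t) (u t)

end AiryStrichartz

end

/-! Put `γᵢ = θᵢ (1 + α) / 3`, so that `qᵢ = 2 / γᵢ` and `γᵢ < 1`. The kernel of `|∂_x| ^ (α + iy)
exp (-t ∂_x ^ 3)` with `0 ≤ α ≤ 1/2` is bounded by `|t| ^ (-(1 + α) / 3)`, with linear growth in `y`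
(`norm_integral_airyIntegrand_le`, a van der Corput argument). Stein interpolation with Plancherel
turns this into decay `|t| ^ (-γ)` from `L^{p'}` to `L^p` for the operator of order `θ α`
(`enorm_bandForm_le`).

Let `f s` be the `L^{p'}` norm of the source at time `s`. Fix a time `t` and consider the Duhamel
integral over an arbitrary set of times. With `θ α / 2` derivatives, the `TT*` argument bounds the
square of its `L²` norm by the energy `E`, the double integral of `|s - s'| ^ (-γ) f s f s'`. With
`θ α` derivatives, its `L^p` norm is bounded by the Riesz potential `M t` of `f`. Interpolating a
second time, at fixed `t`, gives for a second parameter `θ' ≤ θ` the bound `E ^ ((1 - l) / 2) * M t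
^ l` with `l = θ' / θ` (`enorm_bandPairing_duhamelProfile_le`). All of these are bounds by absolute
values, so the restriction to `s` between `t₀` and `t` costs nothing and no Christ–Kiselev lemma is
needed.

What remains is a scalar problem in time. In Lorentz form, Hardy–Littlewood–Sobolev says that `E` is
controlled by the square of the `L^{q',2}` quasinorm of `f` (`rieszEnergy_le_lorentzSq`), and that
the `L^{q,2}` quasinorm of `M` is controlled by `E ^ (1/2)` (`lorentzSq_rieszPotential_le`). If `q₂
≤ q₁`, apply the pointwise bound to the source with `θ = θ₂`: the power `M ^ l` lies in `L^{q₁, 2 q₁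
/ q₂}`. If `q₁ ≤ q₂`, transpose and apply it to the test function with `θ = θ₁`; Hölder in time and
the characterization of `L^{q₁,2}` by testing against functions of finite energy
(`lorentzSq_le_of_forall`) conclude.

The analysis is carried out for frequencies in a compact band away from zero and for bounded,
compactly supported sources, with constants that do not depend on the band. The localized solutions
converge as distributions at each time. A measurable limit is extracted by Mazur's argument in a
weighted `L²` space, and the dual bounds survive the limit (`exists_represents`). -/

namespace AiryStrichartz

/-! ### Oscillatory integrals: uniform bounds for the Airy kernel -/

section Oscillatory

/-- Integration by parts for an oscillatory integral, with a majorant `G'` for the derivative of the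
amplitude. -/
theorem norm_integral_mul_deriv_exp_le {a b : ℝ} (hab : a ≤ b) {B B' : ℝ → ℂ} {φ φ' G G' : ℝ → ℝ}
    (hB : ∀ x ∈ Icc a b, HasDerivAt B (B' x) x) (hφ : ∀ x ∈ Icc a b, HasDerivAt φ (φ' x) x)
    (hG : ∀ x ∈ Icc a b, HasDerivAt G (G' x) x)
    (hB' : ContinuousOn B' (Icc a b)) (hφ' : ContinuousOn φ' (Icc a b))
    (hG' : ContinuousOn G' (Icc a b)) (hle : ∀ x ∈ Icc a b, ‖B' x‖ ≤ G' x) :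
    ‖∫ x in a..b, B x * (φ' x * Complex.exp (Complex.I * φ x))‖
      ≤ ‖B a‖ + ‖B b‖ + (G b - G a) := by
  have hu : uIcc a b = Icc a b := uIcc_of_le hab
  have hE : ∀ x ∈ uIcc a b, HasDerivAt (fun x => Complex.exp (Complex.I * φ x) / Complex.I)
      (φ' x * Complex.exp (Complex.I * φ x)) x := by
    intro x hx
    have h1 := (((hφ x (hu ▸ hx)).ofReal_comp.const_mul Complex.I).cexp).div_const Complex.I
    refine h1.congr_deriv ?_
    rw [eq_comm, eq_div_iff Complex.I_ne_zero]
    ring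
  have hcφ : ContinuousOn φ (Icc a b) := fun x hx => (hφ x hx).continuousAt.continuousWithinAt
  have hcE : ContinuousOn (fun x => Complex.exp (Complex.I * φ x)) (Icc a b) := by
    fun_prop
  have hint : IntervalIntegrable (fun x => (φ' x : ℂ) * Complex.exp (Complex.I * φ x)) volume a b := by
    apply ContinuousOn.intervalIntegrable
    rw [hu]
    exact (Complex.continuous_ofReal.comp_continuousOn hφ').mul hcE
  have hintB : IntervalIntegrable B' volume a b := by
    apply ContinuousOn.intervalIntegrable
    rwa [hu]
  have hintG : IntervalIntegrable G' volume a b := by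
    apply ContinuousOn.intervalIntegrable
    rwa [hu]
  rw [intervalIntegral.integral_mul_deriv_eq_deriv_mul (fun x hx => hB x (hu ▸ hx)) hE hintB hint]
  have hn : ∀ x, ‖Complex.exp (Complex.I * φ x) / Complex.I‖ = 1 := by
    intro x
    rw [norm_div, Complex.norm_I, div_one, mul_comm, Complex.norm_exp_ofReal_mul_I]
  have h3 : ‖∫ x in a..b, B' x * (Complex.exp (Complex.I * φ x) / Complex.I)‖ ≤ G b - G a := by
    rw [← intervalIntegral.integral_eq_sub_of_hasDerivAt (fun x hx => hG x (hu ▸ hx)) hintG]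
    apply intervalIntegral.norm_integral_le_of_norm_le hab _ hintG
    refine Filter.Eventually.of_forall fun x hx => ?_
    rw [norm_mul, hn, mul_one]
    exact hle x (Ioc_subset_Icc_self hx)
  calc _ ≤ ‖B b * (Complex.exp (Complex.I * φ b) / Complex.I) -
        B a * (Complex.exp (Complex.I * φ a) / Complex.I)‖ +
        ‖∫ x in a..b, B' x * (Complex.exp (Complex.I * φ x) / Complex.I)‖ := norm_sub_le _ _
    _ ≤ (‖B b * (Complex.exp (Complex.I * φ b) / Complex.I)‖ +
        ‖B a * (Complex.exp (Complex.I * φ a) / Complex.I)‖) + (G b - G a) := by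
        gcongr
        exact norm_sub_le _ _
    _ = _ := by
        rw [norm_mul, norm_mul, hn, hn]
        ring

/-- The integrand of the Airy kernel in the normalized case. -/
noncomputable def airyIntegrand (z : ℂ) (x ω : ℝ) : ℂ :=
  (ω : ℂ) ^ z * Complex.exp (Complex.I * ((x * ω + ω ^ 3 : ℝ) : ℂ))

theorem norm_airyIntegrand {z : ℂ} {x ω : ℝ} (hω : 0 < ω) : ‖airyIntegrand z x ω‖ = ω ^ z.re := by
  rw [airyIntegrand, norm_mul, mul_comm Complex.I, Complex.norm_exp_ofReal_mul_I, mul_one,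
    Complex.norm_cpow_eq_rpow_re_of_pos hω]

theorem continuousOn_airyIntegrand (z : ℂ) (x : ℝ) : ContinuousOn (airyIntegrand z x) (Ioi 0) := by
  unfold airyIntegrand
  apply ContinuousOn.mul
  · intro ω hω
    exact (Complex.continuousAt_ofReal_cpow_const ω z (Or.inr (ne_of_gt hω))).continuousWithinAt
  · fun_prop

/-- The bound obtained from one integration by parts. -/
theorem norm_integral_airyIntegrand_le_of_majorant {z : ℂ} (hz0 : 0 ≤ z.re) (hz1 : z.re ≤ 1 / 2)
    {x a b : ℝ} (ha : 1 ≤ a) (hab : a ≤ b) {G G' : ℝ → ℝ} {c : ℝ}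
    (hne : ∀ ω ∈ Icc a b, x + 3 * ω ^ 2 ≠ 0)
    (hG : ∀ ω ∈ Icc a b, HasDerivAt G (G' ω) ω) (hG' : ContinuousOn G' (Icc a b))
    (hle : ∀ ω ∈ Icc a b, (1 + |z.im|) / (√ω * |x + 3 * ω ^ 2|) +
      6 * ω * √ω / |x + 3 * ω ^ 2| ^ 2 ≤ G' ω)
    (hend : ∀ ω ∈ Icc a b, √ω ≤ c * |x + 3 * ω ^ 2|) :
    ‖∫ ω in a..b, airyIntegrand z x ω‖ ≤ 2 * c + (G b - G a) := by
  have hpos : ∀ ω ∈ Icc a b, 0 < ω := fun ω hω => by linarith [hω.1]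
  have hone : ∀ ω ∈ Icc a b, 1 ≤ ω := fun ω hω => by linarith [hω.1]
  have hsq : ∀ ω ∈ Icc a b, ω ^ z.re ≤ √ω := fun ω hω => by
    rw [Real.sqrt_eq_rpow]
    exact Real.rpow_le_rpow_of_exponent_le (hone ω hω) hz1
  have hne' : ∀ ω ∈ Icc a b, ((x + 3 * ω ^ 2 : ℝ) : ℂ) ≠ 0 := fun ω hω => by
    exact_mod_cast hne ω hω
  -- The amplitude is divided by the derivative `x + 3 ω ^ 2` of the phase. The two terms of the
  -- quotient rule are bounded by the two terms of `hle`, since `‖z‖ ≤ 1 + |z.im|` and, for `ω ≥ 1`,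
  -- `ω ^ z.re ≤ √ω`.
  set B : ℝ → ℂ := fun ω => (ω : ℂ) ^ z / ((x + 3 * ω ^ 2 : ℝ) : ℂ) with hBdef
  set B' : ℝ → ℂ := fun ω => (z * (ω : ℂ) ^ (z - 1) * ((x + 3 * ω ^ 2 : ℝ) : ℂ) -
    (ω : ℂ) ^ z * ((6 * ω : ℝ) : ℂ)) / ((x + 3 * ω ^ 2 : ℝ) : ℂ) ^ 2 with hB'def
  have hpow : ∀ ω ∈ Icc a b, HasDerivAt (fun ω : ℝ => (ω : ℂ) ^ z) (z * (ω : ℂ) ^ (z - 1)) ω := by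
    intro ω hω
    have h1 : HasDerivAt (fun w : ℂ => w ^ z) (z * (ω : ℂ) ^ (z - 1)) (ω : ℂ) := by
      have := (hasDerivAt_id (ω : ℂ)).cpow_const (c := z)
        (Or.inl (by simpa using hpos ω hω))
      simpa using this
    exact h1.comp_ofReal
  have hden : ∀ ω : ℝ, HasDerivAt (fun ω : ℝ => ((x + 3 * ω ^ 2 : ℝ) : ℂ)) ((6 * ω : ℝ) : ℂ) ω := by
    intro ω
    apply HasDerivAt.ofReal_comp
    have := ((hasDerivAt_pow 2 ω).const_mul 3).const_add x
    refine this.congr_deriv ?_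
    norm_num
    ring
  have hBd : ∀ ω ∈ Icc a b, HasDerivAt B (B' ω) ω := fun ω hω =>
    (hpow ω hω).div (hden ω) (hne' ω hω)
  have hcp : ∀ w : ℂ, ContinuousOn (fun ω : ℝ => (ω : ℂ) ^ w) (Icc a b) := fun w ω hω =>
    (Complex.continuousAt_ofReal_cpow_const ω w (Or.inr (hpos ω hω).ne')).continuousWithinAt
  have hB'c : ContinuousOn B' (Icc a b) := by
    apply ContinuousOn.div
    · exact ((continuousOn_const.mul (hcp _)).mul (by fun_prop)).sub ((hcp z).mul (by fun_prop))
    · fun_prop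
    · intro ω hω
      exact pow_ne_zero 2 (hne' ω hω)
  have hB'le : ∀ ω ∈ Icc a b, ‖B' ω‖ ≤ G' ω := by
    intro ω hω
    refine le_trans ?_ (hle ω hω)
    have hp := hpos ω hω
    have hφ : 0 < |x + 3 * ω ^ 2| := abs_pos.2 (hne ω hω)
    have hs : 0 < √ω := Real.sqrt_pos.2 hp
    have hzn : ‖z‖ ≤ 1 + |z.im| := by
      refine (Complex.norm_le_abs_re_add_abs_im z).trans ?_
      rw [abs_of_nonneg hz0]
      linarith
    have e1 : ‖(ω : ℂ) ^ (z - 1)‖ ≤ 1 / √ω := by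
      rw [Complex.norm_cpow_eq_rpow_re_of_pos hp, Complex.sub_re, Complex.one_re,
        Real.rpow_sub_one hp.ne', div_le_div_iff₀ hp hs, one_mul]
      calc ω ^ z.re * √ω ≤ √ω * √ω := by gcongr; exact hsq ω hω
        _ = ω := Real.mul_self_sqrt hp.le
    have e2 : ‖(ω : ℂ) ^ z‖ ≤ √ω := by
      rw [Complex.norm_cpow_eq_rpow_re_of_pos hp]
      exact hsq ω hω
    have e3 : ‖((x + 3 * ω ^ 2 : ℝ) : ℂ)‖ = |x + 3 * ω ^ 2| := Complex.norm_real _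
    have e4 : ‖((6 * ω : ℝ) : ℂ)‖ = 6 * ω := by
      rw [Complex.norm_real, Real.norm_eq_abs, abs_of_pos (by positivity)]
    calc ‖B' ω‖ ≤ (‖z‖ * ‖(ω : ℂ) ^ (z - 1)‖ * |x + 3 * ω ^ 2| +
          ‖(ω : ℂ) ^ z‖ * (6 * ω)) / |x + 3 * ω ^ 2| ^ 2 := by
          rw [hB'def]
          simp only
          rw [norm_div, norm_pow, e3]
          gcongr
          refine (norm_sub_le _ _).trans ?_
          rw [norm_mul, norm_mul, norm_mul, e3, e4]
      _ ≤ ((1 + |z.im|) * (1 / √ω) * |x + 3 * ω ^ 2| + √ω * (6 * ω)) / |x + 3 * ω ^ 2| ^ 2 := by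
          gcongr
      _ = _ := by
          field_simp
  have key := norm_integral_mul_deriv_exp_le (φ := fun ω => x * ω + ω ^ 3)
    (φ' := fun ω => x + 3 * ω ^ 2) hab hBd (fun ω _ => by
      have := ((hasDerivAt_id ω).const_mul x).add (hasDerivAt_pow 3 ω)
      refine this.congr_deriv ?_
      norm_num) hG hB'c (by fun_prop) hG' hB'le
  have heq : ∫ ω in a..b, airyIntegrand z x ω = ∫ ω in a..b, B ω * (((x + 3 * ω ^ 2 : ℝ) : ℂ) *
      Complex.exp (Complex.I * ((x * ω + ω ^ 3 : ℝ) : ℂ))) := by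
    apply intervalIntegral.integral_congr
    intro ω hω
    rw [uIcc_of_le hab] at hω
    simp only [hBdef, airyIntegrand]
    rw [← mul_assoc, div_mul_cancel₀ _ (hne' ω hω)]
  rw [heq]
  have hBn : ∀ ω ∈ Icc a b, ‖B ω‖ ≤ c := by
    intro ω hω
    have hφ : 0 < |x + 3 * ω ^ 2| := abs_pos.2 (hne ω hω)
    rw [hBdef]
    simp only
    rw [norm_div, Complex.norm_real, Real.norm_eq_abs, div_le_iff₀ hφ,
      Complex.norm_cpow_eq_rpow_re_of_pos (hpos ω hω)]
    exact (hsq ω hω).trans (hend ω hω)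
  have := hBn a ⟨le_rfl, hab⟩
  have := hBn b ⟨hab, le_rfl⟩
  linarith

/-- To the right of the critical point `s ^ 2`, the derivative of the phase is at least `3 (ω ^ 2 -
s ^ 4) ≥ 3 (ω - s ^ 2) ω`. The distance `1 / s` gives `s (ω - s ^ 2) ≥ 1`, and `√ω ≥ s`; with these
the majorant is a combination of `ω ^ (-3/2)` and `(ω - s ^ 2) ^ (-2)`, whose primitives are
explicit and bounded independently of `s`. -/
theorem norm_integral_airyIntegrand_right_le {z : ℂ} (hz0 : 0 ≤ z.re) (hz1 : z.re ≤ 1 / 2)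
    {x a b s : ℝ} (hs : 1 ≤ s) (hx : -(3 * s ^ 4) ≤ x) (ha : s ^ 2 + 1 / s ≤ a) (hab : a ≤ b) :
    ‖∫ ω in a..b, airyIntegrand z x ω‖ ≤ 2 * (1 + |z.im|) := by
  have hs0 : 0 < s := by linarith
  have hinv : 0 < 1 / s := by positivity
  have hs2 : 1 ≤ s ^ 2 := one_le_pow₀ hs
  have h1 : ∀ ω ∈ Icc a b, s ^ 2 < ω := fun ω hω => by linarith [hω.1]
  have hp : ∀ ω ∈ Icc a b, 0 < ω := fun ω hω => by linarith [h1 ω hω]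
  have hsqrt : ∀ ω ∈ Icc a b, s ≤ √ω := fun ω hω => Real.le_sqrt_of_sq_le (h1 ω hω).le
  have h2 : ∀ ω ∈ Icc a b, 1 / s ≤ ω - s ^ 2 := fun ω hω => by linarith [hω.1]
  have hφ : ∀ ω ∈ Icc a b, 3 * (ω - s ^ 2) * ω ≤ x + 3 * ω ^ 2 := fun ω hω => by
    nlinarith [h1 ω hω, sq_nonneg s, mul_pos (pow_pos hs0 2) (sub_pos.2 (h1 ω hω))]
  have hφ0 : ∀ ω ∈ Icc a b, 0 < 3 * (ω - s ^ 2) * ω := fun ω hω => by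
    have := hp ω hω
    have := sub_pos.2 (h1 ω hω)
    positivity
  have key := norm_integral_airyIntegrand_le_of_majorant hz0 hz1 (x := x) (a := a) (b := b)
    (by linarith) hab
    (G := fun ω => -((1 + |z.im|) * (2 * s / 3)) * (√ω)⁻¹ - (2 / (3 * s)) * (ω - s ^ 2)⁻¹)
    (G' := fun ω => -((1 + |z.im|) * (2 * s / 3)) * (-(1 / (2 * √ω)) / (√ω) ^ 2) -
      (2 / (3 * s)) * (-1 / (ω - s ^ 2) ^ 2)) (c := 1 / 3)
    (fun ω hω => (lt_of_lt_of_le (hφ0 ω hω) (hφ ω hω)).ne')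
    (fun ω hω => by
      have hω0 := hp ω hω
      refine HasDerivAt.sub ?_ ?_
      · exact ((Real.hasDerivAt_sqrt hω0.ne').inv (Real.sqrt_pos.2 hω0).ne').const_mul _
      · exact (((hasDerivAt_id ω).sub_const _).inv (sub_pos.2 (h1 ω hω)).ne').const_mul _)
    (by
      have e1 : ∀ ω ∈ Icc a b, √ω ≠ 0 := fun ω hω => (Real.sqrt_pos.2 (hp ω hω)).ne'
      have e2 : ∀ ω ∈ Icc a b, ω - s ^ 2 ≠ 0 := fun ω hω => (sub_pos.2 (h1 ω hω)).ne'
      refine ContinuousOn.sub (continuousOn_const.mul (ContinuousOn.div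
        (ContinuousOn.neg (ContinuousOn.div continuousOn_const (by fun_prop)
          (fun ω hω => mul_ne_zero two_ne_zero (e1 ω hω)))) (by fun_prop)
          (fun ω hω => pow_ne_zero 2 (e1 ω hω))))
        (continuousOn_const.mul (ContinuousOn.div continuousOn_const (by fun_prop)
          (fun ω hω => pow_ne_zero 2 (e2 ω hω)))))
    (fun ω hω => by
      have hω0 := hp ω hω
      have hd := sub_pos.2 (h1 ω hω)
      have hq : 0 < √ω := Real.sqrt_pos.2 hω0
      have hqq : √ω ^ 2 = ω := Real.sq_sqrt hω0.le
      have hab' : |x + 3 * ω ^ 2| = x + 3 * ω ^ 2 :=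
        abs_of_pos (lt_of_lt_of_le (hφ0 ω hω) (hφ ω hω))
      rw [hab']
      have t1 : (1 + |z.im|) / (√ω * (x + 3 * ω ^ 2)) ≤
          (1 + |z.im|) * (s / (3 * ω * √ω)) := by
        rw [← mul_div_assoc]
        rw [div_le_div_iff₀ (mul_pos hq (lt_of_lt_of_le (hφ0 ω hω) (hφ ω hω))) (by positivity)]
        have hi : 0 ≤ 1 + |z.im| := by positivity
        have : 3 * ω ≤ s * (x + 3 * ω ^ 2) := by
          have : 1 ≤ s * (ω - s ^ 2) := by
            have := mul_le_mul_of_nonneg_left (h2 ω hω) hs0.le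
            rwa [mul_one_div_cancel hs0.ne'] at this
          calc 3 * ω = 3 * ω * 1 := by ring
            _ ≤ 3 * ω * (s * (ω - s ^ 2)) := by gcongr
            _ = s * (3 * (ω - s ^ 2) * ω) := by ring
            _ ≤ _ := by gcongr; exact hφ ω hω
        calc (1 + |z.im|) * (3 * ω * √ω) = (1 + |z.im|) * √ω * (3 * ω) := by ring
          _ ≤ (1 + |z.im|) * √ω * (s * (x + 3 * ω ^ 2)) := by gcongr
          _ = _ := by ring
      have t2 : 6 * ω * √ω / (x + 3 * ω ^ 2) ^ 2 ≤ 2 / (3 * s) * (1 / (ω - s ^ 2) ^ 2) := by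
        calc 6 * ω * √ω / (x + 3 * ω ^ 2) ^ 2 ≤ 6 * ω * √ω / (3 * (ω - s ^ 2) * ω) ^ 2 := by
              have := hφ0 ω hω
              gcongr
              exact hφ ω hω
          _ = 2 / (3 * √ω) * (1 / (ω - s ^ 2) ^ 2) := by
              have : 6 * ω * √ω / (3 * (ω - s ^ 2) * ω) ^ 2 =
                  6 * √ω ^ 2 * √ω / (3 * (ω - s ^ 2) * √ω ^ 2) ^ 2 := by rw [hqq]
              rw [this]
              generalize √ω = r at hq
              field_simp
              ring
          _ ≤ _ := by
              gcongr
              exact hsqrt ω hω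
      refine (add_le_add t1 t2).trans (le_of_eq ?_)
      rw [hqq]
      field_simp
      ring)
    (fun ω hω => by
      have hω0 := hp ω hω
      have hq : 0 < √ω := Real.sqrt_pos.2 hω0
      have hqq : √ω ^ 2 = ω := Real.sq_sqrt hω0.le
      rw [abs_of_pos (lt_of_lt_of_le (hφ0 ω hω) (hφ ω hω))]
      have h3 : 1 ≤ √ω * (ω - s ^ 2) := by
        calc (1 : ℝ) = s * (1 / s) := by field_simp
          _ ≤ √ω * (ω - s ^ 2) := by
            apply mul_le_mul (hsqrt ω hω) (h2 ω hω) hinv.le hq.le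
      have h4 := hφ ω hω
      calc √ω = √ω * 1 := by ring
        _ ≤ √ω * (√ω * (ω - s ^ 2)) := by gcongr
        _ = √ω ^ 2 * (ω - s ^ 2) := by ring
        _ = 1 / 3 * (3 * (ω - s ^ 2) * ω) := by rw [hqq]; ring
        _ ≤ _ := by gcongr)
  refine key.trans ?_
  have haI : a ∈ Icc a b := ⟨le_rfl, hab⟩
  have hbI : b ∈ Icc a b := ⟨hab, le_rfl⟩
  have b1 : s * (√a)⁻¹ ≤ 1 := by
    rw [← div_eq_mul_inv, div_le_one (Real.sqrt_pos.2 (hp a haI))]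
    exact hsqrt a haI
  have b2 : (2 / (3 * s)) * (a - s ^ 2)⁻¹ ≤ 2 / 3 := by
    have hd := sub_pos.2 (h1 a haI)
    rw [← div_eq_mul_inv, div_le_iff₀ hd]
    calc 2 / (3 * s) = 2 / 3 * (1 / s) := by field_simp
      _ ≤ _ := by gcongr; exact h2 a haI
  have b3 : 0 ≤ (1 + |z.im|) * (2 * s / 3) * (√b)⁻¹ := by positivity
  have b4 : 0 ≤ (2 / (3 * s)) * (b - s ^ 2)⁻¹ := by
    have hd := sub_pos.2 (h1 b hbI)
    positivity
  have b5 : (1 + |z.im|) * (2 * s / 3) * (√a)⁻¹ ≤ (1 + |z.im|) * (2 / 3) := by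
    calc _ = (1 + |z.im|) * (2 / 3) * (s * (√a)⁻¹) := by ring
      _ ≤ (1 + |z.im|) * (2 / 3) * 1 := by gcongr
      _ = _ := by ring
  have := abs_nonneg z.im
  nlinarith

/-- The mirror image of the estimate to the right of the critical point. Here the factorization `3
(s ^ 2 - ω) (s ^ 2 + ω)` of the phase derivative must be exact, so `x = -(3 s ^ 4)` is imposed; the
amplitude is controlled by `√ω ≤ s`. -/
theorem norm_integral_airyIntegrand_left_le {z : ℂ} (hz0 : 0 ≤ z.re) (hz1 : z.re ≤ 1 / 2)
    {a b s : ℝ} (hs : 1 ≤ s) (ha : 1 ≤ a) (hab : a ≤ b) (hb : b ≤ s ^ 2 - 1 / s) :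
    ‖∫ ω in a..b, airyIntegrand z (-(3 * s ^ 4)) ω‖ ≤ 2 * (1 + |z.im|) := by
  have hs0 : 0 < s := by linarith
  have hinv : 0 < 1 / s := by positivity
  have h1 : ∀ ω ∈ Icc a b, ω < s ^ 2 := fun ω hω => by linarith [hω.2]
  have hp : ∀ ω ∈ Icc a b, 0 < ω := fun ω hω => by linarith [hω.1]
  have hsqrt : ∀ ω ∈ Icc a b, √ω ≤ s := fun ω hω =>
    (Real.sqrt_le_left hs0.le).2 (h1 ω hω).le
  have h2 : ∀ ω ∈ Icc a b, 1 / s ≤ s ^ 2 - ω := fun ω hω => by linarith [hω.2]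
  have hφeq : ∀ ω ∈ Icc a b, |-(3 * s ^ 4) + 3 * ω ^ 2| = 3 * (s ^ 2 - ω) * (s ^ 2 + ω) :=
    fun ω hω => by
      rw [abs_of_neg]
      · ring
      · have := hp ω hω
        have := sub_pos.2 (h1 ω hω)
        nlinarith
  have hφ : ∀ ω ∈ Icc a b, 3 * (s ^ 2 - ω) * s ^ 2 ≤ |-(3 * s ^ 4) + 3 * ω ^ 2| := fun ω hω => by
    rw [hφeq ω hω]
    have := hp ω hω
    have := sub_pos.2 (h1 ω hω)
    gcongr
    linarith
  have hφ0 : ∀ ω ∈ Icc a b, 0 < 3 * (s ^ 2 - ω) * s ^ 2 := fun ω hω => by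
    have := sub_pos.2 (h1 ω hω)
    positivity
  have key := norm_integral_airyIntegrand_le_of_majorant hz0 hz1 (x := -(3 * s ^ 4)) (a := a) (b := b)
    ha hab
    (G := fun ω => ((1 + |z.im|) * (2 / (3 * s))) * √ω + (2 / (3 * s)) * (s ^ 2 - ω)⁻¹)
    (G' := fun ω => ((1 + |z.im|) * (2 / (3 * s))) * (1 / (2 * √ω)) +
      (2 / (3 * s)) * (- (-1) / (s ^ 2 - ω) ^ 2)) (c := 1 / 3)
    (fun ω hω => abs_pos.1 (lt_of_lt_of_le (hφ0 ω hω) (hφ ω hω)))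
    (fun ω hω => by
      have hω0 := hp ω hω
      refine HasDerivAt.add ?_ ?_
      · exact (Real.hasDerivAt_sqrt hω0.ne').const_mul _
      · exact (((hasDerivAt_id ω).const_sub _).inv (sub_pos.2 (h1 ω hω)).ne').const_mul _)
    (by
      have e1 : ∀ ω ∈ Icc a b, √ω ≠ 0 := fun ω hω => (Real.sqrt_pos.2 (hp ω hω)).ne'
      have e2 : ∀ ω ∈ Icc a b, s ^ 2 - ω ≠ 0 := fun ω hω => (sub_pos.2 (h1 ω hω)).ne'
      refine ContinuousOn.add (continuousOn_const.mul (ContinuousOn.div continuousOn_const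
        (by fun_prop) (fun ω hω => mul_ne_zero two_ne_zero (e1 ω hω))))
        (continuousOn_const.mul (ContinuousOn.div continuousOn_const (by fun_prop)
          (fun ω hω => pow_ne_zero 2 (e2 ω hω)))))
    (fun ω hω => by
      have hω0 := hp ω hω
      have hd := sub_pos.2 (h1 ω hω)
      have hq : 0 < √ω := Real.sqrt_pos.2 hω0
      have hqq : √ω ^ 2 = ω := Real.sq_sqrt hω0.le
      have hpos := lt_of_lt_of_le (hφ0 ω hω) (hφ ω hω)
      refine (add_le_add ?_ ?_ : _ ≤ (1 + |z.im|) * (1 / (3 * s * √ω)) +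
        (2 / (3 * s)) * (1 / (s ^ 2 - ω) ^ 2)).trans (le_of_eq ?_)
      · have : 3 * s ≤ |-(3 * s ^ 4) + 3 * ω ^ 2| := by
          refine le_trans ?_ (hφ ω hω)
          calc 3 * s = 3 * (1 / s) * s ^ 2 := by field_simp
            _ ≤ _ := by gcongr; exact h2 ω hω
        rw [mul_one_div]
        refine div_le_div_of_nonneg_left (by positivity) (by positivity) ?_
        calc 3 * s * √ω ≤ |-(3 * s ^ 4) + 3 * ω ^ 2| * √ω := by gcongr
          _ = _ := by ring
      · calc 6 * ω * √ω / |-(3 * s ^ 4) + 3 * ω ^ 2| ^ 2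
            ≤ 6 * s ^ 2 * s / (3 * (s ^ 2 - ω) * s ^ 2) ^ 2 := by
              have := hφ0 ω hω
              have := h1 ω hω
              gcongr
              · exact hsqrt ω hω
              · exact hφ ω hω
          _ = _ := by
              field_simp
              ring
      · field_simp
        try ring)
    (fun ω hω => by
      have hω0 := hp ω hω
      have hd := sub_pos.2 (h1 ω hω)
      refine (hsqrt ω hω).trans ?_
      have h4 := hφ ω hω
      calc s = 1 / 3 * (3 * (1 / s) * s ^ 2) := by field_simp
        _ ≤ 1 / 3 * (3 * (s ^ 2 - ω) * s ^ 2) := by gcongr; exact h2 ω hω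
        _ ≤ _ := by gcongr)
  refine key.trans ?_
  have haI : a ∈ Icc a b := ⟨le_rfl, hab⟩
  have hbI : b ∈ Icc a b := ⟨hab, le_rfl⟩
  have b2 : (2 / (3 * s)) * (s ^ 2 - b)⁻¹ ≤ 2 / 3 := by
    have hd := sub_pos.2 (h1 b hbI)
    rw [← div_eq_mul_inv, div_le_iff₀ hd]
    calc 2 / (3 * s) = 2 / 3 * (1 / s) := by field_simp
      _ ≤ _ := by gcongr; exact h2 b hbI
  have b3 : 0 ≤ (1 + |z.im|) * (2 / (3 * s)) * √a := by positivity
  have b4 : 0 ≤ (2 / (3 * s)) * (s ^ 2 - a)⁻¹ := by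
    have hd := sub_pos.2 (h1 a haI)
    positivity
  have b5 : (1 + |z.im|) * (2 / (3 * s)) * √b ≤ (1 + |z.im|) * (2 / 3) := by
    calc (1 + |z.im|) * (2 / (3 * s)) * √b ≤ (1 + |z.im|) * (2 / (3 * s)) * s := by
          gcongr
          exact hsqrt b hbI
      _ = _ := by field_simp
  have := abs_nonneg z.im
  nlinarith

/-- This allows a fixed subdivision of the half-line to be intersected with `[r, R]` without case
distinctions: clamping the subdivision points to `[r, R]` produces adjacent intervals, and each of
them is either degenerate or contained in the original piece `[p, q]`. -/
theorem norm_integral_clamp_le {f : ℝ → ℂ} {r R p q M : ℝ} (hr : 0 < r) (hM : 0 ≤ M)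
    (h : ∀ a b, 0 < a → p ≤ a → a ≤ b → b ≤ q → ‖∫ ω in a..b, f ω‖ ≤ M) (hpq : p ≤ q) :
    ‖∫ ω in (max r (min R p))..(max r (min R q)), f ω‖ ≤ M := by
  have hle : max r (min R p) ≤ max r (min R q) := max_le_max le_rfl (min_le_min le_rfl hpq)
  rcases hle.eq_or_lt with he | hlt
  · rw [he, intervalIntegral.integral_same, norm_zero]
    exact hM
  · refine h _ _ (lt_of_lt_of_le hr (le_max_left _ _)) ?_ hle ?_
    · by_contra hc
      rw [not_le, max_lt_iff] at hc
      rcases min_lt_iff.1 hc.2 with h1 | h1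
      · have h2 : max r (min R q) ≤ max r (min R p) := by
          rw [min_eq_left h1.le]
          exact max_le_max le_rfl (min_le_left _ _)
        exact absurd hlt (not_lt.2 h2)
      · exact lt_irrefl _ h1
    · by_contra hc
      rw [not_le, lt_max_iff] at hc
      rcases hc with h1 | h1
      · have h2 : max r (min R q) ≤ max r (min R p) := by
          refine max_le (le_max_left _ _) ?_
          exact (min_le_right _ _).trans (h1.le.trans (le_max_left _ _))
        exact absurd hlt (not_lt.2 h2)
      · exact absurd h1 (not_lt.2 (min_le_right _ _))

theorem norm_integral_airyIntegrand_le_length {z : ℂ} {x a b M : ℝ} (ha : 0 < a) (hab : a ≤ b)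
    (hM : ∀ ω ∈ Ioc a b, ω ^ z.re ≤ M) : ‖∫ ω in a..b, airyIntegrand z x ω‖ ≤ M * (b - a) := by
  rw [← abs_of_nonneg (sub_nonneg.2 hab)]
  apply intervalIntegral.norm_integral_le_of_norm_le_const
  intro ω hω
  rw [uIoc_of_le hab] at hω
  rw [norm_airyIntegrand (ha.trans hω.1)]
  exact hM ω hω

/-- The normalized Airy kernel with a frequency cutoff is bounded. -/
theorem norm_integral_airyIntegrand_le {z : ℂ} (hz0 : 0 ≤ z.re) (hz1 : z.re ≤ 1 / 2) {x r R : ℝ}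
    (hr : 0 < r) (hrR : r ≤ R) : ‖∫ ω in r..R, airyIntegrand z x ω‖ ≤ 9 * (1 + |z.im|) := by
  have him := abs_nonneg z.im
  -- For `x < -3` the phase is stationary at `ω = s ^ 2` with `x = -(3 s ^ 4)`. For `x ≥ -3` there
  -- is no stationary point above frequency `1`, and `s = 1` serves.
  obtain ⟨s, hs, hx, hx'⟩ : ∃ s : ℝ, 1 ≤ s ∧ -(3 * s ^ 4) ≤ x ∧ (s = 1 ∨ x = -(3 * s ^ 4)) := by
    by_cases h : -3 ≤ x
    · exact ⟨1, le_rfl, by linarith, Or.inl rfl⟩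
    · have h0 : 1 ≤ -x / 3 := by linarith
      have h1 : ((-x / 3) ^ (1 / 4 : ℝ)) ^ 4 = -x / 3 := by
        rw [← Real.rpow_natCast, ← Real.rpow_mul (by linarith)]
        norm_num
      have h2 : x = -(3 * ((-x / 3) ^ (1 / 4 : ℝ)) ^ 4) := by rw [h1]; ring
      exact ⟨(-x / 3) ^ (1 / 4 : ℝ), Real.one_le_rpow h0 (by norm_num), h2.ge, Or.inr h2⟩
  have hs0 : 0 < s := by linarith
  have hinv : 0 < 1 / s := by positivity
  have hinv1 : 1 / s ≤ 1 := by rw [div_le_one hs0]; exact hs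
  have hs2 : 1 ≤ s ^ 2 := one_le_pow₀ hs
  have hi : ∀ a b, 0 < a → 0 < b → IntervalIntegrable (airyIntegrand z x) volume a b := by
    intro a b ha hb
    apply ContinuousOn.intervalIntegrable
    refine (continuousOn_airyIntegrand z x).mono fun ω hω => ?_
    exact lt_of_lt_of_le (lt_min ha hb) hω.1
  -- The window of half-width `1 / s` around the critical point is treated by size alone: the
  -- amplitude is at most `2 s` there and the length at most `2 / s`, which gives `4`. Frequencies
  -- below `1` give at most `1`, and each side of the window `2 (1 + |z.im|)`; the total is at most
  -- `9 (1 + |z.im|)`.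
  set p := max 1 (s ^ 2 - 1 / s) with hp
  set q := s ^ 2 + 1 / s with hq
  have hpq : p ≤ q := max_le (by linarith) (by linarith)
  have c0 : ∀ t, 0 < max r (min R t) := fun t => lt_of_lt_of_le hr (le_max_left _ _)
  have i1 : ‖∫ ω in (max r (min R 0))..(max r (min R 1)), airyIntegrand z x ω‖ ≤ 1 := by
    refine norm_integral_clamp_le hr zero_le_one (fun a b ha _ hab hb => ?_) zero_le_one
    refine (norm_integral_airyIntegrand_le_length (M := 1) ha hab fun ω hω => ?_).trans (by linarith)
    exact Real.rpow_le_one (ha.trans hω.1).le (hω.2.trans hb) hz0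
  have i2 : ‖∫ ω in (max r (min R 1))..(max r (min R p)), airyIntegrand z x ω‖ ≤
      2 * (1 + |z.im|) := by
    refine norm_integral_clamp_le hr (by positivity) (fun a b ha ha1 hab hb => ?_) (le_max_left _ _)
    rcases hx' with h | h
    · have hp1 : p = 1 := by rw [hp, h]; norm_num
      have : a = b := by linarith
      rw [this, intervalIntegral.integral_same, norm_zero]
      positivity
    · by_cases hb1 : b ≤ s ^ 2 - 1 / s
      · rw [h]
        exact norm_integral_airyIntegrand_left_le hz0 hz1 hs ha1 hab hb1
      · have hb2 : b ≤ 1 := by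
          rcases le_max_iff.1 hb with h3 | h3
          · exact h3
          · exact absurd h3 hb1
        have : a = b := by linarith
        rw [this, intervalIntegral.integral_same, norm_zero]
        positivity
  have i3 : ‖∫ ω in (max r (min R p))..(max r (min R q)), airyIntegrand z x ω‖ ≤ 4 := by
    refine norm_integral_clamp_le hr (by norm_num) (fun a b ha ha1 hab hb => ?_) hpq
    have ha2 := (max_le_iff.1 ha1).1
    have ha3 := (max_le_iff.1 ha1).2
    refine (norm_integral_airyIntegrand_le_length (M := 2 * s) ha hab fun ω hω => ?_).trans ?_
    · have hω1 : 1 ≤ ω := ha2.trans hω.1.le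
      calc ω ^ z.re ≤ ω ^ (1 / 2 : ℝ) := Real.rpow_le_rpow_of_exponent_le hω1 hz1
        _ = √ω := (Real.sqrt_eq_rpow ω).symm
        _ ≤ 2 * s := by
          rw [Real.sqrt_le_left (by positivity)]
          have := hω.2.trans hb
          nlinarith
    · calc 2 * s * (b - a) ≤ 2 * s * (2 * (1 / s)) := by
            gcongr
            linarith
        _ = 4 := by field_simp; norm_num
  have i4 : ‖∫ ω in (max r (min R q))..(max r (min R (max q R))), airyIntegrand z x ω‖ ≤
      2 * (1 + |z.im|) := by
    refine norm_integral_clamp_le hr (by positivity) (fun a b ha ha1 hab hb => ?_) (le_max_left _ _)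
    exact norm_integral_airyIntegrand_right_le hz0 hz1 hs hx ha1 hab
  have e0 : max r (min R 0) = r := max_eq_left ((min_le_right _ _).trans hr.le)
  have e4 : max r (min R (max q R)) = R := by
    rw [min_eq_left (le_max_right _ _), max_eq_right hrR]
  have hsum : ∫ ω in r..R, airyIntegrand z x ω =
      (((∫ ω in (max r (min R 0))..(max r (min R 1)), airyIntegrand z x ω) +
      ∫ ω in (max r (min R 1))..(max r (min R p)), airyIntegrand z x ω) +
      ∫ ω in (max r (min R p))..(max r (min R q)), airyIntegrand z x ω) +
      ∫ ω in (max r (min R q))..(max r (min R (max q R))), airyIntegrand z x ω := by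
    rw [intervalIntegral.integral_add_adjacent_intervals (hi _ _ (c0 _) (c0 _)) (hi _ _ (c0 _) (c0 _)),
      intervalIntegral.integral_add_adjacent_intervals (hi _ _ (c0 _) (c0 _)) (hi _ _ (c0 _) (c0 _)),
      intervalIntegral.integral_add_adjacent_intervals (hi _ _ (c0 _) (c0 _)) (hi _ _ (c0 _) (c0 _)),
      e0, e4]
  rw [hsum]
  refine (norm_add_le _ _).trans ?_
  have := norm_add_le ((∫ ω in (max r (min R 0))..(max r (min R 1)), airyIntegrand z x ω) +
      ∫ ω in (max r (min R 1))..(max r (min R p)), airyIntegrand z x ω)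
      (∫ ω in (max r (min R p))..(max r (min R q)), airyIntegrand z x ω)
  have := norm_add_le (∫ ω in (max r (min R 0))..(max r (min R 1)), airyIntegrand z x ω)
      (∫ ω in (max r (min R 1))..(max r (min R p)), airyIntegrand z x ω)
  linarith

/-- The Airy kernel with a frequency cutoff, on the positive frequencies. -/
theorem norm_integral_cpow_mul_exp_cubic_le {z : ℂ} (hz0 : 0 ≤ z.re) (hz1 : z.re ≤ 1 / 2)
    {x τ r R : ℝ} (hτ : τ ≠ 0) (hr : 0 < r) (hrR : r ≤ R) :
    ‖∫ ω in r..R, (ω : ℂ) ^ z * Complex.exp (Complex.I * ((x * ω + τ * ω ^ 3 : ℝ) : ℂ))‖ ≤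
      9 * (1 + |z.im|) * |τ| ^ (-(1 + z.re) / 3) := by
  -- Complex conjugation exchanges `(z, x, τ)` with `(conj z, -x, -τ)` and preserves the norm.
  wlog hpos : 0 < τ generalizing z x τ
  · have hneg : τ < 0 := lt_of_le_of_ne (not_lt.1 hpos) hτ
    have key := this (z := (starRingEnd ℂ) z) (x := -x) (τ := -τ) (by simpa using hz0)
      (by simpa using hz1) (neg_ne_zero.2 hτ) (by linarith)
    simp only [Complex.conj_re, Complex.conj_im, abs_neg] at key
    refine le_trans (le_of_eq ?_) key
    rw [← Complex.norm_conj, intervalIntegral.integral_of_le hrR, ← integral_conj,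
      intervalIntegral.integral_of_le hrR]
    congr 1
    refine setIntegral_congr_fun measurableSet_Ioc fun ω hω => ?_
    have hω : 0 < ω := hr.trans hω.1
    simp only [map_mul]
    congr 1
    · rw [Complex.cpow_conj _ _ (by rw [Complex.arg_ofReal_of_nonneg hω.le]; exact Real.pi_pos.ne),
        Complex.conj_ofReal]
    · rw [← Complex.exp_conj, map_mul, Complex.conj_I, Complex.conj_ofReal]
      congr 1
      push_cast
      ring
  -- The dilation that normalizes the cubic term, `τ c ^ 3 = 1`. The Jacobian and the amplitude
  -- contribute `c * c ^ z.re`, which is the power of `τ` in the statement.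
  · set c := τ ^ (-(1 / 3) : ℝ) with hc
    have hc0 : 0 < c := Real.rpow_pos_of_pos hpos _
    have hc3 : τ * c ^ 3 = 1 := by
      rw [hc, ← Real.rpow_natCast, ← Real.rpow_mul hpos.le]
      norm_num
      rw [Real.rpow_neg_one, mul_inv_cancel₀ hpos.ne']
    have hsub := intervalIntegral.smul_integral_comp_mul_left (a := r / c) (b := R / c)
      (fun ω : ℝ => (ω : ℂ) ^ z * Complex.exp (Complex.I * ((x * ω + τ * ω ^ 3 : ℝ) : ℂ))) c
    rw [mul_div_cancel₀ _ hc0.ne', mul_div_cancel₀ _ hc0.ne'] at hsub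
    rw [← hsub]
    have hrc : 0 < r / c := by positivity
    have hrRc : r / c ≤ R / c := by gcongr
    have hcong : ∫ ω in (r / c)..(R / c), ((c * ω : ℝ) : ℂ) ^ z *
        Complex.exp (Complex.I * ((x * (c * ω) + τ * (c * ω) ^ 3 : ℝ) : ℂ)) =
        ∫ ω in (r / c)..(R / c), (c : ℂ) ^ z * airyIntegrand z (x * c) ω := by
      apply intervalIntegral.integral_congr
      intro ω hω
      rw [uIcc_of_le hrRc] at hω
      have hω0 : 0 < ω := lt_of_lt_of_le hrc hω.1
      simp only [airyIntegrand]
      rw [Complex.ofReal_mul, Complex.mul_cpow_ofReal_nonneg hc0.le hω0.le, mul_assoc]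
      congr 3
      congr 2
      calc x * (c * ω) + τ * (c * ω) ^ 3 = x * c * ω + (τ * c ^ 3) * ω ^ 3 := by ring
        _ = _ := by rw [hc3, one_mul]
    rw [hcong, intervalIntegral.integral_const_mul, norm_smul, norm_mul,
      Complex.norm_cpow_eq_rpow_re_of_pos hc0, Real.norm_eq_abs, abs_of_pos hc0, ← mul_assoc,
      abs_of_pos hpos]
    have hcc : c * c ^ z.re = τ ^ (-(1 + z.re) / 3) := by
      rw [← Real.rpow_one_add' hc0.le (by linarith), hc, ← Real.rpow_mul hpos.le]
      congr 1
      ring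
    rw [hcc, mul_comm]
    gcongr
    exact norm_integral_airyIntegrand_le hz0 hz1 hrc hrRc

end Oscillatory

/-! ### Stein interpolation in finite dimensions -/

section Interpolation

/-- On the line of real part `1` the factor `exp (z ^ 2)` has modulus `exp (1 - y ^ 2)`; this is how
it absorbs the linear growth in the three lines theorem. -/
theorem one_add_abs_mul_exp_neg_sq_le (y : ℝ) : Real.exp (1 - y ^ 2) * (1 + |y|) ≤ 6 := by
  have h1 : 1 + |y| ≤ 2 * Real.exp (y ^ 2) := by
    have h2 := Real.add_one_le_exp (y ^ 2)
    have h3 : y ^ 2 = |y| ^ 2 := (sq_abs y).symm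
    nlinarith [sq_nonneg (|y| - 1), abs_nonneg y]
  have h4 : Real.exp 1 ≤ 3 := by linarith [Real.exp_one_lt_d9]
  calc Real.exp (1 - y ^ 2) * (1 + |y|) ≤ Real.exp (1 - y ^ 2) * (2 * Real.exp (y ^ 2)) := by gcongr
    _ = 2 * Real.exp 1 := by
      rw [mul_left_comm, ← Real.exp_add]
      ring_nf
    _ ≤ 6 := by linarith

/-- The three lines theorem, with linear growth on the right edge. -/
theorem norm_le_of_three_lines {F : ℂ → ℂ} (hF : Differentiable ℂ F) {K A₀ A₁ : ℝ}
    (hK : ∀ z : ℂ, 0 ≤ z.re → z.re ≤ 1 → ‖F z‖ ≤ K) (hA₀ : 0 ≤ A₀) (hA₁ : 0 ≤ A₁)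
    (h₀ : ∀ y : ℝ, ‖F (y * Complex.I)‖ ≤ A₀)
    (h₁ : ∀ y : ℝ, ‖F (1 + y * Complex.I)‖ ≤ A₁ * (1 + |y|)) {θ : ℝ} (hθ : θ ∈ Icc (0 : ℝ) 1) :
    ‖F θ‖ ≤ 6 * (A₀ ^ (1 - θ) * A₁ ^ θ) := by
  have hnorm : ∀ z : ℂ, ‖Complex.exp (z ^ 2)‖ = Real.exp (z.re ^ 2 - z.im ^ 2) := by
    intro z
    rw [Complex.norm_exp]
    congr 1
    rw [sq, Complex.mul_re]
    ring
  have hK0 : 0 ≤ K := (norm_nonneg _).trans (hK 0 (by simp) (by simp))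
  -- The theorem is applied to `exp (z ^ 2) * F z`. The factor has modulus at most `1` on the left
  -- edge and at least `1` at the real point `θ`, so it is removed at no cost; the constant `6` of
  -- the right edge enters only through `6 ^ θ ≤ 6`.
  have key := Complex.HadamardThreeLines.norm_le_interp_of_mem_verticalClosedStrip'
    (f := fun z => Complex.exp (z ^ 2) * F z) (z := (θ : ℂ)) (a := A₀) (b := 6 * A₁) (l := 0) (u := 1)
    zero_lt_one (by
      change _ ∈ Icc _ _
      simpa using hθ) (by
      apply Differentiable.diffContOnCl
      fun_prop) (by
      refine ⟨Real.exp 1 * K, ?_⟩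
      rintro _ ⟨z, hz, rfl⟩
      have hz' : z.re ∈ Icc (0 : ℝ) 1 := hz
      simp only [Function.comp]
      rw [norm_mul, hnorm]
      have := hK z hz'.1 hz'.2
      gcongr
      nlinarith [sq_nonneg z.im, hz'.1, hz'.2]) (by
      intro z hz
      have hz' : z.re = 0 := hz
      have hzz : z = z.im * Complex.I := by
        apply Complex.ext <;> simp [hz']
      rw [norm_mul, hnorm, hz']
      have h2 : Real.exp (0 ^ 2 - z.im ^ 2) ≤ 1 := by
        rw [Real.exp_le_one_iff]
        nlinarith [sq_nonneg z.im]
      have h3 : ‖F z‖ ≤ A₀ := by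
        rw [hzz]
        exact h₀ _
      calc _ ≤ 1 * A₀ := by gcongr
        _ = A₀ := one_mul _) (by
      intro z hz
      have hz' : z.re = 1 := hz
      have hzz : z = 1 + z.im * Complex.I := by
        apply Complex.ext <;> simp [hz']
      rw [norm_mul, hnorm, hz']
      have h3 : ‖F z‖ ≤ A₁ * (1 + |z.im|) := by
        rw [hzz]
        simpa using h₁ z.im
      have h4 := one_add_abs_mul_exp_neg_sq_le z.im
      rw [one_pow]
      calc _ ≤ Real.exp (1 - z.im ^ 2) * (A₁ * (1 + |z.im|)) := by gcongr
        _ = A₁ * (Real.exp (1 - z.im ^ 2) * (1 + |z.im|)) := by ring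
        _ ≤ A₁ * 6 := by gcongr
        _ = _ := by ring)
  simp only [Complex.ofReal_re, sub_zero, div_one] at key
  rw [norm_mul, hnorm] at key
  have h5 : 1 ≤ Real.exp ((θ : ℂ).re ^ 2 - (θ : ℂ).im ^ 2) := by
    rw [Real.one_le_exp_iff]
    simp
    positivity
  have h6 : (6 * A₁) ^ θ ≤ 6 * A₁ ^ θ := by
    rw [Real.mul_rpow (by norm_num) hA₁]
    gcongr
    calc (6 : ℝ) ^ θ ≤ 6 ^ (1 : ℝ) := Real.rpow_le_rpow_of_exponent_le (by norm_num) hθ.2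
      _ = 6 := Real.rpow_one _
  calc ‖F θ‖ = 1 * ‖F θ‖ := (one_mul _).symm
    _ ≤ _ := by gcongr
    _ ≤ _ := key
    _ ≤ A₀ ^ (1 - θ) * (6 * A₁ ^ θ) := by gcongr
    _ = _ := by ring

/-- The analytic family through a complex number which raises its modulus to the power `w`. -/
noncomputable def modulusPow (c : ℂ) (w : ℂ) : ℂ :=
  if c = 0 then 0 else c / ‖c‖ * Complex.exp (w * Real.log ‖c‖)

theorem differentiable_modulusPow (c : ℂ) : Differentiable ℂ (modulusPow c) := by
  unfold modulusPow
  by_cases h : c = 0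
  · simp only [h, if_true]
    exact differentiable_const _
  · simp only [h, if_false]
    fun_prop

theorem modulusPow_one (c : ℂ) : modulusPow c 1 = c := by
  unfold modulusPow
  split_ifs with h
  · exact h.symm
  · have hn : 0 < ‖c‖ := norm_pos_iff.2 h
    rw [one_mul, ← Complex.ofReal_exp, Real.exp_log hn,
      div_mul_cancel₀ _ (Complex.ofReal_ne_zero.2 hn.ne')]

/-- A nonzero real part is needed only at `c = 0`, where `modulusPow` vanishes but `‖0‖ ^ 0 = 1`. -/
theorem norm_modulusPow (c : ℂ) {w : ℂ} (hw : w.re ≠ 0) : ‖modulusPow c w‖ = ‖c‖ ^ w.re := by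
  unfold modulusPow
  split_ifs with h
  · rw [h, norm_zero, Real.zero_rpow hw]
  · have hn : 0 < ‖c‖ := norm_pos_iff.2 h
    rw [norm_mul, norm_div, Complex.norm_real, norm_norm, div_self hn.ne', one_mul,
      Complex.norm_exp, Complex.re_mul_ofReal, Real.rpow_def_of_pos hn, mul_comm]

theorem norm_modulusPow_le (c : ℂ) {w : ℂ} {M : ℝ} (h0 : 0 ≤ w.re) (h1 : w.re ≤ M) :
    ‖modulusPow c w‖ ≤ (1 + ‖c‖) ^ M := by
  unfold modulusPow
  have h2 : (1 : ℝ) ≤ 1 + ‖c‖ := by linarith [norm_nonneg c]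
  split_ifs with h
  · rw [norm_zero]
    positivity
  · have hn : 0 < ‖c‖ := norm_pos_iff.2 h
    rw [norm_mul, norm_div, Complex.norm_real, norm_norm, div_self hn.ne', one_mul,
      Complex.norm_exp, Complex.re_mul_ofReal, mul_comm, ← Real.rpow_def_of_pos hn]
    calc ‖c‖ ^ w.re ≤ (1 + ‖c‖) ^ w.re := by gcongr; linarith
      _ ≤ _ := Real.rpow_le_rpow_of_exponent_le h2 h1

/-- The weighted `ℓ^a` norm. -/
noncomputable def weightedNorm {ι : Type*} [Fintype ι] (w : ι → ℝ) (a : ℝ) (c : ι → ℂ) : ℝ :=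
  (∑ i, w i * ‖c i‖ ^ a) ^ (1 / a)

variable {ι κ : Type*} [Fintype ι] [Fintype κ]

theorem weightedNorm_nonneg {w : ι → ℝ} (hw : ∀ i, 0 < w i) (a : ℝ) (c : ι → ℂ) :
    0 ≤ weightedNorm w a c :=
  Real.rpow_nonneg (Finset.sum_nonneg fun i _ =>
    mul_nonneg (hw i).le (Real.rpow_nonneg (norm_nonneg _) _)) _

theorem weightedNorm_smul {w : ι → ℝ} (hw : ∀ i, 0 < w i) {a : ℝ} (ha : 0 < a) (k : ℂ)
    (c : ι → ℂ) : weightedNorm w a (fun i => k * c i) = ‖k‖ * weightedNorm w a c := by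
  unfold weightedNorm
  have h1 : ∀ i, w i * ‖k * c i‖ ^ a = ‖k‖ ^ a * (w i * ‖c i‖ ^ a) := fun i => by
    rw [norm_mul, Real.mul_rpow (norm_nonneg _) (norm_nonneg _)]
    ring
  simp_rw [h1]
  rw [← Finset.mul_sum, Real.mul_rpow (by positivity) (Finset.sum_nonneg fun i _ =>
    mul_nonneg (hw i).le (Real.rpow_nonneg (norm_nonneg _) _)), ← Real.rpow_mul (norm_nonneg _),
    mul_one_div_cancel ha.ne', Real.rpow_one]

theorem eq_zero_of_weightedNorm_eq_zero {w : ι → ℝ} (hw : ∀ i, 0 < w i) {a : ℝ} (ha : 0 < a)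
    {c : ι → ℂ} (h : weightedNorm w a c = 0) (i : ι) : c i = 0 := by
  have hnn : ∀ i ∈ Finset.univ, 0 ≤ w i * ‖c i‖ ^ a := fun i _ =>
    mul_nonneg (hw i).le (Real.rpow_nonneg (norm_nonneg _) _)
  unfold weightedNorm at h
  rw [Real.rpow_eq_zero (Finset.sum_nonneg hnn) (one_div_ne_zero ha.ne'),
    Finset.sum_eq_zero_iff_of_nonneg hnn] at h
  have h1 := h i (Finset.mem_univ i)
  rcases mul_eq_zero.1 h1 with h2 | h2
  · exact absurd h2 (hw i).ne'
  · rw [Real.rpow_eq_zero (norm_nonneg _) ha.ne'] at h2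
    exact norm_eq_zero.1 h2

/-- The exponent of the analytic family. -/
noncomputable def stripExponent (a a₀ a₁ : ℝ) (z : ℂ) : ℂ := a * ((1 - z) / a₀ + z / a₁)

theorem stripExponent_re (a a₀ a₁ : ℝ) (z : ℂ) :
    (stripExponent a a₀ a₁ z).re = a * ((1 - z.re) / a₀ + z.re / a₁) := by
  simp [stripExponent, Complex.div_ofReal_re]

/-- Raising moduli to the power `a / a'` carries the unit sphere of weighted `ℓ^a` to that of
`ℓ^{a'}`. Hence the analytic family stays normalized on both edges of the strip. -/
theorem weightedNorm_modulusPow {w : ι → ℝ} {a a' : ℝ} (ha : 0 < a) (ha' : 0 < a') {c : ι → ℂ}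
    (hc : weightedNorm w a c = 1) (hw : ∀ i, 0 < w i) {e : ℂ} (he : e.re = a / a') :
    weightedNorm w a' (fun i => modulusPow (c i) e) = 1 := by
  have hsum : ∑ i, w i * ‖c i‖ ^ a = 1 := by
    have h0 : 0 ≤ ∑ i, w i * ‖c i‖ ^ a := Finset.sum_nonneg fun i _ =>
      mul_nonneg (hw i).le (Real.rpow_nonneg (norm_nonneg _) _)
    have h1 : ((∑ i, w i * ‖c i‖ ^ a) ^ (1 / a)) ^ a = 1 := by
      change (weightedNorm w a c) ^ a = 1
      rw [hc, Real.one_rpow]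
    rwa [← Real.rpow_mul h0, one_div_mul_cancel ha.ne', Real.rpow_one] at h1
  have hre : e.re ≠ 0 := by rw [he]; positivity
  unfold weightedNorm
  have h1 : ∀ i, w i * ‖modulusPow (c i) e‖ ^ a' = w i * ‖c i‖ ^ a := fun i => by
    rw [norm_modulusPow _ hre, he, ← Real.rpow_mul (norm_nonneg _), div_mul_cancel₀ _ ha'.ne']
  simp_rw [h1, hsum, Real.one_rpow]

/-- **Stein interpolation** for an analytic family of bilinear forms on finite dimensional weighted
spaces. -/
theorem norm_bilin_le_of_interpolation {L : ℂ → ι → κ → ℂ}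
    (hL : ∀ i j, Differentiable ℂ fun z => L z i j) {K : ℝ}
    (hK : ∀ z : ℂ, 0 ≤ z.re → z.re ≤ 1 → ∀ i j, ‖L z i j‖ ≤ K)
    {w : ι → ℝ} {v : κ → ℝ} (hw : ∀ i, 0 < w i) (hv : ∀ j, 0 < v j)
    {a₀ a₁ a b₀ b₁ b θ A₀ A₁ : ℝ} (ha₀ : 0 < a₀) (ha₁ : 0 < a₁) (ha : 0 < a) (hb₀ : 0 < b₀)
    (hb₁ : 0 < b₁) (hb : 0 < b) (hθ : θ ∈ Icc (0 : ℝ) 1)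
    (haθ : 1 / a = (1 - θ) / a₀ + θ / a₁) (hbθ : 1 / b = (1 - θ) / b₀ + θ / b₁)
    (hA₀ : 0 ≤ A₀) (hA₁ : 0 ≤ A₁)
    (h₀ : ∀ (y : ℝ) (c : ι → ℂ) (d : κ → ℂ), ‖∑ i, ∑ j, c i * d j * L (y * Complex.I) i j‖ ≤
      A₀ * (weightedNorm w a₀ c * weightedNorm v b₀ d))
    (h₁ : ∀ (y : ℝ) (c : ι → ℂ) (d : κ → ℂ), ‖∑ i, ∑ j, c i * d j * L (1 + y * Complex.I) i j‖ ≤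
      A₁ * (1 + |y|) * (weightedNorm w a₁ c * weightedNorm v b₁ d))
    (c : ι → ℂ) (d : κ → ℂ) :
    ‖∑ i, ∑ j, c i * d j * L θ i j‖ ≤
      6 * (A₀ ^ (1 - θ) * A₁ ^ θ) * (weightedNorm w a c * weightedNorm v b d) := by
  have normalized : ∀ (c : ι → ℂ) (d : κ → ℂ), weightedNorm w a c = 1 → weightedNorm v b d = 1 →
      ‖∑ i, ∑ j, c i * d j * L θ i j‖ ≤ 6 * (A₀ ^ (1 - θ) * A₁ ^ θ) := by
    intro c d hc hd
    -- By `haθ` and `hbθ` both exponents equal `1` at `z = θ`, so `F θ` is the form to be bounded.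
    -- On the two edges their real parts are `a / a₀, b / b₀` and `a / a₁, b / b₁`, which makes the
    -- vectors unit vectors for the edge norms.
    set F : ℂ → ℂ := fun z => ∑ i, ∑ j, modulusPow (c i) (stripExponent a a₀ a₁ z) *
      modulusPow (d j) (stripExponent b b₀ b₁ z) * L z i j with hFdef
    have hse : ∀ a a₀ a₁ : ℝ, Differentiable ℂ (stripExponent a a₀ a₁) := fun a a₀ a₁ => by
      unfold stripExponent
      fun_prop
    have hF : Differentiable ℂ F := by
      refine Differentiable.fun_sum fun i _ => Differentiable.fun_sum fun j _ => ?_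
      exact (((differentiable_modulusPow _).comp (hse _ _ _)).mul
        ((differentiable_modulusPow _).comp (hse _ _ _))).mul (hL i j)
    have hbd : ∀ {a a₀ a₁ : ℝ}, 0 < a → 0 < a₀ → 0 < a₁ → ∀ z : ℂ, 0 ≤ z.re → z.re ≤ 1 →
        0 ≤ (stripExponent a a₀ a₁ z).re ∧
          (stripExponent a a₀ a₁ z).re ≤ a * (1 / a₀ + 1 / a₁) := by
      intro a a₀ a₁ h1 h2 h3 z hz0 hz1
      rw [stripExponent_re]
      have : 0 ≤ 1 - z.re := by linarith
      constructor
      · positivity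
      · gcongr
        linarith
    have hθF : F θ = ∑ i, ∑ j, c i * d j * L θ i j := by
      have e1 : stripExponent a a₀ a₁ θ = 1 := by
        have : (stripExponent a a₀ a₁ θ) = ((a * ((1 - θ) / a₀ + θ / a₁) : ℝ) : ℂ) := by
          simp [stripExponent]
        rw [this, ← haθ, mul_one_div_cancel ha.ne', Complex.ofReal_one]
      have e2 : stripExponent b b₀ b₁ θ = 1 := by
        have : (stripExponent b b₀ b₁ θ) = ((b * ((1 - θ) / b₀ + θ / b₁) : ℝ) : ℂ) := by
          simp [stripExponent]
        rw [this, ← hbθ, mul_one_div_cancel hb.ne', Complex.ofReal_one]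
      simp only [hFdef, e1, e2, modulusPow_one]
    rw [← hθF]
    -- This `K` only certifies boundedness on the strip; it does not enter the final constant.
    refine norm_le_of_three_lines hF (K := ∑ i, ∑ j, (1 + ‖c i‖) ^ (a * (1 / a₀ + 1 / a₁)) *
      (1 + ‖d j‖) ^ (b * (1 / b₀ + 1 / b₁)) * K) ?_ hA₀ hA₁ ?_ ?_ hθ
    · intro z hz0 hz1
      refine (norm_sum_le _ _).trans (Finset.sum_le_sum fun i _ => ?_)
      refine (norm_sum_le _ _).trans (Finset.sum_le_sum fun j _ => ?_)
      rw [norm_mul, norm_mul]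
      have b1 := hbd ha ha₀ ha₁ z hz0 hz1
      have b2 := hbd hb hb₀ hb₁ z hz0 hz1
      gcongr
      · exact norm_modulusPow_le _ b1.1 b1.2
      · exact norm_modulusPow_le _ b2.1 b2.2
      · exact hK z hz0 hz1 i j
    · intro y
      refine (h₀ y _ _).trans (le_of_eq ?_)
      rw [weightedNorm_modulusPow ha ha₀ hc hw, weightedNorm_modulusPow hb hb₀ hd hv]
      · ring
      · rw [stripExponent_re]
        simp
        rw [div_eq_mul_inv]
      · rw [stripExponent_re]
        simp
        rw [div_eq_mul_inv]
    · intro y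
      refine (h₁ y _ _).trans (le_of_eq ?_)
      rw [weightedNorm_modulusPow ha ha₁ hc hw, weightedNorm_modulusPow hb hb₁ hd hv]
      · ring
      · rw [stripExponent_re]
        simp
        rw [div_eq_mul_inv]
      · rw [stripExponent_re]
        simp
        rw [div_eq_mul_inv]
  by_cases hc : weightedNorm w a c = 0
  · have : ∀ i, c i = 0 := eq_zero_of_weightedNorm_eq_zero hw ha hc
    simp [this, hc]
  by_cases hd : weightedNorm v b d = 0
  · have : ∀ i, d i = 0 := eq_zero_of_weightedNorm_eq_zero hv hb hd
    simp [this, hd]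
  have hc0 := weightedNorm_nonneg hw a c
  have hd0 := weightedNorm_nonneg hv b d
  set N := weightedNorm w a c
  set N' := weightedNorm v b d
  have hcn : weightedNorm w a (fun i => ((N⁻¹ : ℝ) : ℂ) * c i) = 1 := by
    rw [weightedNorm_smul hw ha, Complex.norm_real, Real.norm_eq_abs, abs_inv, abs_of_nonneg hc0,
      inv_mul_cancel₀ hc]
  have hdn : weightedNorm v b (fun i => ((N'⁻¹ : ℝ) : ℂ) * d i) = 1 := by
    rw [weightedNorm_smul hv hb, Complex.norm_real, Real.norm_eq_abs, abs_inv, abs_of_nonneg hd0,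
      inv_mul_cancel₀ hd]
  have key := normalized _ _ hcn hdn
  have heq : ∑ i, ∑ j, ((N⁻¹ : ℝ) : ℂ) * c i * (((N'⁻¹ : ℝ) : ℂ) * d j) * L θ i j =
      ((N⁻¹ * N'⁻¹ : ℝ) : ℂ) * ∑ i, ∑ j, c i * d j * L θ i j := by
    rw [Finset.mul_sum]
    refine Finset.sum_congr rfl fun i _ => ?_
    rw [Finset.mul_sum]
    refine Finset.sum_congr rfl fun j _ => ?_
    push_cast
    ring
  rw [heq, norm_mul, Complex.norm_real, Real.norm_eq_abs, abs_of_nonneg (by positivity)] at key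
  have hNN : 0 < N * N' := mul_pos (lt_of_le_of_ne hc0 (Ne.symm hc)) (lt_of_le_of_ne hd0 (Ne.symm hd))
  rw [← mul_inv, inv_mul_le_iff₀ hNN] at key
  linarith

end Interpolation

/-! ### Frequency bands and complex powers of the frequency -/

section Band

/-- The frequency band `1 / (n + 1) ≤ |2 π ξ| ≤ n + 1`. -/
def band (n : ℕ) : Set ℝ := {ξ | ((n : ℝ) + 1)⁻¹ ≤ |2 * Real.pi * ξ| ∧ |2 * Real.pi * ξ| ≤ n + 1}

theorem isClosed_band (n : ℕ) : IsClosed (band n) := by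
  have hc : Continuous fun ξ : ℝ => |2 * Real.pi * ξ| := by fun_prop
  exact (isClosed_le continuous_const hc).inter (isClosed_le hc continuous_const)

theorem measurableSet_band (n : ℕ) : MeasurableSet (band n) := (isClosed_band n).measurableSet

theorem abs_pos_of_mem_band {n : ℕ} {ξ : ℝ} (h : ξ ∈ band n) : 0 < |2 * Real.pi * ξ| :=
  lt_of_lt_of_le (by positivity) h.1

theorem isCompact_band (n : ℕ) : IsCompact (band n) := by
  refine (isCompact_Icc (a := -((n : ℝ) + 1)) (b := n + 1)).of_isClosed_subset (isClosed_band n) ?_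
  intro ξ h
  refine abs_le.1 (le_trans ?_ h.2)
  rw [abs_mul, abs_of_pos Real.two_pi_pos]
  have h1 := abs_nonneg ξ
  nlinarith [Real.pi_gt_three]

theorem volume_band_lt_top (n : ℕ) : volume (band n) < ∞ := (isCompact_band n).measure_lt_top

theorem neg_mem_band {n : ℕ} {ξ : ℝ} : -ξ ∈ band n ↔ ξ ∈ band n := by
  simp [band]

theorem exists_mem_band {ξ : ℝ} (hξ : ξ ≠ 0) : ∃ N : ℕ, ∀ n ≥ N, ξ ∈ band n := by
  have h0 : 0 < |2 * Real.pi * ξ| := abs_pos.2 (mul_ne_zero Real.two_pi_pos.ne' hξ)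
  obtain ⟨N, hN⟩ := exists_nat_ge (max |2 * Real.pi * ξ| |2 * Real.pi * ξ|⁻¹)
  refine ⟨N, fun n hn => ⟨?_, ?_⟩⟩
  · rw [inv_le_comm₀ (by positivity) h0]
    have : (N : ℝ) ≤ n := by exact_mod_cast hn
    linarith [le_max_right |2 * Real.pi * ξ| |2 * Real.pi * ξ|⁻¹]
  · have : (N : ℝ) ≤ n := by exact_mod_cast hn
    linarith [le_max_left |2 * Real.pi * ξ| |2 * Real.pi * ξ|⁻¹]

/-- The complex power of the frequency. -/
noncomputable def freqPow (z : ℂ) (ξ : ℝ) : ℂ := ((|2 * Real.pi * ξ| : ℝ) : ℂ) ^ z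

theorem measurable_freqPow (z : ℂ) : Measurable (freqPow z) := by
  unfold freqPow
  fun_prop

theorem freqPow_neg (z : ℂ) (ξ : ℝ) : freqPow z (-ξ) = freqPow z ξ := by
  simp [freqPow]

theorem freqPow_ofReal (σ ξ : ℝ) : freqPow σ ξ = absDerivSymbol σ ξ := by
  rw [freqPow, absDerivSymbol, Complex.ofReal_cpow (abs_nonneg _)]

theorem norm_freqPow {z : ℂ} {ξ : ℝ} (h : 0 < |2 * Real.pi * ξ|) :
    ‖freqPow z ξ‖ = |2 * Real.pi * ξ| ^ z.re := by
  rw [freqPow, Complex.norm_cpow_eq_rpow_re_of_pos h]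

theorem freqPow_add {z w : ℂ} {ξ : ℝ} (h : 0 < |2 * Real.pi * ξ|) :
    freqPow (z + w) ξ = freqPow z ξ * freqPow w ξ := by
  rw [freqPow, Complex.cpow_add _ _ (Complex.ofReal_ne_zero.2 h.ne')]
  rfl

/-- The bound depends on the band, so it serves only for integrability, analyticity and other
qualitative statements. The quantitative estimates never use it. -/
theorem norm_freqPow_le {n : ℕ} {z : ℂ} {ξ : ℝ} {M : ℝ} (h : ξ ∈ band n) (hz : |z.re| ≤ M) :
    ‖freqPow z ξ‖ ≤ ((n : ℝ) + 1) ^ M := by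
  have h0 := abs_pos_of_mem_band h
  have h1 : (1 : ℝ) ≤ n + 1 := by linarith [(Nat.cast_nonneg n : (0 : ℝ) ≤ n)]
  rw [norm_freqPow h0]
  refine le_trans ?_ (Real.rpow_le_rpow_of_exponent_le h1 hz)
  rcases le_total 0 z.re with hz0 | hz0
  · rw [abs_of_nonneg hz0]
    exact Real.rpow_le_rpow h0.le h.2 hz0
  · rw [abs_of_nonpos hz0]
    calc |2 * Real.pi * ξ| ^ z.re = (|2 * Real.pi * ξ|⁻¹) ^ (-z.re) := by
          rw [Real.inv_rpow h0.le, Real.rpow_neg h0.le, inv_inv]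
      _ ≤ _ := by
          apply Real.rpow_le_rpow (by positivity) _ (by linarith)
          rw [inv_le_comm₀ h0 (by positivity)]
          exact h.1

theorem norm_airySymbol (t ξ : ℝ) : ‖airySymbol t ξ‖ = 1 := by
  have h : -(t : ℂ) * (2 * Real.pi * Complex.I * ξ) ^ 3 =
      ((t * (2 * Real.pi * ξ) ^ 3 : ℝ) : ℂ) * Complex.I := by
    push_cast
    linear_combination (-(t : ℂ) * (2 * Real.pi * ξ) ^ 3 * Complex.I) * Complex.I_sq
  rw [airySymbol, h, Complex.norm_exp_ofReal_mul_I]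

theorem airySymbol_eq (t ξ : ℝ) : airySymbol t ξ =
    Complex.exp (Complex.I * ((t * (2 * Real.pi * ξ) ^ 3 : ℝ) : ℂ)) := by
  rw [airySymbol]
  congr 1
  push_cast
  linear_combination (-(t : ℂ) * (2 * Real.pi * ξ) ^ 3 * Complex.I) * Complex.I_sq

theorem airySymbol_neg_right (t ξ : ℝ) : airySymbol t (-ξ) = airySymbol (-t) ξ := by
  simp only [airySymbol_eq]
  congr 3
  ring

theorem airySymbol_add (s t ξ : ℝ) : airySymbol (s + t) ξ = airySymbol s ξ * airySymbol t ξ := by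
  simp only [airySymbol_eq]
  rw [← Complex.exp_add]
  congr 1
  push_cast
  ring

theorem conj_airySymbol (t ξ : ℝ) : (starRingEnd ℂ) (airySymbol t ξ) = airySymbol (-t) ξ := by
  simp only [airySymbol_eq]
  rw [← Complex.exp_conj, map_mul, Complex.conj_I, Complex.conj_ofReal]
  congr 1
  push_cast
  ring

theorem continuous_airySymbol : Continuous fun p : ℝ × ℝ => airySymbol p.1 p.2 := by
  unfold airySymbol
  fun_prop

/-- Analyticity in the exponent. -/
theorem differentiable_integral_band_freqPow (n : ℕ) (κ : ℝ) (w : ℂ) {V : ℝ → ℂ}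
    (hV : IntegrableOn V (band n)) :
    Differentiable ℂ fun z : ℂ => ∫ ξ in band n, freqPow (κ * z + w) ξ * V ξ := by
  intro z₀
  -- `M` bounds the real part of the exponent on the unit ball around `z₀`. On the band the power
  -- and the logarithm of the frequency are then bounded uniformly, which gives the dominating
  -- function for differentiation under the integral.
  set M : ℝ := |κ| * (|z₀.re| + 1) + |w.re| with hM
  have hre : ∀ z ∈ Metric.ball z₀ 1, |(κ * z + w : ℂ).re| ≤ M := by
    intro z hz
    have h1 : |z.re| ≤ |z₀.re| + 1 := by
      have h2 : |(z - z₀).re| ≤ 1 := (Complex.abs_re_le_norm _).trans (mem_ball_iff_norm.1 hz).le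
      rw [Complex.sub_re] at h2
      have := abs_sub_abs_le_abs_sub z.re z₀.re
      linarith
    rw [Complex.add_re, Complex.re_ofReal_mul]
    refine (abs_add_le _ _).trans ?_
    rw [abs_mul]
    exact add_le_add (mul_le_mul_of_nonneg_left h1 (abs_nonneg _)) le_rfl
  have hlogb : ∀ ξ ∈ band n, ‖Complex.log ((|2 * Real.pi * ξ| : ℝ) : ℂ)‖ ≤
      |Real.log ((n : ℝ) + 1)| := by
    intro ξ hξ
    have h0 := abs_pos_of_mem_band hξ
    rw [← Complex.ofReal_log h0.le, Complex.norm_real, Real.norm_eq_abs]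
    have h1 : Real.log |2 * Real.pi * ξ| ≤ Real.log ((n : ℝ) + 1) := Real.log_le_log h0 hξ.2
    have h2 : -Real.log ((n : ℝ) + 1) ≤ Real.log |2 * Real.pi * ξ| := by
      rw [← Real.log_inv]
      exact Real.log_le_log (by positivity) hξ.1
    refine (abs_le.2 ⟨h2, h1⟩).trans (le_abs_self _)
  have hcont : ∀ z : ℂ, Measurable (freqPow z) := measurable_freqPow
  refine (hasDerivAt_integral_of_dominated_loc_of_deriv_le
    (F := fun (z : ℂ) ξ => freqPow (κ * z + w) ξ * V ξ)
    (F' := fun (z : ℂ) ξ => freqPow (κ * z + w) ξ * Complex.log ((|2 * Real.pi * ξ| : ℝ) : ℂ) * κ * V ξ)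
    (bound := fun ξ => ((n : ℝ) + 1) ^ M * |Real.log ((n : ℝ) + 1)| * |κ| * ‖V ξ‖)
    (Metric.ball_mem_nhds z₀ one_pos) ?_ ?_ ?_ ?_ ?_ ?_).2.differentiableAt
  · exact Filter.Eventually.of_forall fun z => (hcont _).aestronglyMeasurable.mul hV.1
  · refine Integrable.bdd_mul (c := ((n : ℝ) + 1) ^ M) hV (hcont _).aestronglyMeasurable ?_
    refine (ae_restrict_iff' (measurableSet_band n)).2 (Filter.Eventually.of_forall fun ξ hξ => ?_)
    exact norm_freqPow_le hξ (hre z₀ (Metric.mem_ball_self one_pos))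
  · refine AEStronglyMeasurable.mul (AEStronglyMeasurable.mul ((hcont _).aestronglyMeasurable.mul ?_)
      aestronglyMeasurable_const) hV.1
    exact (Measurable.aestronglyMeasurable (by fun_prop))
  · refine (ae_restrict_iff' (measurableSet_band n)).2 (Filter.Eventually.of_forall fun ξ hξ => ?_)
    intro z hz
    rw [norm_mul, norm_mul, norm_mul, Complex.norm_real, Real.norm_eq_abs]
    gcongr
    · exact norm_freqPow_le hξ (hre z hz)
    · exact hlogb ξ hξ
  · exact hV.norm.const_mul _
  · refine (ae_restrict_iff' (measurableSet_band n)).2 (Filter.Eventually.of_forall fun ξ hξ => ?_)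
    intro z hz
    have h0 := abs_pos_of_mem_band hξ
    have h1 : HasDerivAt (fun z : ℂ => (κ : ℂ) * z + w) κ z := by
      simpa using ((hasDerivAt_id z).const_mul (κ : ℂ)).add_const w
    exact (h1.const_cpow (Or.inl (Complex.ofReal_ne_zero.2 h0.ne'))).mul_const (V ξ)

/-- The Airy kernel with a frequency cutoff. -/
theorem norm_integral_band_le (n : ℕ) {z : ℂ} (hz0 : 0 ≤ z.re) (hz1 : z.re ≤ 1 / 2) (x : ℝ) {τ : ℝ}
    (hτ : τ ≠ 0) :
    ‖∫ ξ in band n, freqPow z ξ * airySymbol τ ξ * Complex.exp ((2 * Real.pi * x * ξ : ℝ) * Complex.I)‖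
      ≤ 9 * (1 + |z.im|) * |τ| ^ (-(1 + z.re) / 3) := by
  set f : ℝ → ℂ := fun ξ => freqPow z ξ * airySymbol τ ξ *
    Complex.exp ((2 * Real.pi * x * ξ : ℝ) * Complex.I) with hf
  set r : ℝ := ((n : ℝ) + 1)⁻¹ with hr
  set R : ℝ := (n : ℝ) + 1 with hR
  have hR0 : 0 < R := by positivity
  have hr0 : 0 < r := by positivity
  have hR1 : 1 ≤ R := by
    rw [hR]
    linarith [(Nat.cast_nonneg n : (0 : ℝ) ≤ n)]
  have hrR : r ≤ R := (inv_le_one_of_one_le₀ hR1).trans hR1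
  have h2π := Real.two_pi_pos
  have hsub : band n = Icc (r / (2 * Real.pi)) (R / (2 * Real.pi)) ∪
      Icc (-(R / (2 * Real.pi))) (-(r / (2 * Real.pi))) := by
    ext ξ
    simp only [band, mem_ofPred_eq, mem_union, mem_Icc, abs_mul _ ξ, abs_of_pos h2π]
    rw [div_le_iff₀ h2π, le_div_iff₀ h2π, ← neg_div, ← neg_div,
      div_le_iff₀ h2π, le_div_iff₀ h2π]
    rcases le_total 0 ξ with h | h
    · rw [abs_of_nonneg h]
      constructor
      · rintro ⟨h1, h2⟩
        left
        constructor <;> linarith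
      · rintro (⟨h1, h2⟩ | ⟨h1, h2⟩)
        · constructor <;> linarith
        · nlinarith
    · rw [abs_of_nonpos h]
      constructor
      · rintro ⟨h1, h2⟩
        right
        constructor <;> linarith
      · rintro (⟨h1, h2⟩ | ⟨h1, h2⟩)
        · nlinarith
        · constructor <;> linarith
  have hint : IntegrableOn f (band n) := by
    refine Measure.integrableOn_of_bounded (M := R ^ |z.re|) (volume_band_lt_top n).ne ?_ ?_
    · refine ((measurable_freqPow z).mul ?_ |>.mul ?_).aestronglyMeasurable
      · exact (continuous_airySymbol.comp (by fun_prop : Continuous fun ξ : ℝ => (τ, ξ))).measurable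
      · fun_prop
    · refine (ae_restrict_iff' (measurableSet_band n)).2 (Filter.Eventually.of_forall fun ξ hξ => ?_)
      rw [hf]
      simp only
      rw [norm_mul, norm_mul, norm_airySymbol, Complex.norm_exp_ofReal_mul_I, mul_one, mul_one]
      exact norm_freqPow_le hξ le_rfl
  have hd : r / (2 * Real.pi) ≤ R / (2 * Real.pi) := by gcongr
  -- Each half of the band carries half of the constant: the substitution `ω = 2 π ξ` has Jacobian
  -- `1 / (2 π) ≤ 1 / 2`. The negative half reduces to the positive one with `(-x, -τ)`, which
  -- explains the quantification over `x'` and `τ'`.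
  have hone : ∀ (x' τ' : ℝ), τ' ≠ 0 → |τ'| = |τ| →
      ‖∫ ξ in (r / (2 * Real.pi))..(R / (2 * Real.pi)), freqPow z ξ * airySymbol τ' ξ *
        Complex.exp ((2 * Real.pi * x' * ξ : ℝ) * Complex.I)‖ ≤
      (1 / 2) * (9 * (1 + |z.im|) * |τ| ^ (-(1 + z.re) / 3)) := by
    intro x' τ' hτ' habs
    have key := norm_integral_cpow_mul_exp_cubic_le hz0 hz1 (x := x') hτ' hr0 hrR
    have hs := intervalIntegral.integral_comp_mul_left (a := r / (2 * Real.pi))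
      (b := R / (2 * Real.pi)) (fun ω : ℝ => (ω : ℂ) ^ z *
        Complex.exp (Complex.I * ((x' * ω + τ' * ω ^ 3 : ℝ) : ℂ))) h2π.ne'
    rw [mul_div_cancel₀ _ h2π.ne', mul_div_cancel₀ _ h2π.ne'] at hs
    have hcong : ∫ ξ in (r / (2 * Real.pi))..(R / (2 * Real.pi)), freqPow z ξ * airySymbol τ' ξ *
        Complex.exp ((2 * Real.pi * x' * ξ : ℝ) * Complex.I) =
        ∫ ξ in (r / (2 * Real.pi))..(R / (2 * Real.pi)), ((2 * Real.pi * ξ : ℝ) : ℂ) ^ z *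
        Complex.exp (Complex.I * ((x' * (2 * Real.pi * ξ) + τ' * (2 * Real.pi * ξ) ^ 3 : ℝ) : ℂ)) := by
      apply intervalIntegral.integral_congr
      intro ξ hξ
      rw [uIcc_of_le hd] at hξ
      have hξ0 : 0 < ξ := lt_of_lt_of_le (by positivity) hξ.1
      simp only [freqPow]
      rw [abs_of_pos (by positivity), airySymbol_eq, mul_assoc, ← Complex.exp_add]
      congr 2
      push_cast
      ring
    rw [hcong, hs, norm_smul, Real.norm_eq_abs, abs_of_pos (inv_pos.2 h2π)]
    rw [habs] at key
    have h3 : (2 * Real.pi)⁻¹ ≤ 1 / 2 := by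
      rw [inv_le_comm₀ h2π (by norm_num)]
      norm_num
      linarith [Real.pi_gt_three]
    gcongr
  have hsplit : ∫ ξ in band n, f ξ = (∫ ξ in (r / (2 * Real.pi))..(R / (2 * Real.pi)), f ξ) +
      ∫ ξ in (-(R / (2 * Real.pi)))..(-(r / (2 * Real.pi))), f ξ := by
    have hint' := hint
    rw [hsub] at hint' ⊢
    rw [setIntegral_union _ measurableSet_Icc (hint'.mono_set subset_union_left)
      (hint'.mono_set subset_union_right), integral_Icc_eq_integral_Ioc, integral_Icc_eq_integral_Ioc,
      intervalIntegral.integral_of_le hd, intervalIntegral.integral_of_le (neg_le_neg hd)]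
    rw [Set.disjoint_left]
    intro ξ h1 h2
    have : 0 < r / (2 * Real.pi) := by positivity
    linarith [h1.1, h2.2]
  rw [hsplit, ← intervalIntegral.integral_comp_neg]
  refine (norm_add_le _ _).trans ?_
  have k1 := hone x τ hτ rfl
  have k2 := hone (-x) (-τ) (neg_ne_zero.2 hτ) (abs_neg τ)
  have e2 : ∫ ξ in (r / (2 * Real.pi))..(R / (2 * Real.pi)), f (-ξ) =
      ∫ ξ in (r / (2 * Real.pi))..(R / (2 * Real.pi)), freqPow z ξ * airySymbol (-τ) ξ *
        Complex.exp ((2 * Real.pi * (-x) * ξ : ℝ) * Complex.I) := by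
    apply intervalIntegral.integral_congr
    intro ξ _
    simp only [hf, freqPow_neg, airySymbol_neg_right]
    congr 3
    push_cast
    ring
  rw [e2]
  linarith

end Band

/-! ### The Fourier integral and Plancherel -/

section Fourier

theorem continuous_fourier_of_integrable {f : ℝ → ℂ} (hf : Integrable f) : Continuous (𝓕 f) :=
  VectorFourier.fourierIntegral_continuous Real.continuous_fourierChar
    (by exact continuous_inner) hf

theorem norm_fourier_le {f : ℝ → ℂ} (ξ : ℝ) : ‖𝓕 f ξ‖ ≤ ∫ x, ‖f x‖ :=
  VectorFourier.norm_fourierIntegral_le_integral_norm _ _ _ _ _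

theorem enorm_fourier_le {f : ℝ → ℂ} (ξ : ℝ) : ‖𝓕 f ξ‖ₑ ≤ eLpNorm f 1 volume := by
  rw [Real.fourier_eq, eLpNorm_one_eq_lintegral_enorm]
  refine (enorm_integral_le_lintegral_enorm _).trans (le_of_eq ?_)
  refine lintegral_congr fun x => ?_
  rw [← ofReal_norm, Circle.norm_smul, ofReal_norm]

theorem fourier_sub {f g : ℝ → ℂ} (hf : Integrable f) (hg : Integrable g) (ξ : ℝ) :
    𝓕 (f - g) ξ = 𝓕 f ξ - 𝓕 g ξ := by
  simp only [Real.fourier_eq, Pi.sub_apply, smul_sub]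
  exact integral_sub ((Real.fourierIntegral_convergent_iff ξ).2 hf)
    ((Real.fourierIntegral_convergent_iff ξ).2 hg)

theorem integral_fourier_mul_eq {f g : ℝ → ℂ} (hf : Integrable f) (hg : Integrable g) :
    ∫ ξ, 𝓕 f ξ * g ξ = ∫ x, f x * 𝓕 g x := by
  have h := VectorFourier.integral_fourierIntegral_smul_eq_flip (L := innerₗ ℝ) (μ := volume)
    (ν := volume) Real.continuous_fourierChar (by exact continuous_inner) hf hg
  rw [flip_innerₗ] at h
  exact h

/-- The Plancherel inequality for the Fourier integral. -/
theorem eLpNorm_fourier_le {f : ℝ → ℂ} (hf : Integrable f) (hf2 : MemLp f 2 volume) :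
    eLpNorm (𝓕 f) 2 volume ≤ eLpNorm f 2 volume := by
  set F : Lp ℂ 2 (volume : Measure ℝ) := hf2.toLp f with hF
  -- The pointwise Fourier integral and the Fourier transform of `L²` define the same distribution,
  -- by the multiplication formula against test functions; hence they agree almost everywhere and
  -- the isometry of `L²` applies.
  have hae : 𝓕 f =ᵐ[volume] (𝓕 F : Lp ℂ 2 (volume : Measure ℝ)) := by
    refine ae_eq_of_integral_contDiff_smul_eq
      (continuous_fourier_of_integrable hf).locallyIntegrable
      ((Lp.memLp _).locallyIntegrable (by norm_num)) ?_
    intro g g_smooth g_cpt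
    have hg₁ : HasCompactSupport (Complex.ofRealCLM ∘ g) := g_cpt.comp_left rfl
    have hg₂ : ContDiff ℝ ((⊤ : ℕ∞) : WithTop ℕ∞) (Complex.ofRealCLM ∘ g) := by fun_prop
    set φ : 𝓢(ℝ, ℂ) := hg₁.toSchwartzMap hg₂ with hφ
    have hφa : ∀ x, φ x = (g x : ℂ) := fun x => rfl
    have h1 := DFunLike.congr_fun (Lp.fourier_toTemperedDistribution_eq F) φ
    rw [TemperedDistribution.fourier_apply, Lp.toTemperedDistribution_apply,
      Lp.toTemperedDistribution_apply] at h1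
    have h2 : ∫ x, g x • 𝓕 f x = ∫ x, 𝓕 f x * φ x := by
      refine integral_congr_ae (Filter.Eventually.of_forall fun x => ?_)
      simp only [hφa, Complex.real_smul]
      ring
    have h3 : ∫ x, g x • (𝓕 F : Lp ℂ 2 (volume : Measure ℝ)) x =
        ∫ x, φ x • (𝓕 F : Lp ℂ 2 (volume : Measure ℝ)) x := by
      refine integral_congr_ae (Filter.Eventually.of_forall fun x => ?_)
      simp only [hφa, Complex.real_smul, smul_eq_mul]
    rw [h2, h3, ← h1, integral_fourier_mul_eq hf φ.integrable]
    refine integral_congr_ae ?_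
    filter_upwards [hf2.coeFn_toLp] with x hx
    rw [hF, hx, ← SchwartzMap.fourier_coe, smul_eq_mul, mul_comm]
  rw [eLpNorm_congr_ae hae, ← Lp.enorm_def, ← eLpNorm_congr_ae hf2.coeFn_toLp, ← Lp.enorm_def]
  apply le_of_eq
  rw [← ofReal_norm, ← ofReal_norm, Lp.norm_fourier_eq]

end Fourier

/-! ### Pairing of a frequency profile with a function of space -/

section Pairing

/-- The functions which belong to all Lebesgue spaces. -/
def Nice (f : ℝ → ℂ) : Prop := ∀ p : ℝ≥0∞, 1 ≤ p → MemLp f p volume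

theorem Nice.integrable {f : ℝ → ℂ} (hf : Nice f) : Integrable f := memLp_one_iff_integrable.1 (hf 1 le_rfl)

/-- The pairing of a frequency profile, cut off to a band, with a function of space. -/
noncomputable def bandPairing (n : ℕ) (V g : ℝ → ℂ) : ℂ := ∫ ξ in band n, V ξ * 𝓕 g (-ξ)

theorem integrableOn_mul_fourier {n : ℕ} {V g : ℝ → ℂ} (hV : IntegrableOn V (band n))
    (hg : Integrable g) : IntegrableOn (fun ξ => V ξ * 𝓕 g (-ξ)) (band n) := by
  refine Integrable.mul_bdd (c := ∫ x, ‖g x‖) hV ?_ (Filter.Eventually.of_forall fun ξ => norm_fourier_le _)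
  exact ((continuous_fourier_of_integrable hg).comp continuous_neg).aestronglyMeasurable

theorem enorm_bandPairing_le_one {n : ℕ} {V g : ℝ → ℂ} (hg : Integrable g) :
    ‖bandPairing n V g‖ₑ ≤ (∫⁻ ξ in band n, ‖V ξ‖ₑ) * eLpNorm g 1 volume := by
  refine (enorm_integral_le_lintegral_enorm _).trans ?_
  rw [← lintegral_mul_const' _ _ (memLp_one_iff_integrable.2 hg).2.ne]
  refine lintegral_mono fun ξ => ?_
  rw [enorm_mul]
  gcongr
  exact enorm_fourier_le _

theorem enorm_bandPairing_le_two {n : ℕ} {V g : ℝ → ℂ}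
    (hV : AEStronglyMeasurable V (volume.restrict (band n))) (hg : Nice g) :
    ‖bandPairing n V g‖ₑ ≤ eLpNorm V 2 (volume.restrict (band n)) * eLpNorm g 2 volume := by
  have hc := (continuous_fourier_of_integrable hg.integrable).comp continuous_neg
  calc ‖bandPairing n V g‖ₑ ≤ eLpNorm (fun ξ => V ξ * 𝓕 g (-ξ)) 1 (volume.restrict (band n)) := by
        rw [eLpNorm_one_eq_lintegral_enorm]
        exact enorm_integral_le_lintegral_enorm _
    _ ≤ eLpNorm V 2 (volume.restrict (band n)) *
          eLpNorm (fun ξ => 𝓕 g (-ξ)) 2 (volume.restrict (band n)) :=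
        eLpNorm_smul_le_mul_eLpNorm (φ := V) (f := fun ξ => 𝓕 g (-ξ)) (p := 2) (q := 2) (r := 1)
          hc.aestronglyMeasurable hV
    _ ≤ _ := by
        gcongr
        calc eLpNorm (fun ξ => 𝓕 g (-ξ)) 2 (volume.restrict (band n))
            ≤ eLpNorm (fun ξ => 𝓕 g (-ξ)) 2 volume := eLpNorm_mono_measure _ Measure.restrict_le_self
          _ = eLpNorm (𝓕 g) 2 volume :=
              eLpNorm_comp_measurePreserving (g := 𝓕 g)
                (continuous_fourier_of_integrable hg.integrable).aestronglyMeasurable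
                (Measure.measurePreserving_neg volume)
          _ ≤ _ := eLpNorm_fourier_le hg.integrable (hg 2 (by norm_num))

theorem bandPairing_sub {n : ℕ} {V f g : ℝ → ℂ} (hV : IntegrableOn V (band n)) (hf : Integrable f)
    (hg : Integrable g) : bandPairing n V (f - g) = bandPairing n V f - bandPairing n V g := by
  unfold bandPairing
  rw [← integral_sub (integrableOn_mul_fourier hV hf) (integrableOn_mul_fourier hV hg)]
  congr 1
  ext ξ
  rw [← mul_sub]
  congr 1
  exact fourier_sub hf hg _

theorem bandPairing_congr {n : ℕ} {V f g : ℝ → ℂ} (h : f =ᵐ[volume] g) :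
    bandPairing n V f = bandPairing n V g := by
  unfold bandPairing
  congr 1
  ext ξ
  rw [Real.fourier_congr_ae h]

/-- A single sequence must converge in all `L^p` at once: the pairing is continuous for the `L¹`
norm, whereas the bound to be extended is in terms of an `L^b` norm. -/
theorem exists_simpleFunc_tendsto {g : ℝ → ℂ} (hg : Nice g) : ∃ s : ℕ → SimpleFunc ℝ ℂ,
    ∀ p : ℝ≥0∞, 1 ≤ p → p ≠ ∞ → (∀ k, MemLp (s k) p volume) ∧
      Filter.Tendsto (fun k => eLpNorm (⇑(s k) - g) p volume) Filter.atTop (nhds 0) := by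
  have h1 := hg.integrable.aestronglyMeasurable
  set g' := h1.mk g
  have hg' : Measurable g' := h1.measurable_mk
  have hae : g =ᵐ[volume] g' := h1.ae_eq_mk
  refine ⟨fun k => SimpleFunc.approxOn g' hg' (range g' ∪ {0}) 0 (by simp) k, fun p hp hp' => ?_⟩
  have hm : MemLp g' p volume := (hg p hp).ae_eq hae
  refine ⟨fun k => SimpleFunc.memLp_approxOn_range hg' hm k, ?_⟩
  refine (SimpleFunc.tendsto_approxOn_range_Lp_eLpNorm hp' hg' hm.2).congr fun k => ?_
  exact eLpNorm_congr_ae (by filter_upwards [hae] with x hx; simp [hx])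

/-- It suffices to bound a pairing on simple functions. -/
theorem enorm_bandPairing_le_of_simpleFunc {n : ℕ} {V : ℝ → ℂ} (hV : IntegrableOn V (band n))
    {b : ℝ≥0∞} (hb : 1 ≤ b) (hb' : b ≠ ∞) {C : ℝ≥0∞} (hC : C ≠ ∞)
    (h : ∀ s : SimpleFunc ℝ ℂ, Integrable s → ‖bandPairing n V s‖ₑ ≤ C * eLpNorm s b volume)
    {g : ℝ → ℂ} (hg : Nice g) : ‖bandPairing n V g‖ₑ ≤ C * eLpNorm g b volume := by
  obtain ⟨s, hs⟩ := exists_simpleFunc_tendsto hg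
  have hs1 : ∀ k, Integrable (s k) := fun k =>
    memLp_one_iff_integrable.1 ((hs 1 le_rfl ENNReal.one_ne_top).1 k)
  have hbound : ∀ k, ‖bandPairing n V g‖ₑ ≤ (∫⁻ ξ in band n, ‖V ξ‖ₑ) * eLpNorm (⇑(s k) - g) 1 volume +
      C * (eLpNorm (⇑(s k) - g) b volume + eLpNorm g b volume) := by
    intro k
    have e1 : bandPairing n V g = bandPairing n V (s k) - bandPairing n V (⇑(s k) - g) := by
      rw [bandPairing_sub hV (hs1 k) hg.integrable]
      ring
    rw [e1]
    refine (enorm_sub_le).trans ?_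
    rw [add_comm]
    refine add_le_add (enorm_bandPairing_le_one ((hs1 k).sub hg.integrable)) ((h _ (hs1 k)).trans ?_)
    gcongr
    have e2 : (⇑(s k) : ℝ → ℂ) = (⇑(s k) - g) + g := by simp
    calc eLpNorm (⇑(s k)) b volume = eLpNorm ((⇑(s k) - g) + g) b volume := by rw [← e2]
      _ ≤ _ := eLpNorm_add_le (((hs b hb hb').1 k).1.sub (hg b hb).1) (hg b hb).1 hb
  have hlim : Filter.Tendsto (fun k => (∫⁻ ξ in band n, ‖V ξ‖ₑ) * eLpNorm (⇑(s k) - g) 1 volume +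
      C * (eLpNorm (⇑(s k) - g) b volume + eLpNorm g b volume)) Filter.atTop
      (nhds ((∫⁻ ξ in band n, ‖V ξ‖ₑ) * 0 + C * (0 + eLpNorm g b volume))) := by
    refine Filter.Tendsto.add ?_ ?_
    · exact ENNReal.Tendsto.const_mul (hs 1 le_rfl ENNReal.one_ne_top).2 (Or.inr hV.2.ne)
    · exact ENNReal.Tendsto.const_mul ((hs b hb hb').2.add tendsto_const_nhds) (Or.inr hC)
  rw [mul_zero, zero_add, zero_add] at hlim
  exact ge_of_tendsto' hlim hbound

end Pairing

/-! ### Step functions and weighted finite-dimensional norms -/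

section Step

variable {ι : Type*} [Fintype ι]

/-- A step function. -/
noncomputable def stepFn (E : ι → Set ℝ) (c : ι → ℂ) (x : ℝ) : ℂ := ∑ i, (E i).indicator (fun _ => c i) x


theorem integrable_indicator_const {E : Set ℝ} (hE : MeasurableSet E) (hE' : volume E ≠ ∞) (c : ℂ) :
    Integrable (E.indicator fun _ => c) :=
  (integrable_indicator_iff hE).2 (integrableOn_const hE')

theorem nice_stepFn {E : ι → Set ℝ} (hE : ∀ i, MeasurableSet (E i)) (hE' : ∀ i, volume (E i) ≠ ∞)
    (c : ι → ℂ) : Nice (stepFn E c) := fun p _ => by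
  have h : stepFn E c = fun x => ∑ i, (E i).indicator (fun _ => c i) x := rfl
  rw [h]
  exact memLp_finsetSum _ fun i _ => memLp_indicator_const p (hE i) (c i) (Or.inr (hE' i))

theorem fourier_stepFn {E : ι → Set ℝ} (hE : ∀ i, MeasurableSet (E i)) (hE' : ∀ i, volume (E i) ≠ ∞)
    (c : ι → ℂ) (ξ : ℝ) :
    𝓕 (stepFn E c) ξ = ∑ i, c i * 𝓕 ((E i).indicator fun _ => (1 : ℂ)) ξ := by
  simp only [Real.fourier_eq, stepFn, Finset.smul_sum]
  rw [integral_finsetSum]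
  · refine Finset.sum_congr rfl fun i _ => ?_
    rw [← integral_const_mul]
    refine integral_congr_ae (Filter.Eventually.of_forall fun x => ?_)
    by_cases hx : x ∈ E i
    · simp [hx, Circle.smul_def, mul_comm]
    · simp [hx]
  · intro i _
    exact (Real.fourierIntegral_convergent_iff ξ).2 (integrable_indicator_const (hE i) (hE' i) _)

theorem bandPairing_stepFn {n : ℕ} {V : ℝ → ℂ} (hV : IntegrableOn V (band n)) {E : ι → Set ℝ}
    (hE : ∀ i, MeasurableSet (E i)) (hE' : ∀ i, volume (E i) ≠ ∞) (c : ι → ℂ) :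
    bandPairing n V (stepFn E c) =
      ∑ i, c i * bandPairing n V ((E i).indicator fun _ => (1 : ℂ)) := by
  unfold bandPairing
  simp_rw [fourier_stepFn hE hE', Finset.mul_sum]
  rw [integral_finsetSum]
  · refine Finset.sum_congr rfl fun i _ => ?_
    rw [← integral_const_mul]
    congr 1
    ext ξ
    ring
  · intro i _
    have := (integrableOn_mul_fourier hV (integrable_indicator_const (hE i) (hE' i) 1)).const_mul (c i)
    refine this.congr (Filter.Eventually.of_forall fun ξ => ?_)
    simp only
    ring

/-- Disjointness makes the Lebesgue norm equal to the weighted `ℓ^a` norm of the values, with the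
lengths as weights. This is the bridge to the finite-dimensional interpolation theorem. -/
theorem eLpNorm_stepFn {E : ι → Set ℝ} (hE : ∀ i, MeasurableSet (E i)) (hE' : ∀ i, volume (E i) ≠ ∞)
    (hd : Pairwise fun i j => Disjoint (E i) (E j)) {a : ℝ} (ha : 0 < a) (c : ι → ℂ) :
    eLpNorm (stepFn E c) (ENNReal.ofReal a) volume =
      ENNReal.ofReal (weightedNorm (fun i => volume.real (E i)) a c) := by
  have hpt : ∀ x, ‖stepFn E c x‖ₑ ^ a = ∑ i, (E i).indicator (fun _ => ‖c i‖ₑ ^ a) x := by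
    intro x
    by_cases hx : ∃ i, x ∈ E i
    · obtain ⟨i, hi⟩ := hx
      have hne : ∀ j, j ≠ i → x ∉ E j := fun j hj hxj =>
        Set.disjoint_left.1 (hd hj) hxj hi
      unfold stepFn
      rw [Finset.sum_eq_single i (fun j _ hj => indicator_of_notMem (hne j hj) _) (by simp),
        Finset.sum_eq_single i (fun j _ hj => indicator_of_notMem (hne j hj) _) (by simp),
        indicator_of_mem hi, indicator_of_mem hi]
    · push Not at hx
      unfold stepFn
      rw [Finset.sum_eq_zero fun i _ => indicator_of_notMem (hx i) _,
        Finset.sum_eq_zero fun i _ => indicator_of_notMem (hx i) _, enorm_zero,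
        ENNReal.zero_rpow_of_pos ha]
  have hnn : ∀ i ∈ Finset.univ, 0 ≤ volume.real (E i) * ‖c i‖ ^ a := fun i _ => by positivity
  rw [eLpNorm_eq_lintegral_rpow_enorm_toReal (by simpa using ha) ENNReal.ofReal_ne_top,
    ENNReal.toReal_ofReal ha.le]
  simp_rw [hpt]
  rw [lintegral_finsetSum _ fun i _ => measurable_const.indicator (hE i), weightedNorm,
    ← ENNReal.ofReal_rpow_of_nonneg (Finset.sum_nonneg hnn) (by positivity), ENNReal.ofReal_sum_of_nonneg hnn]
  congr 1
  refine Finset.sum_congr rfl fun i _ => ?_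
  rw [lintegral_indicator_const (hE i), ENNReal.ofReal_mul measureReal_nonneg,
    ofReal_measureReal (hE' i), mul_comm, ← ofReal_norm, ENNReal.ofReal_rpow_of_nonneg (norm_nonneg _) ha.le]

/-- An integrable simple function is almost everywhere a step function with disjoint steps of positive
and finite length. -/
theorem exists_stepFn_ae_eq (s : SimpleFunc ℝ ℂ) (hs : Integrable s) :
    ∃ (κ : Type) (_ : Fintype κ) (E : κ → Set ℝ) (c : κ → ℂ), (∀ i, MeasurableSet (E i)) ∧
      (∀ i, volume (E i) ≠ ∞) ∧ (∀ i, 0 < volume.real (E i)) ∧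
      (Pairwise fun i j => Disjoint (E i) (E j)) ∧ ⇑s =ᵐ[volume] stepFn E c := by
  classical
  -- The value zero is dropped because its fibre has infinite length, and null fibres are dropped
  -- because the weights have to be positive.
  set K : Finset ℂ := s.range.filter fun c => c ≠ 0 ∧ volume (s ⁻¹' {c}) ≠ 0 with hK
  refine ⟨K, Finset.fintypeCoeSort K,
    fun c => s ⁻¹' {c.1}, fun c => c.1, fun c => s.measurableSet_fiber _, ?_, ?_, ?_, ?_⟩
  · intro c
    have hc := (Finset.mem_filter.1 c.2).2
    exact (SimpleFunc.measure_preimage_lt_top_of_integrable s hs hc.1).ne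
  · intro c
    have hc := (Finset.mem_filter.1 c.2).2
    exact ENNReal.toReal_pos hc.2 (SimpleFunc.measure_preimage_lt_top_of_integrable s hs hc.1).ne
  · intro c d hcd
    exact Disjoint.preimage _ (Set.disjoint_singleton.2 fun h => hcd (Subtype.ext h))
  · have hnull : ∀ᵐ x ∂(volume : Measure ℝ), ∀ c ∈ s.range, volume (s ⁻¹' {c}) = 0 → s x ≠ c := by
      rw [Filter.eventually_all_finset]
      intro c _
      by_cases h : volume (s ⁻¹' {c}) = 0
      · have := measure_eq_zero_iff_ae_notMem.1 h
        filter_upwards [this] with x hx _ using hx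
      · exact Filter.Eventually.of_forall fun x h' => absurd h' h
    filter_upwards [hnull] with x hx
    unfold stepFn
    by_cases h0 : s x = 0
    · rw [h0, Finset.sum_eq_zero]
      intro c _
      apply indicator_of_notMem
      intro hxc
      have hxc' : s x = c.1 := hxc
      exact (Finset.mem_filter.1 c.2).2.1 (hxc' ▸ h0)
    · have hmem : s x ∈ K :=
        Finset.mem_filter.2 ⟨s.mem_range_self x, h0, fun h => hx _ (s.mem_range_self x) h rfl⟩
      rw [Finset.sum_eq_single ⟨s x, hmem⟩]
      · exact (indicator_of_mem (s := s ⁻¹' {s x}) rfl (fun _ => s x)).symm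
      · intro c _ hc
        apply indicator_of_notMem
        intro hxc
        exact hc (Subtype.ext (Eq.symm hxc))
      · simp

end Step

/-! ### Interpolated dispersive estimates -/

section Dispersive

theorem integrableOn_freqPow_mul {n : ℕ} {V : ℝ → ℂ} (hV : IntegrableOn V (band n)) (z : ℂ) :
    IntegrableOn (fun ξ => freqPow z ξ * V ξ) (band n) := by
  refine Integrable.bdd_mul (c := ((n : ℝ) + 1) ^ |z.re|) hV (measurable_freqPow z).aestronglyMeasurable ?_
  exact (ae_restrict_iff' (measurableSet_band n)).2 (Filter.Eventually.of_forall fun ξ hξ =>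
    norm_freqPow_le hξ le_rfl)

variable {ι : Type*} [Fintype ι]

/-- **Stein interpolation** for pairings with complex powers of the frequency. -/
theorem enorm_bandPairing_le_of_interpolation {n : ℕ} {V : ι → ℝ → ℂ}
    (hV : ∀ i, IntegrableOn (V i) (band n)) {w : ι → ℝ} (hw : ∀ i, 0 < w i) (κ : ℝ) (η : ℂ)
    {a₀ a₁ a b₀ b₁ b θ A₀ A₁ : ℝ} (ha₀ : 0 < a₀) (ha₁ : 0 < a₁) (ha : 0 < a) (hb₀ : 0 < b₀)
    (hb₁ : 0 < b₁) (hb : 1 ≤ b) (hθ : θ ∈ Icc (0 : ℝ) 1)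
    (haθ : 1 / a = (1 - θ) / a₀ + θ / a₁) (hbθ : 1 / b = (1 - θ) / b₀ + θ / b₁)
    (hA₀ : 0 ≤ A₀) (hA₁ : 0 ≤ A₁)
    (h₀ : ∀ (y : ℝ) (c : ι → ℂ) (g : ℝ → ℂ), Nice g →
      ‖bandPairing n (fun ξ => freqPow (κ * (y * Complex.I) + η) ξ * ∑ i, c i * V i ξ) g‖ₑ ≤
        ENNReal.ofReal (A₀ * weightedNorm w a₀ c) * eLpNorm g (ENNReal.ofReal b₀) volume)
    (h₁ : ∀ (y : ℝ) (c : ι → ℂ) (g : ℝ → ℂ), Nice g →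
      ‖bandPairing n (fun ξ => freqPow (κ * (1 + y * Complex.I) + η) ξ * ∑ i, c i * V i ξ) g‖ₑ ≤
        ENNReal.ofReal (A₁ * (1 + |y|) * weightedNorm w a₁ c) * eLpNorm g (ENNReal.ofReal b₁) volume)
    (c : ι → ℂ) {g : ℝ → ℂ} (hg : Nice g) :
    ‖bandPairing n (fun ξ => freqPow (κ * θ + η) ξ * ∑ i, c i * V i ξ) g‖ₑ ≤
      ENNReal.ofReal (6 * (A₀ ^ (1 - θ) * A₁ ^ θ) * weightedNorm w a c) *
        eLpNorm g (ENNReal.ofReal b) volume := by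
  have hsumV : ∀ c : ι → ℂ, IntegrableOn (fun ξ => ∑ i, c i * V i ξ) (band n) := fun c =>
    integrable_finsetSum _ fun i _ => (hV i).const_mul _
  refine enorm_bandPairing_le_of_simpleFunc (integrableOn_freqPow_mul (hsumV c) _)
    (by simpa using ENNReal.ofReal_le_ofReal hb) ENNReal.ofReal_ne_top ENNReal.ofReal_ne_top ?_ hg
  intro s hs
  obtain ⟨κ', _, E, d, hE, hE', hEpos, hdisj, hsE⟩ := exists_stepFn_ae_eq s hs
  rw [bandPairing_congr hsE, eLpNorm_congr_ae hsE, eLpNorm_stepFn hE hE' hdisj (by linarith)]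
  -- With `g` replaced by a step function, the pairing becomes a finite matrix that is analytic in
  -- `z` and bounded on the strip. Both properties use the frequency localization.
  set L : ℂ → ι → κ' → ℂ := fun z i j => bandPairing n (fun ξ => freqPow (κ * z + η) ξ * V i ξ)
    ((E j).indicator fun _ => (1 : ℂ)) with hL
  have hI1 : ∀ j, Integrable ((E j).indicator fun _ => (1 : ℂ)) := fun j =>
    integrable_indicator_const (hE j) (hE' j) 1
  have hform : ∀ (z : ℂ) (c : ι → ℂ) (d : κ' → ℂ),
      bandPairing n (fun ξ => freqPow (κ * z + η) ξ * ∑ i, c i * V i ξ) (stepFn E d) =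
        ∑ i, ∑ j, c i * d j * L z i j := by
    intro z c d
    rw [bandPairing_stepFn (integrableOn_freqPow_mul (hsumV c) _) hE hE', Finset.sum_comm]
    refine Finset.sum_congr rfl fun j _ => ?_
    have e : bandPairing n (fun ξ => freqPow (κ * z + η) ξ * ∑ i, c i * V i ξ)
        ((E j).indicator fun _ => (1 : ℂ)) = ∑ i, c i * L z i j := by
      simp only [hL, bandPairing]
      simp_rw [Finset.mul_sum, Finset.sum_mul]
      rw [integral_finsetSum]
      · refine Finset.sum_congr rfl fun i _ => ?_
        rw [← integral_const_mul]
        congr 1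
        ext ξ
        ring
      · intro i _
        have := (integrableOn_mul_fourier (integrableOn_freqPow_mul (hV i) (κ * z + η))
          (hI1 j)).const_mul (c i)
        refine this.congr (Filter.Eventually.of_forall fun ξ => ?_)
        simp only
        ring
    rw [e, Finset.mul_sum]
    refine Finset.sum_congr rfl fun i _ => ?_
    ring
  have hdiff : ∀ i j, Differentiable ℂ fun z => L z i j := by
    intro i j
    have := differentiable_integral_band_freqPow n κ η (integrableOn_mul_fourier (hV i) (hI1 j))
    simp only [hL, bandPairing]
    simp_rw [mul_assoc]
    exact this
  have hbound : ∃ K : ℝ, ∀ z : ℂ, 0 ≤ z.re → z.re ≤ 1 → ∀ i j, ‖L z i j‖ ≤ K := by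
    set M := |κ| + |η.re|
    refine ⟨∑ i, ∑ j, ((n : ℝ) + 1) ^ M * ∫ ξ in band n, ‖V i ξ *
      𝓕 ((E j).indicator fun _ => (1 : ℂ)) (-ξ)‖, fun z hz0 hz1 i j => ?_⟩
    have h1 : ‖L z i j‖ ≤ ((n : ℝ) + 1) ^ M * ∫ ξ in band n, ‖V i ξ *
        𝓕 ((E j).indicator fun _ => (1 : ℂ)) (-ξ)‖ := by
      rw [← integral_const_mul]
      refine norm_integral_le_of_norm_le
        ((integrableOn_mul_fourier (hV i) (hI1 j)).norm.const_mul _) ?_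
      refine (ae_restrict_iff' (measurableSet_band n)).2 (Filter.Eventually.of_forall fun ξ hξ => ?_)
      rw [mul_assoc, norm_mul]
      gcongr
      refine norm_freqPow_le hξ ?_
      rw [Complex.add_re, Complex.re_ofReal_mul]
      refine (abs_add_le _ _).trans (add_le_add ?_ le_rfl)
      rw [abs_mul, abs_of_nonneg hz0]
      exact mul_le_of_le_one_right (abs_nonneg _) hz1
    refine h1.trans ?_
    have hnn : ∀ (i : ι) (j : κ'), 0 ≤ ((n : ℝ) + 1) ^ M * ∫ ξ in band n, ‖V i ξ *
        𝓕 ((E j).indicator fun _ => (1 : ℂ)) (-ξ)‖ := fun i j =>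
      mul_nonneg (by positivity) (integral_nonneg fun _ => norm_nonneg _)
    refine le_trans ?_ (Finset.single_le_sum (fun i _ => Finset.sum_nonneg fun j _ => hnn i j)
      (Finset.mem_univ i))
    exact Finset.single_le_sum (f := fun j => ((n : ℝ) + 1) ^ M * ∫ ξ in band n, ‖V i ξ *
        𝓕 ((E j).indicator fun _ => (1 : ℂ)) (-ξ)‖) (fun j _ => hnn i j) (Finset.mem_univ j)
  obtain ⟨K, hK⟩ := hbound
  have key := norm_bilin_le_of_interpolation hdiff hK hw hEpos ha₀ ha₁ ha hb₀ hb₁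
    (by linarith : 0 < b) hθ haθ hbθ hA₀ hA₁ ?_ ?_ c d
  · rw [hform, ← ENNReal.ofReal_mul, ← ofReal_norm]
    · refine ENNReal.ofReal_le_ofReal (key.trans (le_of_eq ?_))
      ring
    · have := weightedNorm_nonneg hw a c
      positivity
  · intro y c d
    have h := h₀ y c (stepFn E d) (nice_stepFn hE hE' d)
    have hc := weightedNorm_nonneg hw a₀ c
    have hd := weightedNorm_nonneg hEpos b₀ d
    rw [hform, eLpNorm_stepFn hE hE' hdisj hb₀, ← ENNReal.ofReal_mul (by positivity), ← ofReal_norm,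
      ENNReal.ofReal_le_ofReal_iff (by positivity)] at h
    rwa [← mul_assoc]
  · intro y c d
    have h := h₁ y c (stepFn E d) (nice_stepFn hE hE' d)
    have hc := weightedNorm_nonneg hw a₁ c
    have hd := weightedNorm_nonneg hEpos b₁ d
    rw [hform, eLpNorm_stepFn hE hE' hdisj hb₁, ← ENNReal.ofReal_mul (by positivity), ← ofReal_norm,
      ENNReal.ofReal_le_ofReal_iff (by positivity)] at h
    rwa [← mul_assoc]

/-- The function of space whose Fourier transform is a profile cut off to a band. -/
noncomputable def bandSynth (n : ℕ) (V : ℝ → ℂ) (x : ℝ) : ℂ := 𝓕 ((band n).indicator V) (-x)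

theorem bandPairing_eq_integral_bandSynth {n : ℕ} {V g : ℝ → ℂ} (hV : IntegrableOn V (band n))
    (hg : Integrable g) : bandPairing n V g = ∫ x, g x * bandSynth n V x := by
  have hVi : Integrable ((band n).indicator V) := (integrable_indicator_iff (measurableSet_band n)).2 hV
  have h1 := integral_fourier_mul_eq hg.comp_neg hVi
  have h2 : ∫ ξ, 𝓕 (fun x => g (-x)) ξ * (band n).indicator V ξ = bandPairing n V g := by
    rw [bandPairing, ← integral_indicator (measurableSet_band n)]
    congr 1
    ext ξ
    have hneg : 𝓕 (fun x => g (-x)) ξ = 𝓕 g (-ξ) := by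
      rw [← Real.fourierInv_eq_fourier_neg, Real.fourierInv_eq_fourier_comp_neg]
    rw [hneg]
    by_cases hξ : ξ ∈ band n
    · simp only [indicator_of_mem hξ]
      ring
    · simp [indicator_of_notMem hξ]
  rw [← h2, h1, ← integral_neg_eq_self]
  simp only [neg_neg, bandSynth]

theorem integrable_fourier_exp_mul {f : ℝ → ℂ} (hf : Integrable f) (x : ℝ) :
    Integrable fun ξ : ℝ => Complex.exp ((2 * Real.pi * x * ξ : ℝ) * Complex.I) * f ξ := by
  refine hf.bdd_mul (c := 1) (Continuous.aestronglyMeasurable (by fun_prop)) ?_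
  exact Filter.Eventually.of_forall fun ξ => (Complex.norm_exp_ofReal_mul_I _).le

/-- The frequency localized bilinear form of `|∂_x| ^ z exp (-τ ∂_x ^ 3)`. -/
noncomputable def bandForm (n : ℕ) (z : ℂ) (τ : ℝ) (f g : ℝ → ℂ) : ℂ :=
  bandPairing n (fun ξ => freqPow z ξ * (airySymbol τ ξ * 𝓕 f ξ)) g

theorem continuous_airySymbol_right (τ : ℝ) : Continuous (airySymbol τ) :=
  continuous_airySymbol.comp (by fun_prop : Continuous fun ξ : ℝ => (τ, ξ))

theorem integrableOn_airySymbol_mul_fourier {n : ℕ} (τ : ℝ) {f : ℝ → ℂ} (hf : Integrable f) :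
    IntegrableOn (fun ξ => airySymbol τ ξ * 𝓕 f ξ) (band n) :=
  ((continuous_airySymbol_right τ).mul (continuous_fourier_of_integrable hf)).continuousOn.integrableOn_compact
    (isCompact_band n)

/-- The reflection `ξ ↦ -ξ` preserves the band and the modulus of the frequency, exchanges `f` and
`g`, and reverses time. This symmetry is what allows Duhamel integrals to be transposed. -/
theorem bandForm_swap (n : ℕ) (z : ℂ) (τ : ℝ) (f g : ℝ → ℂ) :
    bandForm n z τ f g = bandForm n z (-τ) g f := by
  unfold bandForm bandPairing
  rw [← integral_indicator (measurableSet_band n), ← integral_indicator (measurableSet_band n),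
    ← integral_neg_eq_self]
  congr 1
  ext ξ
  by_cases hξ : ξ ∈ band n
  · have hξ' : -ξ ∈ band n := neg_mem_band.2 hξ
    simp only [indicator_of_mem hξ, indicator_of_mem hξ', freqPow_neg, airySymbol_neg_right, neg_neg]
    ring
  · have hξ' : -ξ ∉ band n := fun h => hξ (neg_mem_band.1 h)
    simp only [indicator_of_notMem hξ, indicator_of_notMem hξ']

/-- The dispersive estimate. -/
theorem enorm_bandForm_le_one (n : ℕ) {z : ℂ} (hz0 : 0 ≤ z.re) (hz1 : z.re ≤ 1 / 2) {τ : ℝ}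
    (hτ : τ ≠ 0) {f g : ℝ → ℂ} (hf : Integrable f) (hg : Integrable g) :
    ‖bandForm n z τ f g‖ₑ ≤ ENNReal.ofReal (9 * (1 + |z.im|) * |τ| ^ (-(1 + z.re) / 3)) *
      (eLpNorm f 1 volume * eLpNorm g 1 volume) := by
  set D := ENNReal.ofReal (9 * (1 + |z.im|) * |τ| ^ (-(1 + z.re) / 3)) with hD
  have hV := integrableOn_freqPow_mul (n := n) (integrableOn_airySymbol_mul_fourier (n := n) τ hf) z
  have hone : IntegrableOn (fun ξ => freqPow z ξ * airySymbol τ ξ) (band n) :=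
    integrableOn_freqPow_mul
      ((continuous_airySymbol_right τ).continuousOn.integrableOn_compact (isCompact_band n)) z
  -- The function of space is the convolution of `f` with the band-limited Airy kernel: `𝓕 m y` is
  -- that kernel at `x - y`, which is bounded by `D` uniformly in `n`.
  have hsynth : ∀ x, ‖bandSynth n (fun ξ => freqPow z ξ * (airySymbol τ ξ * 𝓕 f ξ)) x‖ₑ ≤
      D * eLpNorm f 1 volume := by
    intro x
    set m : ℝ → ℂ := fun ξ => Complex.exp ((2 * Real.pi * x * ξ : ℝ) * Complex.I) *
      (band n).indicator (fun ξ => freqPow z ξ * airySymbol τ ξ) ξ with hm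
    have hmi : Integrable m := integrable_fourier_exp_mul
      ((integrable_indicator_iff (measurableSet_band n)).2 hone) x
    have e1 : bandSynth n (fun ξ => freqPow z ξ * (airySymbol τ ξ * 𝓕 f ξ)) x = ∫ y, f y * 𝓕 m y := by
      rw [← integral_fourier_mul_eq hf hmi, bandSynth, Real.fourier_real_eq_integral_exp_smul]
      congr 1
      ext ξ
      simp only [hm]
      by_cases hξ : ξ ∈ band n
      · simp only [indicator_of_mem hξ, smul_eq_mul]
        rw [show -2 * Real.pi * ξ * -x = 2 * Real.pi * x * ξ by ring]
        ring
      · simp [indicator_of_notMem hξ]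
    have e2 : ∀ y, ‖𝓕 m y‖ₑ ≤ D := by
      intro y
      have e3 : 𝓕 m y = ∫ ξ in band n, freqPow z ξ * airySymbol τ ξ *
          Complex.exp ((2 * Real.pi * (x - y) * ξ : ℝ) * Complex.I) := by
        rw [Real.fourier_real_eq_integral_exp_smul, ← integral_indicator (measurableSet_band n)]
        congr 1
        ext ξ
        simp only [hm]
        by_cases hξ : ξ ∈ band n
        · simp only [indicator_of_mem hξ, smul_eq_mul]
          rw [← mul_assoc, ← Complex.exp_add, mul_comm]
          congr 2
          push_cast
          ring
        · simp [indicator_of_notMem hξ]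
      rw [e3, ← ofReal_norm]
      exact ENNReal.ofReal_le_ofReal (norm_integral_band_le n hz0 hz1 _ hτ)
    rw [e1]
    refine (enorm_integral_le_lintegral_enorm _).trans ?_
    rw [eLpNorm_one_eq_lintegral_enorm, ← lintegral_const_mul' _ _ ENNReal.ofReal_ne_top]
    refine lintegral_mono fun y => ?_
    rw [enorm_mul, mul_comm]
    gcongr
    exact e2 y
  rw [bandForm, bandPairing_eq_integral_bandSynth hV hg]
  refine (enorm_integral_le_lintegral_enorm _).trans ?_
  rw [← mul_assoc, eLpNorm_one_eq_lintegral_enorm (f := g), ← lintegral_const_mul']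
  · refine lintegral_mono fun y => ?_
    rw [enorm_mul, mul_comm]
    gcongr
    exact hsynth y
  · exact ENNReal.mul_ne_top ENNReal.ofReal_ne_top (memLp_one_iff_integrable.2 hf).2.ne

/-- Both symbols are unimodular when `z.re = 0`, so Plancherel suffices. This is the left edge of
the interpolation, and imaginary powers cost nothing on it. -/
theorem enorm_bandForm_le_two (n : ℕ) {z : ℂ} (hz : z.re = 0) (τ : ℝ)
    {f g : ℝ → ℂ} (hf : Nice f) (hg : Nice g) :
    ‖bandForm n z τ f g‖ₑ ≤ eLpNorm f 2 volume * eLpNorm g 2 volume := by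
  have hV := integrableOn_freqPow_mul (n := n)
    (integrableOn_airySymbol_mul_fourier (n := n) τ hf.integrable) z
  refine (enorm_bandPairing_le_two hV.1 hg).trans ?_
  gcongr
  calc eLpNorm (fun ξ => freqPow z ξ * (airySymbol τ ξ * 𝓕 f ξ)) 2 (volume.restrict (band n))
      ≤ eLpNorm (𝓕 f) 2 (volume.restrict (band n)) := by
        refine eLpNorm_mono_ae ((ae_restrict_iff' (measurableSet_band n)).2
          (Filter.Eventually.of_forall fun ξ hξ => ?_))
        rw [norm_mul, norm_mul, norm_airySymbol, norm_freqPow (abs_pos_of_mem_band hξ), hz,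
          Real.rpow_zero, one_mul, one_mul]
    _ ≤ eLpNorm (𝓕 f) 2 volume := eLpNorm_mono_measure _ Measure.restrict_le_self
    _ ≤ _ := eLpNorm_fourier_le hf.integrable (hf 2 (by norm_num))

/-- Stein interpolation of the orders `α z + i η` between the `L²` bound at real part `0` and the
dispersive bound at real part `1`; the constant is `54 = 6 * 9`. The shift `η` is carried along
because the later interpolation of Duhamel integrals meets orders with an imaginary part. -/
theorem enorm_bandForm_le_of_step (n : ℕ) {α θ : ℝ} (hα : α ∈ Icc (0 : ℝ) (1 / 2))
    (hθ : θ ∈ Ioo (0 : ℝ) 1) (η : ℝ) {τ : ℝ} (hτ : τ ≠ 0) {E : ι → Set ℝ} (hE : ∀ i, MeasurableSet (E i))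
    (hE' : ∀ i, volume (E i) ≠ ∞) (hEpos : ∀ i, 0 < volume.real (E i))
    (hd : Pairwise fun i j => Disjoint (E i) (E j)) (c : ι → ℂ) {g : ℝ → ℂ} (hg : Nice g) :
    ‖bandForm n (α * θ + η * Complex.I) τ (stepFn E c) g‖ₑ ≤
      ENNReal.ofReal (54 * (1 + |η|) * |τ| ^ (-(θ * (1 + α)) / 3)) *
        (eLpNorm (stepFn E c) (ENNReal.ofReal (2 / (1 + θ))) volume *
          eLpNorm g (ENNReal.ofReal (2 / (1 + θ))) volume) := by
  have hθ0 := hθ.1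
  have hθ1 := hθ.2
  have hp1 : 1 ≤ 2 / (1 + θ) := by
    rw [le_div_iff₀ (by linarith)]
    linarith
  set V : ι → ℝ → ℂ := fun i ξ => airySymbol τ ξ * 𝓕 ((E i).indicator fun _ => (1 : ℂ)) ξ with hVdef
  have hV : ∀ i, IntegrableOn (V i) (band n) := fun i =>
    integrableOn_airySymbol_mul_fourier τ (integrable_indicator_const (hE i) (hE' i) 1)
  have hform : ∀ (z : ℂ) (c : ι → ℂ) (g : ℝ → ℂ), bandForm n z τ (stepFn E c) g =
      bandPairing n (fun ξ => freqPow z ξ * ∑ i, c i * V i ξ) g := by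
    intro z c g
    unfold bandForm
    congr 1
    ext ξ
    rw [fourier_stepFn hE hE', Finset.mul_sum]
    congr 1
    refine Finset.sum_congr rfl fun i _ => ?_
    simp only [hVdef]
    ring
  set A₁ : ℝ := 9 * (1 + |η|) * |τ| ^ (-(1 + α) / 3) with hA₁
  have key := enorm_bandPairing_le_of_interpolation hV hEpos α (η * Complex.I) (a₀ := 2) (a₁ := 1)
    (a := 2 / (1 + θ)) (b₀ := 2) (b₁ := 1) (b := 2 / (1 + θ)) (θ := θ) (A₀ := 1) (A₁ := A₁)
    two_pos one_pos (by linarith) two_pos one_pos hp1 ⟨hθ0.le, hθ1.le⟩ (by field_simp; ring)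
    (by field_simp; ring) zero_le_one (by positivity) ?_ ?_ c hg
  · rw [hform, eLpNorm_stepFn hE hE' hd (by linarith), ← mul_assoc, ← ENNReal.ofReal_mul (by positivity)]
    refine key.trans ?_
    have hwn := weightedNorm_nonneg hEpos (2 / (1 + θ)) c
    gcongr ENNReal.ofReal (?_ * _) * _
    rw [Real.one_rpow, one_mul, hA₁, Real.mul_rpow (by positivity) (by positivity),
      ← Real.rpow_mul (abs_nonneg _), show -(1 + α) / 3 * θ = -(θ * (1 + α)) / 3 by ring, ← mul_assoc]
    refine mul_le_mul_of_nonneg_right ?_ (by positivity)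
    have h1 : (1 : ℝ) ≤ 9 * (1 + |η|) := by linarith [abs_nonneg η]
    have h2 : (9 * (1 + |η|)) ^ θ ≤ 9 * (1 + |η|) := by
      calc (9 * (1 + |η|)) ^ θ ≤ (9 * (1 + |η|)) ^ (1 : ℝ) := Real.rpow_le_rpow_of_exponent_le h1 hθ1.le
        _ = _ := Real.rpow_one _
    linarith
  · intro y c g hg
    have h := enorm_bandForm_le_two n (z := α * (y * Complex.I) + η * Complex.I) (by simp) τ
      (nice_stepFn hE hE' c) hg
    rw [hform] at h
    have e2 := eLpNorm_stepFn hE hE' hd (a := 2) two_pos c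
    rw [ENNReal.ofReal_ofNat] at e2
    rwa [one_mul, ENNReal.ofReal_ofNat, ← e2]
  · intro y c g hg
    have hre : ((α : ℂ) * (1 + y * Complex.I) + η * Complex.I).re = α := by simp
    have him : ((α : ℂ) * (1 + y * Complex.I) + η * Complex.I).im = α * y + η := by simp
    have h := enorm_bandForm_le_one n (z := α * (1 + y * Complex.I) + η * Complex.I)
      (by rw [hre]; exact hα.1) (by rw [hre]; exact hα.2) hτ
      (nice_stepFn hE hE' c).integrable hg.integrable
    have e2 := eLpNorm_stepFn hE hE' hd (a := 1) one_pos c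
    rw [ENNReal.ofReal_one] at e2
    have hwn := weightedNorm_nonneg hEpos 1 c
    rw [hform, hre, him, e2, ← mul_assoc, ← ENNReal.ofReal_mul (by positivity)] at h
    refine h.trans ?_
    rw [ENNReal.ofReal_one]
    gcongr ENNReal.ofReal (?_ * _) * _
    rw [hA₁]
    have hy : 1 + |α * y + η| ≤ (1 + |η|) * (1 + |y|) := by
      have h1 := abs_add_le (α * y) η
      rw [abs_mul, abs_of_nonneg hα.1] at h1
      have h2 : α * |y| ≤ 1 * |y| := by
        gcongr
        linarith [hα.2]
      nlinarith [abs_nonneg η, abs_nonneg y, mul_nonneg (abs_nonneg η) (abs_nonneg y)]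
    calc 9 * (1 + |α * y + η|) * |τ| ^ (-(1 + α) / 3)
        ≤ 9 * ((1 + |η|) * (1 + |y|)) * |τ| ^ (-(1 + α) / 3) := by gcongr
      _ = _ := by ring

/-- The interpolated dispersive estimate. -/
theorem enorm_bandForm_le (n : ℕ) {α θ : ℝ} (hα : α ∈ Icc (0 : ℝ) (1 / 2))
    (hθ : θ ∈ Ioo (0 : ℝ) 1) (η : ℝ) {τ : ℝ} (hτ : τ ≠ 0) {f g : ℝ → ℂ} (hf : Nice f) (hg : Nice g) :
    ‖bandForm n (α * θ + η * Complex.I) τ f g‖ₑ ≤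
      ENNReal.ofReal (54 * (1 + |η|) * |τ| ^ (-(θ * (1 + α)) / 3)) *
        (eLpNorm f (ENNReal.ofReal (2 / (1 + θ))) volume *
          eLpNorm g (ENNReal.ofReal (2 / (1 + θ))) volume) := by
  have hp1 : 1 ≤ 2 / (1 + θ) := by
    rw [le_div_iff₀ (by linarith [hθ.1])]
    linarith [hθ.2]
  have hp1' : (1 : ℝ≥0∞) ≤ ENNReal.ofReal (2 / (1 + θ)) := by
    simpa using ENNReal.ofReal_le_ofReal hp1
  have hV := integrableOn_freqPow_mul (n := n)
    (integrableOn_airySymbol_mul_fourier (n := n) (-τ) hg.integrable) (α * θ + η * Complex.I)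
  -- After the swap `g` is part of a fixed profile and `f` is the function paired with it. The
  -- restriction to step functions in the first argument is then removed by density.
  rw [bandForm_swap, mul_comm (eLpNorm f _ _), ← mul_assoc]
  refine enorm_bandPairing_le_of_simpleFunc hV hp1' ENNReal.ofReal_ne_top
    (ENNReal.mul_ne_top ENNReal.ofReal_ne_top (hg _ hp1').2.ne) ?_ hf
  intro s hs
  obtain ⟨κ', _, E, d, hE, hE', hEpos, hdisj, hsE⟩ := exists_stepFn_ae_eq s hs
  rw [bandPairing_congr hsE, eLpNorm_congr_ae hsE]
  have key := enorm_bandForm_le_of_step n hα hθ η hτ hE hE' hEpos hdisj d hg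
  rw [bandForm_swap, mul_comm (eLpNorm (stepFn E d) _ _), ← mul_assoc] at key
  exact key

end Dispersive

/-! ### Duhamel integrals at a fixed time -/

section Duhamel

/-- The kernel of the Riesz potential, as an extended nonnegative number. -/
noncomputable def rieszKernel (γ τ : ℝ) : ℝ≥0∞ := ENNReal.ofReal (|τ| ^ (-γ))

theorem measurable_rieszKernel (γ : ℝ) : Measurable (rieszKernel γ) := by
  unfold rieszKernel
  fun_prop

theorem rieszKernel_neg (γ τ : ℝ) : rieszKernel γ (-τ) = rieszKernel γ τ := by
  simp [rieszKernel]

/-- The profile at time `t` of the Duhamel integral over the set `S` of times. -/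
noncomputable def duhamelProfile (S : Set ℝ) (t : ℝ) (h : ℝ → ℝ → ℂ) (ξ : ℝ) : ℂ :=
  ∫ s in S, airySymbol (t - s) ξ * 𝓕 (h s) ξ

/-- A family of functions of space which is integrable over the set `S` of times. -/
structure NiceFamily (S : Set ℝ) (h : ℝ → ℝ → ℂ) : Prop where
  stronglyMeasurable : StronglyMeasurable (Function.uncurry h)
  nice : ∀ s, Nice (h s)
  lintegral_lt_top : ∫⁻ s in S, eLpNorm (h s) 1 volume < ∞

theorem stronglyMeasurable_fourier {h : ℝ → ℝ → ℂ} (hh : StronglyMeasurable (Function.uncurry h)) :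
    StronglyMeasurable fun p : ℝ × ℝ => 𝓕 (h p.1) p.2 := by
  have h1 : StronglyMeasurable fun q : (ℝ × ℝ) × ℝ =>
      Complex.exp (((-2 * Real.pi * q.2 * q.1.2 : ℝ) : ℂ) * Complex.I) * h q.1.1 q.2 := by
    refine StronglyMeasurable.mul ?_ ?_
    · exact Continuous.stronglyMeasurable (by fun_prop)
    · exact hh.comp_measurable (g := fun q : (ℝ × ℝ) × ℝ => (q.1.1, q.2)) (by fun_prop)
  have h2 := h1.integral_prod_right' (ν := volume)
  simp_rw [Real.fourier_real_eq_integral_exp_smul, smul_eq_mul]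
  exact h2

theorem stronglyMeasurable_airySymbol_mul_fourier (t : ℝ) {h : ℝ → ℝ → ℂ}
    (hh : StronglyMeasurable (Function.uncurry h)) :
    StronglyMeasurable fun p : ℝ × ℝ => airySymbol (t - p.1) p.2 * 𝓕 (h p.1) p.2 := by
  refine StronglyMeasurable.mul ?_ (stronglyMeasurable_fourier hh)
  exact (continuous_airySymbol.comp
    (by fun_prop : Continuous fun p : ℝ × ℝ => (t - p.1, p.2))).stronglyMeasurable

theorem measurable_eLpNorm_slice {h : ℝ → ℝ → ℂ} (hh : StronglyMeasurable (Function.uncurry h))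
    {p : ℝ} (hp : 0 < p) : Measurable fun s => eLpNorm (h s) (ENNReal.ofReal p) volume := by
  have h1 : ∀ s, eLpNorm (h s) (ENNReal.ofReal p) volume = (∫⁻ x, ‖h s x‖ₑ ^ p) ^ (1 / p) := fun s => by
    rw [eLpNorm_eq_lintegral_rpow_enorm_toReal (by simpa using hp) ENNReal.ofReal_ne_top,
      ENNReal.toReal_ofReal hp.le]
  simp_rw [h1]
  have h2 : Measurable fun q : ℝ × ℝ => ‖h q.1 q.2‖ₑ ^ p := (hh.enorm).pow_const p
  exact h2.lintegral_prod_right'.pow_const _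

theorem enorm_airySymbol (t ξ : ℝ) : ‖airySymbol t ξ‖ₑ = 1 := by
  rw [← ofReal_norm, norm_airySymbol, ENNReal.ofReal_one]

theorem enorm_freqPow_le {n : ℕ} (z : ℂ) {ξ : ℝ} (h : ξ ∈ band n) :
    ‖freqPow z ξ‖ₑ ≤ ENNReal.ofReal (((n : ℝ) + 1) ^ |z.re|) := by
  rw [← ofReal_norm]
  exact ENNReal.ofReal_le_ofReal (norm_freqPow_le h le_rfl)

theorem stronglyMeasurable_duhamelProfile (S : Set ℝ) (t : ℝ) {h : ℝ → ℝ → ℂ}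
    (hh : StronglyMeasurable (Function.uncurry h)) : StronglyMeasurable (duhamelProfile S t h) :=
  (stronglyMeasurable_airySymbol_mul_fourier t hh).integral_prod_left' (μ := volume.restrict S)

theorem enorm_duhamelProfile_le (S : Set ℝ) (t : ℝ) (h : ℝ → ℝ → ℂ) (ξ : ℝ) :
    ‖duhamelProfile S t h ξ‖ₑ ≤ ∫⁻ s in S, eLpNorm (h s) 1 volume := by
  refine (enorm_integral_le_lintegral_enorm _).trans (lintegral_mono fun s => ?_)
  rw [enorm_mul, enorm_airySymbol, one_mul]
  exact enorm_fourier_le ξ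

theorem integrableOn_of_enorm_le {n : ℕ} {V : ℝ → ℂ} (hV : AEStronglyMeasurable V (volume.restrict (band n)))
    {C : ℝ≥0∞} (hC : C < ∞) (h : ∀ ξ, ‖V ξ‖ₑ ≤ C) : IntegrableOn V (band n) := by
  refine ⟨hV, ?_⟩
  refine (lintegral_mono h).trans_lt ?_
  rw [setLIntegral_const]
  exact ENNReal.mul_lt_top hC (volume_band_lt_top n)

theorem integrableOn_duhamelProfile {n : ℕ} {S : Set ℝ} {h : ℝ → ℝ → ℂ} (hh : NiceFamily S h) (t : ℝ) :
    IntegrableOn (duhamelProfile S t h) (band n) :=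
  integrableOn_of_enorm_le (stronglyMeasurable_duhamelProfile S t hh.1).aestronglyMeasurable
    hh.lintegral_lt_top (enorm_duhamelProfile_le S t h)

/-- The pairing of the Duhamel integral is the integral of the bilinear forms. -/
theorem bandPairing_duhamelProfile {n : ℕ} {S : Set ℝ} {h : ℝ → ℝ → ℂ} (hh : NiceFamily S h) (t : ℝ)
    (z : ℂ) {g : ℝ → ℂ} (hg : Integrable g) :
    bandPairing n (fun ξ => freqPow z ξ * duhamelProfile S t h ξ) g =
      ∫ s in S, bandForm n z (t - s) (h s) g := by
  have hmeas : StronglyMeasurable fun p : ℝ × ℝ =>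
      freqPow z p.2 * (airySymbol (t - p.1) p.2 * 𝓕 (h p.1) p.2) * 𝓕 g (-p.2) := by
    refine StronglyMeasurable.mul (StronglyMeasurable.mul ?_
      (stronglyMeasurable_airySymbol_mul_fourier t hh.1)) ?_
    · exact (measurable_freqPow z).stronglyMeasurable.comp_measurable measurable_snd
    · exact ((continuous_fourier_of_integrable hg).comp
        (by fun_prop : Continuous fun p : ℝ × ℝ => -p.2)).stronglyMeasurable
  have hint : Integrable (fun p : ℝ × ℝ =>
      freqPow z p.2 * (airySymbol (t - p.1) p.2 * 𝓕 (h p.1) p.2) * 𝓕 g (-p.2))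
      ((volume.restrict S).prod (volume.restrict (band n))) := by
    refine ⟨hmeas.aestronglyMeasurable, ?_⟩
    unfold HasFiniteIntegral
    rw [lintegral_prod _ hmeas.enorm.aemeasurable]
    have hgf : eLpNorm g 1 volume < ∞ := (memLp_one_iff_integrable.2 hg).2
    calc ∫⁻ s in S, ∫⁻ ξ in band n, ‖freqPow z ξ * (airySymbol (t - s) ξ * 𝓕 (h s) ξ) * 𝓕 g (-ξ)‖ₑ
        ≤ ∫⁻ s in S, (ENNReal.ofReal (((n : ℝ) + 1) ^ |z.re|) * eLpNorm g 1 volume * volume (band n)) *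
            eLpNorm (h s) 1 volume := by
          refine lintegral_mono fun s => ?_
          calc _ ≤ ∫⁻ ξ in band n, ENNReal.ofReal (((n : ℝ) + 1) ^ |z.re|) * eLpNorm (h s) 1 volume *
                eLpNorm g 1 volume := by
                refine setLIntegral_mono' (measurableSet_band n) fun ξ hξ => ?_
                rw [enorm_mul, enorm_mul, enorm_mul, enorm_airySymbol, one_mul]
                gcongr
                · exact enorm_freqPow_le z hξ
                · exact enorm_fourier_le _
                · exact enorm_fourier_le _
            _ = _ := by
                rw [setLIntegral_const]
                ring
      _ < ∞ := by
          rw [lintegral_const_mul']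
          · exact ENNReal.mul_lt_top (ENNReal.mul_lt_top (ENNReal.mul_lt_top ENNReal.ofReal_lt_top hgf)
              (volume_band_lt_top n)) hh.lintegral_lt_top
          · exact (ENNReal.mul_lt_top (ENNReal.mul_lt_top ENNReal.ofReal_lt_top hgf)
              (volume_band_lt_top n)).ne
  simp only [bandForm, bandPairing]
  rw [integral_integral_swap hint]
  refine integral_congr_ae (Filter.Eventually.of_forall fun ξ => ?_)
  simp only [duhamelProfile]
  rw [integral_mul_const, integral_const_mul]

theorem conj_fourier (f : ℝ → ℂ) (ξ : ℝ) :
    (starRingEnd ℂ) (𝓕 f ξ) = 𝓕 (fun x => (starRingEnd ℂ) (f x)) (-ξ) := by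
  rw [Real.fourier_real_eq_integral_exp_smul, Real.fourier_real_eq_integral_exp_smul, ← integral_conj]
  congr 1
  ext x
  rw [smul_eq_mul, smul_eq_mul, map_mul, ← Complex.exp_conj, map_mul, Complex.conj_I, Complex.conj_ofReal]
  congr 2
  push_cast
  ring

theorem Nice.conj {f : ℝ → ℂ} (hf : Nice f) : Nice fun x => (starRingEnd ℂ) (f x) := fun p hp =>
  (hf p hp).star

theorem eLpNorm_conj (f : ℝ → ℂ) (p : ℝ≥0∞) :
    eLpNorm (fun x => (starRingEnd ℂ) (f x)) p volume = eLpNorm f p volume :=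
  eLpNorm_congr_norm_ae (Filter.Eventually.of_forall fun x => by simp)

/-- The `TT*` bound for the Duhamel integral. -/
theorem eLpNorm_duhamelProfile_sq_le {n : ℕ} {S : Set ℝ} {h : ℝ → ℝ → ℂ} (hh : NiceFamily S h) (t σ : ℝ) :
    eLpNorm (fun ξ => freqPow σ ξ * duhamelProfile S t h ξ) 2 (volume.restrict (band n)) ^ 2 ≤
      ∫⁻ s' in S, ∫⁻ s in S,
        ‖bandForm n (2 * σ : ℝ) (s' - s) (h s) (fun x => (starRingEnd ℂ) (h s' x))‖ₑ := by
  set V : ℝ → ℂ := fun ξ => freqPow σ ξ * duhamelProfile S t h ξ with hVdef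
  have hsq : eLpNorm V 2 (volume.restrict (band n)) ^ 2 = ∫⁻ ξ in band n, ‖V ξ * (starRingEnd ℂ) (V ξ)‖ₑ := by
    rw [eLpNorm_eq_lintegral_rpow_enorm_toReal (by norm_num) (by norm_num), ← ENNReal.rpow_natCast,
      ← ENNReal.rpow_mul]
    norm_num
    refine lintegral_congr fun ξ => ?_
    rw [sq]
  have hVm : StronglyMeasurable V :=
    (measurable_freqPow _).stronglyMeasurable.mul (stronglyMeasurable_duhamelProfile S t hh.1)
  have hconjm : StronglyMeasurable fun p : ℝ × ℝ => (starRingEnd ℂ) (airySymbol (t - p.1) p.2 * 𝓕 (h p.1) p.2) :=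
    (Complex.continuous_conj.comp_stronglyMeasurable (stronglyMeasurable_airySymbol_mul_fourier t hh.1))
  have hint : Integrable (fun p : ℝ × ℝ => freqPow σ p.2 * V p.2 *
      (starRingEnd ℂ) (airySymbol (t - p.1) p.2 * 𝓕 (h p.1) p.2))
      ((volume.restrict S).prod (volume.restrict (band n))) := by
    have hmeas : StronglyMeasurable fun p : ℝ × ℝ => freqPow σ p.2 * V p.2 *
        (starRingEnd ℂ) (airySymbol (t - p.1) p.2 * 𝓕 (h p.1) p.2) :=
      (((measurable_freqPow _).stronglyMeasurable.comp_measurable measurable_snd).mul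
        (hVm.comp_measurable measurable_snd)).mul hconjm
    refine ⟨hmeas.aestronglyMeasurable, ?_⟩
    unfold HasFiniteIntegral
    rw [lintegral_prod _ hmeas.enorm.aemeasurable]
    set K := ENNReal.ofReal (((n : ℝ) + 1) ^ |(σ : ℂ).re|) with hK
    set I := ∫⁻ s in S, eLpNorm (h s) 1 volume with hI
    have hIt : I < ∞ := hh.lintegral_lt_top
    calc _ ≤ ∫⁻ s in S, (K * (K * I) * volume (band n)) * eLpNorm (h s) 1 volume := by
          refine lintegral_mono fun s => ?_
          calc _ ≤ ∫⁻ ξ in band n, K * (K * I) * eLpNorm (h s) 1 volume := by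
                refine setLIntegral_mono' (measurableSet_band n) fun ξ hξ => ?_
                simp only [hVdef]
                rw [enorm_mul, enorm_mul, enorm_mul, RCLike.enorm_conj, enorm_mul, enorm_airySymbol, one_mul]
                gcongr
                · exact enorm_freqPow_le _ hξ
                · exact enorm_freqPow_le _ hξ
                · exact enorm_duhamelProfile_le S t h ξ
                · exact enorm_fourier_le _
            _ = _ := by
                rw [setLIntegral_const]
                ring
      _ < ∞ := by
          have : K * (K * I) * volume (band n) < ∞ :=
            ENNReal.mul_lt_top (ENNReal.mul_lt_top ENNReal.ofReal_lt_top
              (ENNReal.mul_lt_top ENNReal.ofReal_lt_top hIt)) (volume_band_lt_top n)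
          rw [lintegral_const_mul' _ _ this.ne]
          exact ENNReal.mul_lt_top this hIt
  have hreal : ∀ ξ ∈ band n, (starRingEnd ℂ) (V ξ) =
      freqPow σ ξ * ∫ s in S, (starRingEnd ℂ) (airySymbol (t - s) ξ * 𝓕 (h s) ξ) := by
    intro ξ _
    simp only [hVdef, duhamelProfile]
    rw [map_mul, integral_conj, freqPow_ofReal, absDerivSymbol, Complex.conj_ofReal]
  -- The `TT*` identity. Expanding the conjugate factor as an integral over `s'` combines the
  -- propagators into one from `s` to `s'`: the time `t` disappears, and the order doubles to `2 σ`.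
  have hswap : ∫ ξ in band n, V ξ * (starRingEnd ℂ) (V ξ) = ∫ s' in S,
      bandPairing n (fun ξ => freqPow (2 * σ : ℝ) ξ * duhamelProfile S s' h ξ)
        (fun x => (starRingEnd ℂ) (h s' x)) := by
    have e1 : ∫ ξ in band n, V ξ * (starRingEnd ℂ) (V ξ) = ∫ ξ in band n, ∫ s in S,
        freqPow σ ξ * V ξ * (starRingEnd ℂ) (airySymbol (t - s) ξ * 𝓕 (h s) ξ) := by
      refine setIntegral_congr_fun (measurableSet_band n) fun ξ hξ => ?_
      rw [integral_const_mul, hreal ξ hξ]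
      ring
    rw [e1, ← integral_integral_swap hint]
    refine integral_congr_ae (Filter.Eventually.of_forall fun s' => ?_)
    simp only [bandPairing]
    refine setIntegral_congr_fun (measurableSet_band n) fun ξ hξ => ?_
    rw [← conj_fourier, map_mul, conj_airySymbol]
    have e2 : duhamelProfile S s' h ξ = airySymbol (s' - t) ξ * duhamelProfile S t h ξ := by
      simp only [duhamelProfile]
      rw [← integral_const_mul]
      refine integral_congr_ae (Filter.Eventually.of_forall fun s => ?_)
      simp only
      rw [← mul_assoc, ← airySymbol_add]
      congr 2
      ring
    have e3 : freqPow ((2 * σ : ℝ) : ℂ) ξ = freqPow σ ξ * freqPow σ ξ := by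
      rw [← freqPow_add (abs_pos_of_mem_band hξ)]
      congr 1
      push_cast
      ring
    simp only [hVdef]
    rw [e2, e3, neg_sub]
    ring
  have hnn : ∫⁻ ξ in band n, ‖V ξ * (starRingEnd ℂ) (V ξ)‖ₑ =
      ‖∫ ξ in band n, V ξ * (starRingEnd ℂ) (V ξ)‖ₑ := by
    have hVV : ∀ ξ, V ξ * (starRingEnd ℂ) (V ξ) = ((‖V ξ‖ ^ 2 : ℝ) : ℂ) := fun ξ => by
      rw [Complex.mul_conj, Complex.normSq_eq_norm_sq]
    have hVint : IntegrableOn (fun ξ => ‖V ξ‖ ^ 2) (band n) := by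
      have hb : ∀ᵐ ξ ∂volume.restrict (band n), ‖V ξ‖ ≤
          (ENNReal.ofReal (((n : ℝ) + 1) ^ |(σ : ℂ).re|) * ∫⁻ s in S, eLpNorm (h s) 1 volume).toReal := by
        refine (ae_restrict_iff' (measurableSet_band n)).2 (Filter.Eventually.of_forall fun ξ hξ => ?_)
        rw [← toReal_enorm]
        refine ENNReal.toReal_mono (ENNReal.mul_lt_top ENNReal.ofReal_lt_top hh.lintegral_lt_top).ne ?_
        simp only [hVdef]
        rw [enorm_mul]
        gcongr
        · exact enorm_freqPow_le _ hξ
        · exact enorm_duhamelProfile_le S t h ξ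
      have : IsFiniteMeasure (volume.restrict (band n)) := ⟨by simpa using volume_band_lt_top n⟩
      refine Integrable.of_bound (hVm.norm.pow 2).aestronglyMeasurable
        ((ENNReal.ofReal (((n : ℝ) + 1) ^ |(σ : ℂ).re|) * ∫⁻ s in S, eLpNorm (h s) 1 volume).toReal ^ 2) ?_
      filter_upwards [hb] with ξ hξ
      rw [norm_pow, norm_norm]
      gcongr
    simp_rw [hVV]
    rw [integral_complex_ofReal, ← ofReal_norm, Complex.norm_real, Real.norm_eq_abs,
      abs_of_nonneg (integral_nonneg fun ξ => by positivity),
      ofReal_integral_eq_lintegral_ofReal hVint (Filter.Eventually.of_forall fun ξ => by positivity)]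
    refine lintegral_congr fun ξ => ?_
    rw [← ofReal_norm, Complex.norm_real, Real.norm_eq_abs, abs_of_nonneg (by positivity)]
  rw [hsq, hnn, hswap]
  refine (enorm_integral_le_lintegral_enorm _).trans (lintegral_mono fun s' => ?_)
  rw [bandPairing_duhamelProfile hh s' _ (hh.nice s').conj.integrable]
  exact enorm_integral_le_lintegral_enorm _

/-- The weighted double integral which controls the Duhamel integral in `L²`. -/
noncomputable def rieszEnergy (γ : ℝ) (S : Set ℝ) (f : ℝ → ℝ≥0∞) : ℝ≥0∞ :=
  ∫⁻ s' in S, ∫⁻ s in S, rieszKernel γ (s' - s) * (f s * f s')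

/-- The Riesz potential over the set `S`. -/
noncomputable def rieszPotential (γ : ℝ) (S : Set ℝ) (f : ℝ → ℝ≥0∞) (t : ℝ) : ℝ≥0∞ :=
  ∫⁻ s in S, rieszKernel γ (t - s) * f s

/-- The dispersive estimate needs a nonzero time difference. Moreover, for `γ ≠ 0`, the power
convention makes `rieszKernel γ 0 = 0`, so the pointwise majorant is not claimed on the diagonal. -/
theorem ae_sub_ne_zero (S : Set ℝ) (t : ℝ) : ∀ᵐ s ∂volume.restrict S, t - s ≠ 0 := by
  refine ae_restrict_of_ae ?_
  filter_upwards [Measure.ae_ne volume t] with s hs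
  rw [sub_ne_zero]
  exact hs.symm

/-- The frequency localized Duhamel integral, with the loss of derivatives of two different
admissible pairs. -/
theorem enorm_bandPairing_duhamelProfile_le (n : ℕ) {α θ θ' : ℝ} (hα : α ∈ Icc (0 : ℝ) (1 / 2))
    (hθ : θ ∈ Ioo (0 : ℝ) 1) (hθ' : 0 < θ') (hle : θ' ≤ θ) {S : Set ℝ} {h : ℝ → ℝ → ℂ}
    (hh : NiceFamily S h) (t : ℝ) {g : ℝ → ℂ} (hg : Nice g) {f : ℝ → ℝ≥0∞}
    (hf : ∀ s, f s = eLpNorm (h s) (ENNReal.ofReal (2 / (1 + θ))) volume)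
    (hE : rieszEnergy (θ * (1 + α) / 3) S f ≠ ∞) (hM : rieszPotential (θ * (1 + α) / 3) S f t ≠ ∞) :
    ‖bandPairing n (fun ξ => freqPow ((θ * α / 2 + θ' * α / 2 : ℝ) : ℂ) ξ * duhamelProfile S t h ξ) g‖ₑ ≤
      324 * (rieszEnergy (θ * (1 + α) / 3) S f ^ ((1 - θ' / θ) / 2) *
        rieszPotential (θ * (1 + α) / 3) S f t ^ (θ' / θ)) *
        eLpNorm g (ENNReal.ofReal (2 / (1 + θ'))) volume := by
  set γ := θ * (1 + α) / 3 with hγ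
  set D := rieszEnergy γ S f with hD
  set M := rieszPotential γ S f t with hMdef
  set σ := θ * α / 2 with hσ
  set l := θ' / θ with hl
  have hθ0 := hθ.1
  have hα0 := hα.1
  have hl0 : 0 < l := by positivity
  have hl1 : l ≤ 1 := by rw [hl, div_le_one hθ0]; exact hle
  have hσ0 : 0 ≤ σ := by positivity
  have hσ1 : σ ≤ 1 := by
    rw [hσ]
    have := hα.2
    nlinarith [hθ.2]
  have hexp : -(θ * (1 + α)) / 3 = -γ := by rw [hγ]; ring
  -- the bound on the left edge
  have hL2 : eLpNorm (fun ξ => freqPow σ ξ * duhamelProfile S t h ξ) 2 (volume.restrict (band n)) ≤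
      ENNReal.ofReal ((54 * D.toReal) ^ (1 / 2 : ℝ)) := by
    have h1 := eLpNorm_duhamelProfile_sq_le (n := n) hh t σ
    have h2 : ∫⁻ s' in S, ∫⁻ s in S,
        ‖bandForm n (2 * σ : ℝ) (s' - s) (h s) (fun x => (starRingEnd ℂ) (h s' x))‖ₑ ≤ 54 * D := by
      rw [hD, rieszEnergy, ← lintegral_const_mul' _ _ (by norm_num)]
      refine lintegral_mono fun s' => ?_
      rw [← lintegral_const_mul' _ _ (by norm_num)]
      refine lintegral_mono_ae ?_
      filter_upwards [ae_sub_ne_zero S s'] with s hs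
      have h3 := enorm_bandForm_le n hα hθ 0 hs (hh.nice s) (hh.nice s').conj
      rw [eLpNorm_conj, ← hf, ← hf, hexp] at h3
      have e1 : ((2 * σ : ℝ) : ℂ) = α * θ + (0 : ℝ) * Complex.I := by
        rw [hσ]
        push_cast
        ring
      rw [e1]
      refine h3.trans (le_of_eq ?_)
      rw [abs_zero, add_zero, mul_one, ENNReal.ofReal_mul (by norm_num), rieszKernel, mul_assoc]
      norm_num
    have h4 := h1.trans h2
    have h5 : (54 : ℝ≥0∞) * D = ENNReal.ofReal (54 * D.toReal) := by
      rw [ENNReal.ofReal_mul (by norm_num), ENNReal.ofReal_toReal hE]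
      norm_num
    rw [h5] at h4
    rw [← ENNReal.ofReal_rpow_of_nonneg (by positivity) (by norm_num)]
    have h6 := ENNReal.rpow_le_rpow h4 (by norm_num : (0 : ℝ) ≤ 1 / 2)
    rwa [← ENNReal.rpow_natCast, ← ENNReal.rpow_mul, Nat.cast_ofNat, mul_one_div_cancel two_ne_zero,
      ENNReal.rpow_one] at h6
  have hp1 : 1 ≤ 2 / (1 + θ') := by
    rw [le_div_iff₀ (by linarith)]
    linarith [hθ.2]
  -- The profile is a fixed vector, so only the exponent of `g` moves, from `2` to `2 / (1 + θ)`.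
  -- The order is `σ z + σ`: at real part `0` it is `σ`, where the `TT*` bound gives `(54 E) ^
  -- (1/2)`; at real part `1` it is `2 σ = θ α`, where integrating the dispersive estimate in time
  -- gives `54 M`. At `z = l` it is `θ α / 2 + θ' α / 2`, and the constant is at most `324 = 6 *
  -- 54`.
  have key := enorm_bandPairing_le_of_interpolation (ι := Unit) (n := n)
    (V := fun _ => duhamelProfile S t h)
    (fun _ => integrableOn_duhamelProfile hh t) (w := fun _ => 1) (fun _ => one_pos) σ σ
    (a₀ := 1) (a₁ := 1) (a := 1) (b₀ := 2) (b₁ := 2 / (1 + θ)) (b := 2 / (1 + θ')) (θ := l)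
    (A₀ := (54 * D.toReal) ^ (1 / 2 : ℝ)) (A₁ := 54 * M.toReal) one_pos one_pos one_pos two_pos
    (by positivity) hp1 ⟨hl0.le, hl1⟩ (by ring) (by rw [hl]; field_simp; ring)
    (by positivity) (by positivity) ?_ ?_ (fun _ => 1) hg
  · simp only [Finset.univ_unique, Finset.sum_singleton, one_mul] at key
    have e1 : (σ : ℂ) * (l : ℂ) + σ = ((σ + θ' * α / 2 : ℝ) : ℂ) := by
      have : σ * l = θ' * α / 2 := by
        rw [hσ, hl]
        field_simp
      rw [← Complex.ofReal_mul, this]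
      push_cast
      ring
    rw [e1] at key
    refine key.trans ?_
    gcongr
    have e2 : weightedNorm (fun _ : Unit => (1 : ℝ)) 1 (fun _ => 1) = 1 := by simp [weightedNorm]
    rw [e2, mul_one, ← Real.rpow_mul (by positivity),
      Real.mul_rpow (by norm_num) ENNReal.toReal_nonneg, Real.mul_rpow (by norm_num) ENNReal.toReal_nonneg]
    have e3 : (54 : ℝ) ^ (1 / 2 * (1 - l)) * 54 ^ l ≤ 54 := by
      rw [← Real.rpow_add (by norm_num)]
      calc (54 : ℝ) ^ (1 / 2 * (1 - l) + l) ≤ 54 ^ (1 : ℝ) :=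
            Real.rpow_le_rpow_of_exponent_le (by norm_num) (by linarith)
        _ = 54 := Real.rpow_one _
    have hx : 1 / 2 * (1 - l) = (1 - l) / 2 := by ring
    calc ENNReal.ofReal (6 * (54 ^ (1 / 2 * (1 - l)) * D.toReal ^ (1 / 2 * (1 - l)) *
          (54 ^ l * M.toReal ^ l)))
        = ENNReal.ofReal (6 * (54 ^ (1 / 2 * (1 - l)) * 54 ^ l) *
          (D.toReal ^ ((1 - l) / 2) * M.toReal ^ l)) := by
          rw [hx]
          congr 1
          ring
      _ ≤ ENNReal.ofReal (6 * 54 * (D.toReal ^ ((1 - l) / 2) * M.toReal ^ l)) := by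
          apply ENNReal.ofReal_le_ofReal
          gcongr
      _ = 324 * (D ^ ((1 - l) / 2) * M ^ l) := by
          rw [ENNReal.ofReal_mul (by norm_num), ENNReal.ofReal_mul (p := D.toReal ^ _) (by positivity),
            ← ENNReal.ofReal_rpow_of_nonneg ENNReal.toReal_nonneg (by linarith),
            ← ENNReal.ofReal_rpow_of_nonneg ENNReal.toReal_nonneg hl0.le,
            ENNReal.ofReal_toReal hE, ENNReal.ofReal_toReal hM]
          norm_num
  · intro y c g hg
    simp only [Finset.univ_unique, Finset.sum_singleton]
    have e2 : weightedNorm (fun _ : Unit => (1 : ℝ)) 1 c = ‖c default‖ := by simp [weightedNorm]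
    have hV : AEStronglyMeasurable (fun ξ => freqPow (σ * (y * Complex.I) + σ) ξ *
        (c default * duhamelProfile S t h ξ)) (volume.restrict (band n)) :=
      ((measurable_freqPow _).stronglyMeasurable.mul (stronglyMeasurable_const.mul
        (stronglyMeasurable_duhamelProfile S t hh.1))).aestronglyMeasurable
    refine (enorm_bandPairing_le_two hV hg).trans ?_
    rw [e2, ENNReal.ofReal_ofNat]
    gcongr
    calc eLpNorm (fun ξ => freqPow (σ * (y * Complex.I) + σ) ξ *
          (c default * duhamelProfile S t h ξ)) 2 (volume.restrict (band n))
        = eLpNorm (c default • fun ξ => freqPow σ ξ * duhamelProfile S t h ξ) 2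
            (volume.restrict (band n)) := by
          refine eLpNorm_congr_norm_ae ((ae_restrict_iff' (measurableSet_band n)).2
            (Filter.Eventually.of_forall fun ξ hξ => ?_))
          have h0 := abs_pos_of_mem_band hξ
          rw [Pi.smul_apply, smul_eq_mul, norm_mul, norm_mul, norm_mul, norm_mul, norm_freqPow h0,
            norm_freqPow h0]
          simp
          ring
      _ = ‖c default‖ₑ * eLpNorm (fun ξ => freqPow σ ξ * duhamelProfile S t h ξ) 2
            (volume.restrict (band n)) := eLpNorm_const_smul _ _ _ _
      _ ≤ ‖c default‖ₑ * ENNReal.ofReal ((54 * D.toReal) ^ (1 / 2 : ℝ)) := by gcongr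
      _ = _ := by
          rw [mul_comm ((54 * D.toReal) ^ (1 / 2 : ℝ)), ENNReal.ofReal_mul (norm_nonneg _), ofReal_norm]
  · intro y c g hg
    simp only [Finset.univ_unique, Finset.sum_singleton]
    have e2 : weightedNorm (fun _ : Unit => (1 : ℝ)) 1 c = ‖c default‖ := by simp [weightedNorm]
    have e3 : bandPairing n (fun ξ => freqPow (σ * (1 + y * Complex.I) + σ) ξ *
        (c default * duhamelProfile S t h ξ)) g =
        c default * ∫ s in S, bandForm n (σ * (1 + y * Complex.I) + σ) (t - s) (h s) g := by
      rw [← bandPairing_duhamelProfile hh t _ hg.integrable]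
      unfold bandPairing
      rw [← integral_const_mul]
      congr 1
      ext ξ
      ring
    rw [e3, e2, enorm_mul]
    have e4 : (σ : ℂ) * (1 + y * Complex.I) + σ = α * θ + ((σ * y : ℝ) : ℂ) * Complex.I := by
      rw [hσ]
      push_cast
      ring
    rw [e4]
    have hG : eLpNorm g (ENNReal.ofReal (2 / (1 + θ))) volume ≠ ∞ := by
      refine (hg _ ?_).2.ne
      have : 1 ≤ 2 / (1 + θ) := by
        rw [le_div_iff₀ (by linarith)]
        linarith [hθ.2]
      simpa using ENNReal.ofReal_le_ofReal this
    have e5 : ‖∫ s in S, bandForm n (α * θ + ((σ * y : ℝ) : ℂ) * Complex.I) (t - s) (h s) g‖ₑ ≤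
        ENNReal.ofReal (54 * (1 + |y|)) * M * eLpNorm g (ENNReal.ofReal (2 / (1 + θ))) volume := by
      refine (enorm_integral_le_lintegral_enorm _).trans ?_
      rw [hMdef, rieszPotential, ← lintegral_const_mul' _ _ ENNReal.ofReal_ne_top,
        ← lintegral_mul_const' _ _ hG]
      refine lintegral_mono_ae ?_
      filter_upwards [ae_sub_ne_zero S t] with s hs
      refine (enorm_bandForm_le n hα hθ (σ * y) hs (hh.nice s) hg).trans ?_
      rw [← hf, hexp, ENNReal.ofReal_mul (by positivity), rieszKernel, ← mul_assoc, mul_assoc (ENNReal.ofReal _)]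
      have habs : |σ * y| ≤ |y| := by
        rw [abs_mul, abs_of_nonneg hσ0]
        exact mul_le_of_le_one_left (abs_nonneg _) hσ1
      have hle54 : ENNReal.ofReal (54 * (1 + |σ * y|)) ≤ ENNReal.ofReal (54 * (1 + |y|)) :=
        ENNReal.ofReal_le_ofReal (by linarith)
      gcongr
    calc _ ≤ ‖c default‖ₑ * (ENNReal.ofReal (54 * (1 + |y|)) * M *
          eLpNorm g (ENNReal.ofReal (2 / (1 + θ))) volume) := by gcongr
      _ = _ := by
          rw [show 54 * M.toReal * (1 + |y|) * ‖c default‖ = ‖c default‖ * (54 * (1 + |y|) * M.toReal) by ring,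
            ENNReal.ofReal_mul (norm_nonneg _), ENNReal.ofReal_mul (q := M.toReal) (by positivity),
            ENNReal.ofReal_toReal hM, ofReal_norm]
          ring

end Duhamel

/-! ### Riesz potentials and their energy -/

section Riesz

theorem rieszKernel_sub_comm (γ s t : ℝ) : rieszKernel γ (s - t) = rieszKernel γ (t - s) := by
  rw [← rieszKernel_neg, neg_sub]

theorem measurable_rieszKernel_sub (γ : ℝ) : Measurable fun p : ℝ × ℝ => rieszKernel γ (p.1 - p.2) :=
  (measurable_rieszKernel γ).comp (by fun_prop)

theorem setLIntegral_rpow_Ioc {γ m : ℝ} (hγ : γ < 1) (hm : 0 ≤ m) :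
    ∫⁻ x in Ioc 0 m, ENNReal.ofReal (x ^ (-γ)) = ENNReal.ofReal (m ^ (1 - γ) / (1 - γ)) := by
  have hint := intervalIntegral.intervalIntegrable_rpow' (a := 0) (b := m) (r := -γ) (by linarith)
  rw [intervalIntegrable_iff_integrableOn_Ioc_of_le hm] at hint
  rw [← ofReal_integral_eq_lintegral_ofReal hint, ← intervalIntegral.integral_of_le hm,
    integral_rpow (Or.inl (by linarith)), Real.zero_rpow (by linarith), sub_zero]
  · congr 2 <;> ring_nf
  · refine (ae_restrict_iff' measurableSet_Ioc).2 (Filter.Eventually.of_forall fun x hx => ?_)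
    exact Real.rpow_nonneg hx.1.le _

theorem lintegral_rieszKernel_Ioo_le {γ m : ℝ} (hγ : γ < 1) (hm : 0 ≤ m) :
    ∫⁻ x in Ioo (-m) m, rieszKernel γ x ≤ 2 * ENNReal.ofReal (m ^ (1 - γ) / (1 - γ)) := by
  have h1 : ∫⁻ x in Ioc 0 m, rieszKernel γ x = ENNReal.ofReal (m ^ (1 - γ) / (1 - γ)) := by
    rw [← setLIntegral_rpow_Ioc hγ hm]
    refine setLIntegral_congr_fun measurableSet_Ioc fun x hx => ?_
    simp only [rieszKernel]
    rw [abs_of_pos hx.1]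
  have h2 : ∫⁻ x in Ico (-m) 0, rieszKernel γ x = ∫⁻ x in Ioc 0 m, rieszKernel γ x := by
    rw [← lintegral_indicator measurableSet_Ico, ← lintegral_indicator measurableSet_Ioc,
      ← lintegral_neg_eq_self]
    refine lintegral_congr fun x => ?_
    by_cases hx : x ∈ Ioc 0 m
    · have hx' : -x ∈ Ico (-m) 0 := ⟨by linarith [hx.2], by linarith [hx.1]⟩
      rw [indicator_of_mem hx, indicator_of_mem hx', rieszKernel_neg]
    · have hx' : -x ∉ Ico (-m) 0 := fun h => hx ⟨by linarith [h.2], by linarith [h.1]⟩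
      rw [indicator_of_notMem hx, indicator_of_notMem hx']
  have hsub : Ioo (-m) m ⊆ (Ico (-m) 0 ∪ Ioc 0 m) ∪ {0} := by
    intro x hx
    rcases lt_trichotomy x 0 with h | h | h
    · exact Or.inl (Or.inl ⟨hx.1.le, h⟩)
    · exact Or.inr h
    · exact Or.inl (Or.inr ⟨h, hx.2.le⟩)
  refine (lintegral_mono_set hsub).trans ((lintegral_union_le _ _ _).trans ?_)
  have h3 : ∫⁻ x in ({0} : Set ℝ), rieszKernel γ x = 0 := by
    rw [Measure.restrict_singleton]
    simp
  rw [h3, add_zero]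
  refine (lintegral_union_le _ _ _).trans ?_
  rw [h2, h1, two_mul]

/-- The restricted weak type bound for the Riesz potential. -/
theorem setLIntegral_rieszKernel_le {γ : ℝ} (hγ0 : 0 < γ) (hγ1 : γ < 1) {E : Set ℝ} (t : ℝ) :
    ∫⁻ s in E, rieszKernel γ (t - s) ≤ ENNReal.ofReal (1 + 2 / (1 - γ)) * volume E ^ (1 - γ) := by
  have h1γ : 0 < 1 - γ := by linarith
  by_cases htop : volume E = ∞
  · rw [htop, ENNReal.top_rpow_of_pos h1γ, ENNReal.mul_top]
    · exact le_top
    · simp only [ne_eq, ENNReal.ofReal_eq_zero, not_le]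
      positivity
  by_cases hzero : volume E = 0
  · rw [setLIntegral_measure_zero _ _ hzero]
    exact zero_le
  set m := (volume E).toReal with hm
  have hm0 : 0 < m := ENNReal.toReal_pos hzero htop
  have hE : volume E = ENNReal.ofReal m := (ENNReal.ofReal_toReal htop).symm
  -- The splitting radius is the measure `m` of `E`. Nearby, the kernel is integrated over the whole
  -- interval; far away it is at most `m ^ (-γ)` on a set of measure at most `m`. Both parts are
  -- multiples of `m ^ (1 - γ)`.
  have hsub : E ⊆ Ioo (t - m) (t + m) ∪ (E ∩ {s | m ≤ |t - s|}) := by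
    intro s hs
    by_cases h : m ≤ |t - s|
    · exact Or.inr ⟨hs, h⟩
    · left
      rw [not_le, abs_lt] at h
      constructor <;> linarith [h.1, h.2]
  have h1 : ∫⁻ s in Ioo (t - m) (t + m), rieszKernel γ (t - s) =
      ∫⁻ x in Ioo (-m) m, rieszKernel γ x := by
    rw [← lintegral_indicator measurableSet_Ioo, ← lintegral_indicator measurableSet_Ioo,
      ← lintegral_sub_left_eq_self _ t]
    refine lintegral_congr fun s => ?_
    by_cases hs : s ∈ Ioo (-m) m
    · have hs' : t - s ∈ Ioo (t - m) (t + m) := ⟨by linarith [hs.2], by linarith [hs.1]⟩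
      rw [indicator_of_mem hs, indicator_of_mem hs', sub_sub_cancel]
    · have hs' : t - s ∉ Ioo (t - m) (t + m) := fun h => hs ⟨by linarith [h.2], by linarith [h.1]⟩
      rw [indicator_of_notMem hs, indicator_of_notMem hs']
  have h2 : ∫⁻ s in E ∩ {s | m ≤ |t - s|}, rieszKernel γ (t - s) ≤ ENNReal.ofReal (m ^ (1 - γ)) := by
    calc ∫⁻ s in E ∩ {s | m ≤ |t - s|}, rieszKernel γ (t - s)
        ≤ ∫⁻ _ in E ∩ {s | m ≤ |t - s|}, ENNReal.ofReal (m ^ (-γ)) := by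
          refine setLIntegral_mono measurable_const fun s hs => ?_
          apply ENNReal.ofReal_le_ofReal
          exact Real.rpow_le_rpow_of_nonpos hm0 hs.2 (by linarith)
      _ ≤ ENNReal.ofReal (m ^ (-γ)) * volume E := by
          rw [setLIntegral_const]
          gcongr
          exact inter_subset_left
      _ = _ := by
          rw [hE, ← ENNReal.ofReal_mul (by positivity), ← Real.rpow_add_one hm0.ne']
          congr 2
          ring
  calc ∫⁻ s in E, rieszKernel γ (t - s)
      ≤ ∫⁻ s in Ioo (t - m) (t + m) ∪ (E ∩ {s | m ≤ |t - s|}), rieszKernel γ (t - s) :=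
        lintegral_mono_set hsub
    _ ≤ 2 * ENNReal.ofReal (m ^ (1 - γ) / (1 - γ)) + ENNReal.ofReal (m ^ (1 - γ)) := by
        refine (lintegral_union_le _ _ _).trans (add_le_add ?_ h2)
        rw [h1]
        exact lintegral_rieszKernel_Ioo_le hγ1 hm0.le
    _ = _ := by
        rw [hE, ENNReal.ofReal_rpow_of_pos hm0, ← ENNReal.ofReal_mul (by positivity),
          ← ENNReal.ofReal_ofNat 2, ← ENNReal.ofReal_mul (by norm_num), ← ENNReal.ofReal_add (by positivity)
          (by positivity)]
        congr 1
        field_simp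
        ring

theorem measurable_rieszPotential {γ : ℝ} {S : Set ℝ} {f : ℝ → ℝ≥0∞} (hf : Measurable f) :
    Measurable (rieszPotential γ S f) := by
  unfold rieszPotential
  have h : Measurable fun p : ℝ × ℝ => rieszKernel γ (p.1 - p.2) * f p.2 :=
    (measurable_rieszKernel_sub γ).mul (hf.comp measurable_snd)
  exact h.lintegral_prod_right'

theorem rieszEnergy_eq {γ : ℝ} {S : Set ℝ} {f : ℝ → ℝ≥0∞} (hf : Measurable f) :
    rieszEnergy γ S f = ∫⁻ t in S, rieszPotential γ S f t * f t := by
  unfold rieszEnergy rieszPotential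
  refine lintegral_congr fun t => ?_
  rw [← lintegral_mul_const _ ?_]
  · simp_rw [mul_assoc]
  · exact ((measurable_rieszKernel γ).comp (by fun_prop)).mul hf

/-- The Riesz potential is symmetric. -/
theorem lintegral_rieszPotential_mul {γ : ℝ} {f g : ℝ → ℝ≥0∞} (hf : Measurable f) (hg : Measurable g) :
    ∫⁻ t, rieszPotential γ univ f t * g t = ∫⁻ t, f t * rieszPotential γ univ g t := by
  have h1 : ∀ t, rieszPotential γ univ f t * g t = ∫⁻ s, rieszKernel γ (t - s) * f s * g t := fun t => by
    rw [rieszPotential, Measure.restrict_univ, lintegral_mul_const]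
    exact ((measurable_rieszKernel γ).comp (by fun_prop)).mul hf
  have h2 : ∀ t, f t * rieszPotential γ univ g t = ∫⁻ s, rieszKernel γ (s - t) * f t * g s := fun t => by
    rw [rieszPotential, Measure.restrict_univ, ← lintegral_const_mul]
    · refine lintegral_congr fun s => ?_
      rw [rieszKernel_sub_comm]
      ring
    · exact ((measurable_rieszKernel γ).comp (by fun_prop)).mul hg
  simp_rw [h1, h2]
  rw [lintegral_lintegral_swap]
  exact (((measurable_rieszKernel_sub γ).mul (hf.comp measurable_snd)).mul
    (hg.comp measurable_fst)).aemeasurable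

/-- The constant in the semigroup property of the Riesz kernels. -/
noncomputable def rieszConst (a : ℝ) : ℝ≥0∞ := ∫⁻ r, rieszKernel a r * rieszKernel a (1 - r)

theorem rieszConst_ne_zero (a : ℝ) : rieszConst a ≠ 0 := by
  unfold rieszConst
  rw [ne_eq, lintegral_eq_zero_iff]
  · intro h
    have h2 : ∀ᵐ r : ℝ, False := by
      filter_upwards [h, Measure.ae_ne volume (0 : ℝ), Measure.ae_ne volume (1 : ℝ)] with r hr h0 h1
      have e0 : 0 < |r| := abs_pos.2 h0
      have e1 : 0 < |1 - r| := abs_pos.2 (sub_ne_zero.2 (Ne.symm h1))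
      simp only [rieszKernel, Pi.zero_apply, mul_eq_zero, ENNReal.ofReal_eq_zero, not_le.2
        (Real.rpow_pos_of_pos e0 _), not_le.2 (Real.rpow_pos_of_pos e1 _), or_self] at hr
    exact h2.exists.elim fun _ h => h
  · exact (measurable_rieszKernel a).mul ((measurable_rieszKernel a).comp (by fun_prop))

/-- The singularities at `0` and `1` are integrable because `a < 1`; at infinity the product decays
like `|r| ^ (-2 a)`, which is integrable because `a > 1 / 2`. -/
theorem rieszConst_lt_top {a : ℝ} (ha0 : 1 / 2 < a) (ha1 : a < 1) : rieszConst a < ∞ := by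
  have hkm : Measurable fun r : ℝ => rieszKernel a (1 - r) := (measurable_rieszKernel a).comp (by fun_prop)
  have hnear : ∀ r : ℝ, rieszKernel a r * rieszKernel a (1 - r) ≤
      ENNReal.ofReal (2 ^ a) * (rieszKernel a (0 - r) + rieszKernel a (1 - r)) := by
    intro r
    have hhalf : ∀ x : ℝ, 1 / 2 ≤ |x| → rieszKernel a x ≤ ENNReal.ofReal (2 ^ a) := fun x hx => by
      apply ENNReal.ofReal_le_ofReal
      calc |x| ^ (-a) ≤ (1 / 2) ^ (-a) := Real.rpow_le_rpow_of_nonpos (by norm_num) hx (by linarith)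
        _ = 2 ^ a := by rw [one_div, Real.inv_rpow (by norm_num), Real.rpow_neg (by norm_num), inv_inv]
    rw [zero_sub, rieszKernel_neg, mul_add]
    rcases le_total (1 / 2) |r| with h | h
    · calc _ ≤ ENNReal.ofReal (2 ^ a) * rieszKernel a (1 - r) := by gcongr; exact hhalf r h
        _ ≤ _ := le_add_self
    · have h' : 1 / 2 ≤ |1 - r| := by
        have := abs_le.1 h
        rw [abs_of_pos (by linarith [this.2])]
        linarith [this.2]
      calc _ ≤ rieszKernel a r * ENNReal.ofReal (2 ^ a) := by gcongr; exact hhalf _ h'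
        _ = ENNReal.ofReal (2 ^ a) * rieszKernel a r := mul_comm _ _
        _ ≤ _ := le_self_add
  have hfar : ∀ r : ℝ, 2 < |r| → rieszKernel a r * rieszKernel a (1 - r) ≤
      ENNReal.ofReal (2 ^ a * |r| ^ (-(2 * a))) := by
    intro r hr
    have h1 : |r| / 2 ≤ |1 - r| := by
      have := abs_sub_abs_le_abs_sub r 1
      rw [abs_one, abs_sub_comm r 1] at this
      linarith
    have hr0 : 0 < |r| := by linarith
    rw [rieszKernel, rieszKernel, ← ENNReal.ofReal_mul (by positivity)]
    apply ENNReal.ofReal_le_ofReal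
    calc |r| ^ (-a) * |1 - r| ^ (-a) ≤ |r| ^ (-a) * (|r| / 2) ^ (-a) := by
          gcongr ?_ * ?_
          exact Real.rpow_le_rpow_of_nonpos (by positivity) h1 (by linarith)
      _ = 2 ^ a * |r| ^ (-(2 * a)) := by
          rw [Real.div_rpow hr0.le (by norm_num), Real.rpow_neg (by norm_num : (0 : ℝ) ≤ 2), div_inv_eq_mul,
            ← mul_assoc, ← Real.rpow_add hr0]
          ring_nf
  have hsplit : rieszConst a ≤ (∫⁻ r in Icc (-2) 2, rieszKernel a r * rieszKernel a (1 - r)) +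
      ∫⁻ r in (Icc (-2) 2)ᶜ, rieszKernel a r * rieszKernel a (1 - r) := by
    rw [rieszConst, lintegral_add_compl _ measurableSet_Icc]
  refine hsplit.trans_lt (ENNReal.add_lt_top.2 ⟨?_, ?_⟩)
  · calc _ ≤ ∫⁻ r in Icc (-2) 2, ENNReal.ofReal (2 ^ a) * (rieszKernel a (0 - r) + rieszKernel a (1 - r)) :=
          lintegral_mono fun r => hnear r
      _ = ENNReal.ofReal (2 ^ a) * ((∫⁻ r in Icc (-2) 2, rieszKernel a (0 - r)) +
          ∫⁻ r in Icc (-2) 2, rieszKernel a (1 - r)) := by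
          rw [lintegral_const_mul' _ _ ENNReal.ofReal_ne_top, lintegral_add_right _ hkm]
      _ < ∞ := by
          have hb : ∀ t : ℝ, ∫⁻ r in Icc (-2) 2, rieszKernel a (t - r) < ∞ := fun t => by
            refine (setLIntegral_rieszKernel_le (by linarith) ha1 t).trans_lt ?_
            refine ENNReal.mul_lt_top ENNReal.ofReal_lt_top (ENNReal.rpow_lt_top_of_nonneg (by linarith) ?_)
            simp
          exact ENNReal.mul_lt_top ENNReal.ofReal_lt_top (ENNReal.add_lt_top.2 ⟨hb 0, hb 1⟩)
  · have hint : ∫⁻ r in Ioi (2 : ℝ), ENNReal.ofReal (2 ^ a * |r| ^ (-(2 * a))) < ∞ := by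
      have h1 := (integrableOn_Ioi_rpow_of_lt (a := -(2 * a)) (by linarith) (c := 2) (by norm_num)).const_mul (2 ^ a)
      have h2 : IntegrableOn (fun r : ℝ => 2 ^ a * |r| ^ (-(2 * a))) (Ioi 2) := by
        refine h1.congr ((ae_restrict_iff' measurableSet_Ioi).2 (Filter.Eventually.of_forall fun r hr => ?_))
        have : (0 : ℝ) < r := lt_trans (by norm_num) hr
        simp only
        rw [abs_of_pos this]
      exact (hasFiniteIntegral_iff_ofReal (Filter.Eventually.of_forall fun r => by positivity)).1 h2.2
    have hint' : ∫⁻ r in Iio (-2 : ℝ), ENNReal.ofReal (2 ^ a * |r| ^ (-(2 * a))) =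
        ∫⁻ r in Ioi (2 : ℝ), ENNReal.ofReal (2 ^ a * |r| ^ (-(2 * a))) := by
      rw [← lintegral_indicator measurableSet_Iio, ← lintegral_indicator measurableSet_Ioi,
        ← lintegral_neg_eq_self]
      refine lintegral_congr fun x => ?_
      by_cases hx : x ∈ Ioi (2 : ℝ)
      · have hx' : -x ∈ Iio (-2 : ℝ) := neg_lt_neg (mem_Ioi.1 hx)
        rw [indicator_of_mem hx, indicator_of_mem hx', abs_neg]
      · have hx' : -x ∉ Iio (-2 : ℝ) := fun h => hx (neg_lt_neg_iff.1 (mem_Iio.1 h))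
        rw [indicator_of_notMem hx, indicator_of_notMem hx']
    have hset : (Icc (-2 : ℝ) 2)ᶜ ⊆ Iio (-2) ∪ Ioi 2 := by
      intro r hr
      by_contra h
      rw [mem_union, not_or, mem_Iio, mem_Ioi, not_lt, not_lt] at h
      exact hr ⟨h.1, h.2⟩
    calc _ ≤ ∫⁻ r in Iio (-2) ∪ Ioi 2, rieszKernel a r * rieszKernel a (1 - r) := lintegral_mono_set hset
      _ ≤ ∫⁻ r in Iio (-2) ∪ Ioi 2, ENNReal.ofReal (2 ^ a * |r| ^ (-(2 * a))) := by
          refine setLIntegral_mono' (measurableSet_Iio.union measurableSet_Ioi) fun r hr => hfar r ?_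
          rcases hr with h | h
          · rw [mem_Iio] at h
            rw [abs_of_neg (by linarith)]
            linarith
          · exact lt_of_lt_of_le h (le_abs_self r)
      _ ≤ _ := lintegral_union_le _ _ _
      _ < ∞ := by
          rw [hint']
          exact ENNReal.add_lt_top.2 ⟨hint, hint⟩

/-- The semigroup property of the Riesz kernels. -/
theorem lintegral_rieszKernel_mul {γ τ : ℝ} (hγ : γ ≠ 0) (hτ : τ ≠ 0) :
    ∫⁻ r, rieszKernel ((1 + γ) / 2) r * rieszKernel ((1 + γ) / 2) (τ - r) =
      rieszConst ((1 + γ) / 2) * rieszKernel γ τ := by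
  set a := (1 + γ) / 2 with ha
  have hτ0 : 0 < |τ| := abs_pos.2 hτ
  have hF : Measurable fun r => rieszKernel a r * rieszKernel a (τ - r) :=
    (measurable_rieszKernel a).mul ((measurable_rieszKernel a).comp (by fun_prop))
  have hscale : ∀ x, rieszKernel a (τ * x) = ENNReal.ofReal (|τ| ^ (-a)) * rieszKernel a x := fun x => by
    rw [rieszKernel, rieszKernel, ← ENNReal.ofReal_mul (by positivity), abs_mul,
      Real.mul_rpow (abs_nonneg _) (abs_nonneg _)]
  -- The scaling `r = τ x` reduces the convolution to its value at `1`; it produces `|τ| ^ (1 - 2 a)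
  -- = |τ| ^ (-γ)`.
  have h1 : ∫⁻ r, rieszKernel a r * rieszKernel a (τ - r) ∂(Measure.map (τ * ·) volume) =
      ∫⁻ x, ENNReal.ofReal (|τ| ^ (-(2 * a))) * (rieszKernel a x * rieszKernel a (1 - x)) := by
    rw [lintegral_map hF (by fun_prop)]
    refine lintegral_congr fun x => ?_
    rw [show τ - τ * x = τ * (1 - x) by ring, hscale, hscale,
      show -(2 * a) = -a + -a by ring, Real.rpow_add hτ0, ENNReal.ofReal_mul (by positivity)]
    ring
  rw [Real.map_volume_mul_left hτ, lintegral_smul_measure, lintegral_const_mul' _ _ ENNReal.ofReal_ne_top] at h1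
  have h2 : ENNReal.ofReal |τ| * ENNReal.ofReal |τ⁻¹| = 1 := by
    rw [← ENNReal.ofReal_mul (abs_nonneg _), abs_inv, mul_inv_cancel₀ hτ0.ne', ENNReal.ofReal_one]
  calc ∫⁻ r, rieszKernel a r * rieszKernel a (τ - r)
      = ENNReal.ofReal |τ| * (ENNReal.ofReal |τ⁻¹| • ∫⁻ r, rieszKernel a r * rieszKernel a (τ - r)) := by
        rw [smul_eq_mul, ← mul_assoc, h2, one_mul]
    _ = ENNReal.ofReal |τ| * (ENNReal.ofReal (|τ| ^ (-(2 * a))) * rieszConst a) := by rw [h1]; rfl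
    _ = (ENNReal.ofReal |τ| * ENNReal.ofReal (|τ| ^ (-(2 * a)))) * rieszConst a := by ring
    _ = rieszConst a * rieszKernel γ τ := by
        rw [← ENNReal.ofReal_mul (abs_nonneg _), ← Real.rpow_one_add' (abs_nonneg _), rieszKernel, mul_comm]
        · congr 3
          rw [ha]
          ring
        · rw [ha]
          intro h
          exact hγ (by linarith)

/-- By symmetry one potential of order `(1 + γ) / 2` moves to the other factor, and the semigroup
property composes the two kernels into a multiple of the kernel `γ`. This exhibits the energy, up to
a constant, as the square of an `L²` norm. -/
theorem lintegral_rieszPotential_mul_eq {γ : ℝ} (hγ : γ ≠ 0) {f g : ℝ → ℝ≥0∞} (hf : Measurable f) (hg : Measurable g) :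
    ∫⁻ r, rieszPotential ((1 + γ) / 2) univ f r * rieszPotential ((1 + γ) / 2) univ g r =
      rieszConst ((1 + γ) / 2) * ∫⁻ t, rieszPotential γ univ f t * g t := by
  set a := (1 + γ) / 2 with ha
  have hk : ∀ γ t, Measurable fun s : ℝ => rieszKernel γ (t - s) := fun γ t =>
    (measurable_rieszKernel γ).comp (by fun_prop)
  have hm : ∀ γ t {f : ℝ → ℝ≥0∞}, Measurable f → Measurable fun s : ℝ => rieszKernel γ (t - s) * f s :=
    fun γ t _ hf => (hk γ t).mul hf
  have h1 : ∀ t, ∫⁻ r, rieszPotential a univ f r * rieszKernel a (t - r) =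
      rieszConst a * rieszPotential γ univ f t := by
    intro t
    have e1 : ∫⁻ r, rieszPotential a univ f r * rieszKernel a (t - r) =
        ∫⁻ s, f s * rieszPotential a univ (fun r => rieszKernel a (t - r)) s :=
      lintegral_rieszPotential_mul hf (hk a t)
    rw [e1, rieszPotential, Measure.restrict_univ, ← lintegral_const_mul _ (hm γ t hf)]
    refine lintegral_congr_ae ?_
    filter_upwards [Measure.ae_ne volume t] with s hs
    have hts : t - s ≠ 0 := sub_ne_zero.2 (Ne.symm hs)
    have e2 : rieszPotential a univ (fun r => rieszKernel a (t - r)) s =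
        ∫⁻ r, rieszKernel a r * rieszKernel a ((t - s) - r) := by
      rw [rieszPotential, Measure.restrict_univ, ← lintegral_add_left_eq_self _ s]
      refine lintegral_congr fun r => ?_
      rw [show s - (s + r) = -r by ring, rieszKernel_neg, show t - (s + r) = t - s - r by ring]
    rw [e2, lintegral_rieszKernel_mul hγ hts]
    ring
  have h2 : ∫⁻ r, rieszPotential a univ f r * rieszPotential a univ g r =
      ∫⁻ r, ∫⁻ t, rieszPotential a univ f r * (rieszKernel a (r - t) * g t) := by
    refine lintegral_congr fun r => ?_
    rw [lintegral_const_mul _ (hm a r hg)]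
    rw [rieszPotential, rieszPotential, Measure.restrict_univ]
  have hp : Measurable fun t => rieszPotential γ univ f t * g t := (measurable_rieszPotential hf).mul hg
  rw [h2, lintegral_lintegral_swap, ← lintegral_const_mul _ hp]
  · refine lintegral_congr fun t => ?_
    have hp : Measurable fun r => rieszPotential a univ f r * rieszKernel a (t - r) :=
      (measurable_rieszPotential hf).mul (hk a t)
    rw [← mul_assoc, ← h1 t, ← lintegral_mul_const _ hp]
    refine lintegral_congr fun r => ?_
    rw [rieszKernel_sub_comm]
    ring
  · exact (((measurable_rieszPotential hf).comp measurable_fst).mul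
      ((measurable_rieszKernel_sub a).mul (hg.comp measurable_snd))).aemeasurable

/-- The Cauchy-Schwarz inequality for the Riesz energy. -/
theorem lintegral_rieszPotential_mul_le {γ : ℝ} (hγ0 : 0 < γ) (hγ1 : γ < 1) {f g : ℝ → ℝ≥0∞}
    (hf : Measurable f) (hg : Measurable g) :
    ∫⁻ t, rieszPotential γ univ f t * g t ≤
      rieszEnergy γ univ f ^ (1 / 2 : ℝ) * rieszEnergy γ univ g ^ (1 / 2 : ℝ) := by
  set a := (1 + γ) / 2 with ha
  have hc0 : rieszConst a ≠ 0 := rieszConst_ne_zero a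
  have hct : rieszConst a ≠ ∞ := (rieszConst_lt_top (by rw [ha]; linarith) (by rw [ha]; linarith)).ne
  -- Positivity of the energy in concrete form: the half-order potential is its square root. The
  -- constant `rieszConst a` appears on both sides of the Cauchy–Schwarz inequality and cancels,
  -- being nonzero and finite.
  have hsq : ∀ {f : ℝ → ℝ≥0∞}, Measurable f →
      ∫⁻ r, rieszPotential a univ f r ^ (2 : ℝ) = rieszConst a * rieszEnergy γ univ f := by
    intro f hf
    rw [rieszEnergy_eq hf, Measure.restrict_univ, ← lintegral_rieszPotential_mul_eq hγ0.ne' hf hf]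
    refine lintegral_congr fun r => ?_
    rw [← sq, ← ENNReal.rpow_natCast, Nat.cast_ofNat]
  have h1 := ENNReal.lintegral_mul_le_Lp_mul_Lq volume (p := 2) (q := 2) Real.HolderConjugate.two_two
    (measurable_rieszPotential (γ := a) (S := univ) hf).aemeasurable
    (measurable_rieszPotential (γ := a) (S := univ) hg).aemeasurable
  simp only [Pi.mul_apply] at h1
  rw [lintegral_rieszPotential_mul_eq hγ0.ne' hf hg, hsq hf, hsq hg, ENNReal.mul_rpow_of_nonneg _ _ (by norm_num),
    ENNReal.mul_rpow_of_nonneg _ _ (by norm_num)] at h1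
  have h2 : rieszConst a ^ (1 / 2 : ℝ) * rieszConst a ^ (1 / 2 : ℝ) = rieszConst a := by
    rw [← ENNReal.rpow_add_of_nonneg _ _ (by norm_num) (by norm_num)]
    norm_num
  have h3 : rieszConst a ^ (1 / 2 : ℝ) * rieszEnergy γ univ f ^ (1 / 2 : ℝ) *
      (rieszConst a ^ (1 / 2 : ℝ) * rieszEnergy γ univ g ^ (1 / 2 : ℝ)) =
      rieszConst a * (rieszEnergy γ univ f ^ (1 / 2 : ℝ) * rieszEnergy γ univ g ^ (1 / 2 : ℝ)) := by
    calc _ = (rieszConst a ^ (1 / 2 : ℝ) * rieszConst a ^ (1 / 2 : ℝ)) *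
          (rieszEnergy γ univ f ^ (1 / 2 : ℝ) * rieszEnergy γ univ g ^ (1 / 2 : ℝ)) := by ring
      _ = _ := by rw [h2]
  rw [← ha, h3] at h1
  exact (ENNReal.mul_le_mul_iff_right hc0 hct).1 h1

end Riesz

/-! ### Superlevel sets and the energy of layered functions -/

section Lorentz

/-- The distribution function of `b`. -/
noncomputable def levelVol (b : ℝ → ℝ≥0∞) (y : ℝ) : ℝ≥0∞ := volume {t | ENNReal.ofReal y < b t}

/-- The square of the `L^{2/e, 2}` quasinorm, up to a constant factor. -/
noncomputable def lorentzSq (e : ℝ) (b : ℝ → ℝ≥0∞) : ℝ≥0∞ :=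
  ∫⁻ y in Ioi (0 : ℝ), ENNReal.ofReal y * levelVol b y ^ e

/-- The superposition of the superlevel sets of `b` with the weight `w`. -/
noncomputable def layered (w : ℝ → ℝ≥0∞) (b : ℝ → ℝ≥0∞) (t : ℝ) : ℝ≥0∞ :=
  ∫⁻ y in Ioi (0 : ℝ), if ENNReal.ofReal y < b t then w y else 0

theorem levelVol_antitone (b : ℝ → ℝ≥0∞) : Antitone (levelVol b) := fun _ _ h =>
  measure_mono fun _ ht => lt_of_le_of_lt (ENNReal.ofReal_le_ofReal h) ht

theorem measurable_levelVol (b : ℝ → ℝ≥0∞) : Measurable (levelVol b) := (levelVol_antitone b).measurable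

theorem measurable_layer {w : ℝ → ℝ≥0∞} {b : ℝ → ℝ≥0∞} (hw : Measurable w) (hb : Measurable b) :
    Measurable fun p : ℝ × ℝ => if ENNReal.ofReal p.1 < b p.2 then w p.1 else 0 :=
  Measurable.ite (measurableSet_lt (by fun_prop) (hb.comp measurable_snd))
    (hw.comp measurable_fst) measurable_const

theorem measurable_layered {w : ℝ → ℝ≥0∞} {b : ℝ → ℝ≥0∞} (hw : Measurable w) (hb : Measurable b) :
    Measurable (layered w b) :=
  ((measurable_layer hw hb).comp measurable_swap).lintegral_prod_right'

theorem lintegral_layer {w : ℝ → ℝ≥0∞} {b : ℝ → ℝ≥0∞} (hb : Measurable b) (y : ℝ) :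
    ∫⁻ t, (if ENNReal.ofReal y < b t then w y else 0) = w y * levelVol b y := by
  have hm : MeasurableSet {t | ENNReal.ofReal y < b t} := measurableSet_lt measurable_const hb
  have : (fun t => if ENNReal.ofReal y < b t then w y else 0) =
      {t | ENNReal.ofReal y < b t}.indicator fun _ => w y := by
    ext t
    simp [indicator]
  rw [this, lintegral_indicator_const hm, levelVol]

/-- The layer cake formula, valid also where `b` is infinite. -/
theorem layered_one (b : ℝ → ℝ≥0∞) : layered (fun _ => 1) b = b := by
  ext t
  have : (fun y => if ENNReal.ofReal y < b t then (1 : ℝ≥0∞) else 0) =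
      {y | ENNReal.ofReal y < b t}.indicator fun _ => 1 := by
    ext y
    simp [indicator]
  have hm : MeasurableSet {y | ENNReal.ofReal y < b t} := measurableSet_lt (by fun_prop) measurable_const
  rw [layered, this, lintegral_indicator_const hm, one_mul, Measure.restrict_apply hm]
  rcases eq_or_ne (b t) ∞ with h | h
  · rw [h]
    have : {y : ℝ | ENNReal.ofReal y < ∞} ∩ Ioi 0 = Ioi 0 := by ext; simp
    rw [this, Real.volume_Ioi]
  · have : {y | ENNReal.ofReal y < b t} ∩ Ioi 0 = Ioo 0 (b t).toReal := by
      ext y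
      simp only [mem_inter_iff, mem_ofPred_eq, mem_Ioi, mem_Ioo]
      constructor
      · rintro ⟨h1, h2⟩
        exact ⟨h2, (ENNReal.ofReal_lt_iff_lt_toReal h2.le h).1 h1⟩
      · rintro ⟨h1, h2⟩
        exact ⟨(ENNReal.ofReal_lt_iff_lt_toReal h1.le h).2 h2, h1⟩
    rw [this, Real.volume_Ioo, sub_zero, ENNReal.ofReal_toReal h]

/-- Every pair satisfies `y ≤ z` or `z ≤ y`. The two triangles overlap on the diagonal, so only an
inequality is obtained. -/
theorem lintegral_mul_lintegral_le {μ : Measure ℝ} [SFinite μ] {F G : ℝ → ℝ≥0∞} (hF : Measurable F)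
    (hG : Measurable G) :
    (∫⁻ y, F y ∂μ) * (∫⁻ z, G z ∂μ) ≤ (∫⁻ z, G z * ∫⁻ y, (if y ≤ z then F y else 0) ∂μ ∂μ) +
      ∫⁻ y, F y * ∫⁻ z, (if z ≤ y then G z else 0) ∂μ ∂μ := by
  have hite : ∀ {H : ℝ → ℝ≥0∞}, Measurable H →
      Measurable fun p : ℝ × ℝ => if p.2 ≤ p.1 then H p.2 else 0 := fun hH =>
    Measurable.ite (measurableSet_le measurable_snd measurable_fst) (hH.comp measurable_snd) measurable_const
  have h1 : (∫⁻ z, G z * ∫⁻ y, (if y ≤ z then F y else 0) ∂μ ∂μ) =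
      ∫⁻ z, ∫⁻ y, G z * (if y ≤ z then F y else 0) ∂μ ∂μ := by
    refine lintegral_congr fun z => ?_
    rw [lintegral_const_mul]
    exact (hite hF).comp (measurable_const.prodMk measurable_id)
  have h2 : (∫⁻ y, F y * ∫⁻ z, (if z ≤ y then G z else 0) ∂μ ∂μ) =
      ∫⁻ z, ∫⁻ y, F y * (if z ≤ y then G z else 0) ∂μ ∂μ := by
    rw [← lintegral_lintegral_swap]
    · refine lintegral_congr fun z => ?_
      rw [lintegral_const_mul]
      exact (hite hG).comp (measurable_const.prodMk measurable_id)
    · exact ((hF.comp measurable_fst).mul (hite hG)).aemeasurable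
  have hm1 : Measurable fun p : ℝ × ℝ => G p.1 * (if p.2 ≤ p.1 then F p.2 else 0) :=
    (hG.comp measurable_fst).mul (hite hF)
  have hm2 : ∀ z, Measurable fun y : ℝ => G z * (if y ≤ z then F y else 0) := fun z =>
    hm1.comp (measurable_const.prodMk measurable_id)
  rw [h1, h2, mul_comm, ← lintegral_mul_const _ hG, ← lintegral_add_left hm1.lintegral_prod_right']
  refine lintegral_mono fun z => ?_
  rw [← lintegral_const_mul _ hF, ← lintegral_add_left (hm2 z)]
  refine lintegral_mono fun y => ?_
  rcases le_total y z with h | h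
  · simp [h]
  · simp [h, mul_comm]

/-- The kernel is even, so `R` and its transpose contribute equally; this accounts for the factor
`2`. -/
theorem rieszEnergy_le_of_mul_le {γ : ℝ} {a : ℝ → ℝ≥0∞} {R : ℝ → ℝ → ℝ≥0∞}
    (hR : Measurable fun p : ℝ × ℝ => R p.1 p.2) (h : ∀ s t, a s * a t ≤ R s t + R t s) :
    rieszEnergy γ univ a ≤ 2 * ∫⁻ t, ∫⁻ s, rieszKernel γ (t - s) * R s t := by
  have h1 : Measurable fun p : ℝ × ℝ => rieszKernel γ (p.1 - p.2) * R p.2 p.1 :=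
    (measurable_rieszKernel_sub γ).mul (hR.comp measurable_swap)
  have h2 : Measurable fun p : ℝ × ℝ => rieszKernel γ (p.1 - p.2) * R p.1 p.2 :=
    (measurable_rieszKernel_sub γ).mul hR
  have hswap : ∫⁻ t, ∫⁻ s, rieszKernel γ (t - s) * R t s = ∫⁻ t, ∫⁻ s, rieszKernel γ (t - s) * R s t := by
    rw [lintegral_lintegral_swap h2.aemeasurable]
    refine lintegral_congr fun t => lintegral_congr fun s => ?_
    rw [rieszKernel_sub_comm]
  have hadd : ∀ t, ∫⁻ s, (rieszKernel γ (t - s) * R s t + rieszKernel γ (t - s) * R t s) =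
      (∫⁻ s, rieszKernel γ (t - s) * R s t) + ∫⁻ s, rieszKernel γ (t - s) * R t s := fun t =>
    lintegral_add_left (h1.comp (measurable_const.prodMk measurable_id)) _
  calc rieszEnergy γ univ a
      ≤ ∫⁻ t, ∫⁻ s, (rieszKernel γ (t - s) * R s t + rieszKernel γ (t - s) * R t s) := by
        rw [rieszEnergy, Measure.restrict_univ]
        refine lintegral_mono fun t => lintegral_mono fun s => ?_
        rw [← mul_add]
        exact mul_le_mul_right (h s t) _
    _ = (∫⁻ t, ∫⁻ s, rieszKernel γ (t - s) * R s t) + ∫⁻ t, ∫⁻ s, rieszKernel γ (t - s) * R t s := by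
        simp_rw [hadd]
        exact lintegral_add_left h1.lintegral_prod_right' _
    _ = _ := by rw [hswap, two_mul]

/-- Both copies are expanded in superlevel sets, and by symmetry only the pairs of heights `y ≤ z`
matter. For such a pair, the potential of the larger set, that of height `y`, is bounded everywhere
by a multiple of the power `1 - γ` of its measure; integrating over the smaller set gives the factor
`levelVol b z`. -/
theorem rieszEnergy_layered_le {γ : ℝ} (hγ0 : 0 < γ) (hγ1 : γ < 1) {w b : ℝ → ℝ≥0∞} (hw : Measurable w)
    (hb : Measurable b) :
    rieszEnergy γ univ (layered w b) ≤ 2 * ENNReal.ofReal (1 + 2 / (1 - γ)) *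
      ∫⁻ z in Ioi (0 : ℝ), w z * levelVol b z *
        ∫⁻ y in Ioi (0 : ℝ), if y ≤ z then w y * levelVol b y ^ (1 - γ) else 0 := by
  set μ := volume.restrict (Ioi (0 : ℝ)) with hμ
  set C := ENNReal.ofReal (1 + 2 / (1 - γ)) with hC
  set X : ℝ → ℝ → ℝ≥0∞ := fun y t => if ENNReal.ofReal y < b t then w y else 0 with hX
  have hXm : Measurable fun p : ℝ × ℝ => X p.1 p.2 := measurable_layer hw hb
  have hX1 : ∀ t, Measurable fun y => X y t := fun t => hXm.comp (measurable_id.prodMk measurable_const)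
  set Q : ℝ → ℝ → ℝ≥0∞ := fun z s => ∫⁻ y, (if y ≤ z then X y s else 0) ∂μ with hQ
  have hQ3 : Measurable fun p : (ℝ × ℝ) × ℝ => if p.2 ≤ p.1.1 then X p.2 p.1.2 else 0 :=
    Measurable.ite (measurableSet_le measurable_snd (by fun_prop))
      (hXm.comp (measurable_snd.prodMk (by fun_prop))) measurable_const
  have hQm : Measurable fun p : ℝ × ℝ => Q p.1 p.2 := hQ3.lintegral_prod_right'
  have hk : ∀ t, Measurable fun s : ℝ => rieszKernel γ (t - s) := fun t =>
    (measurable_rieszKernel γ).comp (by fun_prop)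
  set R : ℝ → ℝ → ℝ≥0∞ := fun s t => ∫⁻ z, X z t * Q z s ∂μ with hR
  have hRm : Measurable fun p : ℝ × ℝ => R p.1 p.2 := by
    have : Measurable fun p : (ℝ × ℝ) × ℝ => X p.2 p.1.2 * Q p.2 p.1.1 :=
      (hXm.comp (measurable_snd.prodMk (by fun_prop))).mul (hQm.comp (measurable_snd.prodMk (by fun_prop)))
    exact this.lintegral_prod_right'
  -- `R s t` collects the heights `z` at time `t` and the lower heights `y ≤ z` at time `s`; `Q z s`
  -- is the inner integral over `y`.
  have hpt : ∀ s t, layered w b s * layered w b t ≤ R s t + R t s := fun s t =>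
    lintegral_mul_lintegral_le (hX1 s) (hX1 t)
  set D : ℝ → ℝ≥0∞ := fun z => ∫⁻ y, (if y ≤ z then w y * levelVol b y ^ (1 - γ) else 0) ∂μ with hD
  have hDm : Measurable D := by
    have : Measurable fun p : ℝ × ℝ => if p.2 ≤ p.1 then w p.2 * levelVol b p.2 ^ (1 - γ) else 0 :=
      Measurable.ite (measurableSet_le measurable_snd measurable_fst)
        ((hw.comp measurable_snd).mul (((measurable_levelVol b).comp measurable_snd).pow_const _))
        measurable_const
    exact this.lintegral_prod_right'
  have hpot : ∀ t z, ∫⁻ s, rieszKernel γ (t - s) * Q z s ≤ C * D z := by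
    intro t z
    have hm : Measurable fun p : ℝ × ℝ => rieszKernel γ (t - p.1) * (if p.2 ≤ z then X p.2 p.1 else 0) :=
      ((hk t).comp measurable_fst).mul (Measurable.ite (measurableSet_le measurable_snd measurable_const)
        (hXm.comp measurable_swap) measurable_const)
    have e1 : ∫⁻ s, rieszKernel γ (t - s) * Q z s =
        ∫⁻ s, ∫⁻ y, rieszKernel γ (t - s) * (if y ≤ z then X y s else 0) ∂μ := by
      refine lintegral_congr fun s => ?_
      rw [hQ, lintegral_const_mul]
      exact Measurable.ite (measurableSet_le measurable_id measurable_const) (hX1 s) measurable_const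
    rw [e1, lintegral_lintegral_swap hm.aemeasurable, hD, ← lintegral_const_mul' _ _ ENNReal.ofReal_ne_top]
    refine lintegral_mono fun y => ?_
    by_cases hy : y ≤ z
    · simp only [hy, if_true]
      have hset : MeasurableSet {s | ENNReal.ofReal y < b s} := measurableSet_lt measurable_const hb
      calc ∫⁻ s, rieszKernel γ (t - s) * X y s
          = ∫⁻ s, {s | ENNReal.ofReal y < b s}.indicator (fun s => w y * rieszKernel γ (t - s)) s := by
            refine lintegral_congr fun s => ?_
            by_cases hs : ENNReal.ofReal y < b s
            · simp [hX, hs, mul_comm, indicator]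
            · simp [hX, hs, indicator]
        _ = w y * ∫⁻ s in {s | ENNReal.ofReal y < b s}, rieszKernel γ (t - s) := by
            rw [lintegral_indicator hset, lintegral_const_mul _ (hk t)]
        _ ≤ w y * (C * levelVol b y ^ (1 - γ)) := by
            gcongr
            exact setLIntegral_rieszKernel_le hγ0 hγ1 t
        _ = _ := by ring
    · simp [hy]
  have hmain : ∫⁻ t, ∫⁻ s, rieszKernel γ (t - s) * R s t ≤ C * ∫⁻ z, w z * levelVol b z * D z ∂μ := by
    have e1 : ∀ t, ∫⁻ s, rieszKernel γ (t - s) * R s t ≤ ∫⁻ z, X z t * (C * D z) ∂μ := by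
      intro t
      have hm : Measurable fun p : ℝ × ℝ => rieszKernel γ (t - p.1) * (X p.2 t * Q p.2 p.1) :=
        ((hk t).comp measurable_fst).mul (((hX1 t).comp measurable_snd).mul (hQm.comp measurable_swap))
      calc ∫⁻ s, rieszKernel γ (t - s) * R s t
          = ∫⁻ s, ∫⁻ z, rieszKernel γ (t - s) * (X z t * Q z s) ∂μ := by
            refine lintegral_congr fun s => ?_
            rw [hR, lintegral_const_mul]
            exact (hX1 t).mul (hQm.comp (measurable_id.prodMk measurable_const))
        _ = ∫⁻ z, (∫⁻ s, rieszKernel γ (t - s) * (X z t * Q z s)) ∂μ :=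
            lintegral_lintegral_swap hm.aemeasurable
        _ = ∫⁻ z, X z t * (∫⁻ s, rieszKernel γ (t - s) * Q z s) ∂μ := by
            refine lintegral_congr fun z => ?_
            rw [← lintegral_const_mul]
            · refine lintegral_congr fun s => ?_
              ring
            · exact (hk t).mul (hQm.comp (measurable_const.prodMk measurable_id))
        _ ≤ _ := by
            refine lintegral_mono fun z => ?_
            gcongr
            exact hpot t z
    calc _ ≤ ∫⁻ t, ∫⁻ z, X z t * (C * D z) ∂μ := lintegral_mono e1
      _ = ∫⁻ z, (∫⁻ t, X z t * (C * D z)) ∂μ := by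
          rw [lintegral_lintegral_swap]
          exact ((hXm.comp measurable_swap).mul ((hDm.const_mul C).comp measurable_snd)).aemeasurable
      _ = ∫⁻ z, C * (w z * levelVol b z * D z) ∂μ := by
          refine lintegral_congr fun z => ?_
          rw [lintegral_mul_const, lintegral_layer hb]
          · ring
          · exact hXm.comp (measurable_const.prodMk measurable_id)
      _ = _ := lintegral_const_mul' _ _ ENNReal.ofReal_ne_top
  refine (rieszEnergy_le_of_mul_le hRm hpt).trans ?_
  rw [mul_assoc]
  gcongr

end Lorentz

/-! ### Hardy–Littlewood–Sobolev in Lorentz form and its dual -/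

section LorentzBounds

theorem setLIntegral_rpow_Ici {e y : ℝ} (he : 1 < e) (hy : 0 < y) :
    ∫⁻ z in Ioi y, ENNReal.ofReal ((y / z) ^ e) = ENNReal.ofReal (y / (e - 1)) := by
  have hint : IntegrableOn (fun z : ℝ => y ^ e * z ^ (-e)) (Ioi y) :=
    (integrableOn_Ioi_rpow_of_lt (by linarith) hy).const_mul _
  have h1 : ∫⁻ z in Ioi y, ENNReal.ofReal ((y / z) ^ e) =
      ∫⁻ z in Ioi y, ENNReal.ofReal (y ^ e * z ^ (-e)) := by
    refine setLIntegral_congr_fun measurableSet_Ioi fun z hz => ?_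
    have hz0 : 0 < z := hy.trans hz
    rw [Real.div_rpow hy.le hz0.le, Real.rpow_neg hz0.le, div_eq_mul_inv]
  rw [h1, ← ofReal_integral_eq_lintegral_ofReal hint]
  · rw [integral_const_mul, integral_Ioi_rpow_of_lt (by linarith) hy]
    congr 1
    rw [show -e + 1 = 1 - e by ring, neg_div, ← div_neg, neg_sub, ← mul_div_assoc, ← Real.rpow_add hy]
    rw [add_sub_cancel, Real.rpow_one]
  · refine (ae_restrict_iff' measurableSet_Ioi).2 (Filter.Eventually.of_forall fun z hz => ?_)
    have hz0 : 0 < z := hy.trans hz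
    positivity

theorem setLIntegral_rpow_inv_Ioc {e z : ℝ} (he : e < 1) (hz : 0 < z) :
    ∫⁻ y in Ioc 0 z, ENNReal.ofReal ((z / y) ^ e) = ENNReal.ofReal (z / (1 - e)) := by
  have h1 : ∫⁻ y in Ioc 0 z, ENNReal.ofReal ((z / y) ^ e) =
      ∫⁻ y in Ioc 0 z, ENNReal.ofReal (z ^ e) * ENNReal.ofReal (y ^ (-e)) := by
    refine setLIntegral_congr_fun measurableSet_Ioc fun y hy => ?_
    rw [← ENNReal.ofReal_mul (by positivity), Real.div_rpow hz.le hy.1.le, Real.rpow_neg hy.1.le, div_eq_mul_inv]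
  rw [h1, lintegral_const_mul' _ _ ENNReal.ofReal_ne_top, setLIntegral_rpow_Ioc he hz.le,
    ← ENNReal.ofReal_mul (by positivity), ← mul_div_assoc, ← Real.rpow_add hz]
  rw [add_sub_cancel, Real.rpow_one]

/-- Young's inequality with exponents `(1 + k) / k` and `1 + k`, after inserting the reciprocal
weights `(y / z) ^ (1/2)` and `(z / y) ^ (1/2)`. The weights make each of the two terms integrable
in the variable on which `f` no longer depends. -/
theorem rpow_mul_le_add {k : ℝ} (hk0 : 0 < k) {y z : ℝ} (hy : 0 < y) (hz : 0 < z) (a b : ℝ≥0∞) :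
    a ^ k * b ≤ a ^ (1 + k) * ENNReal.ofReal ((y / z) ^ ((1 + k) / (2 * k))) +
      b ^ (1 + k) * ENNReal.ofReal ((z / y) ^ ((1 + k) / 2)) := by
  have h1 : ENNReal.ofReal ((y / z) ^ (1 / 2 : ℝ)) * ENNReal.ofReal ((z / y) ^ (1 / 2 : ℝ)) = 1 := by
    rw [← ENNReal.ofReal_mul (by positivity), ← Real.mul_rpow (by positivity) (by positivity)]
    rw [div_mul_div_comm, mul_comm z y, div_self (by positivity), Real.one_rpow, ENNReal.ofReal_one]
  have hpq : ((1 + k) / k).HolderConjugate (1 + k) := by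
    rw [Real.holderConjugate_iff]
    constructor
    · rw [lt_div_iff₀ hk0]
      linarith
    · field_simp
      ring
  have h2 := ENNReal.young_inequality (a ^ k * ENNReal.ofReal ((y / z) ^ (1 / 2 : ℝ)))
    (b * ENNReal.ofReal ((z / y) ^ (1 / 2 : ℝ))) hpq
  have h3 : a ^ k * ENNReal.ofReal ((y / z) ^ (1 / 2 : ℝ)) * (b * ENNReal.ofReal ((z / y) ^ (1 / 2 : ℝ))) =
      a ^ k * b := by
    rw [mul_mul_mul_comm, h1, mul_one]
  rw [h3] at h2
  refine h2.trans (add_le_add ?_ ?_)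
  · refine (ENNReal.div_le_of_le_mul (le_mul_of_one_le_right' ?_)).trans ?_
    · exact ENNReal.one_le_ofReal.2 hpq.lt.le
    · rw [ENNReal.mul_rpow_of_nonneg _ _ (by positivity), ← ENNReal.rpow_mul,
        ENNReal.ofReal_rpow_of_nonneg (by positivity) (by positivity), ← Real.rpow_mul (by positivity)]
      apply le_of_eq
      congr 3 <;> field_simp
  · refine (ENNReal.div_le_of_le_mul (le_mul_of_one_le_right' ?_)).trans ?_
    · exact ENNReal.one_le_ofReal.2 (by linarith)
    · rw [ENNReal.mul_rpow_of_nonneg _ _ (by positivity),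
        ENNReal.ofReal_rpow_of_nonneg (by positivity) (by positivity), ← Real.rpow_mul (by positivity)]
      apply le_of_eq
      congr 3
      ring

/-- A weighted Hardy inequality over the triangle `y ≤ z`. -/
theorem lintegral_triangle_le {k : ℝ} (hk0 : 0 < k) (hk1 : k < 1) {f : ℝ → ℝ≥0∞} (hf : Measurable f) :
    ∫⁻ z in Ioi (0 : ℝ), f z * ∫⁻ y in Ioi (0 : ℝ), (if y ≤ z then f y ^ k else 0) ≤
      ENNReal.ofReal (2 * (1 + k) / (1 - k)) * ∫⁻ y in Ioi (0 : ℝ), ENNReal.ofReal y * f y ^ (1 + k) := by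
  -- Since `k < 1`, one has `e₁ > 1`, so that `(y / z) ^ e₁` is integrable over `z ≥ y`, and `e₂ <
  -- 1`, so that `(z / y) ^ e₂` is integrable over `y ≤ z`. Both integrals are multiples of the
  -- remaining variable, hence the weight `y` on the right.
  set e₁ := (1 + k) / (2 * k) with he₁
  set e₂ := (1 + k) / 2 with he₂
  have he₁1 : 1 < e₁ := by rw [he₁, lt_div_iff₀ (by linarith)]; linarith
  have he₂1 : e₂ < 1 := by rw [he₂]; linarith
  set μ := volume.restrict (Ioi (0 : ℝ)) with hμ
  have hle : MeasurableSet {p : ℝ × ℝ | p.2 ≤ p.1} := measurableSet_le measurable_snd measurable_fst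
  have hm1 : Measurable fun p : ℝ × ℝ => if p.2 ≤ p.1 then f p.2 ^ (1 + k) * ENNReal.ofReal ((p.2 / p.1) ^ e₁) else 0 :=
    Measurable.ite hle (((hf.comp measurable_snd).pow_const _).mul (by fun_prop)) measurable_const
  have hm0 : Measurable fun p : ℝ × ℝ => if p.2 ≤ p.1 then f p.2 ^ k else 0 :=
    Measurable.ite hle ((hf.comp measurable_snd).pow_const _) measurable_const
  have hA : ∫⁻ z, ∫⁻ y, (if y ≤ z then f y ^ (1 + k) * ENNReal.ofReal ((y / z) ^ e₁) else 0) ∂μ ∂μ =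
      ENNReal.ofReal (1 / (e₁ - 1)) * ∫⁻ y, ENNReal.ofReal y * f y ^ (1 + k) ∂μ := by
    rw [lintegral_lintegral_swap hm1.aemeasurable, ← lintegral_const_mul' _ _ ENNReal.ofReal_ne_top]
    refine setLIntegral_congr_fun measurableSet_Ioi fun y hy => ?_
    have hy0 : 0 < y := hy
    have h1 : ∫⁻ z, (if y ≤ z then f y ^ (1 + k) * ENNReal.ofReal ((y / z) ^ e₁) else 0) ∂μ =
        ∫⁻ z in Ici y, f y ^ (1 + k) * ENNReal.ofReal ((y / z) ^ e₁) := by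
      rw [hμ, ← lintegral_indicator measurableSet_Ioi, ← lintegral_indicator measurableSet_Ici]
      refine lintegral_congr fun z => ?_
      by_cases hz : y ≤ z
      · have hz0 : z ∈ Ioi (0 : ℝ) := hy0.trans_le hz
        rw [indicator_of_mem hz0, indicator_of_mem (mem_Ici.2 hz), if_pos hz]
      · rw [indicator_of_notMem (s := Ici y) (fun h => hz h)]
        simp [hz]
    rw [h1, setLIntegral_congr Ioi_ae_eq_Ici.symm, lintegral_const_mul _ (by fun_prop),
      setLIntegral_rpow_Ici he₁1 hy0, ← mul_assoc, ← ENNReal.ofReal_mul (by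
        have : 0 < e₁ - 1 := by linarith
        positivity), mul_comm, one_div, ← div_eq_inv_mul]
  have hB : ∫⁻ z, ∫⁻ y, (if y ≤ z then f z ^ (1 + k) * ENNReal.ofReal ((z / y) ^ e₂) else 0) ∂μ ∂μ =
      ENNReal.ofReal (1 / (1 - e₂)) * ∫⁻ y, ENNReal.ofReal y * f y ^ (1 + k) ∂μ := by
    rw [← lintegral_const_mul' _ _ ENNReal.ofReal_ne_top]
    refine setLIntegral_congr_fun measurableSet_Ioi fun z hz => ?_
    have hz0 : 0 < z := hz
    have h1 : ∫⁻ y, (if y ≤ z then f z ^ (1 + k) * ENNReal.ofReal ((z / y) ^ e₂) else 0) ∂μ =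
        ∫⁻ y in Ioc 0 z, f z ^ (1 + k) * ENNReal.ofReal ((z / y) ^ e₂) := by
      rw [hμ, ← lintegral_indicator measurableSet_Ioi, ← lintegral_indicator measurableSet_Ioc]
      refine lintegral_congr fun y => ?_
      by_cases hy : 0 < y
      · by_cases hyz : y ≤ z
        · rw [indicator_of_mem (mem_Ioi.2 hy), indicator_of_mem (mem_Ioc.2 ⟨hy, hyz⟩), if_pos hyz]
        · rw [indicator_of_mem (mem_Ioi.2 hy), indicator_of_notMem (fun h => hyz h.2), if_neg hyz]
      · rw [indicator_of_notMem (by simpa using hy), indicator_of_notMem (fun h => hy h.1)]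
    rw [h1, lintegral_const_mul _ (by fun_prop),
      setLIntegral_rpow_inv_Ioc he₂1 hz0, ← mul_assoc, ← ENNReal.ofReal_mul (by
        have : 0 < 1 - e₂ := by linarith
        positivity), mul_comm, one_div, ← div_eq_inv_mul]
  calc ∫⁻ z, f z * ∫⁻ y, (if y ≤ z then f y ^ k else 0) ∂μ ∂μ
      = ∫⁻ z, ∫⁻ y, f z * (if y ≤ z then f y ^ k else 0) ∂μ ∂μ := by
        refine lintegral_congr fun z => ?_
        rw [lintegral_const_mul]
        exact hm0.comp (measurable_const.prodMk measurable_id)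
    _ ≤ ∫⁻ z, ∫⁻ y, ((if y ≤ z then f y ^ (1 + k) * ENNReal.ofReal ((y / z) ^ e₁) else 0) +
          (if y ≤ z then f z ^ (1 + k) * ENNReal.ofReal ((z / y) ^ e₂) else 0)) ∂μ ∂μ := by
        refine setLIntegral_mono' measurableSet_Ioi fun z hz => ?_
        refine setLIntegral_mono' measurableSet_Ioi fun y hy => ?_
        by_cases hyz : y ≤ z
        · simp only [hyz, if_true]
          rw [mul_comm]
          exact rpow_mul_le_add hk0 hy hz _ _
        · simp [hyz]
    _ = (∫⁻ z, ∫⁻ y, (if y ≤ z then f y ^ (1 + k) * ENNReal.ofReal ((y / z) ^ e₁) else 0) ∂μ ∂μ) +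
        ∫⁻ z, ∫⁻ y, (if y ≤ z then f z ^ (1 + k) * ENNReal.ofReal ((z / y) ^ e₂) else 0) ∂μ ∂μ := by
        rw [← lintegral_add_left hm1.lintegral_prod_right']
        refine lintegral_congr fun z => ?_
        exact lintegral_add_left (hm1.comp (measurable_const.prodMk measurable_id)) _
    _ = _ := by
        rw [hA, hB, ← add_mul, ← ENNReal.ofReal_add (by
          have : 0 < e₁ - 1 := by linarith
          positivity) (by
          have : 0 < 1 - e₂ := by linarith
          positivity)]
        congr 2
        have h1 : e₁ - 1 = (1 - k) / (2 * k) := by rw [he₁]; field_simp; ring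
        have h2 : 1 - e₂ = (1 - k) / 2 := by rw [he₂]; ring
        rw [h1, h2]
        have : 1 - k ≠ 0 := by linarith
        field_simp
        ring

/-- The Hardy-Littlewood-Sobolev inequality in Lorentz form, for the Riesz energy. -/
theorem rieszEnergy_le_lorentzSq {γ : ℝ} (hγ0 : 0 < γ) (hγ1 : γ < 1) {f : ℝ → ℝ≥0∞} (hf : Measurable f) :
    rieszEnergy γ univ f ≤ 2 * ENNReal.ofReal (1 + 2 / (1 - γ)) * (ENNReal.ofReal (2 * (2 - γ) / γ) *
      lorentzSq (2 - γ) f) := by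
  have h := rieszEnergy_layered_le hγ0 hγ1 (w := fun _ => 1) measurable_const hf
  rw [layered_one] at h
  simp only [one_mul] at h
  refine h.trans ?_
  gcongr
  have h2 := lintegral_triangle_le (k := 1 - γ) (by linarith) (by linarith) (measurable_levelVol f)
  rw [show 1 + (1 - γ) = 2 - γ by ring, sub_sub_cancel] at h2
  exact h2

/-- The superlevel sets of an increasing supremum are increasing unions, so the quasinorm passes to
the limit by monotone convergence. -/
theorem lorentzSq_le_of_iSup {e : ℝ} (he : 0 ≤ e) {b : ℝ → ℝ≥0∞} {c : ℕ → ℝ → ℝ≥0∞} {M : ℝ≥0∞}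
    (hc : Monotone c) (hb : ∀ t, b t ≤ ⨆ k, c k t) (hM : ∀ k, lorentzSq e (c k) ≤ M) :
    lorentzSq e b ≤ M := by
  have hlim : ∀ y : ℝ, Filter.Tendsto (fun k => levelVol (c k) y) Filter.atTop
      (nhds (volume (⋃ k, {t | ENNReal.ofReal y < c k t}))) := fun y =>
    tendsto_measure_iUnion_atTop fun i j hij t ht => lt_of_lt_of_le ht (hc hij t)
  have hle : ∀ y, levelVol b y ≤ volume (⋃ k, {t | ENNReal.ofReal y < c k t}) := fun y => by
    refine measure_mono fun t ht => ?_
    obtain ⟨k, hk⟩ := lt_iSup_iff.1 (lt_of_lt_of_le ht (hb t))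
    exact mem_iUnion.2 ⟨k, hk⟩
  have hmono : ∀ y, Monotone fun k => ENNReal.ofReal y * levelVol (c k) y ^ e := fun y i j hij => by
    have : levelVol (c i) y ≤ levelVol (c j) y := measure_mono fun t ht => lt_of_lt_of_le ht (hc hij t)
    simp only
    gcongr
  have hT := lintegral_tendsto_of_tendsto_of_monotone (μ := volume.restrict (Ioi (0 : ℝ)))
    (f := fun k y => ENNReal.ofReal y * levelVol (c k) y ^ e)
    (F := fun y => ENNReal.ofReal y * volume (⋃ k, {t | ENNReal.ofReal y < c k t}) ^ e)
    (fun k => (ENNReal.measurable_ofReal.mul ((measurable_levelVol (c k)).pow_const e)).aemeasurable)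
    (Filter.Eventually.of_forall hmono)
    (Filter.Eventually.of_forall fun y => ENNReal.Tendsto.const_mul
      ((ENNReal.continuous_rpow_const.tendsto _).comp (hlim y)) (Or.inr ENNReal.ofReal_ne_top))
  refine le_trans ?_ (le_of_tendsto' hT hM)
  refine lintegral_mono fun y => ?_
  simp only
  gcongr
  exact hle y

/-- Truncation in height and in time. -/
noncomputable def trunc (b : ℝ → ℝ≥0∞) (k : ℕ) (t : ℝ) : ℝ≥0∞ := if |t| ≤ k then min (b t) k else 0

theorem trunc_le (b : ℝ → ℝ≥0∞) (k : ℕ) (t : ℝ) : trunc b k t ≤ b t := by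
  unfold trunc
  split_ifs
  · exact min_le_left _ _
  · exact zero_le

theorem trunc_mono (b : ℝ → ℝ≥0∞) : Monotone (trunc b) := fun i j hij t => by
  unfold trunc
  have h : (i : ℝ) ≤ j := by exact_mod_cast hij
  by_cases hi : |t| ≤ i
  · rw [if_pos hi, if_pos (hi.trans h)]
    gcongr
  · rw [if_neg hi]
    exact zero_le

theorem iSup_trunc (b : ℝ → ℝ≥0∞) (t : ℝ) : ⨆ k, trunc b k t = b t := by
  refine le_antisymm (iSup_le fun k => trunc_le b k t) (le_of_forall_lt fun x hx => ?_)
  obtain ⟨i, hi⟩ := exists_nat_ge |t|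
  obtain ⟨j, hj⟩ := ENNReal.exists_nat_gt (ne_top_of_lt hx)
  refine lt_iSup_iff.2 ⟨max i j, ?_⟩
  have : |t| ≤ (max i j : ℕ) := hi.trans (by exact_mod_cast le_max_left i j)
  rw [trunc, if_pos this]
  exact lt_min hx (hj.trans_le (by exact_mod_cast le_max_right i j))

theorem measurable_trunc {b : ℝ → ℝ≥0∞} (hb : Measurable b) (k : ℕ) : Measurable (trunc b k) :=
  Measurable.ite (measurableSet_le (by fun_prop) measurable_const) (hb.min measurable_const) measurable_const

theorem levelVol_trunc_lt_top (b : ℝ → ℝ≥0∞) (k : ℕ) (y : ℝ) : levelVol (trunc b k) y ≤ ENNReal.ofReal (2 * k) := by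
  calc levelVol (trunc b k) y ≤ volume (Icc (-(k : ℝ)) k) := by
        refine measure_mono fun t ht => ?_
        by_contra h
        have h' : ¬ |t| ≤ k := fun h' => h (abs_le.1 h')
        simp [trunc, h'] at ht
    _ = _ := by rw [Real.volume_Icc]; ring_nf

theorem levelVol_trunc_eq_zero (b : ℝ → ℝ≥0∞) {k : ℕ} {y : ℝ} (hy : k ≤ y) : levelVol (trunc b k) y = 0 := by
  have : {t | ENNReal.ofReal y < trunc b k t} = ∅ := by
    refine eq_empty_of_forall_notMem fun t ht => ?_
    have h1 : trunc b k t ≤ k := by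
      unfold trunc
      split_ifs
      · exact min_le_right _ _
      · exact zero_le
    have h2 : (k : ℝ≥0∞) ≤ ENNReal.ofReal y := by
      rw [← ENNReal.ofReal_natCast]
      exact ENNReal.ofReal_le_ofReal hy
    exact absurd (show ENNReal.ofReal y < trunc b k t from ht) (not_lt.2 (h1.trans h2))
  rw [levelVol, this, measure_empty]

/-- `a` is bounded and vanishes off a bounded set. -/
def BoundedSupport (a : ℝ → ℝ≥0∞) : Prop := ∃ k : ℕ, ∀ t, a t ≤ k ∧ (a t ≠ 0 → |t| ≤ k)

theorem boundedSupport_layered_trunc {w b : ℝ → ℝ≥0∞} {m k : ℕ} (hw : ∀ y, w y ≤ m) :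
    BoundedSupport (layered w (trunc b k)) := by
  refine ⟨m * k + k, fun t => ⟨?_, fun h => ?_⟩⟩
  · have h1 : layered w (trunc b k) t ≤ m * layered (fun _ => 1) (trunc b k) t := by
      rw [layered, layered, ← lintegral_const_mul' _ _ (ENNReal.natCast_ne_top m)]
      refine lintegral_mono fun y => ?_
      split_ifs
      · simpa using hw y
      · simp
    rw [layered_one] at h1
    refine h1.trans ?_
    have : trunc b k t ≤ k := by
      unfold trunc
      split_ifs
      · exact min_le_right _ _
      · exact zero_le
    push_cast
    refine le_trans ?_ le_self_add
    gcongr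
  · by_contra h'
    have h'' : ¬ |t| ≤ k := fun h3 => h' (h3.trans (by push_cast; nlinarith [Nat.cast_nonneg (α := ℝ) m, Nat.cast_nonneg (α := ℝ) k]))
    apply h
    simp [layered, trunc, h'']

/-- The quasinorm of `L^{2/γ,2}` is controlled by testing against functions with Riesz energy. -/
theorem lorentzSq_le_of_forall {γ : ℝ} (hγ0 : 0 < γ) (hγ1 : γ < 1) {b : ℝ → ℝ≥0∞} (hb : Measurable b)
    {K : ℝ≥0∞} (hK : ∀ a : ℝ → ℝ≥0∞, Measurable a → BoundedSupport a →
      ∫⁻ t, b t * a t ≤ K * rieszEnergy γ univ a ^ (1 / 2 : ℝ)) :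
    lorentzSq γ b ≤ 2 * ENNReal.ofReal (1 + 2 / (1 - γ)) * K ^ 2 := by
  set C := 2 * ENNReal.ofReal (1 + 2 / (1 - γ)) with hC
  have hCt : C ≠ ∞ := ENNReal.mul_ne_top (by norm_num) ENNReal.ofReal_ne_top
  refine lorentzSq_le_of_iSup hγ0.le (trunc_mono b) (fun t => (iSup_trunc b t).ge) fun k => ?_
  set c := trunc b k with hc
  have hcm : Measurable c := measurable_trunc hb k
  set φ := levelVol c with hφ
  have hφm : Measurable φ := measurable_levelVol c
  have hφt : ∀ y, φ y ≠ ∞ := fun y => ((levelVol_trunc_lt_top b k y).trans_lt ENNReal.ofReal_lt_top).ne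
  -- The extremal test function for the duality is the superposition of the superlevel sets of `c`
  -- with weight `φ ^ (γ - 1)`. Capping the weight at `m` keeps the test function bounded. The
  -- quantity `X m` then increases to `lorentzSq γ c`.
  set w : ℕ → ℝ → ℝ≥0∞ := fun m y => min (φ y ^ (γ - 1)) m with hw
  have hwm : ∀ m, Measurable (w m) := fun m => (hφm.pow_const _).min measurable_const
  set X : ℕ → ℝ≥0∞ := fun m => ∫⁻ z in Ioi (0 : ℝ), ENNReal.ofReal z * (w m z * φ z) with hX
  have hXt : ∀ m, X m ≠ ∞ := fun m => by
    have h1 : X m ≤ ∫⁻ z in Ioi (0 : ℝ), (Iio (k : ℝ)).indicator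
        (fun _ => ENNReal.ofReal k * (m * ENNReal.ofReal (2 * k))) z := by
      refine lintegral_mono fun z => ?_
      by_cases hz : z < k
      · rw [indicator_of_mem (mem_Iio.2 hz)]
        gcongr
        · exact min_le_right _ _
        · exact levelVol_trunc_lt_top b k z
      · simp only [hφ, hc]
        rw [levelVol_trunc_eq_zero b (not_lt.1 hz)]
        simp
    refine (h1.trans_lt ?_).ne
    rw [lintegral_indicator_const measurableSet_Iio, Measure.restrict_apply measurableSet_Iio]
    refine ENNReal.mul_lt_top (ENNReal.mul_lt_top ENNReal.ofReal_lt_top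
      (ENNReal.mul_lt_top (ENNReal.natCast_lt_top m) ENNReal.ofReal_lt_top)) ?_
    rw [Iio_inter_Ioi, Real.volume_Ioo]
    exact ENNReal.ofReal_lt_top
  -- Because `w m * φ ^ (1 - γ) ≤ 1`, the inner integral over heights `y ≤ z` is at most `z`, and
  -- the energy of the test function is bounded by `X m` itself.
  have hEn : ∀ m, rieszEnergy γ univ (layered (w m) c) ≤ C * X m := fun m => by
    refine (rieszEnergy_layered_le hγ0 hγ1 (hwm m) hcm).trans ?_
    gcongr
    refine setLIntegral_mono' measurableSet_Ioi fun z hz => ?_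
    rw [mul_comm (ENNReal.ofReal z)]
    gcongr
    calc ∫⁻ y in Ioi (0 : ℝ), (if y ≤ z then w m y * levelVol c y ^ (1 - γ) else 0)
        ≤ ∫⁻ y in Ioi (0 : ℝ), (Iic z).indicator (fun _ => 1) y := by
          refine lintegral_mono fun y => ?_
          by_cases hy : y ≤ z
          · rw [if_pos hy, indicator_of_mem (mem_Iic.2 hy)]
            rcases eq_or_ne (φ y) 0 with h0 | h0
            · rw [← hφ, h0, ENNReal.zero_rpow_of_pos (by linarith), mul_zero]
              exact zero_le
            · calc w m y * levelVol c y ^ (1 - γ) ≤ φ y ^ (γ - 1) * φ y ^ (1 - γ) := by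
                    gcongr
                    exact min_le_left _ _
                _ = 1 := by rw [← ENNReal.rpow_add _ _ h0 (hφt y)]; simp
          · simp [hy]
      _ = ENNReal.ofReal z := by
          rw [lintegral_indicator_const measurableSet_Iic, Measure.restrict_apply measurableSet_Iic,
            one_mul, Iic_inter_Ioi, Real.volume_Ioc, sub_zero]
  -- On the superlevel set of height `z` the function `b ≥ c` exceeds `z`.
  have hlow : ∀ m, X m ≤ ∫⁻ t, b t * layered (w m) c t := fun m => by
    have hXm := measurable_layer (hwm m) hcm
    calc X m = ∫⁻ z in Ioi (0 : ℝ), ∫⁻ t, ENNReal.ofReal z *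
          (if ENNReal.ofReal z < c t then w m z else 0) := by
          refine lintegral_congr fun z => ?_
          rw [lintegral_const_mul' _ _ ENNReal.ofReal_ne_top, lintegral_layer hcm]
      _ = ∫⁻ t, ∫⁻ z in Ioi (0 : ℝ), ENNReal.ofReal z *
          (if ENNReal.ofReal z < c t then w m z else 0) := by
          rw [lintegral_lintegral_swap]
          exact ((ENNReal.measurable_ofReal.comp measurable_fst).mul hXm).aemeasurable
      _ ≤ ∫⁻ t, ∫⁻ z in Ioi (0 : ℝ), b t * (if ENNReal.ofReal z < c t then w m z else 0) := by
          refine lintegral_mono fun t => lintegral_mono fun z => ?_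
          simp only
          split_ifs with h
          · gcongr
            exact h.le.trans (trunc_le b k t)
          · simp
      _ = _ := by
          refine lintegral_congr fun t => ?_
          rw [layered, lintegral_const_mul]
          exact hXm.comp (measurable_id.prodMk measurable_const)
  -- The two bounds give `X ≤ K (C X) ^ (1/2)`. Dividing by `X ^ (1/2)` is legitimate because the
  -- truncations in height, time and weight make `X m` finite.
  have hXle : ∀ m, X m ≤ C * K ^ 2 := fun m => by
    have h1 : X m ≤ K * (C * X m) ^ (1 / 2 : ℝ) := by
      refine (hlow m).trans ((hK _ (measurable_layered (hwm m) hcm)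
        (boundedSupport_layered_trunc fun y => min_le_right _ _)).trans ?_)
      gcongr
      exact hEn m
    rcases eq_or_ne (X m) 0 with h0 | h0
    · rw [h0]
      exact zero_le
    have h2 : X m ^ (1 / 2 : ℝ) * X m ^ (1 / 2 : ℝ) = X m := by
      rw [← ENNReal.rpow_add_of_nonneg _ _ (by norm_num) (by norm_num)]
      norm_num
    have h3 : X m ^ (1 / 2 : ℝ) * X m ^ (1 / 2 : ℝ) ≤ X m ^ (1 / 2 : ℝ) * (K * C ^ (1 / 2 : ℝ)) := by
      rw [h2]
      refine h1.trans (le_of_eq ?_)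
      rw [ENNReal.mul_rpow_of_nonneg _ _ (by norm_num)]
      ring
    have h4 : X m ^ (1 / 2 : ℝ) ≤ K * C ^ (1 / 2 : ℝ) := by
      refine (ENNReal.mul_le_mul_iff_right ?_ ?_).1 h3
      · simp [h0]
      · exact ENNReal.rpow_ne_top_of_nonneg (by norm_num) (hXt m)
    calc X m = X m ^ (1 / 2 : ℝ) * X m ^ (1 / 2 : ℝ) := h2.symm
      _ ≤ (K * C ^ (1 / 2 : ℝ)) * (K * C ^ (1 / 2 : ℝ)) := by gcongr
      _ = (C ^ (1 / 2 : ℝ) * C ^ (1 / 2 : ℝ)) * K ^ 2 := by ring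
      _ = C * K ^ 2 := by
          rw [← ENNReal.rpow_add_of_nonneg _ _ (by norm_num) (by norm_num)]
          norm_num
  calc lorentzSq γ c ≤ ∫⁻ z in Ioi (0 : ℝ), ⨆ m, ENNReal.ofReal z * (w m z * φ z) := by
        refine lintegral_mono fun z => ?_
        rw [← hφ]
        rcases eq_or_ne (φ z) 0 with h0 | h0
        · rw [h0, ENNReal.zero_rpow_of_pos hγ0, mul_zero]
          exact zero_le
        have hfin : φ z ^ (γ - 1) ≠ ∞ := by
          simp [ENNReal.rpow_eq_top_iff, h0, hφt z]
        obtain ⟨m, hm⟩ := ENNReal.exists_nat_gt hfin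
        refine le_iSup_of_le m ?_
        have : w m z = φ z ^ (γ - 1) := min_eq_left hm.le
        rw [this]
        nth_rewrite 3 [← ENNReal.rpow_one (φ z)]
        rw [← ENNReal.rpow_add _ _ h0 (hφt z), sub_add_cancel]
    _ = ⨆ m, X m := by
        rw [lintegral_iSup]
        · exact fun m => ENNReal.measurable_ofReal.mul ((hwm m).mul hφm)
        · intro i j hij z
          have : w i z ≤ w j z := min_le_min le_rfl (by exact_mod_cast hij)
          simp only
          gcongr
    _ ≤ _ := iSup_le hXle

/-- By duality: the potential tested against `a` is at most the product of the square roots of the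
energies of `f` and `a`, which is the testing condition with `K` the square root of the energy of
`f`. -/
theorem lorentzSq_rieszPotential_le {γ : ℝ} (hγ0 : 0 < γ) (hγ1 : γ < 1) {f : ℝ → ℝ≥0∞} (hf : Measurable f) :
    lorentzSq γ (rieszPotential γ univ f) ≤
      2 * ENNReal.ofReal (1 + 2 / (1 - γ)) * rieszEnergy γ univ f := by
  have h := lorentzSq_le_of_forall hγ0 hγ1 (measurable_rieszPotential hf)
    (K := rieszEnergy γ univ f ^ (1 / 2 : ℝ)) fun a ha _ => lintegral_rieszPotential_mul_le hγ0 hγ1 hf ha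
  rwa [← ENNReal.rpow_natCast, ← ENNReal.rpow_mul, Nat.cast_ofNat, one_div, inv_mul_cancel₀ two_ne_zero,
    ENNReal.rpow_one] at h

end LorentzBounds

/-! ### Lorentz quasinorms: embeddings and powers -/

section LorentzNorm

/-- The weak-type bound: on `(y / 2, y]` the integrand of `lorentzSq` is at least `y / 2` times the
value of `levelVol b y ^ e`, and the interval has length `y / 2`. -/
theorem sq_mul_levelVol_le {e : ℝ} (he : 0 ≤ e) (b : ℝ → ℝ≥0∞) {y : ℝ} (hy : 0 < y) :
    ENNReal.ofReal (y ^ 2) * levelVol b y ^ e ≤ 4 * lorentzSq e b := by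
  have h1 : ENNReal.ofReal (y / 2) * (ENNReal.ofReal (y / 2) * levelVol b y ^ e) ≤ lorentzSq e b := by
    calc _ = ∫⁻ _ in Ioc (y / 2) y, ENNReal.ofReal (y / 2) * levelVol b y ^ e := by
          rw [setLIntegral_const, Real.volume_Ioc, mul_comm, sub_half]
      _ ≤ ∫⁻ s in Ioc (y / 2) y, ENNReal.ofReal s * levelVol b s ^ e := by
          refine setLIntegral_mono' measurableSet_Ioc fun s hs => ?_
          gcongr
          · exact hs.1.le
          · exact levelVol_antitone b hs.2
      _ ≤ _ := lintegral_mono_set fun s hs => (by linarith [hs.1] : (0 : ℝ) < s)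
  calc _ = 4 * (ENNReal.ofReal (y / 2) * (ENNReal.ofReal (y / 2) * levelVol b y ^ e)) := by
        rw [← mul_assoc (ENNReal.ofReal _), ← mul_assoc, ← ENNReal.ofReal_mul (by positivity),
          ← ENNReal.ofReal_ofNat 4, ← ENNReal.ofReal_mul (by norm_num)]
        congr 2
        ring
    _ ≤ _ := by gcongr

/-- A set of positive measure where `b` is infinite lies in every superlevel set, and the weak-type
bound at large heights excludes this. -/
theorem ae_lt_top_of_lorentzSq {e : ℝ} (he : 0 < e) {b : ℝ → ℝ≥0∞} (h : lorentzSq e b ≠ ∞) :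
    ∀ᵐ t, b t < ∞ := by
  rw [ae_iff]
  by_contra h0
  set v := volume {t | ¬ b t < ∞} with hv
  have hle : ∀ y, v ≤ levelVol b y := fun y => by
    refine measure_mono fun t ht => ?_
    have : b t = ∞ := not_lt_top_iff.1 ht
    simp [this]
  have hve : v ^ e ≠ 0 := by simp [ENNReal.rpow_eq_zero_iff, h0, he.le]
  have h1 : ∀ n : ℕ, (n : ℝ≥0∞) * v ^ e ≤ 4 * lorentzSq e b := fun n => by
    have h2 := sq_mul_levelVol_le he.le b (y := n + 1) (by positivity)
    refine le_trans ?_ h2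
    gcongr
    · rw [← ENNReal.ofReal_natCast]
      apply ENNReal.ofReal_le_ofReal
      nlinarith [Nat.cast_nonneg (α := ℝ) n]
    · exact hle _
  have h4 : 4 * lorentzSq e b ≠ ∞ := ENNReal.mul_ne_top (by norm_num) h
  obtain ⟨n, hn⟩ := ENNReal.exists_nat_mul_gt hve h4
  exact absurd (h1 n) (not_le.2 hn)

/-- The embedding of `L^{q,2}` in `L^q` for `q ≥ 2`. -/
theorem lintegral_rpow_le_lorentzSq {q : ℝ} (hq : 2 ≤ q) {b : ℝ → ℝ≥0∞} (hb : Measurable b) :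
    ∫⁻ t, b t ^ q ≤ ENNReal.ofReal q * (4 ^ ((q - 2) / 2) * lorentzSq (2 / q) b ^ (q / 2)) := by
  have hq0 : 0 < q := by linarith
  by_cases htop : lorentzSq (2 / q) b = ∞
  · rw [htop, ENNReal.top_rpow_of_pos (by positivity), ENNReal.mul_top, ENNReal.mul_top]
    · exact le_top
    · simpa using hq0
    · simp [ENNReal.rpow_eq_zero_iff]
  have hfin := ae_lt_top_of_lorentzSq (by positivity) htop
  have h1 : ∫⁻ t, b t ^ q = ∫⁻ t, ENNReal.ofReal ((b t).toReal ^ q) := by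
    refine lintegral_congr_ae ?_
    filter_upwards [hfin] with t ht
    rw [← ENNReal.ofReal_rpow_of_nonneg ENNReal.toReal_nonneg hq0.le, ENNReal.ofReal_toReal ht.ne]
  rw [h1, lintegral_rpow_eq_lintegral_meas_lt_mul volume
    (Filter.Eventually.of_forall fun t => ENNReal.toReal_nonneg) hb.ennreal_toReal.aemeasurable hq0]
  gcongr
  set N := lorentzSq (2 / q) b with hN
  have h4N : (4 * N) ^ ((q - 2) / 2) ≠ ∞ :=
    ENNReal.rpow_ne_top_of_nonneg (by linarith) (ENNReal.mul_ne_top (by norm_num) htop)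
  -- The integrand of the layer cake formula is a product: the power `(q - 2) / 2` of the weak-type
  -- quantity, bounded uniformly in `y`, times the integrand of `lorentzSq (2 / q) b`.
  calc ∫⁻ y in Ioi (0 : ℝ), volume {t | y < (b t).toReal} * ENNReal.ofReal (y ^ (q - 1))
      ≤ ∫⁻ y in Ioi (0 : ℝ), (4 * N) ^ ((q - 2) / 2) * (ENNReal.ofReal y * levelVol b y ^ (2 / q)) := by
        refine setLIntegral_mono' measurableSet_Ioi fun y hy => ?_
        have hy0 : (0 : ℝ) < y := hy
        calc volume {t | y < (b t).toReal} * ENNReal.ofReal (y ^ (q - 1))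
            ≤ levelVol b y * ENNReal.ofReal (y ^ (q - 1)) := by
              gcongr
              refine measure_mono fun t ht => ?_
              have ht' : y < (b t).toReal := ht
              rcases eq_or_ne (b t) ∞ with h | h
              · simp [h]
              · exact (ENNReal.ofReal_lt_iff_lt_toReal hy0.le h).2 ht'
          _ = (ENNReal.ofReal (y ^ 2) * levelVol b y ^ (2 / q)) ^ ((q - 2) / 2) *
              (ENNReal.ofReal y * levelVol b y ^ (2 / q)) := by
              rw [ENNReal.mul_rpow_of_nonneg _ _ (by linarith),
                ENNReal.ofReal_rpow_of_nonneg (by positivity) (by linarith), ← ENNReal.rpow_mul,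
                mul_mul_mul_comm, ← ENNReal.ofReal_mul (by positivity),
                ← ENNReal.rpow_add_of_nonneg _ _ (by have : 0 ≤ q - 2 := by linarith
                                                     positivity) (by positivity)]
              have e1 : 2 / q * ((q - 2) / 2) + 2 / q = 1 := by
                field_simp
                ring
              have e2 : (y ^ 2) ^ ((q - 2) / 2) * y = y ^ (q - 1) := by
                rw [← Real.rpow_natCast, ← Real.rpow_mul hy0.le]
                nth_rewrite 2 [← Real.rpow_one y]
                rw [← Real.rpow_add hy0]
                congr 1
                push_cast
                ring
              rw [e1, e2, ENNReal.rpow_one, mul_comm]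
          _ ≤ _ := by
              have h2 : 0 ≤ (q - 2) / 2 := by linarith
              exact mul_le_mul_left (ENNReal.rpow_le_rpow (sq_mul_levelVol_le (by positivity) b hy0) h2) _
    _ = (4 * N) ^ ((q - 2) / 2) * N := lintegral_const_mul' _ _ h4N
    _ = 4 ^ ((q - 2) / 2) * N ^ (q / 2) := by
        rw [ENNReal.mul_rpow_of_nonneg _ _ (by linarith), mul_assoc]
        congr 1
        nth_rewrite 2 [← ENNReal.rpow_one N]
        rw [← ENNReal.rpow_add_of_nonneg _ _ (by linarith) (by norm_num)]
        congr 1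
        ring

theorem lorentzNorm_eq {p r : ℝ} (hr : 0 < r) {μ : Measure ℝ} (f : ℝ → ℝ≥0∞) :
    lorentzNorm p (ENNReal.ofReal r) μ f = ENNReal.ofReal (p ^ (1 / r)) *
      (∫⁻ y in Ioi (0 : ℝ), ENNReal.ofReal (y ^ (r - 1)) * μ {t | ENNReal.ofReal y < f t} ^ (r / p)) ^ (1 / r) := by
  have hr0 : ENNReal.ofReal r ≠ 0 := by simpa using hr
  have hmeas : Measurable fun y : ℝ => μ {t | ENNReal.ofReal y < f t} := by
    refine Antitone.measurable fun x y hxy => measure_mono fun t ht => ?_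
    exact lt_of_le_of_lt (ENNReal.ofReal_le_ofReal hxy) ht
  have hm2 : Measurable fun y : ℝ => ENNReal.ofReal y⁻¹ := by fun_prop
  have hm3 : Measurable fun y : ℝ => (ENNReal.ofReal y * μ {t | ENNReal.ofReal y < f t} ^ (1 / p)) ^ r :=
    (ENNReal.measurable_ofReal.mul (hmeas.pow_const _)).pow_const _
  rw [lorentzNorm, eLpNorm_eq_lintegral_rpow_enorm_toReal hr0 ENNReal.ofReal_ne_top,
    ENNReal.toReal_ofReal hr.le]
  simp only [enorm_eq_self]
  rw [lintegral_withDensity_eq_lintegral_mul _ hm2 hm3]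
  congr 2
  refine setLIntegral_congr_fun measurableSet_Ioi fun y hy => ?_
  have hy0 : (0 : ℝ) < y := hy
  simp only [Pi.mul_apply]
  rw [ENNReal.mul_rpow_of_nonneg _ _ hr.le, ← mul_assoc, ENNReal.ofReal_rpow_of_nonneg hy0.le hr.le,
    ← ENNReal.ofReal_mul (by positivity), ← ENNReal.rpow_mul, Real.rpow_sub_one hy0.ne']
  congr 2
  · rw [div_eq_inv_mul]
  · ring

/-- The normalization `p ^ (1 / r)` of the quasinorm, here with `p = q` and `r = 2`, has square `q`;
this is the only discrepancy between the two quantities. -/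
theorem lorentzSq_indicator_le {q : ℝ} (hq : 0 < q) {J : Set ℝ} (hJ : MeasurableSet J) (f : ℝ → ℝ≥0∞) :
    lorentzSq (2 / q) (J.indicator f) ≤ ENNReal.ofReal (1 / q) * lorentzNorm q 2 (volume.restrict J) f ^ 2 := by
  have h := lorentzNorm_eq (p := q) (r := 2) two_pos (μ := volume.restrict J) f
  rw [ENNReal.ofReal_ofNat] at h
  have e2 : (∫⁻ y in Ioi (0 : ℝ), ENNReal.ofReal (y ^ (2 - 1 : ℝ)) *
      (volume.restrict J) {t | ENNReal.ofReal y < f t} ^ (2 / q)) = lorentzSq (2 / q) (J.indicator f) := by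
    refine setLIntegral_congr_fun measurableSet_Ioi fun y hy => ?_
    have e3 : {t | ENNReal.ofReal y < f t} ∩ J = {t | ENNReal.ofReal y < J.indicator f t} := by
      ext t
      by_cases ht : t ∈ J <;> simp [ht]
    simp only [levelVol]
    rw [show (2 - 1 : ℝ) = 1 by norm_num, Real.rpow_one, Measure.restrict_apply' hJ, e3]
  rw [e2] at h
  rw [h, mul_pow, ← ENNReal.ofReal_pow (by positivity), ← mul_assoc, ← ENNReal.ofReal_mul (by positivity)]
  rw [← Real.rpow_natCast, ← Real.rpow_mul hq.le, ← ENNReal.rpow_natCast (lorentzSq _ _ ^ _), ← ENNReal.rpow_mul]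
  norm_num
  rw [inv_mul_cancel₀ hq.ne']
  simp

/-- The Lorentz quasinorm of a power. -/
theorem lorentzNorm_le_of_le_rpow {q l c : ℝ} (hq : 0 < q) (hl : 0 < l) (hc : 0 < c) {J : Set ℝ}
    {v M : ℝ → ℝ≥0∞} (h : ∀ᵐ t ∂volume.restrict J, v t ≤ ENNReal.ofReal c * M t ^ l) :
    lorentzNorm (q / l) (ENNReal.ofReal (2 / l)) (volume.restrict J) v ≤
      ENNReal.ofReal ((q / l) ^ (l / 2)) *
        (ENNReal.ofReal (l * c ^ (2 / l)) * lorentzSq (2 / q) M) ^ (l / 2) := by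
  rw [lorentzNorm_eq (by positivity), one_div_div]
  gcongr
  -- The substitution `y = c z ^ l` in the height variable turns the superlevel sets of `c M ^ l`
  -- into those of `M`; the powers of `z` combine to exactly one factor `z`.
  have himg : (fun z : ℝ => c * z ^ l) '' Ioi 0 = Ioi 0 := by
    ext y
    constructor
    · rintro ⟨z, hz, rfl⟩
      have : (0 : ℝ) < z := hz
      exact mem_Ioi.2 (by positivity)
    · intro hy
      have hy0 : (0 : ℝ) < y := hy
      refine ⟨(y / c) ^ (1 / l), mem_Ioi.2 (by positivity), ?_⟩
      simp only
      rw [← Real.rpow_mul (by positivity), one_div, inv_mul_cancel₀ hl.ne', Real.rpow_one]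
      field_simp
  have hderiv : ∀ z ∈ Ioi (0 : ℝ), HasDerivWithinAt (fun z : ℝ => c * z ^ l) (c * (l * z ^ (l - 1))) (Ioi 0) z :=
    fun z hz => ((Real.hasDerivAt_rpow_const (Or.inl (ne_of_gt hz))).const_mul c).hasDerivWithinAt
  have hinj : InjOn (fun z : ℝ => c * z ^ l) (Ioi 0) := by
    intro x hx y hy hxy
    have h1 : x ^ l = y ^ l := mul_left_cancel₀ hc.ne' hxy
    exact (Real.rpow_left_inj (le_of_lt hx) (le_of_lt hy) hl.ne').1 h1
  calc ∫⁻ y in Ioi (0 : ℝ), ENNReal.ofReal (y ^ (2 / l - 1)) *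
        (volume.restrict J) {t | ENNReal.ofReal y < v t} ^ (2 / l / (q / l))
      = ∫⁻ z in Ioi (0 : ℝ), ENNReal.ofReal |c * (l * z ^ (l - 1))| *
          (ENNReal.ofReal ((c * z ^ l) ^ (2 / l - 1)) *
            (volume.restrict J) {t | ENNReal.ofReal (c * z ^ l) < v t} ^ (2 / l / (q / l))) := by
        have h1 := lintegral_image_eq_lintegral_abs_deriv_mul measurableSet_Ioi hderiv hinj
          fun y => ENNReal.ofReal (y ^ (2 / l - 1)) *
            (volume.restrict J) {t | ENNReal.ofReal y < v t} ^ (2 / l / (q / l))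
        rwa [himg] at h1
    _ ≤ ∫⁻ z in Ioi (0 : ℝ), ENNReal.ofReal (l * c ^ (2 / l)) *
          (ENNReal.ofReal z * levelVol M z ^ (2 / q)) := by
        refine setLIntegral_mono' measurableSet_Ioi fun z hz => ?_
        have hz0 : (0 : ℝ) < z := hz
        have e1 : |c * (l * z ^ (l - 1))| * (c * z ^ l) ^ (2 / l - 1) = l * c ^ (2 / l) * z := by
          rw [abs_of_pos (by positivity), Real.mul_rpow hc.le (by positivity), ← Real.rpow_mul hz0.le,
            mul_sub, mul_div_cancel₀ _ hl.ne', Real.rpow_sub_one hc.ne']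
          have : z ^ (l - 1) * z ^ (2 - l * 1) = z := by
            rw [← Real.rpow_add hz0]
            convert Real.rpow_one z using 2
            ring
          calc _ = l * c ^ (2 / l) * (z ^ (l - 1) * z ^ (2 - l * 1)) := by
                field_simp
            _ = _ := by rw [this]
        rw [← mul_assoc (ENNReal.ofReal _), ← ENNReal.ofReal_mul (abs_nonneg _), e1,
          ENNReal.ofReal_mul (by positivity), mul_assoc, div_div_div_cancel_right₀ hl.ne']
        gcongr
        refine le_trans (measure_mono_ae ?_) (Measure.restrict_apply_le _ _)
        filter_upwards [h] with t ht hv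
        have h1 : ENNReal.ofReal (c * z ^ l) < ENNReal.ofReal c * M t ^ l := lt_of_lt_of_le hv ht
        rw [ENNReal.ofReal_mul hc.le] at h1
        have h2 := lt_of_mul_lt_mul_left' h1
        rw [← ENNReal.ofReal_rpow_of_pos hz0] at h2
        exact (ENNReal.rpow_lt_rpow_iff hl).1 h2
    _ = _ := lintegral_const_mul' _ _ ENNReal.ofReal_ne_top

theorem rieszPotential_mono {γ : ℝ} {S T : Set ℝ} {f g : ℝ → ℝ≥0∞} (hST : S ⊆ T) (hfg : ∀ t, f t ≤ g t)
    (t : ℝ) : rieszPotential γ S f t ≤ rieszPotential γ T g t := by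
  refine (lintegral_mono_set hST).trans (lintegral_mono fun s => ?_)
  gcongr
  exact hfg s

theorem rieszEnergy_mono {γ : ℝ} {S T : Set ℝ} {f g : ℝ → ℝ≥0∞} (hST : S ⊆ T) (hfg : ∀ t, f t ≤ g t) :
    rieszEnergy γ S f ≤ rieszEnergy γ T g := by
  unfold rieszEnergy
  refine (lintegral_mono_set hST).trans (lintegral_mono fun s => ?_)
  refine (lintegral_mono_set hST).trans (lintegral_mono fun t => ?_)
  gcongr
  · exact hfg t
  · exact hfg s

end LorentzNorm

/-! ### Truncated sources and localized Duhamel integrals -/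

section Approx

/-- A bounded measurable function of time and space which vanishes off a bounded set. -/
structure BoundedFamily (k : ℕ) (G : ℝ → ℝ → ℂ) : Prop where
  stronglyMeasurable : StronglyMeasurable (Function.uncurry G)
  norm_le : ∀ t x, ‖G t x‖ ≤ k
  support : ∀ t x, G t x ≠ 0 → |t| ≤ k ∧ |x| ≤ k

theorem StronglyMeasurable.slice {G : ℝ → ℝ → ℂ} (hG : StronglyMeasurable (Function.uncurry G)) (t : ℝ) :
    StronglyMeasurable (G t) := hG.comp_measurable measurable_prodMk_left

variable {k : ℕ} {G : ℝ → ℝ → ℂ}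

theorem BoundedFamily.eq_indicator (hG : BoundedFamily k G) (t : ℝ) :
    G t = (Icc (-(k : ℝ)) k).indicator (G t) := by
  refine (indicator_eq_self.2 fun x hx => ?_).symm
  exact abs_le.1 (hG.support t x hx).2

theorem BoundedFamily.nice (hG : BoundedFamily k G) (t : ℝ) : Nice (G t) := fun p _ => by
  rw [hG.eq_indicator t, memLp_indicator_iff_restrict measurableSet_Icc]
  exact MemLp.of_bound (StronglyMeasurable.slice hG.1 t).aestronglyMeasurable k
    (Filter.Eventually.of_forall (hG.norm_le t))

theorem BoundedFamily.eLpNorm_one_le (hG : BoundedFamily k G) (t : ℝ) :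
    eLpNorm (G t) 1 volume ≤ (Icc (-(k : ℝ)) k).indicator (fun _ => k * ENNReal.ofReal (2 * k)) t := by
  by_cases ht : t ∈ Icc (-(k : ℝ)) k
  · rw [indicator_of_mem ht, eLpNorm_one_eq_lintegral_enorm]
    calc ∫⁻ x, ‖G t x‖ₑ ≤ ∫⁻ x, (Icc (-(k : ℝ)) k).indicator (fun _ => (k : ℝ≥0∞)) x := by
          refine lintegral_mono fun x => ?_
          by_cases hx : G t x = 0
          · simp [hx]
          · rw [indicator_of_mem (show x ∈ Icc (-(k : ℝ)) k from abs_le.1 (hG.support t x hx).2),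
              ← ofReal_norm, ← ENNReal.ofReal_natCast]
            exact ENNReal.ofReal_le_ofReal (hG.norm_le t x)
      _ = _ := by
          rw [lintegral_indicator_const measurableSet_Icc, Real.volume_Icc]
          ring_nf
  · have : G t = 0 := by
      ext x
      by_contra hx
      exact ht (abs_le.1 (hG.support t x hx).1)
    rw [this, eLpNorm_zero]
    exact zero_le

theorem BoundedFamily.lintegral_eLpNorm_one_lt_top (hG : BoundedFamily k G) :
    ∫⁻ t, eLpNorm (G t) 1 volume < ∞ := by
  refine (lintegral_mono hG.eLpNorm_one_le).trans_lt ?_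
  rw [lintegral_indicator_const measurableSet_Icc, Real.volume_Icc]
  exact ENNReal.mul_lt_top (ENNReal.mul_lt_top (ENNReal.natCast_lt_top k) ENNReal.ofReal_lt_top)
    ENNReal.ofReal_lt_top

theorem BoundedFamily.niceFamily (hG : BoundedFamily k G) (S : Set ℝ) : NiceFamily S G :=
  ⟨hG.1, hG.nice, (setLIntegral_le_lintegral _ _).trans_lt hG.lintegral_eLpNorm_one_lt_top⟩

/-- The truncation of a function of time and space. -/
noncomputable def truncFamily (h : ℝ → ℝ → ℂ) (n : ℕ) (s x : ℝ) : ℂ :=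
  if |s| ≤ n ∧ |x| ≤ n ∧ ‖h s x‖ ≤ n then h s x else 0

theorem boundedFamily_truncFamily {h : ℝ → ℝ → ℂ} (hh : StronglyMeasurable (Function.uncurry h)) (n : ℕ) :
    BoundedFamily n (truncFamily h n) := by
  refine ⟨?_, fun t x => ?_, fun t x hx => ?_⟩
  · refine StronglyMeasurable.ite (p := fun q : ℝ × ℝ => |q.1| ≤ n ∧ |q.2| ≤ n ∧ ‖h q.1 q.2‖ ≤ n) ?_ hh
      stronglyMeasurable_const
    exact (measurableSet_le (f := fun q : ℝ × ℝ => |q.1|) (by fun_prop) measurable_const).inter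
      ((measurableSet_le (f := fun q : ℝ × ℝ => |q.2|) (by fun_prop) measurable_const).inter
        (measurableSet_le hh.norm.measurable measurable_const))
  · unfold truncFamily
    split_ifs with h1
    · exact h1.2.2
    · simp
  · by_contra h1
    exact hx (if_neg fun h2 => h1 ⟨h2.1, h2.2.1⟩)

theorem enorm_truncFamily_le (h : ℝ → ℝ → ℂ) (n : ℕ) (s x : ℝ) : ‖truncFamily h n s x‖ₑ ≤ ‖h s x‖ₑ := by
  unfold truncFamily
  split_ifs <;> simp

theorem eLpNorm_truncFamily_le (h : ℝ → ℝ → ℂ) (n : ℕ) (s : ℝ) (p : ℝ≥0∞) :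
    eLpNorm (truncFamily h n s) p volume ≤ eLpNorm (h s) p volume :=
  eLpNorm_mono_enorm fun x => enorm_truncFamily_le h n s x

theorem tendsto_truncFamily (h : ℝ → ℝ → ℂ) (s x : ℝ) :
    ∀ᶠ n in Filter.atTop, truncFamily h n s x = h s x := by
  obtain ⟨N, hN⟩ := exists_nat_ge (max |s| (max |x| ‖h s x‖))
  filter_upwards [Filter.eventually_ge_atTop N] with n hn
  have hn' : (N : ℝ) ≤ n := by exact_mod_cast hn
  have h1 := hN.trans hn'
  exact if_pos ⟨(le_max_left _ _).trans h1, (le_max_left _ _).trans ((le_max_right _ _).trans h1),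
    (le_max_right _ _).trans ((le_max_right _ _).trans h1)⟩

/-- The sign of an oriented interval integral. -/
noncomputable def orientation (t₀ t : ℝ) : ℂ := if t₀ ≤ t then 1 else -1

theorem enorm_orientation (t₀ t : ℝ) : ‖orientation t₀ t‖ₑ = 1 := by
  unfold orientation
  split_ifs <;> simp

theorem measurable_orientation (t₀ : ℝ) : Measurable (orientation t₀) :=
  Measurable.ite measurableSet_Ici measurable_const measurable_const

/-- The frequency localized Duhamel integral. -/
noncomputable def bandDuhamel (n : ℕ) (σ t₀ : ℝ) (h : ℝ → ℝ → ℂ) (t x : ℝ) : ℂ :=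
  orientation t₀ t * bandSynth n (fun ξ => freqPow σ ξ * duhamelProfile (uIoc t₀ t) t h ξ) x

theorem measurableSet_uIoc_prod (t₀ : ℝ) : MeasurableSet {p : ℝ × ℝ | p.2 ∈ uIoc t₀ p.1} := by
  simp only [uIoc, mem_Ioc]
  exact (measurableSet_lt (by fun_prop) measurable_snd).inter (measurableSet_le measurable_snd (by fun_prop))

theorem stronglyMeasurable_duhamelProfile_uIoc (t₀ : ℝ) {h : ℝ → ℝ → ℂ}
    (hh : StronglyMeasurable (Function.uncurry h)) :
    StronglyMeasurable fun p : ℝ × ℝ => duhamelProfile (uIoc t₀ p.1) p.1 h p.2 := by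
  have h1 : StronglyMeasurable fun q : (ℝ × ℝ) × ℝ =>
      {p : ℝ × ℝ | p.2 ∈ uIoc t₀ p.1}.indicator (fun _ => (1 : ℂ)) (q.1.1, q.2) *
        (airySymbol (q.1.1 - q.2) q.1.2 * 𝓕 (h q.2) q.1.2) := by
    refine StronglyMeasurable.mul ?_ (StronglyMeasurable.mul ?_ ?_)
    · exact (stronglyMeasurable_const.indicator (measurableSet_uIoc_prod t₀)).comp_measurable
        (g := fun q : (ℝ × ℝ) × ℝ => (q.1.1, q.2)) (by fun_prop)
    · exact (continuous_airySymbol.comp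
        (by fun_prop : Continuous fun q : (ℝ × ℝ) × ℝ => (q.1.1 - q.2, q.1.2))).stronglyMeasurable
    · exact (stronglyMeasurable_fourier hh).comp_measurable
        (g := fun q : (ℝ × ℝ) × ℝ => (q.2, q.1.2)) (by fun_prop)
  have h2 := h1.integral_prod_right' (ν := volume)
  convert h2 using 2 with p
  rw [duhamelProfile, ← integral_indicator measurableSet_uIoc]
  congr 1
  ext s
  by_cases hs : s ∈ uIoc t₀ p.1 <;> simp [hs]

theorem stronglyMeasurable_bandDuhamel (n : ℕ) (σ t₀ : ℝ) {h : ℝ → ℝ → ℂ}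
    (hh : StronglyMeasurable (Function.uncurry h)) :
    StronglyMeasurable (Function.uncurry (bandDuhamel n σ t₀ h)) := by
  have h1 : StronglyMeasurable (Function.uncurry fun t =>
      (band n).indicator fun ξ => freqPow σ ξ * duhamelProfile (uIoc t₀ t) t h ξ) := by
    have h2 : StronglyMeasurable fun p : ℝ × ℝ =>
        freqPow σ p.2 * duhamelProfile (uIoc t₀ p.1) p.1 h p.2 :=
      ((measurable_freqPow _).stronglyMeasurable.comp_measurable measurable_snd).mul
        (stronglyMeasurable_duhamelProfile_uIoc t₀ hh)
    convert h2.indicator (measurable_snd (measurableSet_band n)) using 1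
    ext p
    by_cases hp : p.2 ∈ band n
    · simp [Function.uncurry, hp]
    · simp [Function.uncurry, hp]
  have h3 := (stronglyMeasurable_fourier h1).comp_measurable
    (g := fun q : ℝ × ℝ => (q.1, -q.2)) (by fun_prop)
  exact ((measurable_orientation t₀).comp measurable_fst).stronglyMeasurable.mul h3

theorem BoundedFamily.integral_bandDuhamel_mul (hG : BoundedFamily k G) (n : ℕ) (σ t₀ t : ℝ) {g : ℝ → ℂ}
    (hg : Integrable g) :
    ∫ x, bandDuhamel n σ t₀ G t x * g x = orientation t₀ t *
      bandPairing n (fun ξ => freqPow σ ξ * duhamelProfile (uIoc t₀ t) t G ξ) g := by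
  rw [bandPairing_eq_integral_bandSynth (integrableOn_freqPow_mul
    (integrableOn_duhamelProfile (hG.niceFamily _) t) _) hg, ← integral_const_mul]
  congr 1
  ext x
  rw [bandDuhamel]
  ring

theorem BoundedFamily.exists_enorm_bandDuhamel_le (hG : BoundedFamily k G) (n : ℕ) (σ t₀ : ℝ) :
    ∃ C : ℝ≥0∞, C ≠ ∞ ∧ ∀ t x, ‖bandDuhamel n σ t₀ G t x‖ₑ ≤ C := by
  refine ⟨ENNReal.ofReal (((n : ℝ) + 1) ^ |σ|) * (∫⁻ s, eLpNorm (G s) 1 volume) * volume (band n), ?_,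
    fun t x => ?_⟩
  · exact ENNReal.mul_ne_top (ENNReal.mul_ne_top ENNReal.ofReal_ne_top hG.lintegral_eLpNorm_one_lt_top.ne)
      (volume_band_lt_top n).ne
  · rw [bandDuhamel, enorm_mul, enorm_orientation, one_mul, bandSynth]
    refine (enorm_fourier_le _).trans ?_
    rw [eLpNorm_indicator_eq_eLpNorm_restrict (measurableSet_band n), eLpNorm_one_eq_lintegral_enorm,
      ← setLIntegral_const]
    refine setLIntegral_mono' (measurableSet_band n) fun ξ hξ => ?_
    rw [enorm_mul]
    gcongr
    · simpa using enorm_freqPow_le (σ : ℂ) hξ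
    · exact (enorm_duhamelProfile_le _ _ _ _).trans (setLIntegral_le_lintegral _ _)

/-- The pairing of a frequency localized Duhamel integral over any set of times. -/
theorem BoundedFamily.enorm_bandPairing_le (hG : BoundedFamily k G) (n : ℕ) {α θ θ' : ℝ}
    (hα : α ∈ Icc (0 : ℝ) (1 / 2)) (hθ : θ ∈ Ioo (0 : ℝ) 1) (hθ' : 0 < θ') (hle : θ' ≤ θ) (S : Set ℝ)
    (t : ℝ) {g : ℝ → ℂ} (hg : Nice g) {f : ℝ → ℝ≥0∞}
    (hf : ∀ s, eLpNorm (G s) (ENNReal.ofReal (2 / (1 + θ))) volume ≤ f s)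
    (hE : rieszEnergy (θ * (1 + α) / 3) univ f ≠ ∞) (hM : rieszPotential (θ * (1 + α) / 3) univ f t ≠ ∞) :
    ‖bandPairing n (fun ξ => freqPow ((θ * α / 2 + θ' * α / 2 : ℝ) : ℂ) ξ * duhamelProfile S t G ξ) g‖ₑ ≤
      324 * (rieszEnergy (θ * (1 + α) / 3) univ f ^ ((1 - θ' / θ) / 2) *
        rieszPotential (θ * (1 + α) / 3) univ f t ^ (θ' / θ)) *
        eLpNorm g (ENNReal.ofReal (2 / (1 + θ'))) volume := by
  have h1 := rieszEnergy_mono (γ := θ * (1 + α) / 3) (subset_univ S) hf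
  have h2 := rieszPotential_mono (γ := θ * (1 + α) / 3) (subset_univ S) hf t
  refine (enorm_bandPairing_duhamelProfile_le n hα hθ hθ' hle (hG.niceFamily S) t hg (fun s => rfl)
    (ne_top_of_le_ne_top hE h1) (ne_top_of_le_ne_top hM h2)).trans ?_
  have h0 : 0 < θ' / θ := div_pos hθ' hθ.1
  have h3 : 0 ≤ (1 - θ' / θ) / 2 := by
    have : θ' / θ ≤ 1 := (div_le_one hθ.1).2 hle
    linarith
  gcongr

end Approx

/-! ### Converse of Hölder's inequality for mixed norms -/

section Converse

variable {k : ℕ} {G : ℝ → ℝ → ℂ}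

theorem BoundedFamily.integrable (hG : BoundedFamily k G) :
    Integrable (Function.uncurry G) (volume.prod volume) := by
  refine ⟨hG.1.aestronglyMeasurable, ?_⟩
  have h1 : ∫⁻ z : ℝ × ℝ, ‖Function.uncurry G z‖ₑ ∂(volume.prod volume) = ∫⁻ t, eLpNorm (G t) 1 volume := by
    rw [lintegral_prod _ hG.1.enorm.aemeasurable]
    refine lintegral_congr fun t => ?_
    rw [eLpNorm_one_eq_lintegral_enorm]
    rfl
  exact h1.trans_lt hG.lintegral_eLpNorm_one_lt_top

theorem BoundedFamily.enorm_integral_ofReal {r : ℝ → ℝ → ℝ} (hr : BoundedFamily k fun t x => (r t x : ℂ))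
    (h0 : ∀ t x, 0 ≤ r t x) :
    ‖∫ t, ∫ x, (r t x : ℂ)‖ₑ = ∫⁻ t, ∫⁻ x, ENNReal.ofReal (r t x) := by
  have h1 : Integrable (fun z : ℝ × ℝ => r z.1 z.2) (volume.prod volume) := by
    have h2 := hr.integrable.re
    exact h2
  have h3 : ∫ t, ∫ x, (r t x : ℂ) = ((∫ z : ℝ × ℝ, r z.1 z.2 ∂(volume.prod volume) : ℝ) : ℂ) := by
    rw [← integral_complex_ofReal]
    exact (integral_prod _ hr.integrable).symm
  rw [h3, ← ofReal_norm, Complex.norm_real, Real.norm_of_nonneg (integral_nonneg fun z => h0 _ _),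
    ofReal_integral_eq_lintegral_ofReal h1 (Filter.Eventually.of_forall fun z => h0 _ _),
    lintegral_prod _ h1.1.aemeasurable.ennreal_ofReal]

theorem tendsto_eLpNorm_truncFamily {u : ℝ → ℝ → ℂ} (hu : StronglyMeasurable (Function.uncurry u)) {p : ℝ}
    (hp : 0 < p) (t : ℝ) :
    Filter.Tendsto (fun n => eLpNorm (truncFamily u n t) (ENNReal.ofReal p) volume) Filter.atTop
      (nhds (eLpNorm (u t) (ENNReal.ofReal p) volume)) := by
  have h1 : ∀ v : ℝ → ℂ, eLpNorm v (ENNReal.ofReal p) volume = (∫⁻ x, ‖v x‖ₑ ^ p) ^ (1 / p) := fun v => by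
    rw [eLpNorm_eq_lintegral_rpow_enorm_toReal (by simpa using hp) ENNReal.ofReal_ne_top,
      ENNReal.toReal_ofReal hp.le]
  simp_rw [h1]
  refine (ENNReal.continuous_rpow_const.tendsto _).comp ?_
  refine lintegral_tendsto_of_tendsto_of_monotone (fun n => ?_) (Filter.Eventually.of_forall fun x => ?_)
    (Filter.Eventually.of_forall fun x => ?_)
  · exact (((StronglyMeasurable.slice (boundedFamily_truncFamily hu n).1 t).enorm).pow_const p).aemeasurable
  · intro i j hij
    simp only
    gcongr
    have hij' : (i : ℝ) ≤ j := by exact_mod_cast hij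
    unfold truncFamily
    by_cases hi : |t| ≤ i ∧ |x| ≤ i ∧ ‖u t x‖ ≤ i
    · rw [if_pos hi, if_pos ⟨hi.1.trans hij', hi.2.1.trans hij', hi.2.2.trans hij'⟩]
    · rw [if_neg hi]
      simp
  · refine tendsto_const_nhds.congr' ?_
    filter_upwards [tendsto_truncFamily u t x] with n hn
    rw [hn]

theorem eLpNorm_truncFamily_mono (u : ℝ → ℝ → ℂ) (p : ℝ≥0∞) (t : ℝ) :
    Monotone fun n => eLpNorm (truncFamily u n t) p volume := by
  intro i j hij
  refine eLpNorm_mono_enorm fun x => ?_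
  have hij' : (i : ℝ) ≤ j := by exact_mod_cast hij
  unfold truncFamily
  by_cases hi : |t| ≤ i ∧ |x| ≤ i ∧ ‖u t x‖ ≤ i
  · rw [if_pos hi, if_pos ⟨hi.1.trans hij', hi.2.1.trans hij', hi.2.2.trans hij'⟩]
  · rw [if_neg hi]
    simp

/-- The extremizer in the inequality of Hölder, in the space variable. -/
theorem exists_extremizer {p p' : ℝ} (hpp : p.HolderConjugate p') {u : ℝ → ℝ → ℂ}
    (hu : StronglyMeasurable (Function.uncurry u)) {a : ℝ → ℝ≥0∞} (ha : Measurable a) (ha' : BoundedSupport a)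
    (n : ℕ) :
    ∃ (k : ℕ) (G : ℝ → ℝ → ℂ), BoundedFamily k G ∧
      (∀ t, eLpNorm (G t) (ENNReal.ofReal p') volume ≤ a t) ∧
      ‖∫ t, ∫ x, u t x * G t x‖ₑ = ∫⁻ t, if 1 / ((n : ℝ≥0∞) + 1) ≤
        eLpNorm (truncFamily u n t) (ENNReal.ofReal p) volume then
          a t * eLpNorm (truncFamily u n t) (ENNReal.ofReal p) volume else 0 := by
  obtain ⟨m, hm⟩ := ha'
  have hp0 : 0 < p := hpp.pos
  have hp1 : 0 < p - 1 := hpp.sub_one_pos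
  set v := truncFamily u n with hv
  have hvb : BoundedFamily n v := boundedFamily_truncFamily hu n
  set N : ℝ → ℝ≥0∞ := fun t => eLpNorm (v t) (ENNReal.ofReal p) volume with hN
  have hNm : Measurable N := measurable_eLpNorm_slice hvb.1 hp0
  have hNt : ∀ t, N t ≠ ∞ := fun t => ((hvb.nice t) _ (by simpa using hpp.lt.le)).2.ne
  have hNp : ∀ t, ∫⁻ x, ‖v t x‖ₑ ^ p = N t ^ p := fun t => by
    rw [hN]
    simp only
    rw [eLpNorm_eq_lintegral_rpow_enorm_toReal (by simpa using hp0) ENNReal.ofReal_ne_top,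
      ENNReal.toReal_ofReal hp0.le, ← ENNReal.rpow_mul, one_div, inv_mul_cancel₀ hp0.ne', ENNReal.rpow_one]
  have hat : ∀ t, a t ≠ ∞ := fun t => ((hm t).1.trans_lt (ENNReal.natCast_lt_top m)).ne
  -- The factor `a t * N t ^ (1 - p)` normalizes `|v| ^ (p - 2)` times the conjugate of `v` to have
  -- dual norm `a t`. The exponent `1 - p` is negative, so times at which `N` is below `1 / (n + 1)`
  -- are discarded; this keeps `c` bounded.
  set c : ℝ → ℝ := fun t => if 1 / ((n : ℝ≥0∞) + 1) ≤ N t then (a t).toReal * (N t).toReal ^ (1 - p) else 0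
    with hc
  have hcm : Measurable c := Measurable.ite (measurableSet_le measurable_const hNm)
    (ha.ennreal_toReal.mul (hNm.ennreal_toReal.pow_const _)) measurable_const
  have hc0 : ∀ t, 0 ≤ c t := fun t => by
    simp only [hc]
    split_ifs <;> positivity
  have hN1 : ∀ t, 1 / ((n : ℝ≥0∞) + 1) ≤ N t → 1 / ((n : ℝ) + 1) ≤ (N t).toReal := fun t ht => by
    have := ENNReal.toReal_mono (hNt t) ht
    rwa [ENNReal.toReal_div, ENNReal.toReal_add (by simp) (by simp), ENNReal.toReal_one,
      ENNReal.toReal_natCast] at this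
  set B : ℝ := m * ((n : ℝ) + 1) ^ (p - 1) with hB
  have hcB : ∀ t, c t ≤ B := fun t => by
    simp only [hc]
    split_ifs with ht
    · rw [hB]
      gcongr
      · have := ENNReal.toReal_mono (ENNReal.natCast_ne_top m) (hm t).1
        simpa using this
      · calc (N t).toReal ^ (1 - p) ≤ (1 / ((n : ℝ) + 1)) ^ (1 - p) :=
              Real.rpow_le_rpow_of_nonpos (by positivity) (hN1 t ht) (by linarith)
          _ = _ := by
              rw [one_div, Real.inv_rpow (by positivity), ← Real.rpow_neg (by positivity), neg_sub]
    · positivity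
  have hvm : StronglyMeasurable (Function.uncurry v) := hvb.1
  have hnv : ∀ t x, ‖v t x‖ ^ (p - 1) ≤ (n : ℝ) ^ (p - 1) := fun t x =>
    Real.rpow_le_rpow (norm_nonneg _) (hvb.norm_le t x) hp1.le
  have hpow : ∀ t x, ‖v t x‖ ^ (p - 2) * ‖v t x‖ = ‖v t x‖ ^ (p - 1) := fun t x => by
    rcases eq_or_ne (v t x) 0 with h | h
    · rw [h, norm_zero, mul_zero, Real.zero_rpow hp1.ne']
    · rw [← Real.rpow_add_one (norm_ne_zero_iff.2 h)]
      congr 1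
      ring
  have hpow2 : ∀ t x, ‖v t x‖ ^ (p - 1) * ‖v t x‖ = ‖v t x‖ ^ p := fun t x => by
    rcases eq_or_ne (v t x) 0 with h | h
    · rw [h, norm_zero, mul_zero, Real.zero_rpow hp0.ne']
    · rw [← Real.rpow_add_one (norm_ne_zero_iff.2 h)]
      congr 1
      ring
  set G : ℝ → ℝ → ℂ := fun t x => ((c t * ‖v t x‖ ^ (p - 2) : ℝ) : ℂ) * (starRingEnd ℂ) (v t x) with hG
  have hGnorm : ∀ t x, ‖G t x‖ = c t * ‖v t x‖ ^ (p - 1) := fun t x => by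
    simp only [hG]
    rw [norm_mul, Complex.norm_real, RCLike.norm_conj, Real.norm_of_nonneg
      (mul_nonneg (hc0 t) (by positivity)), mul_assoc, hpow]
  -- `G` vanishes where the truncation `v` vanishes, and elsewhere `v = u`; the pairing with `u` is
  -- therefore the pairing with `v`, which is nonnegative.
  have hr : ∀ t x, u t x * G t x = ((c t * ‖v t x‖ ^ p : ℝ) : ℂ) := fun t x => by
    rcases eq_or_ne (v t x) 0 with h | h
    · simp only [hG, h]
      rw [norm_zero, Real.zero_rpow hp0.ne']
      simp
    · have huv : u t x = v t x := by
        rw [hv] at h ⊢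
        unfold truncFamily at h ⊢
        split_ifs with h1
        · rfl
        · simp [h1] at h
      have h2 : v t x * (starRingEnd ℂ) (v t x) = ((‖v t x‖ * ‖v t x‖ : ℝ) : ℂ) := by
        rw [Complex.mul_conj, Complex.normSq_eq_norm_sq, sq]
      calc u t x * G t x = ((c t * ‖v t x‖ ^ (p - 2) : ℝ) : ℂ) * (v t x * (starRingEnd ℂ) (v t x)) := by
            rw [huv]
            simp only [hG]
            ring
        _ = ((c t * (‖v t x‖ ^ (p - 2) * ‖v t x‖ * ‖v t x‖) : ℝ) : ℂ) := by
            rw [h2]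
            push_cast
            ring
        _ = _ := by rw [hpow, hpow2]
  obtain ⟨k, hk⟩ := exists_nat_ge (max (n : ℝ) (max (B * (n : ℝ) ^ (p - 1)) (B * (n : ℝ) ^ p)))
  have hkn : (n : ℝ) ≤ k := (le_max_left _ _).trans hk
  have hk1 : B * (n : ℝ) ^ (p - 1) ≤ k := (le_max_left _ _).trans ((le_max_right _ _).trans hk)
  have hk2 : B * (n : ℝ) ^ p ≤ k := (le_max_right _ _).trans ((le_max_right _ _).trans hk)
  have hB0 : 0 ≤ B := by positivity
  have hGb : BoundedFamily k G := by
    refine ⟨?_, fun t x => ?_, fun t x hx => ?_⟩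
    · refine StronglyMeasurable.mul ?_ ?_
      · exact (Complex.measurable_ofReal.comp ((hcm.comp measurable_fst).mul
          (hvm.norm.measurable.pow_const _))).stronglyMeasurable
      · exact (RCLike.continuous_conj (K := ℂ)).comp_stronglyMeasurable hvm
    · rw [hGnorm]
      exact (mul_le_mul (hcB t) (hnv t x) (by positivity) hB0).trans hk1
    · have hvx : v t x ≠ 0 := fun h => hx (by simp [hG, h])
      have := hvb.support t x hvx
      exact ⟨this.1.trans hkn, this.2.trans hkn⟩
  have hrb : BoundedFamily k fun t x => ((c t * ‖v t x‖ ^ p : ℝ) : ℂ) := by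
    refine ⟨?_, fun t x => ?_, fun t x hx => ?_⟩
    · exact (Complex.measurable_ofReal.comp ((hcm.comp measurable_fst).mul
          (hvm.norm.measurable.pow_const _))).stronglyMeasurable
    · rw [Complex.norm_real, Real.norm_of_nonneg (mul_nonneg (hc0 t) (by positivity))]
      exact (mul_le_mul (hcB t) (Real.rpow_le_rpow (norm_nonneg _) (hvb.norm_le t x) hp0.le)
        (by positivity) hB0).trans hk2
    · have hvx : v t x ≠ 0 := fun h => hx (by simp [h, Real.zero_rpow hp0.ne'])
      have := hvb.support t x hvx
      exact ⟨this.1.trans hkn, this.2.trans hkn⟩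
  have hcN : ∀ t, ENNReal.ofReal (c t) = if 1 / ((n : ℝ≥0∞) + 1) ≤ N t then a t * N t ^ (1 - p) else 0 := by
    intro t
    simp only [hc]
    split_ifs with ht
    · have h0 : 0 < (N t).toReal := lt_of_lt_of_le (by positivity) (hN1 t ht)
      rw [ENNReal.ofReal_mul ENNReal.toReal_nonneg, ENNReal.ofReal_toReal (hat t),
        ← ENNReal.ofReal_rpow_of_pos h0, ENNReal.ofReal_toReal (hNt t)]
    · simp
  have hN0 : ∀ t, 1 / ((n : ℝ≥0∞) + 1) ≤ N t → N t ≠ 0 := fun t ht h0 => by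
    rw [h0] at ht
    simp at ht
  refine ⟨k, G, hGb, fun t => ?_, ?_⟩
  · have hp'0 : 0 < p' := hpp.symm.pos
    have hexp : (p - 1) * p' = p := hpp.sub_one_mul_conj
    rw [eLpNorm_eq_lintegral_rpow_enorm_toReal (by simpa using hp'0) ENNReal.ofReal_ne_top,
      ENNReal.toReal_ofReal hp'0.le]
    have h1 : ∀ x, ‖G t x‖ₑ ^ p' = ENNReal.ofReal (c t) ^ p' * ‖v t x‖ₑ ^ p := fun x => by
      rw [← ofReal_norm, hGnorm, ENNReal.ofReal_mul (hc0 t), ENNReal.mul_rpow_of_nonneg _ _ hp'0.le,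
        ← ENNReal.ofReal_rpow_of_nonneg (norm_nonneg _) hp1.le, ← ENNReal.rpow_mul, hexp, ofReal_norm]
    simp_rw [h1]
    rw [lintegral_const_mul' _ _ (ENNReal.rpow_ne_top_of_nonneg hp'0.le ENNReal.ofReal_ne_top), hNp,
      ENNReal.mul_rpow_of_nonneg _ _ (by positivity), ← ENNReal.rpow_mul, ← ENNReal.rpow_mul,
      mul_one_div_cancel hp'0.ne', ENNReal.rpow_one, hcN]
    split_ifs with ht
    · have he : p * (1 / p') = p - 1 := by
        rw [eq_comm, eq_div_of_mul_eq hp'0.ne' hexp]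
        ring
      rw [he, mul_assoc, ← ENNReal.rpow_add _ _ (hN0 t ht) (hNt t)]
      simp
    · simp
  · simp_rw [hr]
    rw [hrb.enorm_integral_ofReal fun t x => mul_nonneg (hc0 t) (by positivity)]
    refine lintegral_congr fun t => ?_
    have h1 : ∀ x, ENNReal.ofReal (c t * ‖v t x‖ ^ p) = ENNReal.ofReal (c t) * ‖v t x‖ₑ ^ p := fun x => by
      rw [ENNReal.ofReal_mul (hc0 t), ← ENNReal.ofReal_rpow_of_nonneg (norm_nonneg _) hp0.le, ofReal_norm]
    simp_rw [h1]
    rw [lintegral_const_mul' _ _ ENNReal.ofReal_ne_top, hNp, hcN]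
    split_ifs with ht
    · rw [mul_assoc, ← ENNReal.rpow_add _ _ (hN0 t ht) (hNt t)]
      simp [hN]
    · simp

/-- The converse of the inequality of Hölder, with values in functionals of the norms in time. -/
theorem lintegral_eLpNorm_mul_le {p p' : ℝ} (hpp : p.HolderConjugate p') {u : ℝ → ℝ → ℂ}
    (hu : StronglyMeasurable (Function.uncurry u)) {Φ : (ℝ → ℝ≥0∞) → ℝ≥0∞} (hΦ : Monotone Φ)
    (h : ∀ (k : ℕ) (G : ℝ → ℝ → ℂ), BoundedFamily k G →
      ‖∫ t, ∫ x, u t x * G t x‖ₑ ≤ Φ fun t => eLpNorm (G t) (ENNReal.ofReal p') volume)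
    {a : ℝ → ℝ≥0∞} (ha : Measurable a) (ha' : BoundedSupport a) :
    ∫⁻ t, eLpNorm (u t) (ENNReal.ofReal p) volume * a t ≤ Φ a := by
  set N : ℕ → ℝ → ℝ≥0∞ := fun n t => eLpNorm (truncFamily u n t) (ENNReal.ofReal p) volume with hN
  have hNm : ∀ n, Measurable (N n) := fun n =>
    measurable_eLpNorm_slice (boundedFamily_truncFamily hu n).1 hpp.pos
  have hat : ∀ t, a t ≠ ∞ := fun t => by
    obtain ⟨m, hm⟩ := ha'
    exact ((hm t).1.trans_lt (ENNReal.natCast_lt_top m)).ne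
  have hle : ∀ n : ℕ, (∫⁻ t, if 1 / ((n : ℝ≥0∞) + 1) ≤ N n t then a t * N n t else 0) ≤ Φ a := fun n => by
    obtain ⟨k, G, hG, h1, h2⟩ := exists_extremizer hpp hu ha ha' n
    rw [← h2]
    exact (h k G hG).trans (hΦ h1)
  -- Both the truncation and the threshold relax as `n` grows, so the integrands increase. At a time
  -- where the limiting norm is zero all terms vanish; at any other time the threshold is eventually
  -- passed.
  refine le_of_tendsto' (lintegral_tendsto_of_tendsto_of_monotone
    (f := fun n t => if 1 / ((n : ℝ≥0∞) + 1) ≤ N n t then a t * N n t else 0) (fun n => ?_)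
    (Filter.Eventually.of_forall fun t => ?_) (Filter.Eventually.of_forall fun t => ?_)) hle
  · exact (Measurable.ite (measurableSet_le measurable_const (hNm n)) (ha.mul (hNm n))
      measurable_const).aemeasurable
  · intro i j hij
    simp only
    have h1 : N i t ≤ N j t := eLpNorm_truncFamily_mono u _ t hij
    by_cases hi : 1 / ((i : ℝ≥0∞) + 1) ≤ N i t
    · have h2 : 1 / ((j : ℝ≥0∞) + 1) ≤ 1 / ((i : ℝ≥0∞) + 1) := by gcongr
      rw [if_pos hi, if_pos (h2.trans (hi.trans h1))]
      gcongr
    · rw [if_neg hi]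
      exact zero_le
  · have h1 := tendsto_eLpNorm_truncFamily hu hpp.pos t
    rw [mul_comm]
    rcases eq_or_ne (eLpNorm (u t) (ENNReal.ofReal p) volume) 0 with h0 | h0
    · rw [h0, mul_zero]
      refine tendsto_const_nhds.congr fun n => ?_
      have : N n t = 0 := le_antisymm ((eLpNorm_truncFamily_le u n t _).trans h0.le) zero_le
      simp [this]
    · refine (ENNReal.Tendsto.const_mul h1 (Or.inr (hat t))).congr' ?_
      have h2 : Filter.Tendsto (fun n : ℕ => 1 / ((n : ℝ≥0∞) + 1)) Filter.atTop (nhds 0) := by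
        have := ENNReal.tendsto_inv_nat_nhds_zero.comp (Filter.tendsto_add_atTop_nat 1)
        refine this.congr fun n => ?_
        simp
      filter_upwards [h2.eventually_lt h1 (pos_iff_ne_zero.2 h0)] with n hn
      rw [if_pos hn.le]

end Converse

/-! ### Dual estimates for localized Duhamel integrals -/

section DualEstimates

variable {k m : ℕ} {G h : ℝ → ℝ → ℂ}

theorem rieszPotential_ae_lt_top {γ : ℝ} (hγ0 : 0 < γ) (hγ1 : γ < 1) {f : ℝ → ℝ≥0∞} (hf : Measurable f)
    (hE : rieszEnergy γ univ f ≠ ∞) : ∀ᵐ t, rieszPotential γ univ f t < ∞ := by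
  refine ae_lt_top_of_lorentzSq hγ0 (ne_top_of_le_ne_top ?_ (lorentzSq_rieszPotential_le hγ0 hγ1 hf))
  exact ENNReal.mul_ne_top (ENNReal.mul_ne_top (by norm_num) ENNReal.ofReal_ne_top) hE

/-- The dual estimate for a Duhamel integral, when the exponent of the source dominates. -/
theorem enorm_integral_bandDuhamel_le (hh : BoundedFamily m h) (hG : BoundedFamily k G) (n : ℕ) (t₀ : ℝ)
    {α θ θ' : ℝ} (hα : α ∈ Icc (0 : ℝ) (1 / 2)) (hθ : θ ∈ Ioo (0 : ℝ) 1) (hθ' : 0 < θ') (hle : θ' ≤ θ)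
    {f : ℝ → ℝ≥0∞} (hfm : Measurable f)
    (hf : ∀ s, eLpNorm (h s) (ENNReal.ofReal (2 / (1 + θ))) volume ≤ f s)
    (hE : rieszEnergy (θ * (1 + α) / 3) univ f ≠ ∞) :
    ‖∫ t, ∫ x, bandDuhamel n (θ * α / 2 + θ' * α / 2) t₀ h t x * G t x‖ₑ ≤
      ∫⁻ t, 324 * (rieszEnergy (θ * (1 + α) / 3) univ f ^ ((1 - θ' / θ) / 2) *
        rieszPotential (θ * (1 + α) / 3) univ f t ^ (θ' / θ)) *
        eLpNorm (G t) (ENNReal.ofReal (2 / (1 + θ'))) volume := by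
  have hγ0 : 0 < θ * (1 + α) / 3 := by
    have := mul_pos hθ.1 (by linarith [hα.1] : 0 < 1 + α)
    linarith
  have hγ1 : θ * (1 + α) / 3 < 1 := by
    have : θ * (1 + α) ≤ 1 * (1 + 1 / 2) :=
      mul_le_mul hθ.2.le (by linarith [hα.2]) (by linarith [hα.1]) zero_le_one
    linarith
  refine (enorm_integral_le_lintegral_enorm _).trans (lintegral_mono_ae ?_)
  filter_upwards [rieszPotential_ae_lt_top hγ0 hγ1 hfm hE] with t ht
  rw [hh.integral_bandDuhamel_mul n _ t₀ t (hG.nice t).integrable, enorm_mul, enorm_orientation, one_mul]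
  exact hh.enorm_bandPairing_le n hα hθ hθ' hle _ t (hG.nice t) hf hE ht.ne

theorem stronglyMeasurable_bandForm (n : ℕ) (z : ℂ) (hh : StronglyMeasurable (Function.uncurry h))
    (hG : StronglyMeasurable (Function.uncurry G)) :
    StronglyMeasurable fun p : ℝ × ℝ => bandForm n z (p.1 - p.2) (h p.2) (G p.1) := by
  have h1 : StronglyMeasurable fun q : (ℝ × ℝ) × ℝ =>
      freqPow z q.2 * (airySymbol (q.1.1 - q.1.2) q.2 * 𝓕 (h q.1.2) q.2) * 𝓕 (G q.1.1) (-q.2) := by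
    refine StronglyMeasurable.mul (StronglyMeasurable.mul ?_ (StronglyMeasurable.mul ?_ ?_)) ?_
    · exact (measurable_freqPow z).stronglyMeasurable.comp_measurable measurable_snd
    · exact (continuous_airySymbol.comp
        (by fun_prop : Continuous fun q : (ℝ × ℝ) × ℝ => (q.1.1 - q.1.2, q.2))).stronglyMeasurable
    · exact (stronglyMeasurable_fourier hh).comp_measurable
        (g := fun q : (ℝ × ℝ) × ℝ => (q.1.2, q.2)) (by fun_prop)
    · exact (stronglyMeasurable_fourier hG).comp_measurable
        (g := fun q : (ℝ × ℝ) × ℝ => (q.1.1, -q.2)) (by fun_prop)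
  exact h1.integral_prod_right' (ν := volume.restrict (band n))

theorem enorm_bandForm_le_mul (n : ℕ) (z : ℂ) (τ : ℝ) (f : ℝ → ℂ) {g : ℝ → ℂ} (hg : Integrable g) :
    ‖bandForm n z τ f g‖ₑ ≤ ENNReal.ofReal (((n : ℝ) + 1) ^ |z.re|) * volume (band n) *
      (eLpNorm f 1 volume * eLpNorm g 1 volume) := by
  refine (enorm_bandPairing_le_one hg).trans ?_
  rw [← mul_assoc]
  gcongr
  calc ∫⁻ ξ in band n, ‖freqPow z ξ * (airySymbol τ ξ * 𝓕 f ξ)‖ₑ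
      ≤ ∫⁻ _ in band n, ENNReal.ofReal (((n : ℝ) + 1) ^ |z.re|) * eLpNorm f 1 volume := by
        refine setLIntegral_mono' (measurableSet_band n) fun ξ hξ => ?_
        rw [enorm_mul, enorm_mul, enorm_airySymbol, one_mul]
        gcongr
        · exact enorm_freqPow_le z hξ
        · exact enorm_fourier_le ξ
    _ = _ := by
        rw [setLIntegral_const]
        ring

/-- The sign depends only on the position of `s` relative to `t₀`. After Fubini it therefore leaves
the integral over `t`. -/
theorem orientation_eq_of_mem {t₀ s t : ℝ} (h : s ∈ uIoc t₀ t) :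
    orientation t₀ t = if t₀ < s then 1 else -1 := by
  unfold orientation
  rcases le_total t₀ t with ht | ht
  · rw [uIoc_of_le ht] at h
    rw [if_pos ht, if_pos h.1]
  · rw [uIoc_of_ge ht] at h
    rw [if_neg (not_le.2 (h.1.trans_le h.2)), if_neg (not_lt.2 h.2)]

/-- Fubini and `bandForm_swap` transpose the operator: the test family `G` becomes the source,
integrated over the times `t` for which `s` lies between `t₀` and `t`, and `h s` becomes the test
function. The fixed-time estimates hold for any set of times, so they apply to the transposed
integral as well. -/
theorem integral_bandDuhamel_mul_eq (hh : BoundedFamily m h) (hG : BoundedFamily k G) (n : ℕ) (σ t₀ : ℝ) :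
    ∫ t, ∫ x, bandDuhamel n σ t₀ h t x * G t x =
      ∫ s, (if t₀ < s then 1 else -1) *
        bandPairing n (fun ξ => freqPow σ ξ * duhamelProfile {t | s ∈ uIoc t₀ t} s G ξ) (h s) := by
  set P : Set (ℝ × ℝ) := {p | p.2 ∈ uIoc t₀ p.1} with hP
  have hPm : MeasurableSet P := measurableSet_uIoc_prod t₀
  set I : ℝ → ℝ → ℂ := fun t s => P.indicator (fun _ => (1 : ℂ)) (t, s) *
    (orientation t₀ t * bandForm n σ (t - s) (h s) (G t)) with hI
  have h1 : ∀ t, ∫ x, bandDuhamel n σ t₀ h t x * G t x = ∫ s, I t s := fun t => by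
    rw [hh.integral_bandDuhamel_mul n σ t₀ t (hG.nice t).integrable,
      bandPairing_duhamelProfile (hh.niceFamily _) t _ (hG.nice t).integrable, ← integral_const_mul,
      ← integral_indicator measurableSet_uIoc]
    congr 1
    ext s
    by_cases hs : s ∈ uIoc t₀ t
    · have : (t, s) ∈ P := hs
      simp [hI, hs, this]
    · have : (t, s) ∉ P := hs
      simp [hI, hs, this]
  have h2 : ∀ s, ∫ t, I t s = (if t₀ < s then 1 else -1) *
      bandPairing n (fun ξ => freqPow σ ξ * duhamelProfile {t | s ∈ uIoc t₀ t} s G ξ) (h s) := fun s => by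
    have hTm : MeasurableSet {t | s ∈ uIoc t₀ t} :=
      hPm.preimage (measurable_id.prodMk measurable_const : Measurable fun t : ℝ => (t, s))
    rw [bandPairing_duhamelProfile (hG.niceFamily _) s _ (hh.nice s).integrable, ← integral_const_mul,
      ← integral_indicator hTm]
    congr 1
    ext t
    by_cases ht : s ∈ uIoc t₀ t
    · have h3 : (t, s) ∈ P := ht
      have h4 : t ∈ {t | s ∈ uIoc t₀ t} := ht
      rw [indicator_of_mem h4, hI]
      simp only
      rw [indicator_of_mem h3, one_mul, orientation_eq_of_mem ht, bandForm_swap, neg_sub]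
    · have h3 : (t, s) ∉ P := ht
      have h4 : t ∉ {t | s ∈ uIoc t₀ t} := ht
      rw [indicator_of_notMem h4, hI]
      simp only
      rw [indicator_of_notMem h3, zero_mul]
  simp_rw [h1, ← h2]
  refine integral_integral_swap ⟨?_, ?_⟩
  · refine (StronglyMeasurable.mul ?_ (StronglyMeasurable.mul ?_ ?_)).aestronglyMeasurable
    · exact stronglyMeasurable_const.indicator hPm
    · exact ((measurable_orientation t₀).comp measurable_fst).stronglyMeasurable
    · exact stronglyMeasurable_bandForm n _ hh.1 hG.1
  · have hle : ∀ p : ℝ × ℝ, ‖Function.uncurry I p‖ₑ ≤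
        ENNReal.ofReal (((n : ℝ) + 1) ^ |((σ : ℝ) : ℂ).re|) * volume (band n) *
          (eLpNorm (h p.2) 1 volume * eLpNorm (G p.1) 1 volume) := fun p => by
      simp only [Function.uncurry, hI]
      rw [enorm_mul, enorm_mul, enorm_orientation, one_mul]
      calc _ ≤ 1 * ‖bandForm n σ (p.1 - p.2) (h p.2) (G p.1)‖ₑ := by
            gcongr
            by_cases hp : p ∈ P
            · rw [Prod.mk.eta, indicator_of_mem hp, enorm_one]
            · rw [Prod.mk.eta, indicator_of_notMem hp, enorm_zero]
              exact zero_le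
        _ ≤ _ := by
            rw [one_mul]
            exact enorm_bandForm_le_mul n _ _ _ (hG.nice _).integrable
    refine (lintegral_mono hle).trans_lt ?_
    have hm1 : Measurable fun s => eLpNorm (h s) 1 volume := by
      simpa using measurable_eLpNorm_slice hh.1 one_pos
    have hm2 : Measurable fun s => eLpNorm (G s) 1 volume := by
      simpa using measurable_eLpNorm_slice hG.1 one_pos
    have hC : ENNReal.ofReal (((n : ℝ) + 1) ^ |((σ : ℝ) : ℂ).re|) * volume (band n) ≠ ∞ :=
      ENNReal.mul_ne_top ENNReal.ofReal_ne_top (volume_band_lt_top n).ne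
    have hm3 : Measurable fun p : ℝ × ℝ => eLpNorm (h p.2) 1 volume * eLpNorm (G p.1) 1 volume :=
      (hm1.comp measurable_snd).mul (hm2.comp measurable_fst)
    rw [lintegral_const_mul' _ _ hC, lintegral_prod _ hm3.aemeasurable]
    simp_rw [lintegral_mul_const _ hm1]
    rw [lintegral_const_mul _ hm2]
    exact ENNReal.mul_lt_top hC.lt_top (ENNReal.mul_lt_top hh.lintegral_eLpNorm_one_lt_top
      hG.lintegral_eLpNorm_one_lt_top)

/-- The dual estimate for a Duhamel integral, when the exponent of the test function dominates. -/
theorem enorm_integral_bandDuhamel_le' (hh : BoundedFamily m h) (hG : BoundedFamily k G) (n : ℕ) (t₀ : ℝ)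
    {α θ θ' : ℝ} (hα : α ∈ Icc (0 : ℝ) (1 / 2)) (hθ : θ ∈ Ioo (0 : ℝ) 1) (hθ' : 0 < θ') (hle : θ' ≤ θ)
    {a : ℝ → ℝ≥0∞} (ham : Measurable a)
    (ha : ∀ s, eLpNorm (G s) (ENNReal.ofReal (2 / (1 + θ))) volume ≤ a s)
    (hE : rieszEnergy (θ * (1 + α) / 3) univ a ≠ ∞) :
    ‖∫ t, ∫ x, bandDuhamel n (θ * α / 2 + θ' * α / 2) t₀ h t x * G t x‖ₑ ≤
      ∫⁻ s, 324 * (rieszEnergy (θ * (1 + α) / 3) univ a ^ ((1 - θ' / θ) / 2) *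
        rieszPotential (θ * (1 + α) / 3) univ a s ^ (θ' / θ)) *
        eLpNorm (h s) (ENNReal.ofReal (2 / (1 + θ'))) volume := by
  have hγ0 : 0 < θ * (1 + α) / 3 := by
    have := mul_pos hθ.1 (by linarith [hα.1] : 0 < 1 + α)
    linarith
  have hγ1 : θ * (1 + α) / 3 < 1 := by
    have : θ * (1 + α) ≤ 1 * (1 + 1 / 2) :=
      mul_le_mul hθ.2.le (by linarith [hα.2]) (by linarith [hα.1]) zero_le_one
    linarith
  rw [integral_bandDuhamel_mul_eq hh hG]
  refine (enorm_integral_le_lintegral_enorm _).trans (lintegral_mono_ae ?_)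
  filter_upwards [rieszPotential_ae_lt_top hγ0 hγ1 ham hE] with s hs
  have h1 : ‖(if t₀ < s then 1 else -1 : ℂ)‖ₑ = 1 := by split_ifs <;> simp
  rw [enorm_mul, h1, one_mul]
  exact hG.enorm_bandPairing_le n hα hθ hθ' hle _ s (hh.nice s) ha hE hs.ne

end DualEstimates

/-! ### Pairing an `L^{p'}` function with a Fourier transform -/

section FourierPairing

/-- The norm of `L^1 ∩ L^2`. -/
noncomputable def sumNorm (F : ℝ → ℂ) : ℝ≥0∞ := eLpNorm F 1 volume + eLpNorm F 2 volume

/-- For `p ≥ 2` the `L^p` norm of the Fourier transform interpolates between its supremum,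
controlled by the `L¹` norm, and its `L²` norm. This replaces Hausdorff–Young at the price of a
stronger norm. -/
theorem eLpNorm_fourier_le_sumNorm {p : ℝ} (hp : 2 ≤ p) {F : ℝ → ℂ} (hF : Integrable F)
    (hF2 : MemLp F 2 volume) : eLpNorm (𝓕 F) (ENNReal.ofReal p) volume ≤ sumNorm F := by
  have hp0 : 0 < p := by linarith
  have hmono : sumNorm F ^ p = sumNorm F ^ (p - 2) * sumNorm F ^ (2 : ℝ) := by
    rw [← ENNReal.rpow_add_of_nonneg _ _ (by linarith) (by norm_num), sub_add_cancel]
  have h2 : ∫⁻ ξ, ‖𝓕 F ξ‖ₑ ^ (2 : ℝ) = eLpNorm (𝓕 F) 2 volume ^ (2 : ℝ) := by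
    rw [eLpNorm_eq_lintegral_rpow_enorm_toReal (by norm_num) (by norm_num), ← ENNReal.rpow_mul]
    norm_num
  have h1 : ∫⁻ ξ, ‖𝓕 F ξ‖ₑ ^ p ≤ sumNorm F ^ p := by
    have hm : Measurable fun ξ => ‖𝓕 F ξ‖ₑ ^ (2 : ℝ) :=
      ((continuous_fourier_of_integrable hF).measurable.enorm).pow_const _
    calc ∫⁻ ξ, ‖𝓕 F ξ‖ₑ ^ p ≤ ∫⁻ ξ, sumNorm F ^ (p - 2) * ‖𝓕 F ξ‖ₑ ^ (2 : ℝ) := by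
          refine lintegral_mono fun ξ => ?_
          have : ‖𝓕 F ξ‖ₑ ^ p = ‖𝓕 F ξ‖ₑ ^ (p - 2) * ‖𝓕 F ξ‖ₑ ^ (2 : ℝ) := by
            rw [← ENNReal.rpow_add_of_nonneg _ _ (by linarith) (by norm_num), sub_add_cancel]
          rw [this]
          have hle : ‖𝓕 F ξ‖ₑ ≤ sumNorm F := (enorm_fourier_le ξ).trans le_self_add
          exact mul_le_mul_left (ENNReal.rpow_le_rpow hle (by linarith)) _
      _ = sumNorm F ^ (p - 2) * eLpNorm (𝓕 F) 2 volume ^ (2 : ℝ) := by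
          rw [lintegral_const_mul _ hm, h2]
      _ ≤ sumNorm F ^ (p - 2) * sumNorm F ^ (2 : ℝ) := by
          gcongr
          exact (eLpNorm_fourier_le hF hF2).trans le_add_self
      _ = _ := hmono.symm
  rw [eLpNorm_eq_lintegral_rpow_enorm_toReal (by simpa using hp0) ENNReal.ofReal_ne_top,
    ENNReal.toReal_ofReal hp0.le, one_div, ENNReal.rpow_inv_le_iff hp0]
  exact h1

theorem lintegral_enorm_mul_le {p p' : ℝ} (hpp : p.HolderConjugate p') {f g : ℝ → ℂ}
    (hf : AEStronglyMeasurable f volume) (hg : AEStronglyMeasurable g volume) :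
    ∫⁻ x, ‖f x * g x‖ₑ ≤ eLpNorm f (ENNReal.ofReal p') volume * eLpNorm g (ENNReal.ofReal p) volume := by
  have h := ENNReal.lintegral_mul_le_Lp_mul_Lq volume hpp.symm hf.enorm hg.enorm
  rw [eLpNorm_eq_lintegral_rpow_enorm_toReal (by simpa using hpp.symm.pos) ENNReal.ofReal_ne_top,
    eLpNorm_eq_lintegral_rpow_enorm_toReal (by simpa using hpp.pos) ENNReal.ofReal_ne_top,
    ENNReal.toReal_ofReal hpp.symm.pos.le, ENNReal.toReal_ofReal hpp.pos.le]
  simpa only [enorm_mul, Pi.mul_apply] using h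

/-- The pairing of a function with a Fourier transform. -/
noncomputable def fourierPairing (h F : ℝ → ℂ) : ℂ := ∫ y, h y * 𝓕 F y

variable {p p' : ℝ} {h F F' : ℝ → ℂ}

theorem lintegral_enorm_mul_fourier_le (hpp : p.HolderConjugate p') (hp : 2 ≤ p)
    (hh : MemLp h (ENNReal.ofReal p') volume) (hF : Integrable F) (hF2 : MemLp F 2 volume) :
    ∫⁻ y, ‖h y * 𝓕 F y‖ₑ ≤ eLpNorm h (ENNReal.ofReal p') volume * sumNorm F := by
  refine (lintegral_enorm_mul_le hpp hh.1 (continuous_fourier_of_integrable hF).aestronglyMeasurable).trans ?_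
  gcongr
  exact eLpNorm_fourier_le_sumNorm hp hF hF2

theorem enorm_fourierPairing_le (hpp : p.HolderConjugate p') (hp : 2 ≤ p)
    (hh : MemLp h (ENNReal.ofReal p') volume) (hF : Integrable F) (hF2 : MemLp F 2 volume) :
    ‖fourierPairing h F‖ₑ ≤ eLpNorm h (ENNReal.ofReal p') volume * sumNorm F :=
  (enorm_integral_le_lintegral_enorm _).trans (lintegral_enorm_mul_fourier_le hpp hp hh hF hF2)

theorem sumNorm_lt_top (hF : Integrable F) (hF2 : MemLp F 2 volume) : sumNorm F < ∞ :=
  ENNReal.add_lt_top.2 ⟨(memLp_one_iff_integrable.2 hF).2, hF2.2⟩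

theorem integrable_mul_fourier (hpp : p.HolderConjugate p') (hp : 2 ≤ p)
    (hh : MemLp h (ENNReal.ofReal p') volume) (hF : Integrable F) (hF2 : MemLp F 2 volume) :
    Integrable fun y => h y * 𝓕 F y :=
  ⟨hh.1.mul (continuous_fourier_of_integrable hF).aestronglyMeasurable,
    (lintegral_enorm_mul_fourier_le hpp hp hh hF hF2).trans_lt
      (ENNReal.mul_lt_top hh.2 (sumNorm_lt_top hF hF2))⟩

theorem fourierPairing_sub (hpp : p.HolderConjugate p') (hp : 2 ≤ p)
    (hh : MemLp h (ENNReal.ofReal p') volume) (hF : Integrable F) (hF2 : MemLp F 2 volume)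
    (hF' : Integrable F') (hF2' : MemLp F' 2 volume) :
    fourierPairing h (F - F') = fourierPairing h F - fourierPairing h F' := by
  unfold fourierPairing
  rw [← integral_sub (integrable_mul_fourier hpp hp hh hF hF2) (integrable_mul_fourier hpp hp hh hF' hF2')]
  congr 1
  ext y
  rw [fourier_sub hF hF', mul_sub]

theorem fourierPairing_add (hpp : p.HolderConjugate p') (hp : 2 ≤ p)
    (hh : MemLp h (ENNReal.ofReal p') volume) (hF : Integrable F) (hF2 : MemLp F 2 volume)
    (hF' : Integrable F') (hF2' : MemLp F' 2 volume) :
    fourierPairing h (F + F') = fourierPairing h F + fourierPairing h F' := by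
  have h1 := fourierPairing_sub hpp hp hh (hF.add hF') (hF2.add hF2') hF' hF2'
  rw [add_sub_cancel_right] at h1
  rw [h1, sub_add_cancel]

theorem fourierPairing_smul (h F : ℝ → ℂ) (c : ℂ) : fourierPairing h (c • F) = c * fourierPairing h F := by
  unfold fourierPairing
  rw [← integral_const_mul]
  refine integral_congr_ae (Filter.Eventually.of_forall fun y => ?_)
  have h1 : 𝓕 (c • F) y = c * 𝓕 F y := by
    rw [Real.fourier_eq, Real.fourier_eq, ← integral_const_mul]
    refine integral_congr_ae (Filter.Eventually.of_forall fun x => ?_)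
    simp only [Pi.smul_apply, smul_eq_mul, Circle.smul_def]
    ring
  simp only
  rw [h1]
  ring

theorem enorm_sub_fourierPairing_le {h' : ℝ → ℂ} (hpp : p.HolderConjugate p') (hp : 2 ≤ p)
    (hh : MemLp h (ENNReal.ofReal p') volume) (hh' : MemLp h' (ENNReal.ofReal p') volume)
    (hF : Integrable F) (hF2 : MemLp F 2 volume) (hF' : Integrable F') (hF2' : MemLp F' 2 volume) :
    ‖fourierPairing h' F' - fourierPairing h F‖ₑ ≤
      eLpNorm (h' - h) (ENNReal.ofReal p') volume * sumNorm F' +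
        eLpNorm h (ENNReal.ofReal p') volume * sumNorm (F' - F) := by
  have h1 : fourierPairing h' F' - fourierPairing h F =
      fourierPairing (h' - h) F' + fourierPairing h (F' - F) := by
    rw [fourierPairing_sub hpp hp hh hF' hF2' hF hF2]
    have : fourierPairing (h' - h) F' = fourierPairing h' F' - fourierPairing h F' := by
      unfold fourierPairing
      rw [← integral_sub (integrable_mul_fourier hpp hp hh' hF' hF2')
        (integrable_mul_fourier hpp hp hh hF' hF2')]
      congr 1
      ext y
      rw [Pi.sub_apply, sub_mul]
    rw [this]
    ring
  rw [h1]
  refine (enorm_add_le _ _).trans (add_le_add ?_ ?_)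
  · exact enorm_fourierPairing_le hpp hp (hh'.sub hh) hF' hF2'
  · exact enorm_fourierPairing_le hpp hp hh (hF'.sub hF) (hF2'.sub hF2)

theorem tendsto_eLpNorm_sub {q : ℝ} (hq : 0 < q) {F : ℕ → ℝ → ℂ} {F₀ D : ℝ → ℂ}
    (hF : ∀ n, AEStronglyMeasurable (F n) volume) (hD : MemLp D (ENNReal.ofReal q) volume)
    (hle : ∀ n, ∀ᵐ x, ‖F n x‖ ≤ ‖D x‖)
    (hlim : ∀ᵐ x, Filter.Tendsto (fun n => F n x) Filter.atTop (nhds (F₀ x))) :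
    Filter.Tendsto (fun n => eLpNorm (F n - F₀) (ENNReal.ofReal q) volume) Filter.atTop (nhds 0) := by
  have hF₀ : AEStronglyMeasurable F₀ volume := aestronglyMeasurable_of_tendsto_ae _ hF hlim
  have hle₀ : ∀ᵐ x, ‖F₀ x‖ ≤ ‖D x‖ := by
    filter_upwards [hlim, ae_all_iff.2 hle] with x h1 h2
    exact le_of_tendsto' h1.norm h2
  have h1 : ∀ v : ℝ → ℂ, eLpNorm v (ENNReal.ofReal q) volume = (∫⁻ x, ‖v x‖ₑ ^ q) ^ (1 / q) := fun v => by
    rw [eLpNorm_eq_lintegral_rpow_enorm_toReal (by simpa using hq) ENNReal.ofReal_ne_top,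
      ENNReal.toReal_ofReal hq.le]
  simp_rw [h1]
  have h2 : Filter.Tendsto (fun n => ∫⁻ x, ‖(F n - F₀) x‖ₑ ^ q) Filter.atTop (nhds (∫⁻ _ : ℝ, 0)) := by
    refine tendsto_lintegral_of_dominated_convergence' (fun x => (2 * ‖D x‖ₑ) ^ q)
      (fun n => (((hF n).sub hF₀).enorm).pow_const q) (fun n => ?_) ?_ ?_
    · filter_upwards [hle n, hle₀] with x hx hx'
      gcongr
      refine (enorm_sub_le).trans ?_
      rw [two_mul]
      exact add_le_add (enorm_le_iff_norm_le.2 hx) (enorm_le_iff_norm_le.2 hx')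
    · have h3 : ∫⁻ x, ‖D x‖ₑ ^ q < ∞ := by
        have := hD.2
        rw [h1] at this
        by_contra h4
        rw [not_lt_top_iff.1 h4, ENNReal.top_rpow_of_pos (by positivity)] at this
        exact lt_irrefl _ this
      simp_rw [ENNReal.mul_rpow_of_nonneg _ _ hq.le]
      rw [lintegral_const_mul' _ _ (ENNReal.rpow_ne_top_of_nonneg hq.le (by norm_num))]
      exact ENNReal.mul_ne_top (ENNReal.rpow_ne_top_of_nonneg hq.le (by norm_num)) h3.ne
    · filter_upwards [hlim] with x hx
      have h4 : Filter.Tendsto (fun n => ‖(F n - F₀) x‖ₑ) Filter.atTop (nhds 0) := by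
        have h5 := (hx.sub_const (F₀ x)).enorm
        simpa using h5
      have h6 := (ENNReal.continuous_rpow_const (y := q)).tendsto 0 |>.comp h4
      rwa [ENNReal.zero_rpow_of_pos hq] at h6
  rw [lintegral_zero] at h2
  have h7 := (ENNReal.continuous_rpow_const (y := 1 / q)).tendsto 0 |>.comp h2
  rwa [ENNReal.zero_rpow_of_pos (by positivity)] at h7

theorem tendsto_sumNorm_sub {F : ℕ → ℝ → ℂ} {F₀ D : ℝ → ℂ} (hF : ∀ n, AEStronglyMeasurable (F n) volume)
    (hD : Integrable D) (hD2 : MemLp D 2 volume) (hle : ∀ n, ∀ᵐ x, ‖F n x‖ ≤ ‖D x‖)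
    (hlim : ∀ᵐ x, Filter.Tendsto (fun n => F n x) Filter.atTop (nhds (F₀ x))) :
    Filter.Tendsto (fun n => sumNorm (F n - F₀)) Filter.atTop (nhds 0) := by
  have h1 := tendsto_eLpNorm_sub one_pos hF (by simpa using memLp_one_iff_integrable.2 hD) hle hlim
  have h2 := tendsto_eLpNorm_sub two_pos hF (by simpa using hD2) hle hlim
  rw [ENNReal.ofReal_one] at h1
  rw [ENNReal.ofReal_ofNat] at h2
  simpa [sumNorm] using h1.add h2

end FourierPairing

/-! ### The multiplier acting on Schwartz functions -/

section Multiplier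

/-- The symbol of `|∂_x| ^ σ exp (-τ ∂_x ^ 3)`. -/
noncomputable def airyMultiplier (σ τ ξ : ℝ) : ℂ := absDerivSymbol σ ξ * airySymbol τ ξ

theorem measurable_airyMultiplier_right (σ τ : ℝ) : Measurable (airyMultiplier σ τ) := by
  have h1 : Measurable fun ξ => absDerivSymbol σ ξ := by
    simp_rw [← freqPow_ofReal]
    exact measurable_freqPow _
  exact h1.mul (continuous_airySymbol_right τ).measurable

theorem norm_airyMultiplier_le {σ : ℝ} (hσ0 : 0 ≤ σ) (hσ1 : σ ≤ 1) (τ ξ : ℝ) :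
    ‖airyMultiplier σ τ ξ‖ ≤ 7 * (1 + |ξ|) := by
  rw [airyMultiplier, norm_mul, norm_airySymbol, mul_one, absDerivSymbol, Complex.norm_real,
    Real.norm_of_nonneg (by positivity)]
  have h1 : |2 * Real.pi * ξ| ≤ 7 * |ξ| := by
    rw [abs_mul, abs_of_pos Real.two_pi_pos]
    gcongr
    linarith [Real.pi_lt_d2]
  calc |2 * Real.pi * ξ| ^ σ ≤ (1 + |2 * Real.pi * ξ|) ^ σ := by
        gcongr
        linarith
    _ ≤ (1 + |2 * Real.pi * ξ|) ^ (1 : ℝ) := by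
        gcongr
        linarith [abs_nonneg (2 * Real.pi * ξ)]
    _ ≤ _ := by
        rw [Real.rpow_one]
        linarith

/-- A seminorm which controls multiplication by `airyMultiplier σ τ`. -/
noncomputable def decaySeminorm : Seminorm ℂ 𝓢(ℝ, ℂ) :=
  (Finset.Iic ((3, 0) : ℕ × ℕ)).sup fun m => SchwartzMap.seminorm ℂ m.1 m.2

/-- Of three powers of decay, one pays for the linear growth of the multiplier and two leave an
integrable majorant. The constant is `56 = 7 * 2 ^ 3`. -/
theorem norm_schwartz_le (ψ : 𝓢(ℝ, ℂ)) (ξ : ℝ) :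
    7 * (1 + |ξ|) * ‖ψ ξ‖ ≤ 56 * decaySeminorm ψ * (1 + ξ ^ 2)⁻¹ := by
  have h := SchwartzMap.one_add_le_sup_seminorm_apply (𝕜 := ℂ) (m := (3, 0)) (k := 3) (n := 0) le_rfl le_rfl ψ ξ
  rw [norm_iteratedFDeriv_zero, Real.norm_eq_abs] at h
  change (1 + |ξ|) ^ 3 * ‖ψ ξ‖ ≤ 2 ^ 3 * decaySeminorm ψ at h
  rw [← div_eq_mul_inv, le_div_iff₀ (by positivity)]
  have h1 : 1 + ξ ^ 2 ≤ (1 + |ξ|) ^ 2 := by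
    rw [← sq_abs ξ]
    nlinarith [abs_nonneg ξ]
  calc 7 * (1 + |ξ|) * ‖ψ ξ‖ * (1 + ξ ^ 2) ≤ 7 * (1 + |ξ|) * ‖ψ ξ‖ * (1 + |ξ|) ^ 2 := by gcongr
    _ = 7 * ((1 + |ξ|) ^ 3 * ‖ψ ξ‖) := by ring
    _ ≤ 7 * (2 ^ 3 * decaySeminorm ψ) := by gcongr
    _ = _ := by ring

variable {σ : ℝ}

theorem norm_airyMultiplier_mul_le (hσ0 : 0 ≤ σ) (hσ1 : σ ≤ 1) (τ : ℝ) (ψ : 𝓢(ℝ, ℂ)) (ξ : ℝ) :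
    ‖airyMultiplier σ τ ξ * ψ ξ‖ ≤ ‖(((56 * decaySeminorm ψ) * (1 + ξ ^ 2)⁻¹ : ℝ) : ℂ)‖ := by
  rw [Complex.norm_real, Real.norm_of_nonneg (mul_nonneg (by positivity) (by positivity)), norm_mul]
  refine le_trans ?_ (norm_schwartz_le ψ ξ)
  gcongr
  exact norm_airyMultiplier_le hσ0 hσ1 τ ξ

theorem integrable_decay (c : ℝ) : Integrable fun ξ : ℝ => ((c * (1 + ξ ^ 2)⁻¹ : ℝ) : ℂ) :=
  (integrable_inv_one_add_sq.const_mul c).ofReal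

theorem memLp_two_decay (c : ℝ) : MemLp (fun ξ : ℝ => ((c * (1 + ξ ^ 2)⁻¹ : ℝ) : ℂ)) 2 volume := by
  have hm : AEStronglyMeasurable (fun ξ : ℝ => ((c * (1 + ξ ^ 2)⁻¹ : ℝ) : ℂ)) volume :=
    (integrable_decay c).1
  rw [memLp_two_iff_integrable_sq_norm hm]
  refine Integrable.mono' (g := fun ξ : ℝ => c ^ 2 * (1 + ξ ^ 2)⁻¹) (integrable_inv_one_add_sq.const_mul _)
    (hm.norm.pow 2) (Filter.Eventually.of_forall fun ξ => ?_)
  have h1 : (1 + ξ ^ 2)⁻¹ ≤ 1 := inv_le_one_of_one_le₀ (by nlinarith [sq_nonneg ξ])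
  have h0 : 0 < (1 + ξ ^ 2)⁻¹ := by positivity
  rw [Real.norm_of_nonneg (by positivity), Complex.norm_real, Real.norm_eq_abs, sq_abs, mul_pow]
  gcongr
  nlinarith

theorem aestronglyMeasurable_airyMultiplier_mul (σ τ : ℝ) (ψ : 𝓢(ℝ, ℂ)) :
    AEStronglyMeasurable (fun ξ => airyMultiplier σ τ ξ * ψ ξ) volume :=
  (measurable_airyMultiplier_right σ τ).aestronglyMeasurable.mul ψ.continuous.aestronglyMeasurable

theorem integrable_airyMultiplier_mul (hσ0 : 0 ≤ σ) (hσ1 : σ ≤ 1) (τ : ℝ) (ψ : 𝓢(ℝ, ℂ)) :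
    Integrable fun ξ => airyMultiplier σ τ ξ * ψ ξ :=
  (integrable_decay _).mono (aestronglyMeasurable_airyMultiplier_mul σ τ ψ)
    (Filter.Eventually.of_forall fun ξ => norm_airyMultiplier_mul_le hσ0 hσ1 τ ψ ξ)

theorem memLp_two_airyMultiplier_mul (hσ0 : 0 ≤ σ) (hσ1 : σ ≤ 1) (τ : ℝ) (ψ : 𝓢(ℝ, ℂ)) :
    MemLp (fun ξ => airyMultiplier σ τ ξ * ψ ξ) 2 volume :=
  (memLp_two_decay _).mono (aestronglyMeasurable_airyMultiplier_mul σ τ ψ)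
    (Filter.Eventually.of_forall fun ξ => norm_airyMultiplier_mul_le hσ0 hσ1 τ ψ ξ)

/-- The norm of the majorant of `airyMultiplier σ τ` times a Schwartz function. -/
noncomputable def decayConst : ℝ≥0∞ := sumNorm fun ξ : ℝ => ((56 * (1 + ξ ^ 2)⁻¹ : ℝ) : ℂ)

theorem decayConst_lt_top : decayConst < ∞ := sumNorm_lt_top (integrable_decay _) (memLp_two_decay _)

theorem sumNorm_airyMultiplier_mul_le (hσ0 : 0 ≤ σ) (hσ1 : σ ≤ 1) (τ : ℝ) (ψ : 𝓢(ℝ, ℂ)) :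
    sumNorm (fun ξ => airyMultiplier σ τ ξ * ψ ξ) ≤ ENNReal.ofReal (decaySeminorm ψ) * decayConst := by
  have h1 : ∀ q : ℝ≥0∞, eLpNorm (fun ξ => airyMultiplier σ τ ξ * ψ ξ) q volume ≤
      ENNReal.ofReal (decaySeminorm ψ) * eLpNorm (fun ξ : ℝ => ((56 * (1 + ξ ^ 2)⁻¹ : ℝ) : ℂ)) q volume := fun q => by
    have h2 : (fun ξ : ℝ => (((56 * decaySeminorm ψ) * (1 + ξ ^ 2)⁻¹ : ℝ) : ℂ)) =
        ((decaySeminorm ψ : ℝ) : ℂ) • fun ξ : ℝ => ((56 * (1 + ξ ^ 2)⁻¹ : ℝ) : ℂ) := by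
      ext ξ
      simp only [Pi.smul_apply, smul_eq_mul]
      push_cast
      ring
    refine (eLpNorm_mono fun ξ => norm_airyMultiplier_mul_le hσ0 hσ1 τ ψ ξ).trans (le_of_eq ?_)
    rw [h2, eLpNorm_const_smul, ← ofReal_norm, Complex.norm_real, Real.norm_of_nonneg (apply_nonneg _ _)]
  rw [sumNorm, decayConst, sumNorm, mul_add]
  exact add_le_add (h1 1) (h1 2)

end Multiplier

/-! ### Smooth cutoffs away from zero and infinite frequency -/

section Cutoff

/-- A smooth bump function at the origin. -/
noncomputable def originBump : ContDiffBump (0 : ℝ) := ⟨1, 2, one_pos, one_lt_two⟩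

/-- A smooth cutoff to frequencies away from zero and infinity. -/
noncomputable def freqCutoff (n : ℕ) (ξ : ℝ) : ℝ :=
  originBump (ξ / (n + 1)) * (1 - originBump ((n + 1) * ξ))

theorem freqCutoff_nonneg (n : ℕ) (ξ : ℝ) : 0 ≤ freqCutoff n ξ :=
  mul_nonneg originBump.nonneg (sub_nonneg.2 originBump.le_one)

theorem freqCutoff_le_one (n : ℕ) (ξ : ℝ) : freqCutoff n ξ ≤ 1 :=
  mul_le_one₀ originBump.le_one (sub_nonneg.2 originBump.le_one)
    (sub_le_self _ originBump.nonneg)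

theorem contDiff_freqCutoff (n : ℕ) : ContDiff ℝ ((⊤ : ℕ∞) : WithTop ℕ∞) (freqCutoff n) := by
  have h1 : ContDiff ℝ ((⊤ : ℕ∞) : WithTop ℕ∞) fun ξ : ℝ => originBump (ξ / ((n : ℝ) + 1)) :=
    originBump.contDiff.comp (by fun_prop)
  have h2 : ContDiff ℝ ((⊤ : ℕ∞) : WithTop ℕ∞) fun ξ : ℝ => originBump (((n : ℝ) + 1) * ξ) :=
    originBump.contDiff.comp (by fun_prop)
  exact h1.mul (contDiff_const.sub h2)

theorem freqCutoff_eq_zero_of_le {n : ℕ} {ξ : ℝ} (h : ((n : ℝ) + 1) * |ξ| ≤ 1) : freqCutoff n ξ = 0 := by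
  have : originBump (((n : ℝ) + 1) * ξ) = 1 := by
    refine originBump.one_of_mem_closedBall ?_
    rw [mem_closedBall_zero_iff, Real.norm_eq_abs, abs_mul, abs_of_pos (by positivity)]
    exact h
  rw [freqCutoff, this, sub_self, mul_zero]

theorem freqCutoff_eq_zero_of_ge {n : ℕ} {ξ : ℝ} (h : 2 * ((n : ℝ) + 1) ≤ |ξ|) : freqCutoff n ξ = 0 := by
  have : originBump (ξ / ((n : ℝ) + 1)) = 0 := by
    refine originBump.zero_of_le_dist ?_
    rw [dist_zero_right, Real.norm_eq_abs, abs_div, abs_of_pos (by positivity : 0 < (n : ℝ) + 1),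
      le_div_iff₀ (by positivity)]
    exact h
  rw [freqCutoff, this, zero_mul]

theorem tendsto_freqCutoff {ξ : ℝ} (hξ : ξ ≠ 0) :
    Filter.Tendsto (fun n => freqCutoff n ξ) Filter.atTop (nhds 1) := by
  have h0 : 0 < |ξ| := abs_pos.2 hξ
  obtain ⟨N, hN⟩ := exists_nat_ge (max |ξ| (2 / |ξ|))
  refine tendsto_const_nhds.congr' ?_
  filter_upwards [Filter.eventually_ge_atTop N] with n hn
  have hn' : (N : ℝ) ≤ n := by exact_mod_cast hn
  have h1 : |ξ| ≤ n := (le_max_left _ _).trans (hN.trans hn')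
  have h2 : 2 / |ξ| ≤ n := (le_max_right _ _).trans (hN.trans hn')
  have e1 : originBump (ξ / ((n : ℝ) + 1)) = 1 := by
    refine originBump.one_of_mem_closedBall ?_
    rw [mem_closedBall_zero_iff, Real.norm_eq_abs, abs_div, abs_of_pos (by positivity : 0 < (n : ℝ) + 1),
      div_le_iff₀ (by positivity)]
    change |ξ| ≤ 1 * ((n : ℝ) + 1)
    linarith
  have e2 : originBump (((n : ℝ) + 1) * ξ) = 0 := by
    refine originBump.zero_of_le_dist ?_
    rw [dist_zero_right, Real.norm_eq_abs, abs_mul, abs_of_pos (by positivity : 0 < (n : ℝ) + 1)]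
    rw [div_le_iff₀ h0] at h2
    change 2 ≤ ((n : ℝ) + 1) * |ξ|
    linarith
  rw [freqCutoff, e1, e2]
  norm_num

theorem contDiffAt_airyMultiplier (σ τ : ℝ) {ξ : ℝ} (hξ : ξ ≠ 0) :
    ContDiffAt ℝ ((⊤ : ℕ∞) : WithTop ℕ∞) (airyMultiplier σ τ) ξ := by
  have h1 : ContDiffAt ℝ ((⊤ : ℕ∞) : WithTop ℕ∞) (fun ξ : ℝ => |2 * Real.pi * ξ| ^ σ) ξ := by
    have h0 : 2 * Real.pi * ξ ≠ 0 := mul_ne_zero Real.two_pi_pos.ne' hξ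
    have h2 : ContDiffAt ℝ ((⊤ : ℕ∞) : WithTop ℕ∞) (fun ξ : ℝ => |2 * Real.pi * ξ|) ξ :=
      (contDiffAt_abs h0).comp ξ (by fun_prop)
    exact h2.rpow_const_of_ne (abs_ne_zero.2 h0)
  have h3 : ContDiff ℝ ((⊤ : ℕ∞) : WithTop ℕ∞) (airySymbol τ) := by
    have : ContDiff ℝ ((⊤ : ℕ∞) : WithTop ℕ∞) fun ξ : ℝ => (ξ : ℂ) := Complex.ofRealCLM.contDiff
    unfold airySymbol
    fun_prop
  exact (Complex.ofRealCLM.contDiff.contDiffAt.comp ξ h1).mul h3.contDiffAt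

/-- The multiplier may fail to be smooth at the origin, where the cutoff vanishes identically; away
from it everything is smooth, and the cutoff has compact support. -/
theorem exists_schwartz_cutoff (σ τ : ℝ) (ψ : 𝓢(ℝ, ℂ)) (n : ℕ) :
    ∃ Ψ : 𝓢(ℝ, ℂ), ∀ ξ, Ψ ξ = freqCutoff n ξ * (airyMultiplier σ τ ξ * ψ ξ) := by
  set F : ℝ → ℂ := fun ξ => freqCutoff n ξ * (airyMultiplier σ τ ξ * ψ ξ) with hF
  have hcd : ContDiff ℝ ((⊤ : ℕ∞) : WithTop ℕ∞) F := by
    rw [contDiff_iff_contDiffAt]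
    intro ξ
    rcases eq_or_ne ξ 0 with rfl | hξ
    · refine (contDiffAt_const (c := (0 : ℂ))).congr_of_eventuallyEq ?_
      have : Metric.ball (0 : ℝ) (((n : ℝ) + 1)⁻¹) ∈ nhds (0 : ℝ) := Metric.ball_mem_nhds _ (by positivity)
      filter_upwards [this] with ξ hξ
      rw [mem_ball_zero_iff, Real.norm_eq_abs] at hξ
      have h1 : ((n : ℝ) + 1) * |ξ| ≤ 1 := by
        rw [mul_comm, ← le_div_iff₀ (by positivity), one_div]
        exact hξ.le
      simp [hF, freqCutoff_eq_zero_of_le h1]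
    · exact (Complex.ofRealCLM.contDiff.contDiffAt.comp ξ (contDiff_freqCutoff n).contDiffAt).mul
        ((contDiffAt_airyMultiplier σ τ hξ).mul (ψ.smooth _).contDiffAt)
  have hcs : HasCompactSupport F := by
    refine HasCompactSupport.of_support_subset_isCompact (isCompact_Icc (a := -(2 * ((n : ℝ) + 1)))
      (b := 2 * ((n : ℝ) + 1))) fun ξ hξ => ?_
    by_contra h
    have h1 : ¬ |ξ| ≤ 2 * ((n : ℝ) + 1) := fun h2 => h (abs_le.1 h2)
    exact hξ (by simp [hF, freqCutoff_eq_zero_of_ge (not_le.1 h1).le])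
  exact ⟨hcs.toSchwartzMap hcd, fun ξ => rfl⟩

end Cutoff

/-! ### The propagated source in terms of the regularized source -/

section Symbol

variable {p p' σ₁ σ₂ : ℝ}

/-- Formally, if `H = |∂_x| ^ (-σ₂) g`, then `|∂_x| ^ σ₁ exp (-τ ∂_x ^ 3) g` equals `|∂_x| ^ (σ₁ +
σ₂) exp (-τ ∂_x ^ 3) H`. The multiplier may not be smooth at zero and cannot be moved onto test
functions directly. The identity holds after a smooth cutoff, and both sides converge: the frequency
side by dominated convergence, the space side because the cut-off functions converge in `L¹ ∩ L²`.
-/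
theorem isFunction_airyMultiplier (hpp : p.HolderConjugate p') (hp : 2 ≤ p) (hσ₁ : 0 ≤ σ₁) (hσ₂ : 0 ≤ σ₂)
    (hσ : σ₁ + σ₂ ≤ 1) (τ : ℝ) {H : 𝓢'(ℝ, ℂ)} {h m : ℝ → ℂ} (hh : MemLp h (ENNReal.ofReal p') volume)
    (hm : IsFunction (𝓕 H) fun ξ => absDerivSymbol (-σ₂) ξ * m ξ) (hH : IsFunction H h) (ψ : 𝓢(ℝ, ℂ)) :
    Integrable (fun ξ => airyMultiplier σ₁ τ ξ * m ξ * ψ ξ) ∧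
      fourierPairing h (fun ξ => airyMultiplier (σ₁ + σ₂) τ ξ * ψ ξ) =
        ∫ ξ, airyMultiplier σ₁ τ ξ * m ξ * ψ ξ := by
  have hσ0 : 0 ≤ σ₁ + σ₂ := add_nonneg hσ₁ hσ₂
  set M : ℝ → ℂ := fun ξ => absDerivSymbol (-σ₂) ξ * m ξ with hM
  have hMint : ∀ φ : 𝓢(ℝ, ℂ), Integrable fun ξ => M ξ * φ ξ := fun φ => (hm φ).1
  -- The power law for `|2 π ξ|` is used away from `ξ = 0`, where the conventions for powers of zero
  -- may break it; one point is negligible.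
  have hae : ∀ᵐ ξ : ℝ, airyMultiplier σ₁ τ ξ * m ξ * ψ ξ =
      airyMultiplier (σ₁ + σ₂) τ ξ * (M ξ * ψ ξ) := by
    filter_upwards [Measure.ae_ne volume (0 : ℝ)] with ξ hξ
    have h0 : 0 < |2 * Real.pi * ξ| := abs_pos.2 (mul_ne_zero Real.two_pi_pos.ne' hξ)
    have h1 : absDerivSymbol (σ₁ + σ₂) ξ * absDerivSymbol (-σ₂) ξ = absDerivSymbol σ₁ ξ := by
      rw [absDerivSymbol, absDerivSymbol, absDerivSymbol, ← Complex.ofReal_mul, ← Real.rpow_add h0,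
        add_neg_cancel_right]
    simp only [hM, airyMultiplier]
    rw [← h1]
    ring
  -- The linear growth of the multiplier is absorbed by testing `M` against the Schwartz function `ξ
  -- ψ` as well as against `ψ`.
  have hdom : Integrable fun ξ => 7 * (1 + |ξ|) * ‖M ξ * ψ ξ‖ := by
    have htg : (fun ξ : ℝ => (ξ : ℂ)).HasTemperateGrowth := Complex.ofRealCLM.hasTemperateGrowth
    have h1 := ((hMint ψ).norm.add (hMint (SchwartzMap.smulLeftCLM ℂ (fun ξ : ℝ => (ξ : ℂ)) ψ)).norm).const_mul 7
    refine h1.congr (Filter.Eventually.of_forall fun ξ => ?_)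
    simp only [Pi.add_apply]
    rw [SchwartzMap.smulLeftCLM_apply_apply htg, smul_eq_mul, norm_mul (M ξ), norm_mul (M ξ),
      norm_mul (ξ : ℂ), Complex.norm_real, Real.norm_eq_abs]
    ring
  have hbm : AEStronglyMeasurable (fun ξ => airyMultiplier (σ₁ + σ₂) τ ξ * (M ξ * ψ ξ)) volume :=
    (measurable_airyMultiplier_right _ τ).aestronglyMeasurable.mul (hMint ψ).1
  have hble : ∀ ξ, ‖airyMultiplier (σ₁ + σ₂) τ ξ * (M ξ * ψ ξ)‖ ≤ 7 * (1 + |ξ|) * ‖M ξ * ψ ξ‖ := fun ξ => by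
    rw [norm_mul]
    gcongr
    exact norm_airyMultiplier_le hσ0 hσ τ ξ
  have hbint : Integrable fun ξ => airyMultiplier (σ₁ + σ₂) τ ξ * (M ξ * ψ ξ) :=
    hdom.mono' hbm (Filter.Eventually.of_forall hble)
  refine ⟨hbint.congr (by filter_upwards [hae] with ξ hξ using hξ.symm), ?_⟩
  rw [integral_congr_ae hae]
  choose Ψ hΨ using exists_schwartz_cutoff (σ₁ + σ₂) τ ψ
  set F : ℝ → ℂ := fun ξ => airyMultiplier (σ₁ + σ₂) τ ξ * ψ ξ with hF
  have hFi := integrable_airyMultiplier_mul hσ0 hσ τ ψ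
  have hF2 := memLp_two_airyMultiplier_mul hσ0 hσ τ ψ
  have heq : ∀ n, fourierPairing h (Ψ n) = ∫ ξ, freqCutoff n ξ * (airyMultiplier (σ₁ + σ₂) τ ξ * (M ξ * ψ ξ)) := by
    intro n
    have h1 := (hm (Ψ n)).2
    rw [TemperedDistribution.fourier_apply, (hH _).2] at h1
    calc fourierPairing h (Ψ n) = ∫ x, h x * (𝓕 (Ψ n)) x := rfl
      _ = ∫ ξ, M ξ * Ψ n ξ := h1
      _ = _ := by
          congr 1
          ext ξ
          rw [hΨ]
          ring
  have hcut : ∀ n ξ, ‖((freqCutoff n ξ : ℝ) : ℂ)‖ ≤ 1 := fun n ξ => by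
    rw [Complex.norm_real, Real.norm_of_nonneg (freqCutoff_nonneg n ξ)]
    exact freqCutoff_le_one n ξ
  have hlim : ∀ᵐ ξ : ℝ, Filter.Tendsto (fun n => ((freqCutoff n ξ : ℝ) : ℂ)) Filter.atTop (nhds 1) := by
    filter_upwards [Measure.ae_ne volume (0 : ℝ)] with ξ hξ
    exact (Complex.continuous_ofReal.tendsto 1).comp (tendsto_freqCutoff hξ)
  have hright : Filter.Tendsto (fun n => fourierPairing h (Ψ n)) Filter.atTop
      (nhds (∫ ξ, airyMultiplier (σ₁ + σ₂) τ ξ * (M ξ * ψ ξ))) := by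
    simp_rw [heq]
    refine tendsto_integral_of_dominated_convergence _ (fun n => ?_) hbint.norm (fun n => ?_) ?_
    · exact (Complex.continuous_ofReal.comp (contDiff_freqCutoff n).continuous).aestronglyMeasurable.mul hbm
    · refine Filter.Eventually.of_forall fun ξ => ?_
      rw [norm_mul]
      exact mul_le_of_le_one_left (norm_nonneg _) (hcut n ξ)
    · filter_upwards [hlim] with ξ hξ
      simpa using hξ.mul_const (airyMultiplier (σ₁ + σ₂) τ ξ * (M ξ * ψ ξ))
  have hleft : Filter.Tendsto (fun n => fourierPairing h (Ψ n)) Filter.atTop (nhds (fourierPairing h F)) := by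
    have h1 : Filter.Tendsto (fun n => sumNorm (⇑(Ψ n) - F)) Filter.atTop (nhds 0) := by
      refine tendsto_sumNorm_sub (D := F) (fun n => (Ψ n).continuous.aestronglyMeasurable) hFi hF2 (fun n => ?_) ?_
      · refine Filter.Eventually.of_forall fun ξ => ?_
        rw [hΨ, norm_mul]
        exact mul_le_of_le_one_left (norm_nonneg _) (hcut n ξ)
      · filter_upwards [hlim] with ξ hξ
        simp_rw [hΨ]
        simpa using hξ.mul_const (airyMultiplier (σ₁ + σ₂) τ ξ * ψ ξ)
    rw [tendsto_iff_edist_tendsto_0]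
    have h2 : ∀ n, edist (fourierPairing h (Ψ n)) (fourierPairing h F) ≤
        eLpNorm h (ENNReal.ofReal p') volume * sumNorm (⇑(Ψ n) - F) := fun n => by
      rw [edist_eq_enorm_sub, ← fourierPairing_sub hpp hp hh (Ψ n).integrable ((Ψ n).memLp 2 volume) hFi hF2]
      exact enorm_fourierPairing_le hpp hp hh ((Ψ n).integrable.sub hFi) (((Ψ n).memLp 2 volume).sub hF2)
    refine tendsto_of_tendsto_of_tendsto_of_le_of_le tendsto_const_nhds ?_ (fun n => zero_le) h2
    have h3 := ENNReal.Tendsto.const_mul (a := eLpNorm h (ENNReal.ofReal p') volume) h1 (Or.inr hh.2.ne)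
    rwa [mul_zero] at h3
  exact tendsto_nhds_unique hleft hright

end Symbol

/-! ### The Duhamel term as a tempered distribution -/

section DuhamelDistribution

variable {p p' σ σ₁ σ₂ t₀ : ℝ} {h : ℝ → ℝ → ℂ}

theorem fourier_neg_eq_fourierInv (φ : 𝓢(ℝ, ℂ)) (ξ : ℝ) : 𝓕 (φ : ℝ → ℂ) (-ξ) = (𝓕⁻ φ : 𝓢(ℝ, ℂ)) ξ := by
  rw [SchwartzMap.fourierInv_coe, Real.fourierInv_eq_fourier_neg]

theorem bandForm_eq_fourierPairing (n : ℕ) (hσ0 : 0 ≤ σ) (hσ1 : σ ≤ 1) (τ : ℝ) {f : ℝ → ℂ}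
    (hf : Integrable f) (φ : 𝓢(ℝ, ℂ)) :
    bandForm n σ τ f φ =
      fourierPairing f ((band n).indicator fun ξ => airyMultiplier σ τ ξ * (𝓕⁻ φ : 𝓢(ℝ, ℂ)) ξ) := by
  have hF := (integrable_airyMultiplier_mul hσ0 hσ1 τ (𝓕⁻ φ)).indicator (measurableSet_band n)
  rw [fourierPairing, ← integral_fourier_mul_eq hf hF, bandForm, bandPairing,
    ← integral_indicator (measurableSet_band n)]
  congr 1
  ext ξ
  by_cases hξ : ξ ∈ band n
  · rw [indicator_of_mem hξ, indicator_of_mem hξ, fourier_neg_eq_fourierInv, freqPow_ofReal, airyMultiplier]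
    ring
  · rw [indicator_of_notMem hξ, indicator_of_notMem hξ, mul_zero]

theorem sumNorm_indicator_le (n : ℕ) (F : ℝ → ℂ) : sumNorm ((band n).indicator F) ≤ sumNorm F :=
  add_le_add (eLpNorm_indicator_le _) (eLpNorm_indicator_le _)

theorem tendsto_fourierPairing_trunc (hpp : p.HolderConjugate p') (hp : 2 ≤ p)
    (hhm : StronglyMeasurable (Function.uncurry h)) {s : ℝ} (hh : MemLp (h s) (ENNReal.ofReal p') volume)
    {F : ℝ → ℂ} (hF : Integrable F) (hF2 : MemLp F 2 volume) :
    Filter.Tendsto (fun n => fourierPairing (truncFamily h n s) ((band n).indicator F)) Filter.atTop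
      (nhds (fourierPairing (h s) F)) := by
  have hp' : 0 < p' := hpp.symm.pos
  have hle : ∀ n x, ‖truncFamily h n s x‖ ≤ ‖h s x‖ := fun n x =>
    enorm_le_iff_norm_le.1 (enorm_truncFamily_le h n s x)
  have h1 : Filter.Tendsto (fun n => eLpNorm (truncFamily h n s - h s) (ENNReal.ofReal p') volume)
      Filter.atTop (nhds 0) := by
    refine tendsto_eLpNorm_sub hp' (fun n =>
      (StronglyMeasurable.slice (boundedFamily_truncFamily hhm n).1 s).aestronglyMeasurable) hh
      (fun n => Filter.Eventually.of_forall (hle n)) (Filter.Eventually.of_forall fun x => ?_)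
    refine tendsto_const_nhds.congr' ?_
    filter_upwards [tendsto_truncFamily h s x] with n hn using hn.symm
  have h2 : Filter.Tendsto (fun n => sumNorm ((band n).indicator F - F)) Filter.atTop (nhds 0) := by
    refine tendsto_sumNorm_sub (D := F) (fun n => hF.1.indicator (measurableSet_band n)) hF hF2
      (fun n => Filter.Eventually.of_forall fun x => norm_indicator_le_norm_self _ _) ?_
    filter_upwards [Measure.ae_ne volume (0 : ℝ)] with ξ hξ
    obtain ⟨N, hN⟩ := exists_mem_band hξ
    refine tendsto_const_nhds.congr' ?_
    filter_upwards [Filter.eventually_ge_atTop N] with n hn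
    rw [indicator_of_mem (hN n hn)]
  rw [tendsto_iff_edist_tendsto_0]
  have h3 : ∀ n, edist (fourierPairing (truncFamily h n s) ((band n).indicator F)) (fourierPairing (h s) F) ≤
      eLpNorm (truncFamily h n s - h s) (ENNReal.ofReal p') volume * sumNorm F +
        eLpNorm (h s) (ENNReal.ofReal p') volume * sumNorm ((band n).indicator F - F) := fun n => by
    rw [edist_eq_enorm_sub]
    have hn : MemLp (truncFamily h n s) (ENNReal.ofReal p') volume := hh.mono
      (StronglyMeasurable.slice (boundedFamily_truncFamily hhm n).1 s).aestronglyMeasurable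
      (Filter.Eventually.of_forall (hle n))
    refine (enorm_sub_fourierPairing_le hpp hp hh hn hF hF2 (hF.indicator (measurableSet_band n))
      (hF2.indicator (measurableSet_band n))).trans ?_
    gcongr
    exact sumNorm_indicator_le n F
  refine tendsto_of_tendsto_of_tendsto_of_le_of_le tendsto_const_nhds ?_ (fun n => zero_le) h3
  have h4 := ENNReal.Tendsto.mul_const (b := sumNorm F) h1 (Or.inr (sumNorm_lt_top hF hF2).ne)
  have h5 := ENNReal.Tendsto.const_mul (a := eLpNorm (h s) (ENNReal.ofReal p') volume) h2 (Or.inr hh.2.ne)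
  simpa using h4.add h5

/-- Convergence of the frequency localized Duhamel integrals, tested against a Schwartz function. -/
theorem tendsto_integral_fourierPairing (hpp : p.HolderConjugate p') (hp : 2 ≤ p) (hσ0 : 0 ≤ σ) (hσ1 : σ ≤ 1)
    (hhm : StronglyMeasurable (Function.uncurry h)) (hh : ∀ s, MemLp (h s) (ENNReal.ofReal p') volume)
    {S : Set ℝ} (hS : ∫⁻ s in S, eLpNorm (h s) (ENNReal.ofReal p') volume < ∞) (t : ℝ) (φ : 𝓢(ℝ, ℂ)) :
    IntegrableOn (fun s => fourierPairing (h s)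
      fun ξ => airyMultiplier σ (t - s) ξ * (𝓕⁻ φ : 𝓢(ℝ, ℂ)) ξ) S ∧
    Filter.Tendsto (fun n => ∫ s in S, bandForm n σ (t - s) (truncFamily h n s) φ) Filter.atTop
      (nhds (∫ s in S, fourierPairing (h s)
        fun ξ => airyMultiplier σ (t - s) ξ * (𝓕⁻ φ : 𝓢(ℝ, ℂ)) ξ)) := by
  set K := ENNReal.ofReal (decaySeminorm (𝓕⁻ φ : 𝓢(ℝ, ℂ))) * decayConst with hK
  have hKt : K ≠ ∞ := ENNReal.mul_ne_top ENNReal.ofReal_ne_top decayConst_lt_top.ne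
  have hFi := fun s => integrable_airyMultiplier_mul hσ0 hσ1 (t - s) (𝓕⁻ φ)
  have hF2 := fun s => memLp_two_airyMultiplier_mul hσ0 hσ1 (t - s) (𝓕⁻ φ)
  have hFK := fun s => sumNorm_airyMultiplier_mul_le hσ0 hσ1 (t - s) (𝓕⁻ φ)
  have hm : ∀ n, AEStronglyMeasurable (fun s => bandForm n σ (t - s) (truncFamily h n s) φ)
      (volume.restrict S) := fun n => by
    have hG : StronglyMeasurable (Function.uncurry fun (_ : ℝ) (x : ℝ) => φ x) :=
      φ.continuous.stronglyMeasurable.comp_measurable measurable_snd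
    have h1 := stronglyMeasurable_bandForm n (σ : ℂ) (boundedFamily_truncFamily hhm n).1 hG
    exact (h1.comp_measurable (g := fun s : ℝ => (t, s)) measurable_prodMk_left).aestronglyMeasurable
  have heq : ∀ n s, bandForm n σ (t - s) (truncFamily h n s) φ = fourierPairing (truncFamily h n s)
      ((band n).indicator fun ξ => airyMultiplier σ (t - s) ξ * (𝓕⁻ φ : 𝓢(ℝ, ℂ)) ξ) := fun n s =>
    bandForm_eq_fourierPairing n hσ0 hσ1 _ ((boundedFamily_truncFamily hhm n).nice s).integrable φ
  have hlim : ∀ s, Filter.Tendsto (fun n => bandForm n σ (t - s) (truncFamily h n s) φ) Filter.atTop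
      (nhds (fourierPairing (h s) fun ξ => airyMultiplier σ (t - s) ξ * (𝓕⁻ φ : 𝓢(ℝ, ℂ)) ξ)) := fun s => by
    simp_rw [heq]
    exact tendsto_fourierPairing_trunc hpp hp hhm (hh s) (hFi s) (hF2 s)
  have hbd : ∀ n s, ‖bandForm n σ (t - s) (truncFamily h n s) φ‖ₑ ≤
      eLpNorm (h s) (ENNReal.ofReal p') volume * K := fun n s => by
    rw [heq]
    have hn : MemLp (truncFamily h n s) (ENNReal.ofReal p') volume := (hh s).mono
      (StronglyMeasurable.slice (boundedFamily_truncFamily hhm n).1 s).aestronglyMeasurable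
      (Filter.Eventually.of_forall fun x => enorm_le_iff_norm_le.1 (enorm_truncFamily_le h n s x))
    refine (enorm_fourierPairing_le hpp hp hn ((hFi s).indicator (measurableSet_band n))
      ((hF2 s).indicator (measurableSet_band n))).trans ?_
    gcongr
    · exact eLpNorm_truncFamily_le h n s _
    · exact (sumNorm_indicator_le n _).trans (hFK s)
  have hfm : Measurable fun s => eLpNorm (h s) (ENNReal.ofReal p') volume :=
    measurable_eLpNorm_slice hhm hpp.symm.pos
  have hKint : Integrable (fun s => (eLpNorm (h s) (ENNReal.ofReal p') volume * K).toReal)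
      (volume.restrict S) := by
    refine integrable_toReal_of_lintegral_ne_top (hfm.mul_const _).aemeasurable ?_
    rw [lintegral_mul_const' _ _ hKt]
    exact ENNReal.mul_ne_top hS.ne hKt
  have hbd' : ∀ n s, ‖bandForm n σ (t - s) (truncFamily h n s) φ‖ ≤
      (eLpNorm (h s) (ENNReal.ofReal p') volume * K).toReal := fun n s => by
    rw [← toReal_enorm]
    exact ENNReal.toReal_mono (ENNReal.mul_ne_top (hh s).2.ne hKt) (hbd n s)
  constructor
  · refine hKint.mono' (aestronglyMeasurable_of_tendsto_ae _ hm (Filter.Eventually.of_forall hlim))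
      (Filter.Eventually.of_forall fun s => ?_)
    exact le_of_tendsto' (hlim s).norm fun n => hbd' n s
  · exact tendsto_integral_of_dominated_convergence _ hm hKint
      (fun n => Filter.Eventually.of_forall (hbd' n)) (Filter.Eventually.of_forall hlim)

theorem exists_temperedDistribution {A : 𝓢(ℝ, ℂ) → ℂ} (hadd : ∀ φ ψ, A (φ + ψ) = A φ + A ψ)
    (hsmul : ∀ (c : ℂ) φ, A (c • φ) = c * A φ) {C : ℝ≥0∞} (hC : C ≠ ∞)
    (hle : ∀ φ, ‖A φ‖ₑ ≤ C * ENNReal.ofReal (decaySeminorm φ)) : ∃ V : 𝓢'(ℝ, ℂ), ∀ φ, V φ = A φ := by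
  refine ⟨ContinuousLinearMap.toPointwiseConvergenceCLM _ _ _ _
    (SchwartzMap.mkCLMtoNormedSpace (𝕜 := ℂ) (σ := RingHom.id ℂ) A hadd hsmul
      ⟨Finset.Iic (3, 0), C.toReal, ENNReal.toReal_nonneg, fun φ => ?_⟩), fun φ => rfl⟩
  have h1 := ENNReal.toReal_mono (ENNReal.mul_ne_top hC ENNReal.ofReal_ne_top) (hle φ)
  rw [toReal_enorm, ENNReal.toReal_mul, ENNReal.toReal_ofReal (apply_nonneg _ _)] at h1
  exact h1

theorem airyMultiplier_add_smul (σ τ : ℝ) (φ ψ : 𝓢(ℝ, ℂ)) :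
    (fun ξ => airyMultiplier σ τ ξ * (φ + ψ) ξ) =
      (fun ξ => airyMultiplier σ τ ξ * φ ξ) + fun ξ => airyMultiplier σ τ ξ * ψ ξ := by
  ext ξ
  simp only [add_apply, Pi.add_apply]
  ring

theorem airyMultiplier_smul (σ τ : ℝ) (c : ℂ) (φ : 𝓢(ℝ, ℂ)) :
    (fun ξ => airyMultiplier σ τ ξ * (c • φ) ξ) = c • fun ξ => airyMultiplier σ τ ξ * φ ξ := by
  ext ξ
  simp only [smul_apply, Pi.smul_apply, smul_eq_mul]
  ring

/-- The Duhamel term exists as a tempered distribution, and it is the limit of the frequency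
localized Duhamel integrals. -/
theorem exists_duhamelTerm (hpp : p.HolderConjugate p') (hp : 2 ≤ p) (hσ₁ : 0 ≤ σ₁) (hσ₂ : 0 ≤ σ₂)
    (hσ : σ₁ + σ₂ ≤ 1) (hhm : StronglyMeasurable (Function.uncurry h))
    (hh : ∀ s, MemLp (h s) (ENNReal.ofReal p') volume)
    (hS : ∀ t, ∫⁻ s in uIoc t₀ t, eLpNorm (h s) (ENNReal.ofReal p') volume < ∞) :
    ∃ U : ℝ → 𝓢'(ℝ, ℂ),
      (∀ t (φ : 𝓢(ℝ, ℂ)), Filter.Tendsto (fun n => ∫ x, bandDuhamel n (σ₁ + σ₂) t₀ (truncFamily h n) t x * φ x)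
        Filter.atTop (nhds (U t φ))) ∧
      ∀ t (g : ℝ → 𝓢'(ℝ, ℂ)), (∀ᵐ s ∂volume.restrict (uIoc t₀ t), ∃ H : 𝓢'(ℝ, ℂ),
        IsFourierMultiplier (absDerivSymbol (-σ₂)) (g s) H ∧ IsFunction H (h s)) →
        IsDuhamelTerm σ₁ t₀ t g (U t) := by
  have hσ0 : 0 ≤ σ₁ + σ₂ := add_nonneg hσ₁ hσ₂
  -- `Q t s` is the Fourier transform of the integrand at time `s`, written through `h s` alone. The
  -- distributions are thus built before any family `g` is given, and `g` enters only when their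
  -- Fourier transforms are identified.
  set Q : ℝ → ℝ → 𝓢(ℝ, ℂ) → ℂ := fun t s ψ => fourierPairing (h s)
    fun ξ => airyMultiplier (σ₁ + σ₂) (t - s) ξ * ψ ξ with hQ
  have hFi := fun τ ψ => integrable_airyMultiplier_mul hσ0 hσ τ ψ
  have hF2 := fun τ ψ => memLp_two_airyMultiplier_mul hσ0 hσ τ ψ
  have hQadd : ∀ t s φ ψ, Q t s (φ + ψ) = Q t s φ + Q t s ψ := fun t s φ ψ => by
    simp only [hQ]
    rw [airyMultiplier_add_smul, fourierPairing_add hpp hp (hh s) (hFi _ _) (hF2 _ _) (hFi _ _) (hF2 _ _)]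
  have hQsmul : ∀ t s (c : ℂ) φ, Q t s (c • φ) = c * Q t s φ := fun t s c φ => by
    simp only [hQ]
    rw [airyMultiplier_smul, fourierPairing_smul]
  have hQle : ∀ t s φ, ‖Q t s φ‖ₑ ≤
      eLpNorm (h s) (ENNReal.ofReal p') volume * decayConst * ENNReal.ofReal (decaySeminorm φ) := by
    intro t s φ
    refine (enorm_fourierPairing_le hpp hp (hh s) (hFi _ _) (hF2 _ _)).trans ?_
    rw [mul_assoc, mul_comm decayConst]
    gcongr
    exact sumNorm_airyMultiplier_mul_le hσ0 hσ _ _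
  have hQint : ∀ t φ, IntegrableOn (fun s => Q t s φ) (uIoc t₀ t) := fun t φ => by
    have := (tendsto_integral_fourierPairing hpp hp hσ0 hσ hhm hh (hS t) t (𝓕 φ)).1
    rwa [FourierTransform.fourierInv_fourier_eq] at this
  have hV : ∀ t s, ∃ V : 𝓢'(ℝ, ℂ), ∀ φ, V φ = Q t s φ := fun t s =>
    exists_temperedDistribution (hQadd t s) (hQsmul t s)
      (ENNReal.mul_ne_top (hh s).2.ne decayConst_lt_top.ne) (hQle t s)
  have hI : ∀ t, ∃ V : 𝓢'(ℝ, ℂ), ∀ φ, V φ = ∫ s in t₀..t, Q t s φ := fun t => by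
    refine exists_temperedDistribution (fun φ ψ => ?_) (fun c φ => ?_)
      (C := (∫⁻ s in uIoc t₀ t, eLpNorm (h s) (ENNReal.ofReal p') volume) * decayConst)
      (ENNReal.mul_ne_top (hS t).ne decayConst_lt_top.ne) fun φ => ?_
    · simp_rw [hQadd]
      exact intervalIntegral.integral_add (intervalIntegrable_iff.2 (hQint t φ))
        (intervalIntegrable_iff.2 (hQint t ψ))
    · simp_rw [hQsmul]
      exact intervalIntegral.integral_const_mul _ _
    · have h1 : ‖∫ s in t₀..t, Q t s φ‖ₑ = ‖∫ s in uIoc t₀ t, Q t s φ‖ₑ := by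
        rw [← ofReal_norm, ← ofReal_norm, intervalIntegral.norm_intervalIntegral_eq]
      rw [h1, mul_assoc, ← lintegral_mul_const' _ _ (ENNReal.mul_ne_top decayConst_lt_top.ne ENNReal.ofReal_ne_top)]
      refine (enorm_integral_le_lintegral_enorm _).trans (lintegral_mono fun s => ?_)
      rw [← mul_assoc]
      exact hQle t s φ
  choose V hV using hV
  choose I hI using hI
  refine ⟨fun t => 𝓕⁻ (I t), fun t φ => ?_, fun t g hg => ⟨fun s => 𝓕⁻ (V t s), ?_, fun φ => ⟨?_, ?_⟩⟩⟩
  · rw [TemperedDistribution.fourierInv_apply, hI, intervalIntegral.intervalIntegral_eq_integral_uIoc]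
    have h1 := (tendsto_integral_fourierPairing hpp hp hσ0 hσ hhm hh (hS t) t φ).2
    have h2 : ∀ n, ∫ x, bandDuhamel n (σ₁ + σ₂) t₀ (truncFamily h n) t x * φ x =
        orientation t₀ t * ∫ s in uIoc t₀ t, bandForm n ((σ₁ + σ₂ : ℝ) : ℂ) (t - s) (truncFamily h n s) φ := fun n => by
      have hb := boundedFamily_truncFamily hhm n
      rw [hb.integral_bandDuhamel_mul n _ t₀ t φ.integrable,
        bandPairing_duhamelProfile (hb.niceFamily _) t _ φ.integrable]
    simp_rw [h2]
    have h3 := h1.const_mul (orientation t₀ t)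
    convert h3 using 2
    rw [orientation, Complex.real_smul]
    split_ifs <;> simp [hQ]
  · filter_upwards [hg] with s hs
    obtain ⟨H, ⟨m, hm1, hm2⟩, hH⟩ := hs
    refine ⟨m, hm1, fun ψ => ?_⟩
    rw [FourierTransform.fourier_fourierInv_eq, hV]
    exact isFunction_airyMultiplier hpp hp hσ₁ hσ₂ hσ (t - s) (hh s) hm2 hH ψ
  · simp_rw [TemperedDistribution.fourierInv_apply, hV]
    exact intervalIntegrable_iff.2 (hQint t _)
  · simp_rw [TemperedDistribution.fourierInv_apply, hV, hI]

end DuhamelDistribution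

/-! ### Convex combinations in a Hilbert space -/

section Mazur

/-- Convex combinations of the tails of a bounded sequence of a Hilbert space converge. -/
theorem exists_forall_mem_closure_convexHull {H : Type*} [NormedAddCommGroup H] [InnerProductSpace ℝ H]
    [CompleteSpace H] {x : ℕ → H} {B : ℝ} (hx : ∀ n, ‖x n‖ ≤ B) :
    ∃ u, ∀ n, u ∈ closure (convexHull ℝ (x '' Ici n)) := by
  set K : ℕ → Set H := fun n => closure (convexHull ℝ (x '' Ici n)) with hK
  have hKc : ∀ n, Convex ℝ (K n) := fun n => (convex_convexHull ℝ _).closure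
  have hKanti : Antitone K := fun m n hmn =>
    closure_mono (convexHull_mono (image_mono (Ici_subset_Ici.2 hmn)))
  have hxK : ∀ n, x n ∈ K n := fun n => subset_closure (subset_convexHull ℝ _ ⟨n, self_mem_Ici, rfl⟩)
  -- The elements of minimal norm of the decreasing convex sets `K n` have increasing bounded norms.
  -- Midpoints stay in the earlier set, so the parallelogram law makes the sequence Cauchy, and its
  -- limit lies in every `K n`.
  have h1 : ∀ n, ∃ y ∈ K n, ∀ z ∈ K n, ‖y‖ ≤ ‖z‖ := fun n => by
    obtain ⟨y, hy, hmin⟩ := exists_norm_eq_iInf_of_complete_convex ⟨x n, hxK n⟩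
      (isClosed_closure : IsClosed (K n)).isComplete (hKc n) 0
    refine ⟨y, hy, fun z hz => ?_⟩
    have h2 : ⨅ w : K n, ‖0 - (w : H)‖ ≤ ‖0 - z‖ :=
      ciInf_le ⟨0, by rintro _ ⟨w, rfl⟩; exact norm_nonneg _⟩ (⟨z, hz⟩ : K n)
    rw [← hmin] at h2
    simpa using h2
  choose y hy hmin using h1
  have hmono : Monotone fun n => ‖y n‖ ^ 2 := fun m n hmn => by
    have := hmin m (y n) (hKanti hmn (hy n))
    simp only
    gcongr
  have hbdd : BddAbove (range fun n => ‖y n‖ ^ 2) := by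
    refine ⟨B ^ 2, ?_⟩
    rintro _ ⟨n, rfl⟩
    have := (hmin n _ (hxK n)).trans (hx n)
    simp only
    gcongr
  have hlim := tendsto_atTop_ciSup hmono hbdd
  set ℓ := ⨆ n, ‖y n‖ ^ 2
  have hd : ∀ m n, m ≤ n → ‖y n - y m‖ ^ 2 ≤ 2 * (ℓ - ‖y m‖ ^ 2) := fun m n hmn => by
    have h2 := hmin m ((1 / 2 : ℝ) • y m + (1 / 2 : ℝ) • y n)
      (hKc m (hy m) (hKanti hmn (hy n)) (by norm_num) (by norm_num) (by norm_num))
    have h3 : ‖(1 / 2 : ℝ) • y m + (1 / 2 : ℝ) • y n‖ = (1 / 2) * ‖y n + y m‖ := by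
      rw [← smul_add, norm_smul, add_comm]
      norm_num
    have h4 := parallelogram_law_with_norm ℝ (y n) (y m)
    have h5 : ‖y n‖ ^ 2 ≤ ℓ := le_ciSup hbdd n
    rw [h3] at h2
    nlinarith [norm_nonneg (y m), norm_nonneg (y n + y m)]
  have hcau : CauchySeq y := by
    refine Metric.cauchySeq_iff'.2 fun ε hε => ?_
    have h2 : Filter.Tendsto (fun m => 2 * (ℓ - ‖y m‖ ^ 2)) Filter.atTop (nhds 0) := by
      simpa using (hlim.const_sub ℓ).const_mul 2
    obtain ⟨N, hN⟩ := (h2.eventually (gt_mem_nhds (pow_pos hε 2))).exists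
    refine ⟨N, fun n hn => ?_⟩
    rw [dist_eq_norm]
    exact lt_of_pow_lt_pow_left₀ 2 hε.le ((hd N n hn).trans_lt hN)
  obtain ⟨u, hu⟩ := cauchySeq_tendsto_of_complete hcau
  refine ⟨u, fun n => isClosed_closure.mem_of_tendsto hu ?_⟩
  filter_upwards [Filter.eventually_ge_atTop n] with m hm using hKanti hm (hy m)

end Mazur

/-! ### A finite weight on the line -/

section Weight

/-- A finite measure on the line, equivalent to Lebesgue measure. -/
noncomputable def cauchyWeight : Measure ℝ := volume.withDensity fun x => ENNReal.ofReal (1 + x ^ 2)⁻¹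

theorem measurable_ofReal_inv_one_add_sq : Measurable fun x : ℝ => ENNReal.ofReal (1 + x ^ 2)⁻¹ := by
  fun_prop

instance : IsFiniteMeasure cauchyWeight :=
  isFiniteMeasure_withDensity_ofReal integrable_inv_one_add_sq.2

theorem lintegral_cauchyWeight {f : ℝ → ℝ≥0∞} (hf : Measurable f) :
    ∫⁻ x, f x ∂cauchyWeight = ∫⁻ x, ENNReal.ofReal (1 + x ^ 2)⁻¹ * f x := by
  rw [cauchyWeight, lintegral_withDensity_eq_lintegral_mul _ measurable_ofReal_inv_one_add_sq hf]
  rfl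

theorem cauchyWeight_le : cauchyWeight ≤ volume := by
  refine (withDensity_mono (g := 1) (Filter.Eventually.of_forall fun x => ?_)).trans_eq withDensity_one
  rw [Pi.one_apply, ENNReal.ofReal_le_one]
  exact inv_le_one_of_one_le₀ (by nlinarith)

theorem volume_absolutelyContinuous_cauchyWeight : (volume : Measure ℝ) ≪ cauchyWeight := by
  refine withDensity_absolutelyContinuous' measurable_ofReal_inv_one_add_sq.aemeasurable
    (Filter.Eventually.of_forall fun x => ?_)
  have : 0 < (1 + x ^ 2)⁻¹ := by positivity
  simpa using this

/-- Integration of a rapidly decaying function against Lebesgue measure. -/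
theorem lintegral_mul_le_cauchyWeight {f : ℝ → ℝ≥0∞} (hf : Measurable f) {w : ℝ → ℝ≥0∞} {C : ℝ≥0∞}
    (hw : ∀ x, w x ≤ C * ENNReal.ofReal (1 + x ^ 2)⁻¹) : ∫⁻ x, f x * w x ≤ C * ∫⁻ x, f x ∂cauchyWeight := by
  have hm : Measurable fun x : ℝ => ENNReal.ofReal (1 + x ^ 2)⁻¹ * f x :=
    measurable_ofReal_inv_one_add_sq.mul hf
  rw [lintegral_cauchyWeight hf, ← lintegral_const_mul _ hm]
  refine lintegral_mono fun x => ?_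
  calc f x * w x ≤ f x * (C * ENNReal.ofReal (1 + x ^ 2)⁻¹) := by gcongr; exact hw x
    _ = _ := by ring

theorem enorm_le_cauchy {E : Type*} [NormedAddCommGroup E] {z : E} {c x : ℝ} (h : ‖z‖ * (1 + x ^ 2) ≤ c) :
    ‖z‖ₑ ≤ ENNReal.ofReal c * ENNReal.ofReal (1 + x ^ 2)⁻¹ := by
  have h0 : 0 < 1 + x ^ 2 := by positivity
  have hc : 0 ≤ c := (by positivity : 0 ≤ ‖z‖ * (1 + x ^ 2)).trans h
  rw [← ENNReal.ofReal_mul hc, ← ofReal_norm, ← div_eq_mul_inv]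
  exact ENNReal.ofReal_le_ofReal ((le_div_iff₀ h0).2 h)

theorem exists_schwartz_bound (φ : 𝓢(ℝ, ℂ)) : ∃ C : ℝ, ∀ x, ‖φ x‖ * (1 + x ^ 2) ≤ C := by
  obtain ⟨C0, h0⟩ := φ.decay 0 0
  obtain ⟨C2, h2⟩ := φ.decay 2 0
  refine ⟨C0 + C2, fun x => ?_⟩
  have h3 := h0.2 x
  have h4 := h2.2 x
  simp only [norm_iteratedFDeriv_zero, pow_zero, one_mul, Real.norm_eq_abs, sq_abs] at h3 h4
  linarith

end Weight

/-! ### Bounded functions of time and space in weighted `L²` -/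

section Extraction

/-- A bounded measurable function of time and space. -/
def IsBoundedMeasurable (V : ℝ → ℝ → ℂ) : Prop :=
  StronglyMeasurable (Function.uncurry V) ∧ ∃ C : ℝ, ∀ t x, ‖V t x‖ ≤ C

variable {V W G : ℝ → ℝ → ℂ} {k : ℕ}

theorem IsBoundedMeasurable.combo (hV : IsBoundedMeasurable V) (hW : IsBoundedMeasurable W) (a b : ℝ) :
    IsBoundedMeasurable (a • V + b • W) := by
  obtain ⟨hVm, C, hC⟩ := hV
  obtain ⟨hWm, D, hD⟩ := hW
  refine ⟨(hVm.const_smul a).add (hWm.const_smul b), |a| * C + |b| * D, fun t x => ?_⟩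
  refine (norm_add_le _ _).trans (add_le_add ?_ ?_)
  · rw [Pi.smul_apply, Pi.smul_apply, norm_smul, Real.norm_eq_abs]
    exact mul_le_mul_of_nonneg_left (hC t x) (abs_nonneg a)
  · rw [Pi.smul_apply, Pi.smul_apply, norm_smul, Real.norm_eq_abs]
    exact mul_le_mul_of_nonneg_left (hD t x) (abs_nonneg b)

theorem IsBoundedMeasurable.integrable_slice_mul (hV : IsBoundedMeasurable V) (t : ℝ) {φ : ℝ → ℂ}
    (hφ : Integrable φ) : Integrable fun x => V t x * φ x := by
  obtain ⟨C, hC⟩ := hV.2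
  exact hφ.bdd_mul (StronglyMeasurable.slice hV.1 t).aestronglyMeasurable
    (Filter.Eventually.of_forall (hC t))

theorem IsBoundedMeasurable.integrable_mul (hV : IsBoundedMeasurable V) (hG : BoundedFamily k G) :
    Integrable (fun z : ℝ × ℝ => V z.1 z.2 * G z.1 z.2) (volume.prod volume) := by
  obtain ⟨C, hC⟩ := hV.2
  exact hG.integrable.bdd_mul hV.1.aestronglyMeasurable (Filter.Eventually.of_forall fun z => hC z.1 z.2)

theorem integral_slice_combo (hV : IsBoundedMeasurable V) (hW : IsBoundedMeasurable W) (a b t : ℝ)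
    {φ : ℝ → ℂ} (hφ : Integrable φ) :
    ∫ x, (a • V + b • W) t x * φ x = a • (∫ x, V t x * φ x) + b • ∫ x, W t x * φ x := by
  have ha : Integrable fun x => a • (V t x * φ x) := (hV.integrable_slice_mul t hφ).smul a
  have hb : Integrable fun x => b • (W t x * φ x) := (hW.integrable_slice_mul t hφ).smul b
  rw [← integral_smul, ← integral_smul, ← integral_add ha hb]
  congr 1
  ext x
  simp only [Pi.add_apply, Pi.smul_apply, Complex.real_smul]
  ring

theorem integral_integral_combo (hV : IsBoundedMeasurable V) (hW : IsBoundedMeasurable W) (a b : ℝ)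
    (hG : BoundedFamily k G) :
    ∫ t, ∫ x, (a • V + b • W) t x * G t x =
      a • (∫ t, ∫ x, V t x * G t x) + b • ∫ t, ∫ x, W t x * G t x := by
  have hVi := hV.integrable_mul hG
  have hWi := hW.integrable_mul hG
  have ha : Integrable (fun z : ℝ × ℝ => a • (V z.1 z.2 * G z.1 z.2)) (volume.prod volume) := hVi.smul a
  have hb : Integrable (fun z : ℝ × ℝ => b • (W z.1 z.2 * G z.1 z.2)) (volume.prod volume) := hWi.smul b
  rw [← integral_prod _ hVi, ← integral_prod _ hWi, ← integral_smul, ← integral_smul,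
    ← integral_add ha hb, integral_integral ((hV.combo hW a b).integrable_mul hG)]
  congr 1
  ext z
  simp only [Pi.add_apply, Pi.smul_apply, Complex.real_smul]
  ring

/-- Convex constraints on a linear functional pass to convex combinations. The functionals used are
integrals, whose linearity requires integrability; for this reason bounded measurability is carried
through the hull together with the constraint. -/
theorem mem_of_mem_convexHull {T : (ℝ → ℝ → ℂ) → ℂ}
    (hT : ∀ V W, IsBoundedMeasurable V → IsBoundedMeasurable W → ∀ a b : ℝ,
      T (a • V + b • W) = a • T V + b • T W) {K : Set ℂ} (hK : Convex ℝ K) {s : Set (ℝ → ℝ → ℂ)}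
    (hs : ∀ V ∈ s, IsBoundedMeasurable V ∧ T V ∈ K) (hV : V ∈ convexHull ℝ s) :
    IsBoundedMeasurable V ∧ T V ∈ K := by
  have hc : Convex ℝ {V | IsBoundedMeasurable V ∧ T V ∈ K} := by
    intro V hV W hW a b ha hb hab
    refine ⟨hV.1.combo hW.1 a b, ?_⟩
    rw [hT V W hV.1 hW.1]
    exact hK hV.2 hW.2 ha hb hab
  exact convexHull_min hs hc hV

/-- The square of the norm of `L²` with respect to the product of Cauchy weights. -/
noncomputable def weightedSq (f : ℝ → ℝ → ℂ) : ℝ≥0∞ :=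
  ∫⁻ t, (∫⁻ x, ‖f t x‖ₑ ^ 2 ∂cauchyWeight) ∂cauchyWeight

theorem eLpNorm_uncurry_eq (hV : StronglyMeasurable (Function.uncurry V)) :
    eLpNorm (Function.uncurry V) 2 (cauchyWeight.prod cauchyWeight) = weightedSq V ^ (1 / 2 : ℝ) := by
  rw [eLpNorm_eq_lintegral_rpow_enorm_toReal two_ne_zero ENNReal.ofNat_ne_top, ENNReal.toReal_ofNat, weightedSq]
  congr 1
  have hm : Measurable fun z : ℝ × ℝ => ‖Function.uncurry V z‖ₑ ^ (2 : ℝ) := hV.enorm.pow_const _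
  rw [lintegral_prod _ hm.aemeasurable]
  simp [Function.uncurry]

theorem measurable_lintegral_slice_sq (hV : StronglyMeasurable (Function.uncurry V)) :
    Measurable fun t => ∫⁻ x, ‖V t x‖ₑ ^ 2 ∂cauchyWeight := by
  have hm : Measurable fun z : ℝ × ℝ => ‖V z.1 z.2‖ₑ ^ 2 := hV.enorm.pow_const _
  exact hm.lintegral_prod_right'

/-- On the finite weight, Hölder passes from `L^p` to `L²` in space, and in time `N ^ 2 ≤ 1 + N ^
q`. A uniform bound in the mixed Lebesgue norm thus becomes a uniform bound in one Hilbert space. -/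
theorem weightedSq_le (hV : StronglyMeasurable (Function.uncurry V)) {p q : ℝ} (hp : 2 ≤ p) (hq : 2 ≤ q) :
    weightedSq V ≤ (cauchyWeight univ ^ (1 / 2 - 1 / p)) ^ 2 *
      (cauchyWeight univ + ∫⁻ t, eLpNorm (V t) (ENNReal.ofReal p) volume ^ q) := by
  have hp0 : 0 < p := by linarith
  have hNm : Measurable fun t => eLpNorm (V t) (ENNReal.ofReal p) volume := measurable_eLpNorm_slice hV hp0
  have h1 : ∀ t, ∫⁻ x, ‖V t x‖ₑ ^ 2 ∂cauchyWeight ≤ (cauchyWeight univ ^ (1 / 2 - 1 / p)) ^ 2 *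
      (1 + eLpNorm (V t) (ENNReal.ofReal p) volume ^ q) := fun t => by
    have h2 : eLpNorm (V t) 2 cauchyWeight ≤
        eLpNorm (V t) (ENNReal.ofReal p) volume * cauchyWeight univ ^ (1 / 2 - 1 / p) := by
      have h3 := eLpNorm_le_eLpNorm_mul_rpow_measure_univ (μ := cauchyWeight) (p := 2) (q := ENNReal.ofReal p)
        (by rw [← ENNReal.ofReal_ofNat 2]; exact ENNReal.ofReal_le_ofReal hp)
        (StronglyMeasurable.slice hV t).aestronglyMeasurable
      rw [ENNReal.toReal_ofReal hp0.le, ENNReal.toReal_ofNat] at h3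
      refine h3.trans ?_
      gcongr
      exact cauchyWeight_le
    have h4 : ∫⁻ x, ‖V t x‖ₑ ^ 2 ∂cauchyWeight = eLpNorm (V t) 2 cauchyWeight ^ 2 := by
      rw [eLpNorm_eq_lintegral_rpow_enorm_toReal two_ne_zero ENNReal.ofNat_ne_top, ENNReal.toReal_ofNat,
        ← ENNReal.rpow_natCast, ← ENNReal.rpow_mul]
      simp
    rw [h4]
    calc _ ≤ (eLpNorm (V t) (ENNReal.ofReal p) volume * cauchyWeight univ ^ (1 / 2 - 1 / p)) ^ 2 := by gcongr
      _ = (cauchyWeight univ ^ (1 / 2 - 1 / p)) ^ 2 * eLpNorm (V t) (ENNReal.ofReal p) volume ^ (2 : ℝ) := by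
          rw [mul_pow, mul_comm, ENNReal.rpow_ofNat]
      _ ≤ _ := by
          gcongr
          rcases le_total (eLpNorm (V t) (ENNReal.ofReal p) volume) 1 with h | h
          · exact (ENNReal.rpow_le_one h zero_le_two).trans le_self_add
          · exact (ENNReal.rpow_le_rpow_of_exponent_le h hq).trans le_add_self
  have hm : Measurable fun t => eLpNorm (V t) (ENNReal.ofReal p) volume ^ q := hNm.pow_const _
  calc weightedSq V ≤ ∫⁻ t, (cauchyWeight univ ^ (1 / 2 - 1 / p)) ^ 2 *
      (1 + eLpNorm (V t) (ENNReal.ofReal p) volume ^ q) ∂cauchyWeight := lintegral_mono h1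
    _ = (cauchyWeight univ ^ (1 / 2 - 1 / p)) ^ 2 * (cauchyWeight univ +
          ∫⁻ t, eLpNorm (V t) (ENNReal.ofReal p) volume ^ q ∂cauchyWeight) := by
        rw [lintegral_const_mul _ (hm.const_add 1), lintegral_add_left measurable_const]
        simp
    _ ≤ _ := by
        gcongr
        exact cauchyWeight_le

theorem lintegral_enorm_le_sqrt {f : ℝ → ℂ} (hf : StronglyMeasurable f) :
    ∫⁻ x, ‖f x‖ₑ ∂cauchyWeight ≤
      (∫⁻ x, ‖f x‖ₑ ^ 2 ∂cauchyWeight) ^ (1 / 2 : ℝ) * cauchyWeight univ ^ (1 / 2 : ℝ) := by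
  have h3 := eLpNorm_le_eLpNorm_mul_rpow_measure_univ (μ := cauchyWeight) (p := 1) (q := 2)
    (by norm_num) hf.aestronglyMeasurable
  rw [eLpNorm_one_eq_lintegral_enorm, eLpNorm_eq_lintegral_rpow_enorm_toReal two_ne_zero ENNReal.ofNat_ne_top,
    ENNReal.toReal_ofNat, ENNReal.toReal_one] at h3
  convert h3 using 3
  · simp
  · norm_num

end Extraction

/-! ### Extraction of a measurable limit -/

section Extraction

variable {v : ℕ → ℝ → ℝ → ℂ} {u : ℝ → ℝ → ℂ}

/-- Convex combinations of the tails of a sequence of functions converge rapidly in a weighted `L²` space. -/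
theorem exists_convexHull_weightedSq_le (hv : ∀ n, IsBoundedMeasurable (v n)) {B : ℝ≥0∞} (hB : B ≠ ∞)
    (hvB : ∀ n, weightedSq (v n) ≤ B) :
    ∃ u : ℝ → ℝ → ℂ, StronglyMeasurable (Function.uncurry u) ∧ ∃ V : ℕ → ℝ → ℝ → ℂ,
      (∀ n, V n ∈ convexHull ℝ (v '' Ici n)) ∧ ∀ n, weightedSq (V n - u) ≤ (1 / 2) ^ n := by
  set μ : Measure (ℝ × ℝ) := cauchyWeight.prod cauchyWeight with hμ
  have hmem : ∀ n, MemLp (Function.uncurry (v n)) 2 μ := fun n => by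
    obtain ⟨C, hC⟩ := (hv n).2
    exact MemLp.of_bound (hv n).1.aestronglyMeasurable C (Filter.Eventually.of_forall fun z => hC z.1 z.2)
  set x : ℕ → Lp ℂ 2 μ := fun n => (hmem n).toLp with hx
  have hxB : ∀ n, ‖x n‖ ≤ (B ^ (1 / 2 : ℝ)).toReal := fun n => by
    rw [hx, Lp.norm_toLp, eLpNorm_uncurry_eq (hv n).1]
    exact ENNReal.toReal_mono (ENNReal.rpow_ne_top_of_nonneg (by norm_num) hB)
      (ENNReal.rpow_le_rpow (hvB n) (by norm_num))
  obtain ⟨U, hU⟩ := exists_forall_mem_closure_convexHull hxB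
  -- Convex combinations of classes in `L²` are lifted to the same combinations of genuine
  -- functions, on which pairings at an individual time make sense.
  have hrep : ∀ n, ∀ w ∈ convexHull ℝ (x '' Ici n), ∃ V ∈ convexHull ℝ (v '' Ici n),
      Function.uncurry V =ᵐ[μ] w := fun n => by
    refine convexHull_min ?_ ?_
    · rintro _ ⟨m, hm, rfl⟩
      exact ⟨v m, subset_convexHull ℝ _ ⟨m, hm, rfl⟩, (hmem m).coeFn_toLp.symm⟩
    · rintro w₁ ⟨V₁, hV₁, h₁⟩ w₂ ⟨V₂, hV₂, h₂⟩ a b ha hb hab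
      refine ⟨a • V₁ + b • V₂, convex_convexHull ℝ _ hV₁ hV₂ ha hb hab, ?_⟩
      filter_upwards [h₁, h₂, Lp.coeFn_add (a • w₁) (b • w₂), Lp.coeFn_smul a w₁, Lp.coeFn_smul b w₂]
        with z hz₁ hz₂ hz₃ hz₄ hz₅
      rw [hz₃, Pi.add_apply, hz₄, hz₅, Pi.smul_apply, Pi.smul_apply, ← hz₁, ← hz₂]
      rfl
  have h1 : ∀ n : ℕ, ∃ V ∈ convexHull ℝ (v '' Ici n),
      eLpNorm (Function.uncurry V - (U : ℝ × ℝ → ℂ)) 2 μ < (1 / 2) ^ n := fun n => by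
    obtain ⟨w, hw, hd⟩ := EMetric.mem_closure_iff.1 (hU n) ((1 / 2) ^ n)
      (ENNReal.pow_pos (by norm_num) n)
    obtain ⟨V, hV, hVw⟩ := hrep n w hw
    refine ⟨V, hV, ?_⟩
    rw [edist_comm, Lp.edist_def] at hd
    refine (eLpNorm_congr_ae ?_).trans_lt hd
    filter_upwards [hVw] with z hz
    rw [Pi.sub_apply, Pi.sub_apply, hz]
  choose V hV hVd using h1
  have hVm : ∀ n, StronglyMeasurable (Function.uncurry (V n)) := fun n =>
    (mem_of_mem_convexHull (T := 0) (s := v '' Ici n) (K := univ) (by simp) convex_univ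
      (by rintro _ ⟨m, -, rfl⟩; exact ⟨hv m, trivial⟩) (hV n)).1.1
  refine ⟨Function.curry U, ?_, V, hV, fun n => ?_⟩
  · rw [Function.uncurry_curry]
    exact Lp.stronglyMeasurable U
  · have h2 : StronglyMeasurable (Function.uncurry (V n - Function.curry U)) :=
      (hVm n).sub (Lp.stronglyMeasurable U)
    have h3 := eLpNorm_uncurry_eq h2
    have h4 : weightedSq (V n - Function.curry U) = eLpNorm (Function.uncurry (V n) - (U : ℝ × ℝ → ℂ)) 2 μ ^ 2 := by
      have : Function.uncurry (V n) - (U : ℝ × ℝ → ℂ) = Function.uncurry (V n - Function.curry U) := rfl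
      rw [this, h3, ← ENNReal.rpow_natCast, ← ENNReal.rpow_mul]
      simp
    rw [h4]
    calc _ ≤ ((1 / 2 : ℝ≥0∞) ^ n) ^ 2 := by gcongr; exact (hVd n).le
      _ ≤ (1 / 2 : ℝ≥0∞) ^ n := by
          rw [sq]
          refine mul_le_of_le_one_left' ?_
          exact pow_le_one₀ zero_le (by simp)

/-- A limit in the weighted `L²` space is a limit against Schwartz functions, at almost every time. -/
theorem ae_tendsto_slice {V : ℕ → ℝ → ℝ → ℂ} (hV : ∀ n, IsBoundedMeasurable (V n))
    (hu : StronglyMeasurable (Function.uncurry u)) (hVu : ∀ n, weightedSq (V n - u) ≤ (1 / 2) ^ n) :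
    ∀ᵐ t, ∀ φ : 𝓢(ℝ, ℂ), Integrable (fun x => u t x * φ x) ∧
      Filter.Tendsto (fun n => ∫ x, V n t x * φ x) Filter.atTop (nhds (∫ x, u t x * φ x)) := by
  have hdm : ∀ n, StronglyMeasurable (Function.uncurry (V n - u)) := fun n => (hV n).1.sub hu
  set D : ℕ → ℝ → ℝ≥0∞ := fun n t => ∫⁻ x, ‖(V n - u) t x‖ₑ ^ 2 ∂cauchyWeight with hD
  have hDm : ∀ n, Measurable (D n) := fun n => measurable_lintegral_slice_sq (hdm n)
  -- The geometric rate makes the errors summable, so they tend to zero at almost every time without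
  -- passing to a further subsequence.
  have h1 : ∫⁻ t, ∑' n, D n t ∂cauchyWeight ≠ ∞ := by
    rw [lintegral_tsum fun n => (hDm n).aemeasurable]
    refine ne_top_of_le_ne_top ?_ (ENNReal.tsum_le_tsum hVu)
    rw [ENNReal.tsum_geometric]
    simp
  have h2 : ∀ᵐ t ∂cauchyWeight, ∑' n, D n t < ∞ :=
    ae_lt_top (Measurable.tsum hDm) h1
  filter_upwards [volume_absolutelyContinuous_cauchyWeight.ae_le h2] with t ht φ
  have h3 : Filter.Tendsto (fun n => D n t) Filter.atTop (nhds 0) :=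
    ENNReal.tendsto_atTop_zero_of_tsum_ne_top ht.ne
  obtain ⟨C, hC⟩ := exists_schwartz_bound φ
  have h4 : ∀ n, ∫⁻ x, ‖V n t x * φ x - u t x * φ x‖ₑ ≤
      ENNReal.ofReal C * (D n t ^ (1 / 2 : ℝ) * cauchyWeight univ ^ (1 / 2 : ℝ)) := fun n => by
    have hs := StronglyMeasurable.slice (hdm n) t
    calc ∫⁻ x, ‖V n t x * φ x - u t x * φ x‖ₑ = ∫⁻ x, ‖(V n - u) t x‖ₑ * ‖φ x‖ₑ := by
          refine lintegral_congr fun x => ?_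
          rw [← sub_mul, enorm_mul]
          rfl
      _ ≤ ENNReal.ofReal C * ∫⁻ x, ‖(V n - u) t x‖ₑ ∂cauchyWeight :=
          lintegral_mul_le_cauchyWeight hs.enorm fun x => enorm_le_cauchy (hC x)
      _ ≤ _ := by
          gcongr
          exact lintegral_enorm_le_sqrt hs
  have h5 : Filter.Tendsto (fun n => ENNReal.ofReal C * (D n t ^ (1 / 2 : ℝ) * cauchyWeight univ ^ (1 / 2 : ℝ)))
      Filter.atTop (nhds 0) := by
    have h6 := ENNReal.Tendsto.const_mul (a := ENNReal.ofReal C) (ENNReal.Tendsto.mul_const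
      (b := cauchyWeight univ ^ (1 / 2 : ℝ))
      (((ENNReal.continuous_rpow_const (y := 1 / 2)).tendsto 0).comp h3)
      (Or.inr (ENNReal.rpow_ne_top_of_nonneg (by norm_num) (measure_ne_top _ _))))
      (Or.inr ENNReal.ofReal_ne_top)
    simpa using h6
  have h6 := tendsto_of_tendsto_of_tendsto_of_le_of_le tendsto_const_nhds h5 (fun _ => zero_le) h4
  have hVi : ∀ n, Integrable fun x => V n t x * φ x := fun n => (hV n).integrable_slice_mul t φ.integrable
  have hui : Integrable fun x => u t x * φ x := by
    obtain ⟨n, hn⟩ := (h6.eventually (gt_mem_nhds ENNReal.zero_lt_top)).exists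
    have hsm : AEStronglyMeasurable (fun x => u t x * φ x) volume :=
      (StronglyMeasurable.slice hu t).aestronglyMeasurable.mul φ.continuous.aestronglyMeasurable
    have h7 : Integrable fun x => V n t x * φ x - u t x * φ x := ⟨(hVi n).1.sub hsm, hn⟩
    exact ((hVi n).sub h7).congr (Filter.Eventually.of_forall fun _ => sub_sub_cancel _ _)
  exact ⟨hui, tendsto_integral_of_L1 _ hui.1 (Filter.Eventually.of_forall hVi) h6⟩

/-- A limit in the weighted `L²` space is a limit against bounded functions of bounded support. -/
theorem tendsto_integral_boundedFamily {V : ℕ → ℝ → ℝ → ℂ} (hV : ∀ n, IsBoundedMeasurable (V n))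
    (hu : StronglyMeasurable (Function.uncurry u)) (hVu : ∀ n, weightedSq (V n - u) ≤ (1 / 2) ^ n)
    {k : ℕ} {G : ℝ → ℝ → ℂ} (hG : BoundedFamily k G) :
    Filter.Tendsto (fun n => ∫ t, ∫ x, V n t x * G t x) Filter.atTop (nhds (∫ t, ∫ x, u t x * G t x)) := by
  have hdm : ∀ n, StronglyMeasurable (Function.uncurry (V n - u)) := fun n => (hV n).1.sub hu
  set c : ℝ := (1 + (k : ℝ) ^ 2) with hc
  have hc1 : ∀ t : ℝ, |t| ≤ k → 1 + t ^ 2 ≤ c := fun t ht => by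
    have := sq_abs t
    rw [hc, ← this]
    gcongr
  have h1 : ∀ n t, ∫⁻ x, ‖(V n - u) t x‖ₑ * ‖G t x‖ₑ ≤ ENNReal.ofReal (k * c) *
      ((∫⁻ x, ‖(V n - u) t x‖ₑ ∂cauchyWeight) * ENNReal.ofReal c * ENNReal.ofReal (1 + t ^ 2)⁻¹) := fun n t => by
    by_cases ht : |t| ≤ k
    · have h2 : ∫⁻ x, ‖(V n - u) t x‖ₑ * ‖G t x‖ₑ ≤
          ENNReal.ofReal (k * c) * ∫⁻ x, ‖(V n - u) t x‖ₑ ∂cauchyWeight := by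
        refine lintegral_mul_le_cauchyWeight (StronglyMeasurable.slice (hdm n) t).enorm fun x =>
          enorm_le_cauchy ?_
        by_cases hx : G t x = 0
        · rw [hx, norm_zero, zero_mul]
          positivity
        · exact mul_le_mul (hG.norm_le t x) (hc1 x (hG.support t x hx).2) (by positivity) (by positivity)
      refine h2.trans ?_
      gcongr
      rw [mul_assoc]
      refine le_mul_of_one_le_right' ?_
      rw [← ENNReal.ofReal_mul (by positivity), ENNReal.one_le_ofReal, ← div_eq_mul_inv,
        one_le_div (by positivity)]
      exact hc1 t ht
    · have h2 : ∀ x, G t x = 0 := fun x => by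
        by_contra hx
        exact ht (hG.support t x hx).1
      simp [h2]
  have h2 : ∀ n, ∫⁻ z : ℝ × ℝ, ‖V n z.1 z.2 * G z.1 z.2 - u z.1 z.2 * G z.1 z.2‖ₑ ∂(volume.prod volume) ≤
      ENNReal.ofReal (k * c) * (ENNReal.ofReal c *
        (((1 / 2) ^ n) ^ (1 / 2 : ℝ) * cauchyWeight univ ^ (1 / 2 : ℝ) * cauchyWeight univ ^ (1 / 2 : ℝ))) := fun n => by
    have hm1 : Measurable fun t => ∫⁻ x, ‖(V n - u) t x‖ₑ ∂cauchyWeight := by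
      have hm : Measurable fun z : ℝ × ℝ => ‖(V n - u) z.1 z.2‖ₑ := (hdm n).enorm
      exact hm.lintegral_prod_right'
    have hm2 : Measurable fun z : ℝ × ℝ => ‖V n z.1 z.2 * G z.1 z.2 - u z.1 z.2 * G z.1 z.2‖ₑ :=
      (((hV n).1.mul hG.1).sub (hu.mul hG.1)).enorm
    have h3 : ∫⁻ t, ∫⁻ x, ‖(V n - u) t x‖ₑ ∂cauchyWeight ∂cauchyWeight ≤
        ((1 / 2) ^ n) ^ (1 / 2 : ℝ) * cauchyWeight univ ^ (1 / 2 : ℝ) * cauchyWeight univ ^ (1 / 2 : ℝ) := by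
      have h4 := eLpNorm_le_eLpNorm_mul_rpow_measure_univ (μ := cauchyWeight.prod cauchyWeight) (p := 1) (q := 2)
        (by norm_num) (hdm n).aestronglyMeasurable
      rw [eLpNorm_one_eq_lintegral_enorm, eLpNorm_uncurry_eq (hdm n), lintegral_prod _ (hdm n).enorm.aemeasurable] at h4
      refine h4.trans ?_
      rw [← univ_prod_univ, Measure.prod_prod, ENNReal.mul_rpow_of_nonneg _ _ (by norm_num), ← mul_assoc]
      norm_num only [ENNReal.toReal_one, ENNReal.toReal_ofNat]
      gcongr
      simpa using hVu n
    calc _ = ∫⁻ t, ∫⁻ x, ‖(V n - u) t x‖ₑ * ‖G t x‖ₑ := by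
          rw [lintegral_prod _ hm2.aemeasurable]
          refine lintegral_congr fun t => lintegral_congr fun x => ?_
          rw [← sub_mul, enorm_mul]
          rfl
      _ ≤ ∫⁻ t, ENNReal.ofReal (k * c) * ((∫⁻ x, ‖(V n - u) t x‖ₑ ∂cauchyWeight) *
            (ENNReal.ofReal c * ENNReal.ofReal (1 + t ^ 2)⁻¹)) := by
          refine lintegral_mono fun t => ?_
          rw [← mul_assoc (∫⁻ x, ‖(V n - u) t x‖ₑ ∂cauchyWeight)]
          exact h1 n t
      _ = ENNReal.ofReal (k * c) * ∫⁻ t, (∫⁻ x, ‖(V n - u) t x‖ₑ ∂cauchyWeight) *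
            (ENNReal.ofReal c * ENNReal.ofReal (1 + t ^ 2)⁻¹) := lintegral_const_mul' _ _ ENNReal.ofReal_ne_top
      _ ≤ _ := by
          gcongr
          exact (lintegral_mul_le_cauchyWeight hm1 fun t => le_rfl).trans (by gcongr)
  have h5 : Filter.Tendsto (fun n : ℕ => ENNReal.ofReal (k * c) * (ENNReal.ofReal c *
        (((1 / 2) ^ n) ^ (1 / 2 : ℝ) * cauchyWeight univ ^ (1 / 2 : ℝ) * cauchyWeight univ ^ (1 / 2 : ℝ))))
      Filter.atTop (nhds 0) := by
    have hf : cauchyWeight univ ^ (1 / 2 : ℝ) ≠ ∞ :=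
      ENNReal.rpow_ne_top_of_nonneg (by norm_num) (measure_ne_top _ _)
    have h3 : Filter.Tendsto (fun n : ℕ => (1 / 2 : ℝ≥0∞) ^ n) Filter.atTop (nhds 0) :=
      ENNReal.tendsto_pow_atTop_nhds_zero_of_lt_one (by simp)
    have h6 := ENNReal.Tendsto.const_mul (a := ENNReal.ofReal (k * c)) (ENNReal.Tendsto.const_mul
      (a := ENNReal.ofReal c) (ENNReal.Tendsto.mul_const (ENNReal.Tendsto.mul_const
      (((ENNReal.continuous_rpow_const (y := 1 / 2)).tendsto 0).comp h3) (Or.inr hf)) (Or.inr hf))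
      (Or.inr ENNReal.ofReal_ne_top)) (Or.inr ENNReal.ofReal_ne_top)
    simpa using h6
  have h6 := tendsto_of_tendsto_of_tendsto_of_le_of_le tendsto_const_nhds h5 (fun _ => zero_le) h2
  have hVi : ∀ n, Integrable (fun z : ℝ × ℝ => V n z.1 z.2 * G z.1 z.2) (volume.prod volume) := fun n =>
    (hV n).integrable_mul hG
  have hui : Integrable (fun z : ℝ × ℝ => u z.1 z.2 * G z.1 z.2) (volume.prod volume) := by
    obtain ⟨n, hn⟩ := (h6.eventually (gt_mem_nhds ENNReal.zero_lt_top)).exists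
    have hsm : AEStronglyMeasurable (fun z : ℝ × ℝ => u z.1 z.2 * G z.1 z.2) (volume.prod volume) :=
      (hu.mul hG.1).aestronglyMeasurable
    have h7 : Integrable (fun z : ℝ × ℝ => V n z.1 z.2 * G z.1 z.2 - u z.1 z.2 * G z.1 z.2)
      (volume.prod volume) := ⟨(hVi n).1.sub hsm, hn⟩
    exact ((hVi n).sub h7).congr (Filter.Eventually.of_forall fun _ => sub_sub_cancel _ _)
  simp_rw [← integral_prod _ (hVi _), ← integral_prod _ hui]
  exact tendsto_integral_of_L1 _ hui.1 (Filter.Eventually.of_forall hVi) h6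

/-- A bounded sequence of functions of time and space, which converges as distributions at every
time, has a measurable limit. -/
theorem exists_limit (hv : ∀ n, IsBoundedMeasurable (v n)) {p q : ℝ} (hp : 2 ≤ p) (hq : 2 ≤ q) {B : ℝ≥0∞}
    (hB : B ≠ ∞) (hvB : ∀ n, ∫⁻ t, eLpNorm (v n t) (ENNReal.ofReal p) volume ^ q ≤ B)
    {L : ℝ → 𝓢(ℝ, ℂ) → ℂ}
    (hL : ∀ t φ, Filter.Tendsto (fun n => ∫ x, v n t x * φ x) Filter.atTop (nhds (L t φ))) :
    ∃ u : ℝ → ℝ → ℂ, StronglyMeasurable (Function.uncurry u) ∧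
      (∀ᵐ t, ∀ φ : 𝓢(ℝ, ℂ), Integrable (fun x => u t x * φ x) ∧ L t φ = ∫ x, u t x * φ x) ∧
      ∀ k G, BoundedFamily k G → ∀ c, (∀ n, ‖∫ t, ∫ x, v n t x * G t x‖ₑ ≤ c) →
        ‖∫ t, ∫ x, u t x * G t x‖ₑ ≤ c := by
  have hfin : (cauchyWeight univ ^ (1 / 2 - 1 / p)) ^ 2 * (cauchyWeight univ + B) ≠ ∞ := by
    refine ENNReal.mul_ne_top (ENNReal.pow_ne_top (ENNReal.rpow_ne_top_of_nonneg ?_ (measure_ne_top _ _)))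
      (ENNReal.add_ne_top.2 ⟨measure_ne_top _ _, hB⟩)
    have := one_div_le_one_div_of_le two_pos hp
    linarith
  obtain ⟨u, hu, V, hV, hVu⟩ := exists_convexHull_weightedSq_le hv hfin fun n =>
    (weightedSq_le (hv n).1 hp hq).trans (by gcongr; exact hvB n)
  have hVb : ∀ n, IsBoundedMeasurable (V n) := fun n =>
    (mem_of_mem_convexHull (T := 0) (s := v '' Ici n) (K := univ) (by simp) convex_univ
      (by rintro _ ⟨m, -, rfl⟩; exact ⟨hv m, trivial⟩) (hV n)).1
  refine ⟨u, hu, ?_, fun k G hG c hc => ?_⟩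
  · filter_upwards [ae_tendsto_slice hVb hu hVu] with t ht φ
    refine ⟨(ht φ).1, tendsto_nhds_unique ?_ (ht φ).2⟩
    rw [Metric.tendsto_atTop]
    intro ε hε
    obtain ⟨N, hN⟩ := Metric.tendsto_atTop.1 (hL t φ) (ε / 2) (half_pos hε)
    refine ⟨N, fun n hn => ?_⟩
    -- `V n` is a convex combination of the tail beyond `n`, all of whose pairings lie within `ε /
    -- 2` of the distributional limit. Hence the strong limit and the distributional limit coincide.
    have h1 := (mem_of_mem_convexHull (T := fun V => ∫ x, V t x * φ x) (s := v '' Ici n)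
      (K := Metric.closedBall (L t φ) (ε / 2))
      (fun V W hV hW a b => integral_slice_combo hV hW a b t φ.integrable) (convex_closedBall _ _)
      (by rintro _ ⟨m, hm, rfl⟩; exact ⟨hv m, (hN m (hn.trans hm)).le⟩) (hV n)).2
    exact (Metric.mem_closedBall.1 h1).trans_lt (half_lt_self hε)
  · rcases eq_or_ne c ∞ with rfl | hc'
    · exact le_top
    refine le_of_tendsto (tendsto_integral_boundedFamily hVb hu hVu hG).enorm
      (Filter.Eventually.of_forall fun n => ?_)
    have key : ∀ z : ℂ, ‖z‖ₑ ≤ c ↔ z ∈ Metric.closedBall (0 : ℂ) c.toReal := fun z => by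
      rw [mem_closedBall_zero_iff, ← toReal_enorm, ENNReal.toReal_le_toReal enorm_ne_top hc']
    rw [key]
    exact (mem_of_mem_convexHull (T := fun V => ∫ t, ∫ x, V t x * G t x) (s := v '' Ici n)
      (fun V W hV hW a b => integral_integral_combo hV hW a b hG) (convex_closedBall _ _)
      (by rintro _ ⟨m, hm, rfl⟩; exact ⟨hv m, (key _).1 (hc m)⟩) (hV n)).2

end Extraction

/-! ### Scalar estimates in time -/

section ScalarBounds

variable {γ l q q' : ℝ} {a f b v : ℝ → ℝ≥0∞}

theorem lorentzSq_congr_ae {e : ℝ} (h : a =ᵐ[volume] b) : lorentzSq e a = lorentzSq e b := by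
  unfold lorentzSq levelVol
  refine lintegral_congr fun y => ?_
  congr 2
  refine measure_congr (Filter.eventuallyEq_set.2 ?_)
  filter_upwards [h] with t ht
  rw [ht]

/-- The constant of the weak form of the Hardy–Littlewood–Sobolev inequality. -/
noncomputable def dualConst (γ : ℝ) : ℝ≥0∞ := 2 * ENNReal.ofReal (1 + 2 / (1 - γ))

theorem dualConst_ne_top (γ : ℝ) : dualConst γ ≠ ∞ := ENNReal.mul_ne_top (by norm_num) ENNReal.ofReal_ne_top

/-- The constant of the embedding of `L^{q,2}` in `L^q`. -/
noncomputable def embeddingConst (q : ℝ) : ℝ≥0∞ := ENNReal.ofReal q * 4 ^ ((q - 2) / 2)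

theorem embeddingConst_ne_top (q : ℝ) : embeddingConst q ≠ ∞ :=
  ENNReal.mul_ne_top ENNReal.ofReal_ne_top (ENNReal.rpow_ne_top_of_ne_zero (by norm_num) (by norm_num))

theorem lintegral_rpow_le_of_lorentzSq (hγ0 : 0 < γ) (hγ1 : γ < 1) (hb : Measurable b) {K : ℝ≥0∞}
    (h : lorentzSq γ b ≤ K) : ∫⁻ t, b t ^ (2 / γ) ≤ embeddingConst (2 / γ) * K ^ (1 / γ) := by
  have h1 := lintegral_rpow_le_lorentzSq (q := 2 / γ) ((le_div_iff₀ hγ0).2 (by linarith)) hb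
  rw [div_div_cancel₀ two_ne_zero, ← mul_assoc, show 2 / γ / 2 = 1 / γ by field_simp] at h1
  refine h1.trans ?_
  rw [embeddingConst]
  gcongr

theorem lintegral_rieszPotential_rpow_le (hγ0 : 0 < γ) (hγ1 : γ < 1) (ha : Measurable a) :
    ∫⁻ t, rieszPotential γ univ a t ^ (2 / γ) ≤
      embeddingConst (2 / γ) * (dualConst γ * rieszEnergy γ univ a) ^ (1 / γ) :=
  lintegral_rpow_le_of_lorentzSq hγ0 hγ1 (measurable_rieszPotential ha)
    (lorentzSq_rieszPotential_le hγ0 hγ1 ha)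

/-- A bounded function of bounded support has finite energy. -/
theorem BoundedSupport.rieszEnergy_ne_top (hγ0 : 0 < γ) (hγ1 : γ < 1) (ha : Measurable a)
    (hs : BoundedSupport a) : rieszEnergy γ univ a ≠ ∞ := by
  obtain ⟨k, hk⟩ := hs
  refine ne_top_of_le_ne_top ?_ (rieszEnergy_le_lorentzSq hγ0 hγ1 ha)
  refine ENNReal.mul_ne_top (dualConst_ne_top γ) (ENNReal.mul_ne_top ENNReal.ofReal_ne_top ?_)
  have h1 : ∀ y ∈ Ioi (0 : ℝ), ENNReal.ofReal y * levelVol a y ^ (2 - γ) ≤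
      (Iic (k : ℝ)).indicator (fun _ => k * ENNReal.ofReal (2 * k) ^ (2 - γ)) y := fun y hy => by
    by_cases hyk : y ≤ k
    · rw [indicator_of_mem (show y ∈ Iic (k : ℝ) from hyk)]
      have h2 : levelVol a y ≤ ENNReal.ofReal (2 * k) := by
        rw [show (2 * (k : ℝ)) = k - (-k) by ring, ← Real.volume_Icc]
        exact measure_mono fun t ht => abs_le.1 ((hk t).2 (ne_bot_of_gt ht))
      have h3 : ENNReal.ofReal y ≤ k := by
        rw [← ENNReal.ofReal_natCast]
        exact ENNReal.ofReal_le_ofReal hyk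
      exact mul_le_mul' h3 (ENNReal.rpow_le_rpow h2 (by linarith))
    · have h2 : levelVol a y = 0 := by
        rw [levelVol, show {t | ENNReal.ofReal y < a t} = ∅ from ?_, measure_empty]
        refine eq_empty_of_forall_notMem fun t ht => ?_
        have h3 : ENNReal.ofReal y < k := lt_of_lt_of_le ht (hk t).1
        rw [← ENNReal.ofReal_natCast] at h3
        exact hyk (ENNReal.ofReal_lt_ofReal_iff'.1 h3).1.le
      rw [h2, ENNReal.zero_rpow_of_pos (by linarith), mul_zero]
      exact zero_le
  refine ne_top_of_le_ne_top ?_ (setLIntegral_mono' measurableSet_Ioi h1)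
  rw [setLIntegral_indicator measurableSet_Iic, setLIntegral_const, Iic_inter_Ioi, Real.volume_Ioc]
  exact ENNReal.mul_ne_top (ENNReal.mul_ne_top (ENNReal.natCast_ne_top k)
    (ENNReal.rpow_ne_top_of_nonneg (by linarith) ENNReal.ofReal_ne_top)) ENNReal.ofReal_ne_top

/-- Hölder in time: since `l q = 2 / γ`, the `L^q` norm of `M ^ l` is a power of the `L^{2/γ}` norm
of `M`, and the latter is controlled through the embedding of `L^{2/γ,2}`. The powers of the energy,
`(1 - l) / 2` and `l / 2`, add up to `1 / 2`. -/
theorem lintegral_energy_mul_potential_le (hγ0 : 0 < γ) (hγ1 : γ < 1) (hl0 : 0 < l) (hl1 : l ≤ 1)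
    (hq : q = 2 / (γ * l)) (hqq : q.HolderConjugate q') (ha : Measurable a) (hf : Measurable f) :
    ∫⁻ s, 324 * (rieszEnergy γ univ a ^ ((1 - l) / 2) * rieszPotential γ univ a s ^ l) * f s ≤
      324 * (embeddingConst (2 / γ) * dualConst γ ^ (1 / γ)) ^ (1 / q) * (∫⁻ s, f s ^ q') ^ (1 / q') *
        rieszEnergy γ univ a ^ (1 / 2 : ℝ) := by
  set E := rieszEnergy γ univ a
  have hM : Measurable (rieszPotential γ univ a) := measurable_rieszPotential ha
  have hMl : Measurable fun s => rieszPotential γ univ a s ^ l := hM.pow_const l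
  have hq0 : 0 < q := hqq.pos
  have h1 : ∫⁻ s, 324 * (E ^ ((1 - l) / 2) * rieszPotential γ univ a s ^ l) * f s =
      324 * E ^ ((1 - l) / 2) * ∫⁻ s, rieszPotential γ univ a s ^ l * f s := by
    have hm : Measurable fun s => rieszPotential γ univ a s ^ l * f s := hMl.mul hf
    rw [← lintegral_const_mul _ hm]
    refine lintegral_congr fun s => ?_
    ring
  have h2 : ∫⁻ s, rieszPotential γ univ a s ^ l * f s ≤
      (∫⁻ s, rieszPotential γ univ a s ^ (2 / γ)) ^ (1 / q) * (∫⁻ s, f s ^ q') ^ (1 / q') := by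
    have h3 := ENNReal.lintegral_mul_le_Lp_mul_Lq volume hqq hMl.aemeasurable hf.aemeasurable
    simp_rw [← ENNReal.rpow_mul] at h3
    rwa [show l * q = 2 / γ by rw [hq]; field_simp] at h3
  have h3 : (∫⁻ s, rieszPotential γ univ a s ^ (2 / γ)) ^ (1 / q) ≤
      (embeddingConst (2 / γ) * dualConst γ ^ (1 / γ)) ^ (1 / q) * E ^ (l / 2) := by
    calc _ ≤ (embeddingConst (2 / γ) * (dualConst γ * E) ^ (1 / γ)) ^ (1 / q) := by
          gcongr
          exact lintegral_rieszPotential_rpow_le hγ0 hγ1 ha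
      _ = _ := by
          rw [ENNReal.mul_rpow_of_nonneg _ E (by positivity : 0 ≤ 1 / γ), ← mul_assoc,
            ENNReal.mul_rpow_of_nonneg _ _ (by positivity : 0 ≤ 1 / q), ← ENNReal.rpow_mul E,
            show 1 / γ * (1 / q) = l / 2 by rw [hq]; field_simp]
  have h4 : E ^ (1 / 2 : ℝ) = E ^ ((1 - l) / 2) * E ^ (l / 2) := by
    rw [← ENNReal.rpow_add_of_nonneg _ _ (by linarith) (by linarith)]
    congr 1
    ring
  rw [h1, h4]
  calc _ ≤ 324 * E ^ ((1 - l) / 2) * ((embeddingConst (2 / γ) * dualConst γ ^ (1 / γ)) ^ (1 / q) * E ^ (l / 2) *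
        (∫⁻ s, f s ^ q') ^ (1 / q')) := by
        gcongr
        exact h2.trans (by gcongr)
    _ = _ := by ring

/-- Indicators of bounded measurable sets are admissible test functions. -/
theorem ae_le_of_forall_boundedSupport (hv : Measurable v)
    (h : ∀ a, Measurable a → BoundedSupport a → ∫⁻ t, v t * a t ≤ ∫⁻ t, b t * a t) : ∀ᵐ t, v t ≤ b t := by
  have h1 : ∀ k : ℕ, ∀ᵐ t, t ∈ Icc (-(k : ℝ)) k → v t ≤ b t := fun k => by
    rw [← ae_restrict_iff' measurableSet_Icc]
    refine ae_le_of_forall_setLIntegral_le_of_sigmaFinite₀ hv.aemeasurable fun s hs _ => ?_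
    have hsm : MeasurableSet (s ∩ Icc (-(k : ℝ)) k) := hs.inter measurableSet_Icc
    have h2 := h ((s ∩ Icc (-(k : ℝ)) k).indicator 1) (measurable_one.indicator hsm) ⟨k + 1, fun t => ?_⟩
    · have h3 : ∀ c : ℝ → ℝ≥0∞, ∫⁻ t, c t * (s ∩ Icc (-(k : ℝ)) k).indicator 1 t =
          ∫⁻ t in s, c t ∂volume.restrict (Icc (-(k : ℝ)) k) := fun c => by
        rw [Measure.restrict_restrict hs, ← lintegral_indicator hsm]
        refine lintegral_congr fun t => ?_
        by_cases ht : t ∈ s ∩ Icc (-(k : ℝ)) k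
        · rw [indicator_of_mem ht, indicator_of_mem ht, Pi.one_apply, mul_one]
        · rw [indicator_of_notMem ht, indicator_of_notMem ht, mul_zero]
      rwa [h3, h3] at h2
    · by_cases ht : t ∈ s ∩ Icc (-(k : ℝ)) k
      · refine ⟨?_, fun _ => ?_⟩
        · rw [indicator_of_mem ht, Pi.one_apply]
          exact_mod_cast Nat.le_add_left 1 k
        · push_cast
          exact (abs_le.2 ht.2).trans (by linarith)
      · rw [indicator_of_notMem ht]
        exact ⟨zero_le, fun h => absurd rfl h⟩
  filter_upwards [ae_all_iff.2 h1] with t ht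
  obtain ⟨k, hk⟩ := exists_nat_ge |t|
  exact ht k (abs_le.1 hk)

/-- The majorant `E ^ ((1 - l) / 2) * M ^ l` has finite Lebesgue norm. -/
theorem lintegral_majorant_rpow_le (hγ0 : 0 < γ) (hγ1 : γ < 1) (hl0 : 0 < l) (hf : Measurable f) :
    ∫⁻ t, (324 * (rieszEnergy γ univ f ^ ((1 - l) / 2) * rieszPotential γ univ f t ^ l)) ^ (2 / (γ * l)) ≤
      (324 * rieszEnergy γ univ f ^ ((1 - l) / 2)) ^ (2 / (γ * l)) *
        (embeddingConst (2 / γ) * (dualConst γ * rieszEnergy γ univ f) ^ (1 / γ)) := by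
  have h0 : 0 ≤ 2 / (γ * l) := by positivity
  have hm : Measurable fun t => rieszPotential γ univ f t ^ (2 / γ) := (measurable_rieszPotential hf).pow_const _
  calc _ = ∫⁻ t, (324 * rieszEnergy γ univ f ^ ((1 - l) / 2)) ^ (2 / (γ * l)) *
        rieszPotential γ univ f t ^ (2 / γ) := by
        refine lintegral_congr fun t => ?_
        rw [← mul_assoc, ENNReal.mul_rpow_of_nonneg _ _ h0, ← ENNReal.rpow_mul (rieszPotential γ univ f t),
          show l * (2 / (γ * l)) = 2 / γ by field_simp]
    _ = (324 * rieszEnergy γ univ f ^ ((1 - l) / 2)) ^ (2 / (γ * l)) *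
        ∫⁻ t, rieszPotential γ univ f t ^ (2 / γ) := lintegral_const_mul _ hm
    _ ≤ _ := by
        gcongr
        exact lintegral_rieszPotential_rpow_le hγ0 hγ1 hf

/-- The rule for the quasinorm of a power gives `L^{2/(γ l), 2/l}` for `M ^ l`. With the `L^{2/γ,2}`
bound for `M`, the prefactor contributes `E ^ ((1 - l) / 2)` and the power `E ^ (l / 2)`. -/
theorem lorentzNorm_le_of_le_majorant (hγ0 : 0 < γ) (hγ1 : γ < 1) (hl0 : 0 < l) (hl1 : l ≤ 1) (hf : Measurable f)
    (hE : rieszEnergy γ univ f ≠ ∞) {J : Set ℝ}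
    (h : ∀ᵐ t, v t ≤ 324 * (rieszEnergy γ univ f ^ ((1 - l) / 2) * rieszPotential γ univ f t ^ l)) :
    lorentzNorm (2 / (γ * l)) (ENNReal.ofReal (2 / l)) (volume.restrict J) v ≤
      ENNReal.ofReal ((2 / (γ * l)) ^ (l / 2)) * (ENNReal.ofReal (l * 324 ^ (2 / l)) * dualConst γ) ^ (l / 2) *
        rieszEnergy γ univ f ^ (1 / 2 : ℝ) := by
  set E := rieszEnergy γ univ f with hEdef
  -- The power rule needs a positive constant. When `E = 0` any constant `≥ 324` dominates,
  -- including the case `l = 1`, where `0 ^ 0 = 1`; the conclusion is still zero because `M` has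
  -- zero quasinorm.
  set c : ℝ := if E = 0 then 324 else 324 * E.toReal ^ ((1 - l) / 2) with hc
  have hpos : E ≠ 0 → 0 < E.toReal := fun h0 => ENNReal.toReal_pos h0 hE
  have hc0 : 0 < c := by
    rw [hc]
    split_ifs with h0
    · norm_num
    · have := Real.rpow_pos_of_pos (hpos h0) ((1 - l) / 2)
      positivity
  have hcE : 324 * E ^ ((1 - l) / 2) ≤ ENNReal.ofReal c := by
    rw [hc]
    split_ifs with h0
    · rw [h0, show ENNReal.ofReal 324 = 324 * 1 by norm_num]
      gcongr
      exact ENNReal.rpow_le_one zero_le_one (by linarith)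
    · rw [ENNReal.ofReal_mul (by norm_num), ← ENNReal.ofReal_rpow_of_pos (hpos h0), ENNReal.ofReal_toReal hE]
      norm_num
  have h1 := lorentzNorm_le_of_le_rpow (q := 2 / γ) (l := l) (c := c) (M := rieszPotential γ univ f) (J := J)
    (by positivity) hl0 hc0 (ae_restrict_of_ae (h.mono fun t ht => ht.trans (by
      rw [← mul_assoc]
      gcongr)))
  rw [div_div, div_div_cancel₀ two_ne_zero] at h1
  refine h1.trans ?_
  rw [mul_assoc]
  gcongr
  have h2 : ENNReal.ofReal (l * c ^ (2 / l)) * (dualConst γ * E) ≤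
      ENNReal.ofReal (l * 324 ^ (2 / l)) * dualConst γ * E ^ (1 / l) := by
    by_cases h0 : E = 0
    · simp [h0]
    · have h3 : c ^ (2 / l) = 324 ^ (2 / l) * E.toReal ^ (1 / l - 1) := by
        rw [hc, if_neg h0, Real.mul_rpow (by norm_num) (Real.rpow_nonneg (hpos h0).le _),
          ← Real.rpow_mul (hpos h0).le]
        congr 2
        field_simp
      have h4 : E ^ (1 / l) = ENNReal.ofReal (E.toReal ^ (1 / l - 1)) * E := by
        rw [← ENNReal.ofReal_rpow_of_pos (hpos h0), ENNReal.ofReal_toReal hE]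
        conv_rhs => rw [← ENNReal.rpow_one E, ← ENNReal.rpow_mul, one_mul, ← ENNReal.rpow_add _ _ h0 hE]
        congr 1
        ring
      rw [h3, h4, ← mul_assoc l, ENNReal.ofReal_mul (by positivity)]
      exact le_of_eq (by ring)
  calc _ ≤ (ENNReal.ofReal (l * c ^ (2 / l)) * (dualConst γ * E)) ^ (l / 2) := by
        gcongr
        exact lorentzSq_rieszPotential_le hγ0 hγ1 hf
    _ ≤ (ENNReal.ofReal (l * 324 ^ (2 / l)) * dualConst γ * E ^ (1 / l)) ^ (l / 2) := by gcongr
    _ = _ := by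
        rw [ENNReal.mul_rpow_of_nonneg _ (E ^ (1 / l)) (by positivity), ← ENNReal.rpow_mul E,
          show 1 / l * (l / 2) = 1 / 2 by field_simp]

/-- Finite energy makes the potential finite at some time `t`. The kernel centred at `t` is bounded
below almost everywhere on a bounded interval, so local integrability follows. -/
theorem lintegral_lt_top_of_rieszEnergy (hγ0 : 0 < γ) (hγ1 : γ < 1) (hf : Measurable f)
    (hE : rieszEnergy γ univ f ≠ ∞) (s₀ s₁ : ℝ) : ∫⁻ s in uIoc s₀ s₁, f s < ∞ := by
  obtain ⟨t, ht⟩ := (rieszPotential_ae_lt_top hγ0 hγ1 hf hE).exists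
  set R : ℝ := |t - s₀| + |s₁ - s₀| + 1 with hR
  have hR0 : 0 < R := by positivity
  have h1 : ∀ᵐ s ∂volume.restrict (uIoc s₀ s₁), ENNReal.ofReal (R ^ (-γ)) * f s ≤ rieszKernel γ (t - s) * f s := by
    filter_upwards [ae_sub_ne_zero (uIoc s₀ s₁) t, ae_restrict_mem measurableSet_uIoc] with s hs hsm
    gcongr
    refine ENNReal.ofReal_le_ofReal ?_
    have h2 : |t - s| ≤ R := by
      have h3 : |s - s₀| ≤ |s₁ - s₀| := abs_sub_left_of_mem_uIcc (uIoc_subset_uIcc hsm)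
      have h4 := abs_sub_le t s₀ s
      rw [abs_sub_comm s₀ s] at h4
      linarith
    exact Real.rpow_le_rpow_of_nonpos (abs_pos.2 hs) h2 (by linarith)
  have h2 : ENNReal.ofReal (R ^ (-γ)) * ∫⁻ s in uIoc s₀ s₁, f s < ∞ := by
    rw [← lintegral_const_mul _ hf]
    refine (lintegral_mono_ae h1).trans_lt (lt_of_le_of_lt ?_ ht)
    rw [rieszPotential, Measure.restrict_univ]
    exact setLIntegral_le_lintegral _ _
  refine lt_top_iff_ne_top.2 fun h => ?_
  rw [h, ENNReal.mul_top] at h2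
  · exact lt_irrefl _ h2
  · simpa using Real.rpow_pos_of_pos hR0 _

theorem lintegral_lt_top_of_rpow (hq : 1 ≤ q) (hf : ∫⁻ s, f s ^ q ≠ ∞) (s₀ s₁ : ℝ) :
    ∫⁻ s in uIoc s₀ s₁, f s < ∞ := by
  calc _ ≤ ∫⁻ s in uIoc s₀ s₁, 1 + f s ^ q := by
        refine lintegral_mono fun s => ?_
        rcases le_total (f s) 1 with h | h
        · exact h.trans le_self_add
        · refine le_trans ?_ le_add_self
          conv_lhs => rw [← ENNReal.rpow_one (f s)]
          exact ENNReal.rpow_le_rpow_of_exponent_le h hq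
    _ = volume (uIoc s₀ s₁) + ∫⁻ s in uIoc s₀ s₁, f s ^ q := by
        rw [lintegral_add_left measurable_const]
        simp
    _ < ∞ := by
        refine ENNReal.add_lt_top.2 ⟨?_, (setLIntegral_le_lintegral _ _).trans_lt hf.lt_top⟩
        rw [uIoc, Real.volume_Ioc]
        exact ENNReal.ofReal_lt_top

end ScalarBounds

/-! ### Assembly: from dual bounds to the Duhamel term -/

section Assembly

variable {J : Set ℝ} {t₀ : ℝ} {h : ℝ → ℝ → ℂ}

/-- The datum is modified on a null set of times, and extended by zero outside `J`, so that it is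
jointly measurable with every slice in `L^p`. All norms over `J` then become norms over the line. -/
theorem MeasurableOnSlab.exists_representative (hJ : MeasurableSet J) (hm : MeasurableOnSlab J h) {p : ℝ}
    (hp : 0 < p) (hfin : ∀ᵐ s ∂volume.restrict J, eLpNorm (h s) (ENNReal.ofReal p) volume < ∞) :
    ∃ h' : ℝ → ℝ → ℂ, StronglyMeasurable (Function.uncurry h') ∧
      (∀ s, MemLp (h' s) (ENNReal.ofReal p) volume) ∧
      (∀ᵐ s ∂volume.restrict J, h' s =ᵐ[volume] h s) ∧
      (fun s => eLpNorm (h' s) (ENNReal.ofReal p) volume) =ᵐ[volume]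
        J.indicator fun s => eLpNorm (h s) (ENNReal.ofReal p) volume := by
  set h₀ : ℝ → ℝ → ℂ := Function.curry (hm.mk _) with hh₀
  have hm₀ : StronglyMeasurable (Function.uncurry h₀) := hm.stronglyMeasurable_mk
  have hae : ∀ᵐ s ∂volume.restrict J, h₀ s =ᵐ[volume] h s := by
    filter_upwards [Measure.ae_ae_of_ae_prod hm.ae_eq_mk] with s hs
    filter_upwards [hs] with x hx using hx.symm
  set A : Set ℝ := J ∩ {s | eLpNorm (h₀ s) (ENNReal.ofReal p) volume < ∞} with hA
  have hAm : MeasurableSet A :=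
    hJ.inter (measurableSet_lt (measurable_eLpNorm_slice hm₀ hp) measurable_const)
  set h' : ℝ → ℝ → ℂ := A.indicator h₀ with hh'
  have hmem : ∀ s ∈ A, h' s = h₀ s := fun s hs => indicator_of_mem hs _
  have hnot : ∀ s, s ∉ A → h' s = 0 := fun s hs => indicator_of_notMem hs _
  have hae' : ∀ᵐ s ∂volume.restrict J, h' s =ᵐ[volume] h s := by
    filter_upwards [hae, hfin, ae_restrict_mem hJ] with s hs hf hsJ
    rw [hmem s ⟨hsJ, by rwa [mem_ofPred_eq, eLpNorm_congr_ae hs]⟩]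
    exact hs
  refine ⟨h', ?_, fun s => ?_, hae', ?_⟩
  · have : Function.uncurry h' = (Prod.fst ⁻¹' A).indicator (Function.uncurry h₀) := by
      ext ⟨s, x⟩
      by_cases hs : s ∈ A
      · rw [indicator_of_mem (show (s, x) ∈ Prod.fst ⁻¹' A from hs)]
        simp only [Function.uncurry, hmem s hs]
      · rw [indicator_of_notMem (show (s, x) ∉ Prod.fst ⁻¹' A from hs)]
        simp only [Function.uncurry, hnot s hs, Pi.zero_apply]
    rw [this]
    exact hm₀.indicator (measurable_fst hAm)
  · by_cases hs : s ∈ A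
    · rw [hmem s hs]
      exact ⟨(StronglyMeasurable.slice hm₀ s).aestronglyMeasurable, hs.2⟩
    · rw [hnot s hs]
      exact MemLp.zero
  · filter_upwards [(ae_restrict_iff' hJ).1 hae'] with s hs
    by_cases hsJ : s ∈ J
    · rw [indicator_of_mem hsJ]
      exact eLpNorm_congr_ae (hs hsJ)
    · rw [indicator_of_notMem hsJ, hnot s fun h => hsJ h.1, eLpNorm_zero]

theorem MeasurableOnSlab.aemeasurable_eLpNorm (hm : MeasurableOnSlab J h) {p : ℝ} (hp : 0 < p) :
    AEMeasurable (fun s => eLpNorm (h s) (ENNReal.ofReal p) volume) (volume.restrict J) := by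
  refine ⟨fun s => eLpNorm (Function.curry (hm.mk _) s) (ENNReal.ofReal p) volume,
    measurable_eLpNorm_slice (h := Function.curry (hm.mk _)) hm.stronglyMeasurable_mk hp, ?_⟩
  filter_upwards [Measure.ae_ae_of_ae_prod hm.ae_eq_mk] with s hs
  exact eLpNorm_congr_ae hs

theorem mixedNorm_eq {q : ℝ} (hq : 0 < q) (p : ℝ) (J : Set ℝ) (h : ℝ → ℝ → ℂ) :
    mixedNorm q p J h = (∫⁻ s in J, eLpNorm (h s) (ENNReal.ofReal p) volume ^ q) ^ (1 / q) := by
  rw [mixedNorm, eLpNorm_eq_lintegral_rpow_enorm_toReal (by simpa using hq) ENNReal.ofReal_ne_top,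
    ENNReal.toReal_ofReal hq.le]
  simp

theorem holderConjugate_two_div {θ : ℝ} (hθ : θ ∈ Ioo (0 : ℝ) 1) :
    (2 / (1 - θ)).HolderConjugate (2 / (1 + θ)) := by
  have h1 : 0 < 1 - θ := by linarith [hθ.2]
  have h2 : 0 < 1 + θ := by linarith [hθ.1]
  rw [Real.holderConjugate_iff]
  refine ⟨(one_lt_div h1).2 (by linarith [hθ.1]), ?_⟩
  rw [inv_div, inv_div]
  ring

/-- `u` is the Duhamel term of every family of distributions that is given by `h`. -/
def Represents (σ₁ σ₂ : ℝ) (J : Set ℝ) (t₀ : ℝ) (h u : ℝ → ℝ → ℂ) : Prop :=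
  ∀ (g : ℝ → 𝓢'(ℝ, ℂ)) (h₀ : ℝ → ℝ → ℂ), (∀ᵐ s ∂volume.restrict J, h s =ᵐ[volume] h₀ s) →
    IsAbsDeriv (-σ₂) J g h₀ → IsDuhamel σ₁ J t₀ g u

/-- Uniform dual bounds for the frequency localized Duhamel integrals give the Duhamel term. -/
theorem exists_represents (hJ : J.OrdConnected) (ht₀ : t₀ ∈ J) {p₁ p₁' p₂ p₂' q₁ σ₁ σ₂ : ℝ}
    (hpp : p₂.HolderConjugate p₂') (hp₂ : 2 ≤ p₂) (hp₁ : 2 ≤ p₁) (hq₁ : 2 ≤ q₁) (hσ₁ : 0 ≤ σ₁) (hσ₂ : 0 ≤ σ₂)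
    (hσ : σ₁ + σ₂ ≤ 1) (hhm : StronglyMeasurable (Function.uncurry h))
    (hh : ∀ s, MemLp (h s) (ENNReal.ofReal p₂') volume)
    (hS : ∀ t, ∫⁻ s in uIoc t₀ t, eLpNorm (h s) (ENNReal.ofReal p₂') volume < ∞)
    {Φ : (ℝ → ℝ≥0∞) → ℝ≥0∞} (hΦ : ∀ n k G, BoundedFamily k G →
      ‖∫ t, ∫ x, bandDuhamel n (σ₁ + σ₂) t₀ (truncFamily h n) t x * G t x‖ₑ ≤
        Φ fun t => eLpNorm (G t) (ENNReal.ofReal p₁') volume)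
    {B : ℝ≥0∞} (hB : B ≠ ∞) (hΦB : ∀ v : ℝ → ℝ → ℂ, StronglyMeasurable (Function.uncurry v) →
      (∀ k G, BoundedFamily k G → ‖∫ t, ∫ x, v t x * G t x‖ₑ ≤
        Φ fun t => eLpNorm (G t) (ENNReal.ofReal p₁') volume) →
      ∫⁻ t, eLpNorm (v t) (ENNReal.ofReal p₁) volume ^ q₁ ≤ B) :
    ∃ u : ℝ → ℝ → ℂ, StronglyMeasurable (Function.uncurry u) ∧
      (∀ k G, BoundedFamily k G → ‖∫ t, ∫ x, u t x * G t x‖ₑ ≤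
        Φ fun t => eLpNorm (G t) (ENNReal.ofReal p₁') volume) ∧
      Represents σ₁ σ₂ J t₀ h u := by
  obtain ⟨U, hU, hUD⟩ := exists_duhamelTerm hpp hp₂ hσ₁ hσ₂ hσ hhm hh hS
  have hbm : ∀ n, StronglyMeasurable
      (Function.uncurry (bandDuhamel n (σ₁ + σ₂) t₀ (truncFamily h n))) := fun n =>
    stronglyMeasurable_bandDuhamel n _ t₀ (boundedFamily_truncFamily hhm n).1
  have hbb : ∀ n, IsBoundedMeasurable (bandDuhamel n (σ₁ + σ₂) t₀ (truncFamily h n)) := fun n => by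
    obtain ⟨C, hC, hle⟩ := (boundedFamily_truncFamily hhm n).exists_enorm_bandDuhamel_le n (σ₁ + σ₂) t₀
    refine ⟨hbm n, C.toReal, fun t x => ?_⟩
    rw [← toReal_enorm]
    exact ENNReal.toReal_mono hC (hle t x)
  -- `hΦB` is applied to each localized solution to supply the uniform bound needed for compactness.
  -- The dual bounds themselves also pass to `u`, so the sharper Lorentz estimate can later be
  -- derived for `u` directly.
  obtain ⟨u, hum, hu, hud⟩ := exists_limit hbb hp₁ hq₁ hB
    (fun n => hΦB _ (hbm n) fun k G hG => hΦ n k G hG) hU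
  refine ⟨u, hum, fun k G hG => hud k G hG _ fun n => hΦ n k G hG, fun g h₀ hh₀ hg => ⟨U, fun t ht => ?_, ?_⟩⟩
  · refine hUD t g (ae_restrict_of_ae_restrict_of_subset (uIoc_subset_uIcc.trans (hJ.uIcc_subset ht₀ ht)) ?_)
    filter_upwards [hh₀, hg] with s hs hgs
    obtain ⟨H, hH, hHf⟩ := hgs
    refine ⟨H, hH, fun φ => ?_⟩
    have he : (fun x => h s x * φ x) =ᵐ[volume] fun x => h₀ s x * φ x := by
      filter_upwards [hs] with x hx
      rw [hx]
    exact ⟨(hHf φ).1.congr he.symm, (hHf φ).2.trans (integral_congr_ae he.symm)⟩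
  · exact ae_restrict_of_ae (hu.mono fun t ht φ => ht φ)

section Exponents

variable {α θ θ' θ₁ θ₂ : ℝ}

theorem exponent_pos (hα : α ∈ Icc (0 : ℝ) (1 / 2)) (hθ : θ ∈ Ioo (0 : ℝ) 1) : 0 < θ * (1 + α) / 3 := by
  have := mul_pos hθ.1 (by linarith [hα.1] : 0 < 1 + α)
  linarith

theorem exponent_lt_one (hα : α ∈ Icc (0 : ℝ) (1 / 2)) (hθ : θ ∈ Ioo (0 : ℝ) 1) : θ * (1 + α) / 3 < 1 := by
  have : θ * (1 + α) ≤ 1 * (1 + 1 / 2) :=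
    mul_le_mul hθ.2.le (by linarith [hα.2]) (by linarith [hα.1]) zero_le_one
  linarith

theorem two_le_two_div_one_sub (hθ : θ ∈ Ioo (0 : ℝ) 1) : 2 ≤ 2 / (1 - θ) := by
  have h1 : 0 < 1 - θ := by linarith [hθ.2]
  rw [le_div_iff₀ h1]
  linarith [hθ.1]

theorem order_add_le_one (hα : α ∈ Icc (0 : ℝ) (1 / 2)) (hθ₁ : θ₁ ∈ Ioo (0 : ℝ) 1) (hθ₂ : θ₂ ∈ Ioo (0 : ℝ) 1) :
    θ₁ * α / 2 + θ₂ * α / 2 ≤ 1 := by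
  have h1 : θ₁ * α ≤ 1 * (1 / 2) := mul_le_mul hθ₁.2.le hα.2 hα.1 zero_le_one
  have h2 : θ₂ * α ≤ 1 * (1 / 2) := mul_le_mul hθ₂.2.le hα.2 hα.1 zero_le_one
  linarith

theorem order_nonneg (hα : α ∈ Icc (0 : ℝ) (1 / 2)) (hθ : θ ∈ Ioo (0 : ℝ) 1) : 0 ≤ θ * α / 2 := by
  have := mul_nonneg hθ.1.le hα.1
  linarith

end Exponents

/-- The estimate when the exponent of the solution dominates. -/
theorem exists_represents_of_ge {α θ₁ θ₂ q₂ q₂' : ℝ} (hα : α ∈ Icc (0 : ℝ) (1 / 2)) (hθ₁ : θ₁ ∈ Ioo (0 : ℝ) 1)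
    (hθ₂ : θ₂ ∈ Ioo (0 : ℝ) 1) (hle : θ₂ ≤ θ₁) (hq₂ : q₂ = 2 / (θ₂ * (1 + α) / 3))
    (hqq : q₂.HolderConjugate q₂') :
    ∃ C : ℝ≥0∞, C ≠ ∞ ∧ ∀ (J : Set ℝ) (t₀ : ℝ) (h : ℝ → ℝ → ℂ), J.OrdConnected → t₀ ∈ J →
      StronglyMeasurable (Function.uncurry h) → (∀ s, MemLp (h s) (ENNReal.ofReal (2 / (1 + θ₂))) volume) →
      ∫⁻ s, eLpNorm (h s) (ENNReal.ofReal (2 / (1 + θ₂))) volume ^ q₂' ≠ ∞ →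
      ∃ u : ℝ → ℝ → ℂ, StronglyMeasurable (Function.uncurry u) ∧ Represents (θ₁ * α / 2) (θ₂ * α / 2) J t₀ h u ∧
        lorentzNorm (2 / (θ₁ * (1 + α) / 3)) 2 (volume.restrict J)
          (fun t => eLpNorm (u t) (ENNReal.ofReal (2 / (1 - θ₁))) volume) ≤
          C * (∫⁻ s, eLpNorm (h s) (ENNReal.ofReal (2 / (1 + θ₂))) volume ^ q₂') ^ (1 / q₂') := by
  set γ := θ₁ * (1 + α) / 3 with hγ
  have hγ0 : 0 < γ := exponent_pos hα hθ₁
  have hγ1 : γ < 1 := exponent_lt_one hα hθ₁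
  set D : ℝ≥0∞ := 324 * (embeddingConst (2 / γ) * dualConst γ ^ (1 / γ)) ^ (1 / q₂) with hD
  have hq0 : 0 < q₂ := hqq.pos
  have hDt : D ≠ ∞ := ENNReal.mul_ne_top (by norm_num) (ENNReal.rpow_ne_top_of_nonneg (by positivity)
    (ENNReal.mul_ne_top (embeddingConst_ne_top _)
      (ENNReal.rpow_ne_top_of_nonneg (by positivity) (dualConst_ne_top γ))))
  refine ⟨ENNReal.ofReal ((2 / γ) ^ (1 / 2 : ℝ)) * (dualConst γ ^ (1 / 2 : ℝ) * D),
    ENNReal.mul_ne_top ENNReal.ofReal_ne_top (ENNReal.mul_ne_top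
      (ENNReal.rpow_ne_top_of_nonneg (by norm_num) (dualConst_ne_top γ)) hDt), ?_⟩
  intro J t₀ h hJ ht₀ hhm hh hF
  set f : ℝ → ℝ≥0∞ := fun s => eLpNorm (h s) (ENNReal.ofReal (2 / (1 + θ₂))) volume with hf
  have hp₂' : 0 < 2 / (1 + θ₂) := (holderConjugate_two_div hθ₂).symm.pos
  have hp₁' : 0 < 2 / (1 + θ₁) := (holderConjugate_two_div hθ₁).symm.pos
  have hfm : Measurable f := measurable_eLpNorm_slice hhm hp₂'
  set F : ℝ≥0∞ := (∫⁻ s, f s ^ q₂') ^ (1 / q₂') with hFdef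
  have hFt : F ≠ ∞ := ENNReal.rpow_ne_top_of_nonneg (by have := hqq.symm.pos; positivity) hF
  set K : ℝ≥0∞ := D * F with hK
  have hKt : K ≠ ∞ := ENNReal.mul_ne_top hDt hFt
  -- The value `∞` for infinite energy keeps `Φ` monotone and makes the dual bound trivial there,
  -- also when `K = 0`.
  set Φ : (ℝ → ℝ≥0∞) → ℝ≥0∞ := fun a =>
    if rieszEnergy γ univ a = ∞ then ∞ else K * rieszEnergy γ univ a ^ (1 / 2 : ℝ) with hΦ
  have hΦm : Monotone Φ := fun a b hab => by
    simp only [hΦ]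
    have h1 : rieszEnergy γ univ a ≤ rieszEnergy γ univ b := rieszEnergy_mono subset_rfl hab
    by_cases hb : rieszEnergy γ univ b = ∞
    · rw [if_pos hb]
      exact le_top
    · rw [if_neg hb, if_neg (ne_top_of_le_ne_top hb h1)]
      gcongr
  have hl0 : 0 < θ₂ / θ₁ := div_pos hθ₂.1 hθ₁.1
  have hl1 : θ₂ / θ₁ ≤ 1 := (div_le_one hθ₁.1).2 hle
  have hql : q₂ = 2 / (γ * (θ₂ / θ₁)) := by
    have := hθ₁.1.ne'
    rw [hq₂, hγ]
    congr 1
    field_simp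
  have hdual : ∀ n k G, BoundedFamily k G →
      ‖∫ t, ∫ x, bandDuhamel n (θ₁ * α / 2 + θ₂ * α / 2) t₀ (truncFamily h n) t x * G t x‖ₑ ≤
        Φ fun t => eLpNorm (G t) (ENNReal.ofReal (2 / (1 + θ₁))) volume := fun n k G hG => by
    simp only [hΦ]
    split_ifs with hE
    · exact le_top
    have ham : Measurable fun t => eLpNorm (G t) (ENNReal.ofReal (2 / (1 + θ₁))) volume :=
      measurable_eLpNorm_slice hG.1 hp₁'
    refine (enorm_integral_bandDuhamel_le' (boundedFamily_truncFamily hhm n) hG n t₀ hα hθ₁ hθ₂.1 hle ham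
      (fun s => le_rfl) hE).trans ?_
    refine le_trans ?_ (lintegral_energy_mul_potential_le hγ0 hγ1 hl0 hl1 hql hqq ham hfm)
    refine lintegral_mono fun s => ?_
    gcongr
    exact eLpNorm_truncFamily_le h n s _
  have hbound : ∀ v : ℝ → ℝ → ℂ, StronglyMeasurable (Function.uncurry v) →
      (∀ k G, BoundedFamily k G → ‖∫ t, ∫ x, v t x * G t x‖ₑ ≤
        Φ fun t => eLpNorm (G t) (ENNReal.ofReal (2 / (1 + θ₁))) volume) →
      lorentzSq γ (fun t => eLpNorm (v t) (ENNReal.ofReal (2 / (1 - θ₁))) volume) ≤ dualConst γ * K ^ 2 :=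
    fun v hv hvΦ => by
      refine lorentzSq_le_of_forall hγ0 hγ1
        (measurable_eLpNorm_slice hv (holderConjugate_two_div hθ₁).pos) fun a ha hab => ?_
      refine (lintegral_eLpNorm_mul_le (holderConjugate_two_div hθ₁) hv hΦm hvΦ ha hab).trans ?_
      simp only [hΦ]
      rw [if_neg (hab.rieszEnergy_ne_top hγ0 hγ1 ha)]
  obtain ⟨u, hum, hud, hrep⟩ := exists_represents (q₁ := 2 / γ) hJ ht₀ (holderConjugate_two_div hθ₂)
    (two_le_two_div_one_sub hθ₂) (two_le_two_div_one_sub hθ₁) ((le_div_iff₀ hγ0).2 (by linarith))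
    (order_nonneg hα hθ₁) (order_nonneg hα hθ₂) (order_add_le_one hα hθ₁ hθ₂) hhm hh
    (lintegral_lt_top_of_rpow hqq.symm.lt.le hF t₀) hdual
    (B := embeddingConst (2 / γ) * (dualConst γ * K ^ 2) ^ (1 / γ))
    (ENNReal.mul_ne_top (embeddingConst_ne_top _) (ENNReal.rpow_ne_top_of_nonneg (by positivity)
      (ENNReal.mul_ne_top (dualConst_ne_top γ) (ENNReal.pow_ne_top hKt))))
    (fun v hv hvΦ => lintegral_rpow_le_of_lorentzSq hγ0 hγ1
      (measurable_eLpNorm_slice hv (holderConjugate_two_div hθ₁).pos) (hbound v hv hvΦ))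
  refine ⟨u, hum, hrep, ?_⟩
  -- The power rule with exponent and constant `1` merely converts `lorentzNorm` into `lorentzSq`.
  have h1 := lorentzNorm_le_of_le_rpow (q := 2 / γ) (l := 1) (c := 1) (J := J) (by positivity) one_pos one_pos
    (v := fun t => eLpNorm (u t) (ENNReal.ofReal (2 / (1 - θ₁))) volume)
    (M := fun t => eLpNorm (u t) (ENNReal.ofReal (2 / (1 - θ₁))) volume)
    (Filter.Eventually.of_forall fun t => by simp)
  rw [div_one, div_one, ENNReal.ofReal_ofNat, div_div_cancel₀ two_ne_zero, Real.one_rpow, one_mul,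
    ENNReal.ofReal_one, one_mul] at h1
  refine h1.trans ?_
  rw [mul_assoc]
  gcongr
  calc _ ≤ (dualConst γ * K ^ 2) ^ (1 / 2 : ℝ) := by
        gcongr
        exact hbound u hum hud
    _ = dualConst γ ^ (1 / 2 : ℝ) * D * F := by
        rw [ENNReal.mul_rpow_of_nonneg _ _ (by norm_num), ← ENNReal.rpow_natCast, ← ENNReal.rpow_mul, mul_assoc]
        simp [hK]

/-- The estimate when the exponent of the source dominates. -/
theorem exists_represents_of_le {α θ₁ θ₂ : ℝ} (hα : α ∈ Icc (0 : ℝ) (1 / 2)) (hθ₁ : θ₁ ∈ Ioo (0 : ℝ) 1)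
    (hθ₂ : θ₂ ∈ Ioo (0 : ℝ) 1) (hle : θ₁ ≤ θ₂) :
    ∃ C : ℝ≥0∞, C ≠ ∞ ∧ ∀ (J : Set ℝ) (t₀ : ℝ) (h : ℝ → ℝ → ℂ), J.OrdConnected → t₀ ∈ J →
      StronglyMeasurable (Function.uncurry h) → (∀ s, MemLp (h s) (ENNReal.ofReal (2 / (1 + θ₂))) volume) →
      lorentzSq (2 - θ₂ * (1 + α) / 3) (fun s => eLpNorm (h s) (ENNReal.ofReal (2 / (1 + θ₂))) volume) ≠ ∞ →
      ∃ u : ℝ → ℝ → ℂ, StronglyMeasurable (Function.uncurry u) ∧ Represents (θ₁ * α / 2) (θ₂ * α / 2) J t₀ h u ∧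
        lorentzNorm (2 / (θ₁ * (1 + α) / 3)) (ENNReal.ofReal (2 / (θ₁ / θ₂))) (volume.restrict J)
          (fun t => eLpNorm (u t) (ENNReal.ofReal (2 / (1 - θ₁))) volume) ≤
          C * lorentzSq (2 - θ₂ * (1 + α) / 3)
            (fun s => eLpNorm (h s) (ENNReal.ofReal (2 / (1 + θ₂))) volume) ^ (1 / 2 : ℝ) := by
  set γ := θ₂ * (1 + α) / 3 with hγ
  set l := θ₁ / θ₂ with hl
  have hγ0 : 0 < γ := exponent_pos hα hθ₂
  have hγ1 : γ < 1 := exponent_lt_one hα hθ₂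
  have hl0 : 0 < l := div_pos hθ₁.1 hθ₂.1
  have hl1 : l ≤ 1 := (div_le_one hθ₂.1).2 hle
  have hγl : θ₁ * (1 + α) / 3 = γ * l := by
    have := hθ₂.1.ne'
    rw [hγ, hl]
    field_simp
  set A : ℝ≥0∞ := dualConst γ * ENNReal.ofReal (2 * (2 - γ) / γ) with hA
  have hAt : A ≠ ∞ := ENNReal.mul_ne_top (dualConst_ne_top γ) ENNReal.ofReal_ne_top
  set D : ℝ≥0∞ := ENNReal.ofReal ((2 / (γ * l)) ^ (l / 2)) *
    (ENNReal.ofReal (l * 324 ^ (2 / l)) * dualConst γ) ^ (l / 2) with hD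
  have hDt : D ≠ ∞ := ENNReal.mul_ne_top ENNReal.ofReal_ne_top (ENNReal.rpow_ne_top_of_nonneg (by positivity)
    (ENNReal.mul_ne_top ENNReal.ofReal_ne_top (dualConst_ne_top γ)))
  refine ⟨D * A ^ (1 / 2 : ℝ), ENNReal.mul_ne_top hDt (ENNReal.rpow_ne_top_of_nonneg (by norm_num) hAt), ?_⟩
  intro J t₀ h hJ ht₀ hhm hh hF
  set f : ℝ → ℝ≥0∞ := fun s => eLpNorm (h s) (ENNReal.ofReal (2 / (1 + θ₂))) volume with hf
  have hp₂' : 0 < 2 / (1 + θ₂) := (holderConjugate_two_div hθ₂).symm.pos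
  have hfm : Measurable f := measurable_eLpNorm_slice hhm hp₂'
  have hEle : rieszEnergy γ univ f ≤ A * lorentzSq (2 - γ) f := by
    rw [hA, mul_assoc]
    exact rieszEnergy_le_lorentzSq hγ0 hγ1 hfm
  have hE : rieszEnergy γ univ f ≠ ∞ := ne_top_of_le_ne_top (ENNReal.mul_ne_top hAt hF) hEle
  -- Here the energy and the potential are those of the source, so the dual bound is a pairing with
  -- a fixed majorant and yields an inequality at almost every time.
  set b : ℝ → ℝ≥0∞ := fun t =>
    324 * (rieszEnergy γ univ f ^ ((1 - l) / 2) * rieszPotential γ univ f t ^ l) with hb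
  have hbm : Measurable b := (((measurable_rieszPotential hfm).pow_const l).const_mul _).const_mul _
  set Φ : (ℝ → ℝ≥0∞) → ℝ≥0∞ := fun a => ∫⁻ t, b t * a t with hΦ
  have hΦm : Monotone Φ := fun a c hac => lintegral_mono fun t => by
    gcongr
    exact hac t
  have hdual : ∀ n k G, BoundedFamily k G →
      ‖∫ t, ∫ x, bandDuhamel n (θ₁ * α / 2 + θ₂ * α / 2) t₀ (truncFamily h n) t x * G t x‖ₑ ≤
        Φ fun t => eLpNorm (G t) (ENNReal.ofReal (2 / (1 + θ₁))) volume := fun n k G hG => by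
    rw [add_comm (θ₁ * α / 2)]
    exact enorm_integral_bandDuhamel_le (boundedFamily_truncFamily hhm n) hG n t₀ hα hθ₂ hθ₁.1 hle hfm
      (fun s => eLpNorm_truncFamily_le h n s _) hE
  have hbound : ∀ v : ℝ → ℝ → ℂ, StronglyMeasurable (Function.uncurry v) →
      (∀ k G, BoundedFamily k G → ‖∫ t, ∫ x, v t x * G t x‖ₑ ≤
        Φ fun t => eLpNorm (G t) (ENNReal.ofReal (2 / (1 + θ₁))) volume) →
      ∀ᵐ t, eLpNorm (v t) (ENNReal.ofReal (2 / (1 - θ₁))) volume ≤ b t := fun v hv hvΦ =>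
    ae_le_of_forall_boundedSupport (measurable_eLpNorm_slice hv (holderConjugate_two_div hθ₁).pos)
      fun a ha hab => lintegral_eLpNorm_mul_le (holderConjugate_two_div hθ₁) hv hΦm hvΦ ha hab
  have hγl0 : 0 < γ * l := mul_pos hγ0 hl0
  have hγl1 : γ * l ≤ 1 := mul_le_one₀ hγ1.le hl0.le hl1
  obtain ⟨u, hum, hud, hrep⟩ := exists_represents (q₁ := 2 / (γ * l)) hJ ht₀ (holderConjugate_two_div hθ₂)
    (two_le_two_div_one_sub hθ₂) (two_le_two_div_one_sub hθ₁) ((le_div_iff₀ hγl0).2 (by linarith))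
    (order_nonneg hα hθ₁) (order_nonneg hα hθ₂) (order_add_le_one hα hθ₁ hθ₂) hhm hh
    (lintegral_lt_top_of_rieszEnergy hγ0 hγ1 hfm hE t₀) hdual
    (B := (324 * rieszEnergy γ univ f ^ ((1 - l) / 2)) ^ (2 / (γ * l)) *
        (embeddingConst (2 / γ) * (dualConst γ * rieszEnergy γ univ f) ^ (1 / γ)))
    (ENNReal.mul_ne_top (ENNReal.rpow_ne_top_of_nonneg (by positivity) (ENNReal.mul_ne_top (by norm_num)
      (ENNReal.rpow_ne_top_of_nonneg (by linarith) hE)))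
      (ENNReal.mul_ne_top (embeddingConst_ne_top _) (ENNReal.rpow_ne_top_of_nonneg (by positivity)
      (ENNReal.mul_ne_top (dualConst_ne_top γ) hE))))
    (fun v hv hvΦ => (lintegral_mono_ae ((hbound v hv hvΦ).mono fun t ht =>
      ENNReal.rpow_le_rpow ht (by positivity))).trans (lintegral_majorant_rpow_le hγ0 hγ1 hl0 hfm))
  refine ⟨u, hum, hrep, ?_⟩
  rw [hγl]
  refine (lorentzNorm_le_of_le_majorant hγ0 hγ1 hl0 hl1 hfm hE (hbound u hum hud)).trans ?_
  rw [mul_assoc (D : ℝ≥0∞)]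
  gcongr
  rw [← ENNReal.mul_rpow_of_nonneg _ _ (by norm_num)]
  gcongr

end Assembly

end AiryStrichartz

/-! ### The two Lorentz–Strichartz estimates -/

theorem mainTheorem4 (θ₁ θ₂ α q₁ p₁ q₂ p₂ q₂' p₂' : ℝ)
    (hθ₁ : θ₁ ∈ Ioo (0 : ℝ) 1) (hθ₂ : θ₂ ∈ Ioo (0 : ℝ) 1) (hα : α ∈ Icc (0 : ℝ) (1 / 2))
    (hq₁ : q₁ = 6 / (θ₁ * (α + 1))) (hp₁ : p₁ = 2 / (1 - θ₁))
    (hq₂ : q₂ = 6 / (θ₂ * (α + 1))) (hp₂ : p₂ = 2 / (1 - θ₂))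
    (hq₂' : 1 / q₂ + 1 / q₂' = 1) (hp₂' : 1 / p₂ + 1 / p₂' = 1) :
    (q₁ ≤ q₂ →
      ∃ C : ℝ≥0, ∀ (J : Set ℝ) (t₀ : ℝ), J.OrdConnected → t₀ ∈ J →
        ∀ (g : ℝ → 𝓢'(ℝ, ℂ)) (h : ℝ → ℝ → ℂ),
          AiryStrichartz.MeasurableOnSlab J h →
          AiryStrichartz.IsAbsDeriv (-(θ₂ * α / 2)) J g h →
          AiryStrichartz.mixedNorm q₂' p₂' J h < ∞ →
          ∃ u : ℝ → ℝ → ℂ, AiryStrichartz.MeasurableOnSlab J u ∧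
            AiryStrichartz.IsDuhamel (θ₁ * α / 2) J t₀ g u ∧
            AiryStrichartz.mixedLorentzNorm q₁ 2 p₁ J u ≤
              C * AiryStrichartz.mixedNorm q₂' p₂' J h) ∧
    (q₂ ≤ q₁ →
      ∃ C : ℝ≥0, ∀ (J : Set ℝ) (t₀ : ℝ), J.OrdConnected → t₀ ∈ J →
        ∀ (g : ℝ → 𝓢'(ℝ, ℂ)) (h : ℝ → ℝ → ℂ),
          AiryStrichartz.MeasurableOnSlab J h →
          AiryStrichartz.IsAbsDeriv (-(θ₂ * α / 2)) J g h →
          AiryStrichartz.mixedLorentzNorm q₂' 2 p₂' J h < ∞ →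
          ∃ u : ℝ → ℝ → ℂ, AiryStrichartz.MeasurableOnSlab J u ∧
            AiryStrichartz.IsDuhamel (θ₁ * α / 2) J t₀ g u ∧
            AiryStrichartz.mixedLorentzNorm q₁ (ENNReal.ofReal (2 * q₁ / q₂)) p₁ J u ≤
              C * AiryStrichartz.mixedLorentzNorm q₂' 2 p₂' J h) := by
  have hα1 : 0 < α + 1 := by linarith [hα.1]
  have hγ0 := AiryStrichartz.exponent_pos hα hθ₂
  have hγ1 := AiryStrichartz.exponent_lt_one hα hθ₂
  have hq₁γ : q₁ = 2 / (θ₁ * (1 + α) / 3) := by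
    have := hθ₁.1.ne'
    rw [hq₁, add_comm α]
    field_simp
    norm_num
  have hq₂γ : q₂ = 2 / (θ₂ * (1 + α) / 3) := by
    have := hθ₂.1.ne'
    rw [hq₂, add_comm α]
    field_simp
    norm_num
  have hp₂'θ : p₂' = 2 / (1 + θ₂) := by
    have h1 : 1 / p₂' = (1 + θ₂) / 2 := by
      rw [hp₂, one_div_div] at hp₂'
      linarith
    rw [← one_div_one_div p₂', h1, one_div_div]
  have hq₂'1 : 1 / q₂' = (2 - θ₂ * (1 + α) / 3) / 2 := by
    rw [hq₂γ, one_div_div] at hq₂'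
    linarith
  have hq₂'γ : q₂' = 2 / (2 - θ₂ * (1 + α) / 3) := by
    rw [← one_div_one_div q₂', hq₂'1, one_div_div]
  have hqq : q₂.HolderConjugate q₂' := by
    rw [Real.holderConjugate_iff]
    refine ⟨?_, by simpa using hq₂'⟩
    rw [hq₂γ]
    exact (one_lt_div hγ0).2 (by linarith)
  have hq₂'0 : 0 < q₂' := hqq.symm.pos
  have hp0 : 0 < 2 / (1 + θ₂) := (AiryStrichartz.holderConjugate_two_div hθ₂).symm.pos
  subst hp₂'θ
  subst hp₁
  refine ⟨fun hle => ?_, fun hle => ?_⟩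
  -- With `α` fixed, `qᵢ` decreases in `θᵢ`, so the order of the time exponents is opposite to that
  -- of the parameters.
  · have hθ : θ₂ ≤ θ₁ := by
      rw [hq₁, hq₂, div_le_div_iff_of_pos_left (by norm_num) (mul_pos hθ₁.1 hα1) (mul_pos hθ₂.1 hα1)] at hle
      exact le_of_mul_le_mul_right hle hα1
    obtain ⟨C, hC, hmain⟩ := AiryStrichartz.exists_represents_of_ge hα hθ₁ hθ₂ hθ hq₂γ hqq
    refine ⟨C.toNNReal, fun J t₀ hJ ht₀ g h hm hg hfin => ?_⟩
    rw [AiryStrichartz.mixedNorm_eq hq₂'0] at hfin ⊢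
    have hfin' : ∫⁻ s in J, eLpNorm (h s) (ENNReal.ofReal (2 / (1 + θ₂))) volume ^ q₂' ≠ ∞ := fun htop => by
      rw [htop, ENNReal.top_rpow_of_pos (by positivity)] at hfin
      exact lt_irrefl _ hfin
    have hae : ∀ᵐ s ∂volume.restrict J, eLpNorm (h s) (ENNReal.ofReal (2 / (1 + θ₂))) volume < ∞ := by
      filter_upwards [ae_lt_top' ((AiryStrichartz.MeasurableOnSlab.aemeasurable_eLpNorm hm hp0).pow_const q₂')
        hfin'] with s hs
      exact (ENNReal.rpow_lt_top_iff_of_pos hq₂'0).1 hs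
    obtain ⟨h', hm', hmem, hJh, hnorm⟩ :=
      AiryStrichartz.MeasurableOnSlab.exists_representative hJ.measurableSet hm hp0 hae
    have hint : ∫⁻ s, eLpNorm (h' s) (ENNReal.ofReal (2 / (1 + θ₂))) volume ^ q₂' =
        ∫⁻ s in J, eLpNorm (h s) (ENNReal.ofReal (2 / (1 + θ₂))) volume ^ q₂' := by
      rw [← lintegral_indicator hJ.measurableSet]
      refine lintegral_congr_ae (hnorm.mono fun s hs => ?_)
      simp only [] at hs ⊢
      rw [hs]
      by_cases hsJ : s ∈ J <;> simp [hsJ, hq₂'0]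
    obtain ⟨u, hum, hrep, hbound⟩ := hmain J t₀ h' hJ ht₀ hm' hmem (hint ▸ hfin')
    refine ⟨u, hum.aestronglyMeasurable, hrep g h hJh hg, ?_⟩
    rw [hint] at hbound
    rw [ENNReal.coe_toNNReal hC, AiryStrichartz.mixedLorentzNorm, hq₁γ]
    exact hbound
  · have hθ : θ₁ ≤ θ₂ := by
      rw [hq₁, hq₂, div_le_div_iff_of_pos_left (by norm_num) (mul_pos hθ₂.1 hα1) (mul_pos hθ₁.1 hα1)] at hle
      exact le_of_mul_le_mul_right hle hα1
    obtain ⟨C, hC, hmain⟩ := AiryStrichartz.exists_represents_of_le hα hθ₁ hθ₂ hθ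
    have hD : C * ENNReal.ofReal (1 / q₂') ^ (1 / 2 : ℝ) ≠ ∞ :=
      ENNReal.mul_ne_top hC (ENNReal.rpow_ne_top_of_nonneg (by norm_num) ENNReal.ofReal_ne_top)
    refine ⟨(C * ENNReal.ofReal (1 / q₂') ^ (1 / 2 : ℝ)).toNNReal, fun J t₀ hJ ht₀ g h hm hg hfin => ?_⟩
    rw [AiryStrichartz.mixedLorentzNorm] at hfin
    rw [ENNReal.coe_toNNReal hD, AiryStrichartz.mixedLorentzNorm.eq_1 q₂']
    set N := AiryStrichartz.lorentzNorm q₂' 2 (volume.restrict J)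
      fun t => eLpNorm (h t) (ENNReal.ofReal (2 / (1 + θ₂))) volume
    -- The exponent of the source quasinorm `L^{q₂',2}` is exactly the `2 - γ` of the
    -- Hardy–Littlewood–Sobolev bound with `γ = 2 / q₂`.
    have h2q : 2 / q₂' = 2 - θ₂ * (1 + α) / 3 := by
      rw [← mul_one_div, hq₂'1]
      ring
    have hsq := AiryStrichartz.lorentzSq_indicator_le hq₂'0 hJ.measurableSet
      fun t => eLpNorm (h t) (ENNReal.ofReal (2 / (1 + θ₂))) volume
    have hsqt := ne_top_of_le_ne_top (ENNReal.mul_ne_top ENNReal.ofReal_ne_top (ENNReal.pow_ne_top hfin.ne)) hsq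
    have hae : ∀ᵐ s ∂volume.restrict J, eLpNorm (h s) (ENNReal.ofReal (2 / (1 + θ₂))) volume < ∞ := by
      rw [ae_restrict_iff' hJ.measurableSet]
      filter_upwards [AiryStrichartz.ae_lt_top_of_lorentzSq (by positivity) hsqt] with s hs hsJ
      rwa [indicator_of_mem hsJ] at hs
    obtain ⟨h', hm', hmem, hJh, hnorm⟩ :=
      AiryStrichartz.MeasurableOnSlab.exists_representative hJ.measurableSet hm hp0 hae
    rw [← AiryStrichartz.lorentzSq_congr_ae hnorm, h2q] at hsq hsqt
    obtain ⟨u, hum, hrep, hbound⟩ := hmain J t₀ h' hJ ht₀ hm' hmem hsqt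
    refine ⟨u, hum.aestronglyMeasurable, hrep g h hJh hg, ?_⟩
    have hr : 2 * q₁ / q₂ = 2 / (θ₁ / θ₂) := by
      have h1 := hθ₁.1.ne'
      have h2 := hθ₂.1.ne'
      rw [hq₁, hq₂]
      field_simp
    rw [AiryStrichartz.mixedLorentzNorm, hr, hq₁γ]
    refine hbound.trans ?_
    rw [mul_assoc C]
    gcongr
    calc _ ≤ (ENNReal.ofReal (1 / q₂') * N ^ 2) ^ (1 / 2 : ℝ) := by gcongr
      _ = _ := by
          rw [ENNReal.mul_rpow_of_nonneg _ _ (by norm_num), ← ENNReal.rpow_natCast, ← ENNReal.rpow_mul]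
          simp
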